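/- Let $\gamma\in(-1,1)$, and let $\mathbb D=\{|z|\le 1\}\subset\mathbb C$, with polar coordinates $z=\rho e^{i\omega}$, $x=1-\rho^2$, and Lebesgue measure $dV$. Set $L^2_\gamma=L^2(\mathbb D,x^\gamma dV)$ and $$\mathcal L_\gamma=-\rho^{-1}x^{-\gamma}\partial_\rho(\rho\,x^{\gamma+1}\partial_\rho)-\rho^{-2}\partial_\omega^2+(1+\gamma)^2 = -x\Delta+(2+2\gamma)\rho\partial_\rho-\partial_\omega^2+(1+\gamma)^2 .$$ Let $\mathcal L_{\gamma,min}$ be the closure in $L^2_\gamma$ of $\mathcal L_\gamma$ with domain $\dot C^\infty(\mathbb D)$ (functions smooth on $\mathbb D$, all of whose derivatives vanish on $\mathbb S^1=\partial\mathbb D$), and let $\mathcal L_{\gamma,D}$ be the Friedrichs extension of $\mathcal L_\gamma$ on $C_c^\infty(\mathbb D^{int})$, i.e. the self-adjoint operator associated with the closure of the form $\alpha_\gamma(f)=\|\sqrt x\,\partial_\rho f\|^2_{L^2_\gamma}+\|\rho^{-1}\partial_\omega f\|^2_{L^2_\gamma}+(1+\gamma)^2\|f\|^2_{L^2_\gamma}$.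 For $s>0$ let $\widetilde H^{s,\gamma}_D(\mathbb D)=\mathrm{dom}(\mathcal L_{\gamma,D}^{s/2})$ with norm $\|\mathcal L_{\gamma,D}^{s/2}u\|_{L^2_\gamma}$, and for $r\ge 0$ let $H^r(\mathbb S^1)$ be the Sobolev space with norm $\big(\sum_{m\in\mathbb Z}(1+m^2)^{r}|f_m|^2\big)^{1/2}$, where $f_m$ are the Fourier coefficients of $f$. Let $\mathcal A_\gamma=C^\infty(\mathbb D)+x^{-\gamma}C^\infty(\mathbb D)$ if $\gamma\ne0$ and $\mathcal A_0=C^\infty(\mathbb D)+\log x\,C^\infty(\mathbb D)$. For $f\in\mathcal A_\gamma$ define the Neumann trace $$\tau^N_\gamma f=\lim_{\rho\to1^-}\rho\,x^{\gamma+1}\,(f\,\partial_\rho\phi_\gamma-\phi_\gamma\,\partial_\rho f),$$ where $\phi_\gamma=1$ if $\gamma\in(-1,0)$, $\phi_0=\log x-\log(1-x)-c_0$ with a fixed constant $c_0>\log(e^4-1)$, and $\phi_\gamma=-\gamma\sum_{k\ge0}\frac{x^{k-\gamma}}{k-\gamma}$ if $\gamma\in(0,1)$. Then: 1. For every $s>1+|\gamma|$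 there is a unique bounded linear map $\tau^N_\gamma\colon\widetilde H^{s,\gamma}_D(\mathbb D)\to H^{s-1-|\gamma|}(\mathbb S^1)$ that agrees with the Neumann trace above on $\mathcal A_\gamma\cap\widetilde H^{s,\gamma}_D(\mathbb D)$. It is surjective, and it has a bounded linear right inverse $H^{s-1-|\gamma|}(\mathbb S^1)\to\widetilde H^{s,\gamma}_D(\mathbb D)$ which extends a continuous linear operator from $C^\infty(\mathbb S^1)$ to $C^\infty(\mathbb D)$ if $\gamma\ge0$, and from $C^\infty(\mathbb S^1)$ to $x^{-\gamma}C^\infty(\mathbb D)$ (with the topology of $C^\infty(\mathbb D)$ transported by multiplication by $x^{-\gamma}$) if $\gamma<0$. 2. In particular, for $s=2$ one has $\widetilde H^{2,\gamma}_D(\mathbb D)=\mathrm{dom}(\mathcal L_{\gamma,D})$, so that $\tau^N_\gamma\colon\mathrm{dom}(\mathcal L_{\gamma,D})\to H^{1-|\gamma|}(\mathbb S^1)$ is bounded and surjective, and $$\mathrm{dom}(\mathcal L_{\gamma,min})=\widetilde H^{2,\gamma}_D(\mathbb D)\cap\ker\tau^N_\gamma .$$ -/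

import Mathlib

open MeasureTheory Filter Topology
open scoped ContDiff InnerProductSpace

namespace KeldyshDisk

noncomputable section

/-! ### The weighted space on the disk and the classical operator -/

/-- The measure `x ^ γ dV` on the unit disk, `x = 1 - |z|²`, `dV` the Lebesgue measure
(the unit circle is a null set, so the open disk is used). -/
def diskMeasure (γ : ℝ) : Measure ℂ :=
  (volume.restrict (Metric.ball (0 : ℂ) 1)).withDensity
    (fun z => ENNReal.ofReal ((1 - ‖z‖ ^ 2) ^ γ))

/-- The Hilbert space `L²_γ = L²(𝔻, x ^ γ dV)` of complex-valued functions. -/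
abbrev L2 (γ : ℝ) : Type := Lp ℂ 2 (diskMeasure γ)

/-- The closed unit disk. -/
abbrev disk : Set ℂ := Metric.closedBall (0 : ℂ) 1

/-- The radial derivative `∂_ρ f`, i.e. the derivative in the direction `z / |z|`. -/
def radialDeriv (f : ℂ → ℂ) (z : ℂ) : ℂ := fderiv ℝ f z (z / (‖z‖ : ℂ))

/-- The angular derivative `∂_ω f`, i.e. the derivative in the direction `i z`. -/
def angularDeriv (f : ℂ → ℂ) (z : ℂ) : ℂ := fderiv ℝ f z (Complex.I * z)

/-- The differential operator, in the form with smooth coefficients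
`L_γ = - x Δ + (2 + 2 γ) ρ ∂_ρ - ∂_ω² + (γ + 1)²`, which on the punctured open disk is the same as
`- ρ⁻¹ x^(-γ) ∂_ρ (ρ x^(γ+1) ∂_ρ) - ρ⁻² ∂_ω² + (1 + γ)²`.
Note that `fderiv ℝ f z z` is `ρ ∂_ρ f`. -/
def keldysh (γ : ℝ) (f : ℂ → ℂ) (z : ℂ) : ℂ :=
  -((1 - ‖z‖ ^ 2 : ℝ) : ℂ) * Laplacian.laplacian f z
    + ((2 + 2 * γ : ℝ) : ℂ) * fderiv ℝ f z z
    - angularDeriv (angularDeriv f) z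
    + (((γ + 1) ^ 2 : ℝ) : ℂ) * f z

/-- `C^∞(𝔻)`: smooth up to the boundary on the closed disk. -/
def SmoothOnDisk (f : ℂ → ℂ) : Prop := ContDiffOn ℝ ∞ f disk

/-- `Ċ^∞(𝔻)`: smooth on the closed disk, with all derivatives vanishing on the unit circle. -/
def SmoothFlat (f : ℂ → ℂ) : Prop :=
  SmoothOnDisk f ∧ ∀ (k : ℕ) (z : ℂ), ‖z‖ = 1 → iteratedFDerivWithin ℝ k f disk z = 0

/-- `C_c^∞` of the open disk. -/
def TestFunction (f : ℂ → ℂ) : Prop :=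
  ContDiff ℝ ∞ f ∧ HasCompactSupport f ∧ tsupport f ⊆ Metric.ball (0 : ℂ) 1

/-! ### The minimal operator -/

/-- Graph of the minimal operator: the closure in `L²_γ × L²_γ` of the graph of `L_γ` on `Ċ^∞(𝔻)`
(the set under the span is already a linear subspace). -/
def minimalGraph (γ : ℝ) : Submodule ℂ (L2 γ × L2 γ) :=
  (Submodule.span ℂ {p : L2 γ × L2 γ | ∃ f : ℂ → ℂ, SmoothFlat f ∧
    (p.1 : ℂ → ℂ) =ᵐ[diskMeasure γ] f ∧
    (p.2 : ℂ → ℂ) =ᵐ[diskMeasure γ] keldysh γ f}).topologicalClosure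

/-- The domain of the minimal operator `L_{γ,min}`. -/
def minimalDomain (γ : ℝ) : Submodule ℂ (L2 γ) :=
  (minimalGraph γ).map (LinearMap.fst ℂ (L2 γ) (L2 γ))

/-! ### The Friedrichs extension `L_{γ,D}` -/

/-- The form domain: the completion of `C_c^∞` of the open disk for the norm of
`α_γ(f) = ‖√x ∂_ρ f‖² + ‖ρ⁻¹ ∂_ω f‖² + (1 + γ)² ‖f‖²` (norms in `L²_γ`). The map
`f ↦ ((1 + γ) f, √x ∂_ρ f, ρ⁻¹ ∂_ω f)` is isometric from `C_c^∞` with this norm to `(L²_γ)³`;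
the completion is realized as the closure of its image
(the set under the span is already a linear subspace). -/
def formSpace (γ : ℝ) : Submodule ℂ (PiLp 2 (fun _ : Fin 3 => L2 γ)) :=
  (Submodule.span ℂ {U | ∃ f : ℂ → ℂ, TestFunction f ∧
    (U 0 : ℂ → ℂ) =ᵐ[diskMeasure γ] (fun z => ((1 + γ : ℝ) : ℂ) * f z) ∧
    (U 1 : ℂ → ℂ) =ᵐ[diskMeasure γ]
      (fun z => ((Real.sqrt (1 - ‖z‖ ^ 2) : ℝ) : ℂ) * radialDeriv f z) ∧
    (U 2 : ℂ → ℂ) =ᵐ[diskMeasure γ]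
      (fun z => ((‖z‖⁻¹ : ℝ) : ℂ) * angularDeriv f z)}).topologicalClosure

instance formSpaceComplete (γ : ℝ) : CompleteSpace (formSpace γ) :=
  (Submodule.isClosed_topologicalClosure _).completeSpace_coe

/-- The inclusion of the form domain in `L²_γ` (the first component, divided by `1 + γ`). -/
def formInclusion (γ : ℝ) : formSpace γ →L[ℂ] L2 γ :=
  (((1 + γ : ℝ) : ℂ)⁻¹) • ((PiLp.proj 2 (fun _ : Fin 3 => L2 γ) 0).comp (formSpace γ).subtypeL)

/-- The graph of the Friedrichs extension `L_{γ,D}`: the pairs `(u, w)` such that `u` is in the form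
domain and `α_γ(u, v) = (w, v)_{L²_γ}` for all `v` in the form domain. -/
def dirichletGraph (γ : ℝ) : Submodule ℂ (L2 γ × L2 γ) where
  carrier := {p | ∃ U : formSpace γ, formInclusion γ U = p.1 ∧
    ∀ V : formSpace γ, ⟪V, U⟫_ℂ = ⟪formInclusion γ V, p.2⟫_ℂ}
  zero_mem' := ⟨0, by simp, by simp⟩
  add_mem' := by
    rintro p q ⟨U, hU, hU'⟩ ⟨V, hV, hV'⟩
    refine ⟨U + V, by simp [hU, hV], fun W => ?_⟩
    rw [inner_add_right, hU', hV', Prod.snd_add, inner_add_right]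
  smul_mem' := by
    rintro c p ⟨U, hU, hU'⟩
    refine ⟨c • U, by simp [hU], fun W => ?_⟩
    have h := inner_smul_right (𝕜 := ℂ) W U c
    rw [h, hU']
    exact (inner_smul_right (𝕜 := ℂ) (formInclusion γ W) p.2 c).symm

/-- The domain of the Friedrichs extension `L_{γ,D}`. -/
def dirichletDomain (γ : ℝ) : Submodule ℂ (L2 γ) :=
  (dirichletGraph γ).map (LinearMap.fst ℂ (L2 γ) (L2 γ))

/-- The bounded, non-negative self-adjoint operator `L_{γ,D}⁻¹`; see `mem_dirichletGraph_iff`. -/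
def dirichletInverse (γ : ℝ) : L2 γ →L[ℂ] L2 γ :=
  (formInclusion γ).comp (formInclusion γ).adjoint

/-- `L_{γ,D} u = w` if and only if `u = L_{γ,D}⁻¹ w`. -/
theorem mem_dirichletGraph_iff (γ : ℝ) (u w : L2 γ) :
    (u, w) ∈ dirichletGraph γ ↔ u = dirichletInverse γ w := by
  constructor
  · rintro ⟨U, hU, hU'⟩
    have h : U = (formInclusion γ).adjoint w := by
      refine ext_inner_left ℂ fun V => ?_
      rw [hU', ContinuousLinearMap.adjoint_inner_right]
    rw [h] at hU
    exact hU.symm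
  · intro h
    refine ⟨(formInclusion γ).adjoint w, h.symm, fun V => ?_⟩
    rw [ContinuousLinearMap.adjoint_inner_right]

/-! ### The Dirichlet Sobolev scale -/

/-- The real power `A ^ r` of a non-negative bounded operator `A` on a complex Hilbert space, through
the continuous functional calculus (used for `r > 0`). -/
def opPow {H : Type*} [NormedAddCommGroup H] [InnerProductSpace ℂ H] [CompleteSpace H]
    (A : H →L[ℂ] H) (r : ℝ) : H →L[ℂ] H := CFC.rpow A r

/-- `L_{γ,D}^(-s/2) = (L_{γ,D}⁻¹)^(s/2)`, a bounded operator for `s > 0`. -/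
def dirichletNegPow (γ s : ℝ) : L2 γ →L[ℂ] L2 γ :=
  opPow (dirichletInverse γ) (s / 2)

/-- The Dirichlet Sobolev space `H̃_D^{s,γ}(𝔻) = dom (L_{γ,D}^(s/2))`, for `s > 0`: the domain of
`L_{γ,D}^(s/2)` is the range of its bounded inverse. -/
def dirichletSobolev (γ s : ℝ) : Submodule ℂ (L2 γ) :=
  LinearMap.range (dirichletNegPow γ s).toLinearMap

/-- The norm `‖u‖ = ‖L_{γ,D}^(s/2) u‖_{L²_γ}` of `H̃_D^{s,γ}(𝔻)`. There is exactly one `v` with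
`L_{γ,D}^(-s/2) v = u`, namely `v = L_{γ,D}^(s/2) u`. -/
def dirichletSobolevNorm (γ s : ℝ) (u : dirichletSobolev γ s) : ℝ :=
  sInf {r : ℝ | ∃ v : L2 γ, dirichletNegPow γ s v = u ∧ r = ‖v‖}

/-! ### Sobolev spaces on the circle -/

instance factTwoPiPos : Fact (0 < 2 * Real.pi) := ⟨Real.two_pi_pos⟩

/-- The circle `S¹`, as `ℝ / 2πℤ` (the angular variable). -/
abbrev S1 : Type := AddCircle (2 * Real.pi)

/-- `L²(S¹)`, for the normalized rotation-invariant measure. -/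
abbrev L2S1 : Type := Lp ℂ 2 (AddCircle.haarAddCircle (T := 2 * Real.pi))

/-- The bracket `⟨m⟩ = (1 + m²)^(1/2)`. -/
def bracket (m : ℤ) : ℝ := Real.sqrt (1 + (m : ℝ) ^ 2)

/-- The Sobolev space `H^r(S¹)`, `r ≥ 0`: the functions of `L²(S¹)` with
`∑ ⟨m⟩^(2r) |f_m|² < ∞`, `f_m` the Fourier coefficients. -/
def circleSobolev (r : ℝ) : Submodule ℂ L2S1 where
  carrier := {f | Summable fun m : ℤ => bracket m ^ (2 * r) * ‖fourierCoeff f m‖ ^ 2}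
  zero_mem' := by
    have h : ∀ m : ℤ, fourierCoeff ((0 : L2S1) : S1 → ℂ) m = 0 := fun m => by
      rw [← fourierBasis_repr]; simp
    change Summable _
    simp only [h]
    simp
  add_mem' := by
    intro f g hf hg
    change Summable _ at hf hg ⊢
    refine Summable.of_nonneg_of_le (fun m => ?_) (fun m => ?_) ((hf.add hg).mul_left 2)
    · exact mul_nonneg (Real.rpow_nonneg (Real.sqrt_nonneg _) _) (sq_nonneg _)
    · have h : fourierCoeff ((f + g : L2S1) : S1 → ℂ) m = fourierCoeff f m + fourierCoeff g m := by
        simp only [← fourierBasis_repr]; simp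
      have h1 : ‖fourierCoeff f m + fourierCoeff g m‖ ^ 2
          ≤ 2 * (‖fourierCoeff f m‖ ^ 2 + ‖fourierCoeff g m‖ ^ 2) := by
        have := norm_add_le (fourierCoeff f m) (fourierCoeff g m)
        nlinarith [norm_nonneg (fourierCoeff f m + fourierCoeff g m),
          norm_nonneg (fourierCoeff f m), norm_nonneg (fourierCoeff g m),
          sq_nonneg (‖fourierCoeff f m‖ - ‖fourierCoeff g m‖)]
      have h2 : 0 ≤ bracket m ^ (2 * r) := Real.rpow_nonneg (Real.sqrt_nonneg _) _
      rw [h]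
      nlinarith [mul_le_mul_of_nonneg_left h1 h2]
  smul_mem' := by
    intro c f hf
    change Summable _ at hf ⊢
    have h : ∀ m : ℤ, fourierCoeff ((c • f : L2S1) : S1 → ℂ) m = c * fourierCoeff f m := fun m => by
      simp only [← fourierBasis_repr]; simp
    refine (hf.mul_left (‖c‖ ^ 2)).congr fun m => ?_
    rw [h, norm_mul]
    ring

/-- The norm of `H^r(S¹)`. -/
def circleSobolevNorm (r : ℝ) (f : circleSobolev r) : ℝ :=
  Real.sqrt (∑' m : ℤ, bracket m ^ (2 * r) * ‖fourierCoeff (f : L2S1) m‖ ^ 2)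

/-- `C^∞(S¹)`. -/
def SmoothOnCircle (a : S1 → ℂ) : Prop := ContDiff ℝ ∞ (fun t : ℝ => a (t : S1))

/-! ### The Neumann trace on the conormal space -/

/-- The conormal space `𝒜_γ`: `C^∞(𝔻) + x^(-γ) C^∞(𝔻)` for `γ ≠ 0`,
`C^∞(𝔻) + log x C^∞(𝔻)` for `γ = 0`, as functions on the open disk. -/
def Conormal (γ : ℝ) (f : ℂ → ℂ) : Prop :=
  ∃ f₀ f₁ : ℂ → ℂ, SmoothOnDisk f₀ ∧ SmoothOnDisk f₁ ∧ ∀ z ∈ Metric.ball (0 : ℂ) 1,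
    f z = f₀ z + (((if γ = 0 then Real.log (1 - ‖z‖ ^ 2) else (1 - ‖z‖ ^ 2) ^ (-γ)) : ℝ) : ℂ) * f₁ z

/-- The radial solution `φ_γ`, as a function of `x = 1 - ρ²`; `c₀` is the fixed constant used for
`γ = 0`. -/
def phi (c₀ γ x : ℝ) : ℝ :=
  if γ < 0 then 1
  else if γ = 0 then Real.log x - Real.log (1 - x) - c₀
  else -γ * ∑' k : ℕ, x ^ ((k : ℝ) - γ) / ((k : ℝ) - γ)

/-- The point of the disk with polar coordinates `(ρ, θ)`. -/
def polar (ρ θ : ℝ) : ℂ := (ρ : ℂ) * Complex.exp ((θ : ℂ) * Complex.I)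

/-- The Wronskian `W(f, φ_γ) = ρ x^(γ+1) (f ∂_ρ φ_γ - φ_γ ∂_ρ f)` at `(ρ, θ)`. -/
def wronskian (c₀ γ : ℝ) (f : ℂ → ℂ) (ρ θ : ℝ) : ℂ :=
  ((ρ * (1 - ρ ^ 2) ^ (γ + 1) : ℝ) : ℂ) *
    (f (polar ρ θ) * ((deriv (fun t : ℝ => phi c₀ γ (1 - t ^ 2)) ρ : ℝ) : ℂ)
      - ((phi c₀ γ (1 - ρ ^ 2) : ℝ) : ℂ) * deriv (fun t : ℝ => f (polar t θ)) ρ)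

/-- `g` is the Neumann trace `τ_γ^N f`: the boundary value of `W(f, φ_γ)`. -/
def HasNeumannTrace (c₀ γ : ℝ) (f : ℂ → ℂ) (g : S1 → ℂ) : Prop :=
  ∀ θ : ℝ, Tendsto (fun ρ : ℝ => wronskian c₀ γ f ρ θ) (𝓝[<] 1) (𝓝 (g (θ : S1)))

/-! ### Bounded extensions of the trace, and right inverses -/

/-- `T` is a bounded linear map `H̃_D^{s,γ}(𝔻) → H^{s-1-|γ|}(S¹)` which coincides with `τ_γ^N` on
all elements of `𝒜_γ` that belong to `H̃_D^{s,γ}(𝔻)`. -/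
def IsNeumannExtension (c₀ γ s : ℝ)
    (T : dirichletSobolev γ s →ₗ[ℂ] circleSobolev (s - 1 - |γ|)) : Prop :=
  (∃ C : ℝ, ∀ u, circleSobolevNorm _ (T u) ≤ C * dirichletSobolevNorm γ s u) ∧
  ∀ (f : ℂ → ℂ) (u : dirichletSobolev γ s), Conormal γ f →
    ((u : L2 γ) : ℂ → ℂ) =ᵐ[diskMeasure γ] f →
    ∃ g : S1 → ℂ, HasNeumannTrace c₀ γ f g ∧
      ((T u : L2S1) : S1 → ℂ) =ᵐ[AddCircle.haarAddCircle] g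

/-- `Q` is a continuous linear operator `C^∞(S¹) → C^∞(𝔻)` for the usual Fréchet topologies: every
`C^k` norm on the closed disk of `Q a` is controlled by some `C^N` norm of `a`. -/
def IsContinuousSmoothOperator (Q : (S1 → ℂ) → ℂ → ℂ) : Prop :=
  (∀ a, SmoothOnCircle a → SmoothOnDisk (Q a)) ∧
  (∀ (c : ℂ) (a b : S1 → ℂ), SmoothOnCircle a → SmoothOnCircle b →
    ∀ z ∈ disk, Q (fun θ => c * a θ + b θ) z = c * Q a z + Q b z) ∧
  ∀ k : ℕ, ∃ (N : ℕ) (C : ℝ), ∀ (a : S1 → ℂ) (M : ℝ), SmoothOnCircle a →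
    (∀ j ≤ N, ∀ t : ℝ, ‖iteratedDeriv j (fun t : ℝ => a (t : S1)) t‖ ≤ M) →
    ∀ z ∈ disk, ‖iteratedFDerivWithin ℝ k (Q a) disk z‖ ≤ C * M

/-- `R` is a bounded right inverse of `T` which extends a continuous linear operator from `C^∞(S¹)`
to `C^∞(𝔻)` if `γ ≥ 0`, to `x^(-γ) C^∞(𝔻)` if `γ < 0`. -/
def IsSmoothRightInverse (γ s : ℝ)
    (T : dirichletSobolev γ s →ₗ[ℂ] circleSobolev (s - 1 - |γ|))
    (R : circleSobolev (s - 1 - |γ|) →ₗ[ℂ] dirichletSobolev γ s) : Prop :=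
  (∃ C : ℝ, ∀ h, dirichletSobolevNorm γ s (R h) ≤ C * circleSobolevNorm _ h) ∧
  (∀ h, T (R h) = h) ∧
  ∃ Q : (S1 → ℂ) → ℂ → ℂ, IsContinuousSmoothOperator Q ∧
    ∀ (a : S1 → ℂ) (h : circleSobolev (s - 1 - |γ|)), SmoothOnCircle a →
      ((h : L2S1) : S1 → ℂ) =ᵐ[AddCircle.haarAddCircle] a →
      ((R h : L2 γ) : ℂ → ℂ) =ᵐ[diskMeasure γ]
        fun z => (((1 - ‖z‖ ^ 2) ^ (max (-γ) 0) : ℝ) : ℂ) * Q a z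

end

end KeldyshDisk

namespace KeldyshDisk

noncomputable section

open ComplexConjugate

/-! ### Wirtinger derivatives -/

/-! The problem is diagonalised. Because L_γ(x^(-γ) p) = x^(-γ) L_{-γ} p, writing u = x^σ p with σ =
max(-γ, 0) turns L_γ into L_{|γ|} acting on p (`keldysh_wt`), and for p smooth up to the circle x^σ
p lies in the Friedrichs domain (`wt_eq_dirichletInverse`). In each Fourier mode L_{|γ|} is
triangular on the monomials z^a z̄^b. This gives a Hilbert basis `eig γ (m, k)` of eigenfunctions,
each x^σ times a polynomial, with eigenvalues λ = (|m| + 2k + 1 + |γ|)², so powers of L_{γ,D} act by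
powers of λ. Up to the constant `tauC γ` the Neumann trace is the boundary value of x^(-σ) u, whose
Fourier coefficients are `bt γ m u` = ∑_k `bv γ m k` ⟨eig γ (m, k), u⟩, where `bv` collects the
boundary values of the eigenfunctions.

Boundedness is the Cauchy-Schwarz inequality together with ∑_k bv² λ^(-s) ≤ C (1 + m²)^(1+|γ|-s)
(`exists_bv_sum_bound`). No closed formula for the eigenfunctions enters. Their boundary values are
recovered from Green's formula against h z^a z̄^b, where h is the more singular radial factor at the
boundary: the boundary term is the nonzero constant `kap γ`, the same for all monomials of the mode
(`dual_pairing`). If the test function is concentrated in x ≲ 1/N, Bessel's inequality bounds ∑ bv²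
over λ ≤ N by a multiple of N^(1+|γ|) (`exists_bv_block_bound`), and geometric blocks of eigenvalues
can be summed because s > 1 + |γ|.

For the right inverse, e^{imθ} is extended by x^σ z^a z̄^b with a + b comparable to m². This
function has boundary layer 1/m² and spectral mass near λ ≈ 1 + m², which gives the optimal norm
(`exists_frequency_bound`, `exists_ext_bound`). Its derivatives grow only polynomially in m, so
rapidly decreasing Fourier coefficients give a series converging in C^∞ of the closed disk.

Agreement with the classical trace is proved in `conormal_data`. Let u = x^σ A + h B lie in the
Sobolev space. Its pairing with L of a monomial of the mode tends to 0 as the degree grows, while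
the part h B contributes in the limit `kap γ` times a Fourier coefficient of B. Hence B vanishes on
the circle. Green's formula then identifies `bt` with the Fourier coefficients of A, and the
Wronskian tends to `tauC γ` times A. The extension is unique because the eigenfunctions are conormal
and span a dense subspace.

For the minimal domain, functions vanishing on the circle are limits of test functions in the graph
norm (`mem_testGraph_of_vanishing`), so the minimal range contains L(M_j - M_{j+1}) for consecutive
monomials M_j of a mode. A vector y orthogonal to this range has coefficients c_m bv/λ, and
therefore ⟨y, v⟩ is assembled from the boundary coefficients of L_{γ,D}⁻¹ v
(`mem_minimalRange_of_bt`). The converse inclusion is Green's formula. -/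

theorem two_le_infty : (2 : WithTop ℕ∞) ≤ ∞ := by
  have h : ((2 : ℕ∞) : WithTop ℕ∞) ≤ ((⊤ : ℕ∞) : WithTop ℕ∞) := WithTop.coe_le_coe.2 le_top
  exact h

/-- The Wirtinger derivative `∂f/∂z`. -/
def dz (f : ℂ → ℂ) (z : ℂ) : ℂ := (fderiv ℝ f z 1 - Complex.I * fderiv ℝ f z Complex.I) / 2

/-- The Wirtinger derivative `∂f/∂z̄`. -/
def db (f : ℂ → ℂ) (z : ℂ) : ℂ := (fderiv ℝ f z 1 + Complex.I * fderiv ℝ f z Complex.I) / 2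

/-- A real-linear map of ℂ splits into a complex-linear and an antilinear part. The two coefficients
are the Wirtinger derivatives. -/
theorem clm_apply_eq (L : ℂ →L[ℝ] ℂ) (v : ℂ) :
    L v = (L 1 - Complex.I * L Complex.I) / 2 * v
      + (L 1 + Complex.I * L Complex.I) / 2 * conj v := by
  have h : v = v.re • (1 : ℂ) + v.im • Complex.I := by
    simp [Complex.re_add_im]
  have h2 : L v = v.re * L 1 + v.im * L Complex.I := by
    conv_lhs => rw [h]
    rw [map_add, map_smul, map_smul]; simp
  have h4 : v = v.re + v.im * Complex.I := (Complex.re_add_im v).symm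
  have h5 : conj v = v.re - v.im * Complex.I := by
    conv_lhs => rw [h4]
    simp [-Complex.re_add_im, sub_eq_add_neg]
  rw [h2, h5]
  conv_rhs => rw [h4]
  simp only [Complex.add_re, Complex.add_im, Complex.ofReal_re, Complex.ofReal_im, Complex.mul_re,
    Complex.mul_im, Complex.I_re, Complex.I_im]
  ring_nf
  simp only [Complex.I_sq]
  ring

theorem fderiv_apply_eq (f : ℂ → ℂ) (z v : ℂ) :
    fderiv ℝ f z v = dz f z * v + db f z * conj v :=
  clm_apply_eq _ v

/-- The splitting into linear and antilinear parts is unique, so both derivatives can be read off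
any formula for the differential. The calculus rules below are obtained this way. -/
theorem dz_db_of_hasFDerivAt {f : ℂ → ℂ} {L : ℂ →L[ℝ] ℂ} {z : ℂ} {a b : ℂ}
    (h : HasFDerivAt f L z) (hL : ∀ v, L v = a * v + b * conj v) : dz f z = a ∧ db f z = b := by
  constructor
  · rw [dz, h.fderiv, hL, hL]
    simp
    ring_nf
    simp only [Complex.I_sq]
    ring
  · rw [db, h.fderiv, hL, hL]
    simp
    ring_nf
    simp only [Complex.I_sq]
    ring

theorem dz_congr {f g : ℂ → ℂ} {z : ℂ} (h : f =ᶠ[𝓝 z] g) : dz f z = dz g z := by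
  rw [dz, dz, h.fderiv_eq]

theorem db_congr {f g : ℂ → ℂ} {z : ℂ} (h : f =ᶠ[𝓝 z] g) : db f z = db g z := by
  rw [db, db, h.fderiv_eq]

theorem dz_mul {f g : ℂ → ℂ} {z : ℂ} (hf : DifferentiableAt ℝ f z) (hg : DifferentiableAt ℝ g z) :
    dz (fun z => f z * g z) z = dz f z * g z + f z * dz g z := by
  have h := hf.hasFDerivAt.mul hg.hasFDerivAt
  refine (dz_db_of_hasFDerivAt (b := db f z * g z + f z * db g z) h fun v => ?_).1
  simp [fderiv_apply_eq]; ring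

theorem db_mul {f g : ℂ → ℂ} {z : ℂ} (hf : DifferentiableAt ℝ f z) (hg : DifferentiableAt ℝ g z) :
    db (fun z => f z * g z) z = db f z * g z + f z * db g z := by
  have h := hf.hasFDerivAt.mul hg.hasFDerivAt
  refine (dz_db_of_hasFDerivAt (a := dz f z * g z + f z * dz g z) h fun v => ?_).2
  simp [fderiv_apply_eq]; ring

theorem dz_add {f g : ℂ → ℂ} {z : ℂ} (hf : DifferentiableAt ℝ f z) (hg : DifferentiableAt ℝ g z) :
    dz (fun z => f z + g z) z = dz f z + dz g z := by
  have h := hf.hasFDerivAt.add hg.hasFDerivAt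
  refine (dz_db_of_hasFDerivAt (b := db f z + db g z) h fun v => ?_).1
  simp [fderiv_apply_eq]; ring

theorem db_add {f g : ℂ → ℂ} {z : ℂ} (hf : DifferentiableAt ℝ f z) (hg : DifferentiableAt ℝ g z) :
    db (fun z => f z + g z) z = db f z + db g z := by
  have h := hf.hasFDerivAt.add hg.hasFDerivAt
  refine (dz_db_of_hasFDerivAt (a := dz f z + dz g z) h fun v => ?_).2
  simp [fderiv_apply_eq]; ring

theorem dz_const_mul {f : ℂ → ℂ} {z : ℂ} (c : ℂ) (hf : DifferentiableAt ℝ f z) :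
    dz (fun z => c * f z) z = c * dz f z := by
  have h := hf.hasFDerivAt.const_mul c
  refine (dz_db_of_hasFDerivAt (b := c * db f z) h fun v => ?_).1
  simp [fderiv_apply_eq]; ring

theorem db_const_mul {f : ℂ → ℂ} {z : ℂ} (c : ℂ) (hf : DifferentiableAt ℝ f z) :
    db (fun z => c * f z) z = c * db f z := by
  have h := hf.hasFDerivAt.const_mul c
  refine (dz_db_of_hasFDerivAt (a := c * dz f z) h fun v => ?_).2
  simp [fderiv_apply_eq]; ring

theorem dz_const (c z : ℂ) : dz (fun _ => c) z = 0 := by simp [dz]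

theorem db_const (c z : ℂ) : db (fun _ => c) z = 0 := by simp [db]

theorem dz_id (z : ℂ) : dz (fun z => z) z = 1 :=
  (dz_db_of_hasFDerivAt (b := 0) (hasFDerivAt_id z) fun v => by simp).1

theorem db_id (z : ℂ) : db (fun z => z) z = 0 :=
  (dz_db_of_hasFDerivAt (a := 1) (hasFDerivAt_id z) fun v => by simp).2

theorem hasFDerivAt_conj (z : ℂ) : HasFDerivAt (fun z : ℂ => conj z)
    (Complex.conjCLE : ℂ →L[ℝ] ℂ) z := Complex.conjCLE.hasFDerivAt

theorem dz_conj (z : ℂ) : dz (fun z => conj z) z = 0 :=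
  (dz_db_of_hasFDerivAt (b := 1) (hasFDerivAt_conj z) fun v => by simp).1

theorem db_conj (z : ℂ) : db (fun z => conj z) z = 1 :=
  (dz_db_of_hasFDerivAt (a := 0) (hasFDerivAt_conj z) fun v => by simp).2

theorem dz_db_conj_comp {f : ℂ → ℂ} {z : ℂ} (hf : DifferentiableAt ℝ f z) :
    dz (fun z => conj (f z)) z = conj (db f z) ∧ db (fun z => conj (f z)) z = conj (dz f z) := by
  have h := (hasFDerivAt_conj (f z)).comp z hf.hasFDerivAt
  refine dz_db_of_hasFDerivAt h fun v => ?_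
  simp [fderiv_apply_eq]; ring

/-- The boundary defining function `x = 1 - |z|²`. -/
def xr (z : ℂ) : ℝ := 1 - ‖z‖ ^ 2

theorem xr_eq (z : ℂ) : ((xr z : ℝ) : ℂ) = 1 - z * conj z := by
  rw [xr, Complex.mul_conj, Complex.normSq_eq_norm_sq]; push_cast; ring

theorem hasFDerivAt_xr (z : ℂ) :
    HasFDerivAt xr (-(2 : ℝ) • innerSL ℝ z) z := by
  have h := (hasFDerivAt_id z).norm_sq.const_sub 1
  refine h.congr_fderiv ?_
  ext x; simp; ring

theorem contDiff_xr : ContDiff ℝ ∞ xr := contDiff_const.sub (contDiff_norm_sq ℝ)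

theorem continuous_xr : Continuous xr := contDiff_xr.continuous

theorem hasFDerivAt_radial {k : ℝ → ℝ} {z : ℂ} (hk : DifferentiableAt ℝ k (xr z)) :
    dz (fun z => ((k (xr z) : ℝ) : ℂ)) z = -((deriv k (xr z) : ℝ) : ℂ) * conj z ∧
    db (fun z => ((k (xr z) : ℝ) : ℂ)) z = -((deriv k (xr z) : ℝ) : ℂ) * z := by
  have h1 := hk.hasDerivAt.comp_hasFDerivAt z (hasFDerivAt_xr z)
  have h := Complex.ofRealCLM.hasFDerivAt.comp z h1
  refine dz_db_of_hasFDerivAt h fun v => ?_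
  apply Complex.ext
  · simp [Complex.inner]; ring
  · simp [Complex.inner]; ring

theorem dz_radial {k : ℝ → ℝ} {z : ℂ} (hk : DifferentiableAt ℝ k (xr z)) :
    dz (fun z => ((k (xr z) : ℝ) : ℂ)) z = -((deriv k (xr z) : ℝ) : ℂ) * conj z :=
  (hasFDerivAt_radial hk).1

theorem db_radial {k : ℝ → ℝ} {z : ℂ} (hk : DifferentiableAt ℝ k (xr z)) :
    db (fun z => ((k (xr z) : ℝ) : ℂ)) z = -((deriv k (xr z) : ℝ) : ℂ) * z :=
  (hasFDerivAt_radial hk).2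

theorem contDiffAt_radial {k : ℝ → ℝ} {z : ℂ} (hk : ContDiffAt ℝ ∞ k (xr z)) :
    ContDiffAt ℝ ∞ (fun z => ((k (xr z) : ℝ) : ℂ)) z :=
  Complex.ofRealCLM.contDiff.contDiffAt.comp z (hk.comp z contDiff_xr.contDiffAt)

/-! ### Second Wirtinger derivatives and the operator written in terms of them -/

theorem contDiffAt_fderiv {f : ℂ → ℂ} {z : ℂ} (hf : ContDiffAt ℝ ∞ f z) (v : ℂ) :
    ContDiffAt ℝ ∞ (fun w => fderiv ℝ f w v) z :=
  (hf.fderiv_right (m := ∞) (by simp)).clm_apply contDiffAt_const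

theorem contDiffAt_dz {f : ℂ → ℂ} {z : ℂ} (hf : ContDiffAt ℝ ∞ f z) :
    ContDiffAt ℝ ∞ (dz f) z :=
  ((contDiffAt_fderiv hf 1).sub (contDiffAt_const.mul (contDiffAt_fderiv hf _))).div_const _

theorem contDiffAt_db {f : ℂ → ℂ} {z : ℂ} (hf : ContDiffAt ℝ ∞ f z) :
    ContDiffAt ℝ ∞ (db f) z :=
  ((contDiffAt_fderiv hf 1).add (contDiffAt_const.mul (contDiffAt_fderiv hf _))).div_const _

theorem differentiableAt_of_smooth {f : ℂ → ℂ} {z : ℂ} (hf : ContDiffAt ℝ ∞ f z) :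
    DifferentiableAt ℝ f z := hf.differentiableAt (by simp)

theorem eventually_smooth {f : ℂ → ℂ} {z : ℂ} (hf : ContDiffAt ℝ ∞ f z) :
    ∀ᶠ w in 𝓝 z, DifferentiableAt ℝ f w := by
  have h1 : ContDiffAt ℝ 1 f z := hf.of_le (by exact_mod_cast le_top)
  filter_upwards [h1.eventually (by simp)] with w hw
  exact hw.differentiableAt (by simp)

theorem fderiv_fderiv_eq {f : ℂ → ℂ} {z : ℂ} (hf : ContDiffAt ℝ ∞ f z) (a b : ℂ) :
    fderiv ℝ (fderiv ℝ f) z a b = (dz (dz f) z * a + db (dz f) z * conj a) * b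
      + (dz (db f) z * a + db (db f) z * conj a) * conj b := by
  have h1 : DifferentiableAt ℝ (fderiv ℝ f) z :=
    (hf.fderiv_right (m := ∞) (by simp)).differentiableAt (by simp)
  have h2 : fderiv ℝ (fderiv ℝ f) z a b = fderiv ℝ (fun w => fderiv ℝ f w b) z a := by
    rw [fderiv_clm_apply h1 (differentiableAt_const b)]
    simp
  have h3 : (fun w => fderiv ℝ f w b) = fun w => dz f w * b + db f w * conj b := by
    funext w; exact fderiv_apply_eq f w b
  have h4 := differentiableAt_of_smooth (contDiffAt_dz hf)
  have h5 := differentiableAt_of_smooth (contDiffAt_db hf)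
  rw [h2, h3, fderiv_apply_eq, dz_add (by fun_prop) (by fun_prop), db_add (by fun_prop) (by fun_prop),
    dz_mul h4 (by fun_prop), dz_mul h5 (by fun_prop), db_mul h4 (by fun_prop),
    db_mul h5 (by fun_prop)]
  simp only [dz_const, db_const]
  ring

theorem db_dz_comm {f : ℂ → ℂ} {z : ℂ} (hf : ContDiffAt ℝ ∞ f z) :
    db (dz f) z = dz (db f) z := by
  have h : IsSymmSndFDerivAt ℝ f z := hf.isSymmSndFDerivAt (by simpa using two_le_infty)
  -- Symmetry at the pair (1, i) suffices: the difference of the two sides is 2i times the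
  -- commutator of ∂ and ∂̄.
  have h1 := h 1 Complex.I
  rw [fderiv_fderiv_eq hf, fderiv_fderiv_eq hf] at h1
  simp at h1
  have h2 : (2 * Complex.I) * (db (dz f) z - dz (db f) z) = 0 := by linear_combination h1
  have h3 : (2 * Complex.I : ℂ) ≠ 0 := by simp
  exact sub_eq_zero.1 ((mul_eq_zero.1 h2).resolve_left h3)

/-- The operator `z ∂_z + z̄ ∂_z̄`, i.e. `ρ ∂_ρ`. -/
def euler (f : ℂ → ℂ) (z : ℂ) : ℂ := z * dz f z + conj z * db f z

/-- Here Δ = 4 ∂∂̄, ∂_ω = i(z∂ - z̄∂̄) and x = 1 - z z̄ have been inserted. With polynomial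
coefficients in z and z̄, the later identities for the operator reduce to ring identities. -/
theorem keldysh_eq (γ : ℝ) {f : ℂ → ℂ} {z : ℂ} (hf : ContDiffAt ℝ ∞ f z) :
    keldysh γ f z = -4 * dz (db f) z + z ^ 2 * dz (dz f) z + 2 * z * conj z * dz (db f) z
      + conj z ^ 2 * db (db f) z + (3 + 2 * γ) * euler f z + (γ + 1) ^ 2 * f z := by
  have h0 : angularDeriv f = fun w => Complex.I * (w * dz f w) - Complex.I * (conj w * db f w) := by
    funext w; rw [angularDeriv, fderiv_apply_eq]; simp; ring
  have h4 := differentiableAt_of_smooth (contDiffAt_dz hf)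
  have h5 := differentiableAt_of_smooth (contDiffAt_db hf)
  have hc : DifferentiableAt ℝ (fun z : ℂ => conj z) z := (hasFDerivAt_conj z).differentiableAt
  have hid : DifferentiableAt ℝ (fun z : ℂ => z) z := differentiableAt_id
  have h6 : DifferentiableAt ℝ (fun w => w * dz f w) z := hid.mul h4
  have h7 : DifferentiableAt ℝ (fun w => conj w * db f w) z := hc.mul h5
  have h8 : angularDeriv f = fun w => Complex.I * (w * dz f w) + (-Complex.I) * (conj w * db f w) := by
    rw [h0]; funext w; ring
  have hang : angularDeriv (angularDeriv f) z =
      -(z * dz f z + z ^ 2 * dz (dz f) z - 2 * z * conj z * dz (db f) z + conj z * db f z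
        + conj z ^ 2 * db (db f) z) := by
    rw [angularDeriv, fderiv_apply_eq, h8,
      dz_add (h6.const_mul _) (h7.const_mul _), db_add (h6.const_mul _) (h7.const_mul _),
      dz_const_mul _ h6, dz_const_mul _ h7, db_const_mul _ h6, db_const_mul _ h7,
      dz_mul hid h4, dz_mul hc h5, db_mul hid h4, db_mul hc h5, dz_id, db_id, dz_conj, db_conj,
      db_dz_comm hf]
    simp
    ring_nf
    simp only [Complex.I_sq]
    ring
  have hlap : Laplacian.laplacian f z = 4 * dz (db f) z := by
    rw [InnerProductSpace.laplacian_eq_iteratedFDeriv_complexPlane]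
    simp only [iteratedFDeriv_two_apply, fderiv_fderiv_eq hf, db_dz_comm hf]
    simp
    ring_nf
    simp only [Complex.I_sq]
    ring
  rw [keldysh, hang, hlap, fderiv_apply_eq]
  have hx := xr_eq z
  rw [xr] at hx
  rw [hx, euler]
  push_cast
  ring

theorem keldysh_congr (γ : ℝ) {f g : ℂ → ℂ} {z : ℂ} (h : f =ᶠ[𝓝 z] g) :
    keldysh γ f z = keldysh γ g z := by
  have h1 : angularDeriv f =ᶠ[𝓝 z] angularDeriv g := by
    filter_upwards [h.eventually_nhds] with w hw
    have hw' : f =ᶠ[𝓝 w] g := hw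
    rw [angularDeriv, angularDeriv, hw'.fderiv_eq]
  have h2 : Laplacian.laplacian f z = Laplacian.laplacian g z := by
    simp only [InnerProductSpace.laplacian_eq_iteratedFDeriv_complexPlane]
    rw [h.iteratedFDeriv ℝ 2 |>.eq_of_nhds]
  rw [keldysh, keldysh, h2, angularDeriv, angularDeriv, h1.fderiv_eq, h.fderiv_eq, h.eq_of_nhds]

/-! ### Products with a radial factor, and the intertwining of γ with -γ -/

theorem dz_dz_mul {f g : ℂ → ℂ} {z : ℂ} (hf : ContDiffAt ℝ ∞ f z) (hg : ContDiffAt ℝ ∞ g z) :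
    dz (dz fun z => f z * g z) z = dz (dz f) z * g z + 2 * dz f z * dz g z + f z * dz (dz g) z := by
  have h : (dz fun z => f z * g z) =ᶠ[𝓝 z] fun z => dz f z * g z + f z * dz g z := by
    filter_upwards [eventually_smooth hf, eventually_smooth hg] with w h1 h2 using dz_mul h1 h2
  have h1 := differentiableAt_of_smooth hf
  have h2 := differentiableAt_of_smooth hg
  have h3 := differentiableAt_of_smooth (contDiffAt_dz hf)
  have h4 := differentiableAt_of_smooth (contDiffAt_dz hg)
  have hA : DifferentiableAt ℝ (fun z => dz f z * g z) z := h3.mul h2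
  have hB : DifferentiableAt ℝ (fun z => f z * dz g z) z := h1.mul h4
  rw [dz_congr h, dz_add hA hB, dz_mul h3 h2, dz_mul h1 h4]
  ring

theorem db_db_mul {f g : ℂ → ℂ} {z : ℂ} (hf : ContDiffAt ℝ ∞ f z) (hg : ContDiffAt ℝ ∞ g z) :
    db (db fun z => f z * g z) z = db (db f) z * g z + 2 * db f z * db g z + f z * db (db g) z := by
  have h : (db fun z => f z * g z) =ᶠ[𝓝 z] fun z => db f z * g z + f z * db g z := by
    filter_upwards [eventually_smooth hf, eventually_smooth hg] with w h1 h2 using db_mul h1 h2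
  have h1 := differentiableAt_of_smooth hf
  have h2 := differentiableAt_of_smooth hg
  have h3 := differentiableAt_of_smooth (contDiffAt_db hf)
  have h4 := differentiableAt_of_smooth (contDiffAt_db hg)
  have hA : DifferentiableAt ℝ (fun z => db f z * g z) z := h3.mul h2
  have hB : DifferentiableAt ℝ (fun z => f z * db g z) z := h1.mul h4
  rw [db_congr h, db_add hA hB, db_mul h3 h2, db_mul h1 h4]
  ring

theorem dz_db_mul {f g : ℂ → ℂ} {z : ℂ} (hf : ContDiffAt ℝ ∞ f z) (hg : ContDiffAt ℝ ∞ g z) :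
    dz (db fun z => f z * g z) z = dz (db f) z * g z + db f z * dz g z + dz f z * db g z
      + f z * dz (db g) z := by
  have h : (db fun z => f z * g z) =ᶠ[𝓝 z] fun z => db f z * g z + f z * db g z := by
    filter_upwards [eventually_smooth hf, eventually_smooth hg] with w h1 h2 using db_mul h1 h2
  have h1 := differentiableAt_of_smooth hf
  have h2 := differentiableAt_of_smooth hg
  have h3 := differentiableAt_of_smooth (contDiffAt_db hf)
  have h4 := differentiableAt_of_smooth (contDiffAt_db hg)
  have hA : DifferentiableAt ℝ (fun z => db f z * g z) z := h3.mul h2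
  have hB : DifferentiableAt ℝ (fun z => f z * db g z) z := h1.mul h4
  rw [dz_congr h, dz_add hA hB, dz_mul h3 h2, dz_mul h1 h4]
  ring

theorem eventually_differentiable_radial {k : ℝ → ℝ} {z : ℂ} (hk : ContDiffAt ℝ ∞ k (xr z)) :
    ∀ᶠ w in 𝓝 z, DifferentiableAt ℝ k (xr w) := by
  have h1 : ContDiffAt ℝ 1 k (xr z) := hk.of_le (by exact_mod_cast le_top)
  have h2 := (continuous_xr.tendsto z).eventually (h1.eventually (by simp))
  filter_upwards [h2] with w hw
  exact hw.differentiableAt (by simp)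

theorem second_derivatives_radial {k : ℝ → ℝ} {z : ℂ} (hk : ContDiffAt ℝ ∞ k (xr z)) :
    dz (dz fun z => ((k (xr z) : ℝ) : ℂ)) z = (deriv (deriv k) (xr z) : ℝ) * conj z ^ 2 ∧
    db (db fun z => ((k (xr z) : ℝ) : ℂ)) z = (deriv (deriv k) (xr z) : ℝ) * z ^ 2 ∧
    dz (db fun z => ((k (xr z) : ℝ) : ℂ)) z
      = (deriv (deriv k) (xr z) : ℝ) * (z * conj z) - (deriv k (xr z) : ℝ) := by
  have hk1 : ContDiffAt ℝ ∞ (deriv k) (xr z) := hk.derivWithin (by simp)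
  have hk2 := hk1.differentiableAt (by simp)
  have hd := (differentiableAt_of_smooth (contDiffAt_radial hk1)).const_mul (-1 : ℂ)
  have hc : DifferentiableAt ℝ (fun z : ℂ => conj z) z := (hasFDerivAt_conj z).differentiableAt
  have hid : DifferentiableAt ℝ (fun z : ℂ => z) z := differentiableAt_id
  have h1 : (dz fun z => ((k (xr z) : ℝ) : ℂ)) =ᶠ[𝓝 z]
      fun z => ((-1) * ((deriv k (xr z) : ℝ) : ℂ)) * conj z := by
    filter_upwards [eventually_differentiable_radial hk] with w hw
    rw [dz_radial hw]; ring
  have h2 : (db fun z => ((k (xr z) : ℝ) : ℂ)) =ᶠ[𝓝 z]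
      fun z => ((-1) * ((deriv k (xr z) : ℝ) : ℂ)) * z := by
    filter_upwards [eventually_differentiable_radial hk] with w hw
    rw [db_radial hw]; ring
  refine ⟨?_, ?_, ?_⟩
  · rw [dz_congr h1, dz_mul hd hc, dz_const_mul _ (differentiableAt_of_smooth (contDiffAt_radial hk1)),
      dz_radial hk2, dz_conj]
    ring
  · rw [db_congr h2, db_mul hd hid, db_const_mul _ (differentiableAt_of_smooth (contDiffAt_radial hk1)),
      db_radial hk2, db_id]
    ring
  · rw [dz_congr h2, dz_mul hd hid, dz_const_mul _ (differentiableAt_of_smooth (contDiffAt_radial hk1)),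
      dz_radial hk2, dz_id]
    ring

/-- The operator applied to a product with a radial factor. -/
theorem keldysh_radial_mul (γ : ℝ) {k : ℝ → ℝ} {w : ℂ → ℂ} {z : ℂ}
    (hk : ContDiffAt ℝ ∞ k (xr z)) (hw : ContDiffAt ℝ ∞ w z) :
    keldysh γ (fun z => ((k (xr z) : ℝ) : ℂ) * w z) z =
      (k (xr z) : ℝ) * keldysh γ w z + 4 * xr z * deriv k (xr z) * euler w z
      - 4 * (z * conj z) * xr z * deriv (deriv k) (xr z) * w z
      + 4 * xr z * deriv k (xr z) * w z
      - 4 * (1 + γ) * (z * conj z) * deriv k (xr z) * w z := by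
  have hK := contDiffAt_radial hk
  have hk' := hk.differentiableAt (by simp)
  obtain ⟨h1, h2, h3⟩ := second_derivatives_radial hk
  have hKd := differentiableAt_of_smooth hK
  have hwd := differentiableAt_of_smooth hw
  rw [keldysh_eq γ (hK.mul hw), keldysh_eq γ hw, dz_dz_mul hK hw, db_db_mul hK hw, dz_db_mul hK hw,
    h1, h2, h3, euler, euler, dz_mul hKd hwd, db_mul hKd hwd, dz_radial hk', db_radial hk', xr_eq]
  ring

/-- `L_γ (x^(-γ) p) = x^(-γ) L_{-γ} p`. -/
theorem keldysh_rpow_mul (γ : ℝ) {w : ℂ → ℂ} {z : ℂ} (hz : 0 < xr z) (hw : ContDiffAt ℝ ∞ w z) :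
    keldysh γ (fun z => ((xr z ^ (-γ) : ℝ) : ℂ) * w z) z = (xr z ^ (-γ) : ℝ) * keldysh (-γ) w z := by
  have hk : ContDiffAt ℝ ∞ (fun t : ℝ => t ^ (-γ)) (xr z) :=
    Real.contDiffAt_rpow_const_of_ne hz.ne'
  have h1 : deriv (fun t : ℝ => t ^ (-γ)) (xr z) = -γ * xr z ^ (-γ - 1) :=
    Real.deriv_rpow_const ..
  have h2 : deriv (deriv (fun t : ℝ => t ^ (-γ))) (xr z) = -γ * (-γ - 1) * xr z ^ (-γ - 2) := by
    have : deriv (fun t : ℝ => t ^ (-γ)) = fun t => -γ * t ^ (-γ - 1) := by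
      funext t; exact Real.deriv_rpow_const ..
    rw [this, deriv_const_mul_field, Real.deriv_rpow_const]
    rw [show -γ - 1 - 1 = -γ - 2 by ring]; ring
  have h3 : xr z ^ (-γ - 1) = xr z ^ (-γ) / xr z := by rw [Real.rpow_sub hz, Real.rpow_one]
  have h4 : xr z ^ (-γ - 2) = xr z ^ (-γ) / xr z ^ 2 := by
    rw [Real.rpow_sub hz]; norm_num
  have hxc : (xr z : ℂ) ≠ 0 := by exact_mod_cast hz.ne'
  rw [keldysh_radial_mul γ hk hw, h1, h2, h3, h4, keldysh_eq γ hw, keldysh_eq (-γ) hw]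
  have hzz : z * conj z = 1 - xr z := by rw [xr_eq]; ring
  rw [hzz]
  push_cast
  field_simp
  ring

/-- The operator applied to a product with `log x`, for `γ = 0`. -/
theorem keldysh_log_mul (c : ℝ) {w : ℂ → ℂ} {z : ℂ} (hz : 0 < xr z) (hw : ContDiffAt ℝ ∞ w z) :
    keldysh 0 (fun z => ((Real.log (xr z) + c : ℝ) : ℂ) * w z) z
      = (Real.log (xr z) + c : ℝ) * keldysh 0 w z + 4 * (euler w z + w z) := by
  have hk : ContDiffAt ℝ ∞ (fun t : ℝ => Real.log t + c) (xr z) :=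
    (Real.contDiffAt_log.2 hz.ne').add contDiffAt_const
  have h0 : deriv (fun t : ℝ => Real.log t + c) = fun t => t⁻¹ := by
    funext t; simp
  have hxc : (xr z : ℂ) ≠ 0 := by exact_mod_cast hz.ne'
  have hzz : z * conj z = 1 - xr z := by rw [xr_eq]; ring
  rw [keldysh_radial_mul 0 hk hw, h0, hzz]
  simp only [deriv_inv]
  push_cast
  field_simp
  ring

/-! ### Integration on the disk -/

theorem mem_ball_iff_xr {z : ℂ} : z ∈ Metric.ball (0 : ℂ) 1 ↔ 0 < xr z := by
  rw [mem_ball_zero_iff, xr, sub_pos, sq_lt_one_iff₀ (norm_nonneg z)]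

theorem xr_le_one (z : ℂ) : xr z ≤ 1 := by
  rw [xr]; nlinarith [sq_nonneg ‖z‖]

theorem measurable_density (γ : ℝ) :
    Measurable fun z : ℂ => ENNReal.ofReal ((1 - ‖z‖ ^ 2) ^ γ) := by fun_prop

theorem integral_diskMeasure {E : Type*} [NormedAddCommGroup E] [NormedSpace ℝ E]
    (γ : ℝ) (f : ℂ → E) :
    ∫ z, f z ∂diskMeasure γ = ∫ z in Metric.ball (0 : ℂ) 1, (xr z ^ γ) • f z := by
  rw [diskMeasure, integral_withDensity_eq_integral_toReal_smul (measurable_density γ)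
    (ae_of_all _ fun z => ENNReal.ofReal_lt_top)]
  refine setIntegral_congr_fun measurableSet_ball fun z hz => ?_
  rw [mem_ball_iff_xr] at hz
  change (ENNReal.ofReal (xr z ^ γ)).toReal • f z = _
  rw [ENNReal.toReal_ofReal (Real.rpow_nonneg hz.le _)]

theorem integrable_diskMeasure {E : Type*} [NormedAddCommGroup E] [NormedSpace ℝ E]
    {γ : ℝ} {f : ℂ → E} :
    Integrable f (diskMeasure γ) ↔
      IntegrableOn (fun z => (xr z ^ γ) • f z) (Metric.ball (0 : ℂ) 1) := by
  rw [diskMeasure, integrable_withDensity_iff_integrable_smul' (measurable_density γ)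
    (ae_of_all _ fun z => ENNReal.ofReal_lt_top)]
  refine integrableOn_congr_fun (fun z hz => ?_) measurableSet_ball
  rw [mem_ball_iff_xr] at hz
  change (ENNReal.ofReal (xr z ^ γ)).toReal • f z = _
  rw [ENNReal.toReal_ofReal (Real.rpow_nonneg hz.le _)]

theorem diskMeasure_absolutelyContinuous (γ : ℝ) :
    diskMeasure γ ≪ volume.restrict (Metric.ball (0 : ℂ) 1) :=
  withDensity_absolutelyContinuous _ _

theorem ae_mem_ball (γ : ℝ) : ∀ᵐ z ∂diskMeasure γ, 0 < xr z := by
  refine (diskMeasure_absolutelyContinuous γ).ae_le ?_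
  filter_upwards [ae_restrict_mem measurableSet_ball] with z hz
  exact mem_ball_iff_xr.1 hz

theorem ae_ne_zero (γ : ℝ) : ∀ᵐ z ∂diskMeasure γ, z ≠ 0 := by
  refine (diskMeasure_absolutelyContinuous γ).ae_le ?_
  exact ae_restrict_of_ae (Measure.ae_ne volume 0)

theorem aestronglyMeasurable_of_continuousOn {γ : ℝ} {f : ℂ → ℂ}
    (hf : ContinuousOn f (Metric.ball (0 : ℂ) 1)) :
    AEStronglyMeasurable f (diskMeasure γ) :=
  (hf.aestronglyMeasurable measurableSet_ball).mono_ac (diskMeasure_absolutelyContinuous γ)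

/-! ### Radial integrals in the variable x -/

theorem image_one_sub_sq : (fun y : ℝ => 1 - y ^ 2) '' Set.Ioo 0 1 = Set.Ioo 0 1 := by
  ext x
  constructor
  · rintro ⟨y, ⟨h0, h1⟩, rfl⟩
    exact ⟨by nlinarith, by nlinarith⟩
  · rintro ⟨h0, h1⟩
    refine ⟨Real.sqrt (1 - x), ⟨Real.sqrt_pos.2 (by linarith), ?_⟩, ?_⟩
    · rw [Real.sqrt_lt' one_pos]; linarith
    · change 1 - Real.sqrt (1 - x) ^ 2 = x
      rw [Real.sq_sqrt (by linarith)]; ring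

theorem hasDerivAt_one_sub_sq (y : ℝ) : HasDerivAt (fun y : ℝ => 1 - y ^ 2) (-(2 * y)) y := by
  simpa using (hasDerivAt_pow 2 y).const_sub 1

theorem injOn_one_sub_sq : Set.InjOn (fun y : ℝ => 1 - y ^ 2) (Set.Ioo 0 1) := by
  intro a ha b hb h
  have h' : a ^ 2 = b ^ 2 := by simpa using h
  exact (sq_eq_sq₀ ha.1.le hb.1.le).1 h'

theorem integrableOn_radial {E : Type*} [NormedAddCommGroup E] [NormedSpace ℝ E] {g : ℝ → E} :
    IntegrableOn (fun z => g (xr z)) (Metric.ball (0 : ℂ) 1) ↔ IntegrableOn g (Set.Ioo 0 1) := by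
  have h1 := integrableOn_fun_norm_addHaar (E := ℂ) volume (f := fun y => g (1 - y ^ 2)) (r := 1)
  simp only [Complex.finrank_real_complex, Nat.add_one_sub_one, pow_one] at h1
  have h2 := integrableOn_image_iff_integrableOn_abs_deriv_smul measurableSet_Ioo
    (fun y _ => (hasDerivAt_one_sub_sq y).hasDerivWithinAt) injOn_one_sub_sq g
  rw [image_one_sub_sq] at h2
  refine Iff.trans h1 (Iff.trans ?_ h2.symm)
  have h3 : ∀ y ∈ Set.Ioo (0 : ℝ) 1, |-(2 * y)| • g (1 - y ^ 2) = (2 : ℝ) • y • g (1 - y ^ 2) := by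
    intro y hy
    rw [abs_neg, abs_of_nonneg (by linarith [hy.1]), mul_smul]
  rw [integrableOn_congr_fun h3 measurableSet_Ioo]
  exact (integrable_smul_iff (two_ne_zero' ℝ) _).symm

/-- Polar coordinates with x = 1 - ρ²: the measure 2π ρ dρ becomes π dx. -/
theorem integral_radial {E : Type*} [NormedAddCommGroup E] [NormedSpace ℝ E] (g : ℝ → E) :
    ∫ z in Metric.ball (0 : ℂ) 1, g (xr z) = Real.pi • ∫ x in Set.Ioo 0 1, g x := by
  have h1 := integral_fun_norm_addHaar (E := ℂ) volume
    ((Set.Iio (1 : ℝ)).indicator fun y => g (1 - y ^ 2))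
  have h2 := integral_image_eq_integral_abs_deriv_smul measurableSet_Ioo
    (fun y _ => (hasDerivAt_one_sub_sq y).hasDerivWithinAt) injOn_one_sub_sq g
  rw [image_one_sub_sq] at h2
  have h3 : ∫ y in Set.Ioi (0 : ℝ), y ^ (Module.finrank ℝ ℂ - 1) •
      (Set.Iio (1 : ℝ)).indicator (fun y => g (1 - y ^ 2)) y
      = ∫ y in Set.Ioo (0 : ℝ) 1, y • g (1 - y ^ 2) := by
    rw [← Set.Ioi_inter_Iio, ← setIntegral_indicator measurableSet_Iio]
    refine setIntegral_congr_fun measurableSet_Ioi fun y _ => ?_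
    by_cases hy : y < 1 <;> simp [Set.indicator, hy]
  have h4 : ∫ y in Set.Ioo (0 : ℝ) 1, |-(2 * y)| • g (1 - y ^ 2)
      = (2 : ℝ) • ∫ y in Set.Ioo (0 : ℝ) 1, y • g (1 - y ^ 2) := by
    rw [← integral_smul]
    refine setIntegral_congr_fun measurableSet_Ioo fun y hy => ?_
    change _ = (2 : ℝ) • y • g (1 - y ^ 2)
    rw [abs_neg, abs_of_nonneg (by linarith [hy.1]), mul_smul]
  have h5 : ∫ z in Metric.ball (0 : ℂ) 1, g (xr z)
      = ∫ z : ℂ, (Set.Iio (1 : ℝ)).indicator (fun y => g (1 - y ^ 2)) ‖z‖ := by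
    rw [← integral_indicator measurableSet_ball]
    refine integral_congr_ae (ae_of_all _ fun z => ?_)
    by_cases hz : ‖z‖ < 1 <;> simp [Set.indicator, hz, xr]
  rw [h5, h1, h3, h2, h4, Complex.finrank_real_complex, Measure.real, Complex.volume_ball]
  simp only [ENNReal.ofReal_one, one_pow, one_mul, ENNReal.coe_toReal, NNReal.coe_real_pi]
  rw [← Nat.cast_smul_eq_nsmul ℝ, smul_smul, smul_smul]
  congr 1
  push_cast
  ring

theorem integrableOn_rpow_Ioo {α : ℝ} (hα : -1 < α) :
    IntegrableOn (fun x : ℝ => x ^ α) (Set.Ioo 0 1) := by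
  have h := intervalIntegral.intervalIntegrable_rpow' (a := 0) (b := 1) hα
  rw [intervalIntegrable_iff_integrableOn_Ioc_of_le zero_le_one] at h
  exact h.mono_set Set.Ioo_subset_Ioc_self

theorem integrableOn_rpow_mul_pow {α : ℝ} (hα : -1 < α) (n : ℕ) :
    IntegrableOn (fun x : ℝ => x ^ α * (1 - x) ^ n) (Set.Ioo 0 1) := by
  refine (integrableOn_rpow_Ioo hα).mono' ?_ ?_
  · exact (by fun_prop : Measurable fun x : ℝ => x ^ α * (1 - x) ^ n).aestronglyMeasurable
  · filter_upwards [ae_restrict_mem measurableSet_Ioo] with x hx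
    have h1 : 0 ≤ x ^ α := Real.rpow_nonneg hx.1.le _
    have h2 : (1 - x) ^ n ≤ 1 := pow_le_one₀ (by linarith [hx.2]) (by linarith [hx.1])
    have h3 : 0 ≤ (1 - x) ^ n := pow_nonneg (by linarith [hx.2]) _
    rw [Real.norm_of_nonneg (mul_nonneg h1 h3)]
    exact mul_le_of_le_one_right h1 h2

/-- From (1 - x)^n ≤ e^(-nx) ≤ e · e^(-(n+1)x) on (0, 1) the integral is compared with a Gamma
integral. The exponent n + 1 keeps the bound meaningful for n = 0. -/
theorem integral_rpow_mul_pow_le {α : ℝ} (hα : -1 < α) (n : ℕ) :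
    ∫ x in Set.Ioo (0 : ℝ) 1, x ^ α * (1 - x) ^ n
      ≤ Real.exp 1 * Real.Gamma (α + 1) * ((n : ℝ) + 1) ^ (-(α + 1)) := by
  have hn : (0 : ℝ) < n + 1 := by positivity
  have hG := Real.integral_rpow_mul_exp_neg_mul_Ioi (a := α + 1) (r := n + 1) (by linarith) hn
  -- The integral of a non-integrable function is 0 by convention, so a positive value forces
  -- integrability.
  have hGi : IntegrableOn (fun t : ℝ => t ^ (α + 1 - 1) * Real.exp (-((n + 1) * t))) (Set.Ioi 0) := by
    by_contra h
    have := integral_undef h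
    rw [this] at hG
    have : 0 < (1 / ((n : ℝ) + 1)) ^ (α + 1) * Real.Gamma (α + 1) :=
      mul_pos (Real.rpow_pos_of_pos (by positivity) _) (Real.Gamma_pos_of_pos (by linarith))
    linarith
  calc ∫ x in Set.Ioo (0 : ℝ) 1, x ^ α * (1 - x) ^ n
      ≤ ∫ x in Set.Ioo (0 : ℝ) 1,
          Real.exp 1 * (x ^ (α + 1 - 1) * Real.exp (-((n + 1) * x))) := by
        refine setIntegral_mono_on (integrableOn_rpow_mul_pow hα n)
          ((hGi.mono_set Set.Ioo_subset_Ioi_self).const_mul _) measurableSet_Ioo fun x hx => ?_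
        have h1 : 1 - x ≤ Real.exp (-x) := by linarith [Real.add_one_le_exp (-x)]
        have h2 : (1 - x) ^ n ≤ Real.exp (-x) ^ n := pow_le_pow_left₀ (by linarith [hx.2]) h1 n
        have h3 : Real.exp (-x) ^ n ≤ Real.exp 1 * Real.exp (-((n + 1) * x)) := by
          rw [← Real.exp_nat_mul, ← Real.exp_add]
          exact Real.exp_le_exp.2 (by linarith [hx.2])
        have h4 : 0 ≤ x ^ α := Real.rpow_nonneg hx.1.le _
        rw [show α + 1 - 1 = α by ring]
        nlinarith [mul_le_mul_of_nonneg_left (h2.trans h3) h4]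
    _ = Real.exp 1 * ∫ x in Set.Ioo (0 : ℝ) 1, x ^ (α + 1 - 1) * Real.exp (-((n + 1) * x)) := by
        rw [integral_const_mul]
    _ ≤ Real.exp 1 * ∫ x in Set.Ioi (0 : ℝ), x ^ (α + 1 - 1) * Real.exp (-((n + 1) * x)) := by
        refine mul_le_mul_of_nonneg_left (setIntegral_mono_set hGi ?_
          (Set.Ioo_subset_Ioi_self.eventuallyLE)) (Real.exp_pos _).le
        filter_upwards [ae_restrict_mem measurableSet_Ioi] with x hx
        exact mul_nonneg (Real.rpow_nonneg (le_of_lt hx) _) (Real.exp_pos _).le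
    _ = _ := by
        rw [hG, Real.rpow_neg hn.le, one_div, Real.inv_rpow hn.le]; ring

/-- Vanishing of the integral of a function with a nontrivial rotation character. -/
theorem integral_eq_zero_of_rotation {γ : ℝ} {f : ℂ → ℂ} {w c : ℂ} (hw : ‖w‖ = 1) (hc : c ≠ 1)
    (hf : ∀ z, f (w * z) = c * f z) : ∫ z, f z ∂diskMeasure γ = 0 := by
  rw [integral_diskMeasure, ← integral_indicator measurableSet_ball]
  set F : ℂ → ℂ := (Metric.ball (0 : ℂ) 1).indicator fun z => (xr z ^ γ) • f z with hF
  let r : Circle := ⟨w, mem_sphere_zero_iff_norm.2 hw⟩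
  have h1 : ∀ z, F (rotation r z) = c * F z := by
    intro z
    have hr : rotation r z = w * z := rfl
    have hn : ‖w * z‖ = ‖z‖ := by rw [norm_mul, hw, one_mul]
    rw [hr]
    simp only [hF, Set.indicator, mem_ball_zero_iff, hn, xr, hf]
    split_ifs
    · simp; ring
    · simp
  have h2 : ∫ z, F (rotation r z) = ∫ z, F z :=
    (rotation r).measurePreserving.integral_comp
      (rotation r).toHomeomorph.measurableEmbedding F
  simp only [h1, integral_const_mul] at h2
  have h3 : (c - 1) * ∫ z, F z = 0 := by linear_combination h2
  exact (mul_eq_zero.1 h3).resolve_left (sub_ne_zero.2 hc)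

theorem integrable_rpow_diskMeasure {γ a : ℝ} (h : -1 < a + γ) :
    Integrable (fun z => xr z ^ a) (diskMeasure γ) := by
  rw [integrable_diskMeasure]
  have h1 : IntegrableOn (fun z => xr z ^ (a + γ)) (Metric.ball (0 : ℂ) 1) :=
    (integrableOn_radial (g := fun x : ℝ => x ^ (a + γ))).2 (integrableOn_rpow_Ioo h)
  refine (integrableOn_congr_fun (fun z hz => ?_) measurableSet_ball).1 h1
  rw [mem_ball_iff_xr] at hz
  rw [Real.rpow_add hz, smul_eq_mul, mul_comm]

theorem isFiniteMeasure_diskMeasure {γ : ℝ} (h : -1 < γ) : IsFiniteMeasure (diskMeasure γ) := by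
  have h1 : Integrable (fun _ : ℂ => (1 : ℝ)) (diskMeasure γ) := by
    simpa using integrable_rpow_diskMeasure (γ := γ) (a := 0) (by linarith)
  rwa [integrable_const_iff_isFiniteMeasure one_ne_zero] at h1

theorem memLp_of_sq_le {γ : ℝ} {f : ℂ → ℂ} {g : ℂ → ℝ}
    (hf : AEStronglyMeasurable f (diskMeasure γ)) (hg : Integrable g (diskMeasure γ))
    (h : ∀ z, 0 < xr z → ‖f z‖ ^ 2 ≤ g z) : MemLp f 2 (diskMeasure γ) := by
  rw [memLp_two_iff_integrable_sq_norm hf]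
  refine hg.mono' (hf.norm.pow 2) ?_
  filter_upwards [ae_mem_ball γ] with z hz
  rw [Real.norm_of_nonneg (sq_nonneg _)]
  exact h z hz

/-! ### Classes of functions in the weighted space -/

/-- The class in `L²_γ` of a square-integrable function (zero if it is not square-integrable). -/
def vec (γ : ℝ) (f : ℂ → ℂ) : L2 γ :=
  open Classical in if h : MemLp f 2 (diskMeasure γ) then h.toLp f else 0

theorem vec_ae {γ : ℝ} {f : ℂ → ℂ} (h : MemLp f 2 (diskMeasure γ)) :
    (vec γ f : ℂ → ℂ) =ᵐ[diskMeasure γ] f := by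
  rw [vec, dif_pos h]; exact h.coeFn_toLp

theorem vec_eq {γ : ℝ} {f : ℂ → ℂ} {u : L2 γ} (h : (u : ℂ → ℂ) =ᵐ[diskMeasure γ] f) :
    vec γ f = u := by
  have hm : MemLp f 2 (diskMeasure γ) := (memLp_congr_ae h).1 (Lp.memLp u)
  exact Lp.ext ((vec_ae hm).trans h.symm)

theorem vec_congr {γ : ℝ} {f g : ℂ → ℂ} (hg : MemLp g 2 (diskMeasure γ))
    (h : ∀ z, 0 < xr z → f z = g z) : vec γ f = vec γ g := by
  refine vec_eq ((vec_ae hg).trans ?_)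
  filter_upwards [ae_mem_ball γ] with z hz using (h z hz).symm

theorem memLp_congr {γ : ℝ} {f g : ℂ → ℂ} (hg : MemLp g 2 (diskMeasure γ))
    (h : ∀ z, 0 < xr z → f z = g z) : MemLp f 2 (diskMeasure γ) := by
  refine (memLp_congr_ae ?_).1 hg
  filter_upwards [ae_mem_ball γ] with z hz using (h z hz).symm

theorem vec_add {γ : ℝ} {f g : ℂ → ℂ} (hf : MemLp f 2 (diskMeasure γ))
    (hg : MemLp g 2 (diskMeasure γ)) : vec γ (fun z => f z + g z) = vec γ f + vec γ g := by
  refine vec_eq ?_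
  filter_upwards [Lp.coeFn_add (vec γ f) (vec γ g), vec_ae hf, vec_ae hg] with z h1 h2 h3
  rw [h1, Pi.add_apply, h2, h3]

theorem vec_sub {γ : ℝ} {f g : ℂ → ℂ} (hf : MemLp f 2 (diskMeasure γ))
    (hg : MemLp g 2 (diskMeasure γ)) : vec γ (fun z => f z - g z) = vec γ f - vec γ g := by
  refine vec_eq ?_
  filter_upwards [Lp.coeFn_sub (vec γ f) (vec γ g), vec_ae hf, vec_ae hg] with z h1 h2 h3
  rw [h1, Pi.sub_apply, h2, h3]

theorem vec_const_mul {γ : ℝ} {f : ℂ → ℂ} (c : ℂ) (hf : MemLp f 2 (diskMeasure γ)) :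
    vec γ (fun z => c * f z) = c • vec γ f := by
  refine vec_eq ?_
  filter_upwards [Lp.coeFn_smul c (vec γ f), vec_ae hf] with z h1 h2
  rw [h1, Pi.smul_apply, h2, smul_eq_mul]

theorem inner_eq_of_ae {γ : ℝ} {u v : L2 γ} {f g : ℂ → ℂ} (hf : (u : ℂ → ℂ) =ᵐ[diskMeasure γ] f)
    (hg : (v : ℂ → ℂ) =ᵐ[diskMeasure γ] g) :
    ⟪u, v⟫_ℂ = ∫ z, conj (f z) * g z ∂diskMeasure γ := by
  rw [L2.inner_def]
  refine integral_congr_ae ?_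
  filter_upwards [hf, hg] with z h1 h2
  rw [h1, h2, RCLike.inner_apply, mul_comm]

theorem inner_vec {γ : ℝ} {f g : ℂ → ℂ} (hf : MemLp f 2 (diskMeasure γ))
    (hg : MemLp g 2 (diskMeasure γ)) :
    ⟪vec γ f, vec γ g⟫_ℂ = ∫ z, conj (f z) * g z ∂diskMeasure γ :=
  inner_eq_of_ae (vec_ae hf) (vec_ae hg)

theorem norm_sq_vec {γ : ℝ} {f : ℂ → ℂ} (hf : MemLp f 2 (diskMeasure γ)) :
    ‖vec γ f‖ ^ 2 = ∫ z, ‖f z‖ ^ 2 ∂diskMeasure γ := by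
  have h := inner_vec hf hf
  rw [inner_self_eq_norm_sq_to_K] at h
  have h2 : ∫ z, conj (f z) * f z ∂diskMeasure γ = ((∫ z, ‖f z‖ ^ 2 ∂diskMeasure γ : ℝ) : ℂ) := by
    rw [← integral_complex_ofReal]
    refine integral_congr_ae (ae_of_all _ fun z => ?_)
    change conj (f z) * f z = _
    rw [mul_comm, Complex.mul_conj, Complex.normSq_eq_norm_sq]
  rw [h2] at h
  exact Complex.ofReal_injective (by rw [← h]; push_cast; rfl)

theorem norm_sq_vec_le {γ : ℝ} {f : ℂ → ℂ} {g : ℂ → ℝ} (hf : MemLp f 2 (diskMeasure γ))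
    (hg : Integrable g (diskMeasure γ)) (h : ∀ z, 0 < xr z → ‖f z‖ ^ 2 ≤ g z) :
    ‖vec γ f‖ ^ 2 ≤ ∫ z, g z ∂diskMeasure γ := by
  rw [norm_sq_vec hf]
  refine integral_mono_ae ((memLp_two_iff_integrable_sq_norm hf.1).1 hf) hg ?_
  filter_upwards [ae_mem_ball γ] with z hz using h z hz

/-- Dominated convergence in `L²_γ`. -/
theorem tendsto_vec {γ : ℝ} {F : ℕ → ℂ → ℂ} {f : ℂ → ℂ} {g : ℂ → ℝ}
    (hF : ∀ n, AEStronglyMeasurable (F n) (diskMeasure γ))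
    (hg : Integrable g (diskMeasure γ)) (h : ∀ n z, 0 < xr z → ‖F n z‖ ^ 2 ≤ g z)
    (hlim : ∀ z, 0 < xr z → z ≠ 0 → Tendsto (fun n => F n z) atTop (𝓝 (f z))) :
    MemLp f 2 (diskMeasure γ) ∧ Tendsto (fun n => vec γ (F n)) atTop (𝓝 (vec γ f)) := by
  have hlim' : ∀ᵐ z ∂diskMeasure γ, Tendsto (fun n => F n z) atTop (𝓝 (f z)) := by
    filter_upwards [ae_mem_ball γ, ae_ne_zero γ] with z h1 h2 using hlim z h1 h2
  have hfm : AEStronglyMeasurable f (diskMeasure γ) :=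
    aestronglyMeasurable_of_tendsto_ae atTop hF hlim'
  have hfg : ∀ᵐ z ∂diskMeasure γ, ‖f z‖ ^ 2 ≤ g z := by
    filter_upwards [hlim', ae_mem_ball γ] with z hz h1
    exact le_of_tendsto (hz.norm.pow 2) (Eventually.of_forall fun n => h n z h1)
  have hf : MemLp f 2 (diskMeasure γ) := by
    rw [memLp_two_iff_integrable_sq_norm hfm]
    refine hg.mono' (hfm.norm.pow 2) ?_
    filter_upwards [hfg] with z hz
    rwa [Real.norm_of_nonneg (sq_nonneg _)]
  have hFm : ∀ n, MemLp (F n) 2 (diskMeasure γ) := fun n => memLp_of_sq_le (hF n) hg (h n)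
  refine ⟨hf, ?_⟩
  rw [tendsto_iff_norm_sub_tendsto_zero]
  have h1 : Tendsto (fun n => ∫ z, ‖F n z - f z‖ ^ 2 ∂diskMeasure γ) atTop
      (𝓝 (∫ _, (0 : ℝ) ∂diskMeasure γ)) := by
    refine tendsto_integral_of_dominated_convergence (fun z => 4 * g z)
      (fun n => ((hF n).sub hfm).norm.pow 2) (hg.const_mul 4) (fun n => ?_) ?_
    · filter_upwards [hfg, ae_mem_ball γ] with z h1 h2
      have h3 := h n z h2
      have h4 := norm_sub_le (F n z) (f z)
      rw [Real.norm_of_nonneg (sq_nonneg _)]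
      nlinarith [sq_nonneg (‖F n z‖ - ‖f z‖), norm_nonneg (F n z - f z), norm_nonneg (F n z),
        norm_nonneg (f z)]
    · filter_upwards [hlim'] with z hz
      have := ((hz.sub_const (f z)).norm).pow 2
      simpa using this
  have h2 : ∀ n, ‖vec γ (F n) - vec γ f‖ = Real.sqrt (∫ z, ‖F n z - f z‖ ^ 2 ∂diskMeasure γ) := by
    intro n
    have hs : MemLp (fun z => F n z - f z) 2 (diskMeasure γ) := (hFm n).sub hf
    rw [← vec_sub (hFm n) hf, ← norm_sq_vec hs, Real.sqrt_sq (norm_nonneg _)]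
  simp only [h2]
  have h3 := (Real.continuous_sqrt.tendsto _).comp h1
  simpa [Function.comp_def] using h3

/-! ### Green's formula for compactly supported functions -/

/-- Smoothness in the open disk. -/
def SmoothInt (f : ℂ → ℂ) : Prop := ∀ z, 0 < xr z → ContDiffAt ℝ ∞ f z

/-- `f` vanishes outside a compact subset of the open disk. -/
def CompactlyIn (f : ℂ → ℂ) : Prop :=
  ∃ C : Set ℂ, IsCompact C ∧ (∀ z ∈ C, 0 < xr z) ∧ ∀ z ∉ C, f z = 0

theorem TestFunction.smoothInt {f : ℂ → ℂ} (hf : TestFunction f) : SmoothInt f :=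
  fun _ _ => hf.1.contDiffAt

theorem TestFunction.compactlyIn {f : ℂ → ℂ} (hf : TestFunction f) : CompactlyIn f :=
  ⟨tsupport f, hf.2.1, fun _ hz => mem_ball_iff_xr.1 (hf.2.2 hz), fun _ hz =>
    image_eq_zero_of_notMem_tsupport hz⟩

theorem isOpen_xr_pos : IsOpen {z : ℂ | 0 < xr z} := isOpen_lt continuous_const continuous_xr

theorem contDiff_of_compactlyIn {f : ℂ → ℂ} (hf : SmoothInt f) (hc : CompactlyIn f) :
    ContDiff ℝ ∞ f := by
  obtain ⟨C, hC, hC1, hC2⟩ := hc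
  rw [contDiff_iff_contDiffAt]
  intro z
  by_cases hz : z ∈ C
  · exact hf z (hC1 z hz)
  · have : f =ᶠ[𝓝 z] fun _ => 0 := by
      filter_upwards [hC.isClosed.isOpen_compl.mem_nhds hz] with w hw using hC2 w hw
    exact contDiffAt_const.congr_of_eventuallyEq this

theorem CompactlyIn.hasCompactSupport {f : ℂ → ℂ} (hc : CompactlyIn f) : HasCompactSupport f := by
  obtain ⟨C, hC, -, hC2⟩ := hc
  exact HasCompactSupport.intro hC hC2

theorem testFunction_of_compactlyIn {f : ℂ → ℂ} (hf : SmoothInt f) (hc : CompactlyIn f) :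
    TestFunction f := by
  refine ⟨contDiff_of_compactlyIn hf hc, hc.hasCompactSupport, ?_⟩
  obtain ⟨C, hC, hC1, hC2⟩ := hc
  have h : tsupport f ⊆ C := by
    refine closure_minimal (fun z hz => ?_) hC.isClosed
    by_contra h
    exact hz (hC2 z h)
  exact fun z hz => mem_ball_iff_xr.2 (hC1 z (h hz))

theorem CompactlyIn.mono {f g : ℂ → ℂ} (hf : CompactlyIn f) (h : ∀ z, f z = 0 → g z = 0) :
    CompactlyIn g := by
  obtain ⟨C, hC, hC1, hC2⟩ := hf
  exact ⟨C, hC, hC1, fun z hz => h z (hC2 z hz)⟩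

theorem CompactlyIn.mono_nhds {f g : ℂ → ℂ} (hf : CompactlyIn f)
    (h : ∀ z, f =ᶠ[𝓝 z] (fun _ => 0) → g z = 0) : CompactlyIn g := by
  obtain ⟨C, hC, hC1, hC2⟩ := hf
  refine ⟨C, hC, hC1, fun z hz => h z ?_⟩
  filter_upwards [hC.isClosed.isOpen_compl.mem_nhds hz] with w hw using hC2 w hw

theorem integrable_of_compactlyIn {γ : ℝ} {f : ℂ → ℂ}
    (hf : ContinuousOn f (Metric.ball (0 : ℂ) 1)) (hc : CompactlyIn f) :
    Integrable f (diskMeasure γ) := by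
  rw [integrable_diskMeasure]
  obtain ⟨C, hC, hC1, hC2⟩ := hc
  have h1 : ContinuousOn (fun z => xr z ^ γ • f z) C := by
    have h : ContinuousOn (fun z => xr z ^ γ) C :=
      continuous_xr.continuousOn.rpow_const fun z hz => Or.inl (hC1 z hz).ne'
    exact h.smul (hf.mono fun z hz => mem_ball_iff_xr.2 (hC1 z hz))
  have h2 : IntegrableOn (fun z => xr z ^ γ • f z) C := h1.integrableOn_compact hC
  have h3 : IntegrableOn (fun z => xr z ^ γ • f z) Set.univ := by
    rw [← Set.union_compl_self C]
    refine h2.union ?_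
    refine (integrableOn_congr_fun (fun z hz => ?_) hC.measurableSet.compl).2 integrableOn_zero
    simp [hC2 z hz]
  exact h3.mono_set (Set.subset_univ _)

theorem integral_fderiv_eq_zero {F : ℂ → ℂ} (hF : SmoothInt F) (hc : CompactlyIn F) (v : ℂ) :
    Integrable (fun z => fderiv ℝ F z v) ∧ ∫ z, fderiv ℝ F z v = 0 := by
  have hs := contDiff_of_compactlyIn hF hc
  have hcs := hc.hasCompactSupport
  have h1 : Continuous fun z => fderiv ℝ F z v :=
    (hs.continuous_fderiv (by simp)).clm_apply continuous_const
  have h2 : Integrable fun z => fderiv ℝ F z v :=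
    h1.integrable_of_hasCompactSupport (hcs.fderiv_apply ℝ v)
  have h3 : Integrable F := hs.continuous.integrable_of_hasCompactSupport hcs
  refine ⟨h2, ?_⟩
  -- Integration by parts against the constant function 1.
  have h := integral_smul_fderiv_eq_neg_fderiv_smul_of_integrable (μ := volume) (𝕜 := ℝ)
    (f := fun _ : ℂ => (1 : ℝ)) (g := F) (v := v) (by simp) (by simpa using h2) (by simpa using h3)
    (by fun_prop) (fun z _ => hs.contDiffAt.differentiableAt (by simp))
  simpa using h

/-- The divergence theorem in Wirtinger form, for a field with compact support in the open disk. -/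
theorem integral_dz_db_eq_zero {F G : ℂ → ℂ} (hF : SmoothInt F) (hFc : CompactlyIn F)
    (hG : SmoothInt G) (hGc : CompactlyIn G) :
    ∫ z in Metric.ball (0 : ℂ) 1, (dz F z + db G z) = 0 := by
  obtain ⟨i1, e1⟩ := integral_fderiv_eq_zero hF hFc 1
  obtain ⟨i2, e2⟩ := integral_fderiv_eq_zero hF hFc Complex.I
  obtain ⟨i3, e3⟩ := integral_fderiv_eq_zero hG hGc 1
  obtain ⟨i4, e4⟩ := integral_fderiv_eq_zero hG hGc Complex.I
  have h0 : ∀ H : ℂ → ℂ, CompactlyIn H → ∀ z ∉ Metric.ball (0 : ℂ) 1, ∀ v, fderiv ℝ H z v = 0 := by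
    intro H ⟨C, hC, hC1, hC2⟩ z hz v
    have hz' : z ∉ C := fun h => hz (mem_ball_iff_xr.2 (hC1 z h))
    have : H =ᶠ[𝓝 z] fun _ => 0 := by
      filter_upwards [hC.isClosed.isOpen_compl.mem_nhds hz'] with w hw using hC2 w hw
    rw [this.fderiv_eq]; simp
  rw [setIntegral_eq_integral_of_forall_compl_eq_zero fun z hz => by
    simp [dz, db, h0 F hFc z hz, h0 G hGc z hz]]
  simp only [dz, db]
  have j1 : Integrable fun z => (fderiv ℝ F z 1 - Complex.I * fderiv ℝ F z Complex.I) / 2 :=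
    (i1.sub (i2.const_mul _)).div_const 2
  have j2 : Integrable fun z => (fderiv ℝ G z 1 + Complex.I * fderiv ℝ G z Complex.I) / 2 :=
    (i3.add (i4.const_mul _)).div_const 2
  rw [integral_add j1 j2,
    integral_div, integral_div, integral_sub i1 (i2.const_mul _), integral_add i3 (i4.const_mul _),
    integral_const_mul, integral_const_mul, e1, e2, e3, e4]
  simp

/-- The density of the bilinear form belonging to the principal part of `L_γ`. -/
def bform (f g : ℂ → ℂ) (z : ℂ) : ℂ :=
  2 * (dz f z * db g z + db f z * dz g z) - euler f z * euler g z

theorem bform_comm (f g : ℂ → ℂ) (z : ℂ) : bform f g z = bform g f z := by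
  rw [bform, bform]; ring

theorem contDiffAt_euler {f : ℂ → ℂ} {z : ℂ} (hf : ContDiffAt ℝ ∞ f z) :
    ContDiffAt ℝ ∞ (euler f) z :=
  (contDiffAt_id.mul (contDiffAt_dz hf)).add
    ((Complex.conjCLE.contDiff.contDiffAt (n := ∞) (x := z)).mul (contDiffAt_db hf))

theorem smoothInt_continuousOn {f : ℂ → ℂ} (hf : SmoothInt f) :
    ContinuousOn f (Metric.ball (0 : ℂ) 1) :=
  fun z hz => (hf z (mem_ball_iff_xr.1 hz)).continuousAt.continuousWithinAt

theorem SmoothInt.dz {f : ℂ → ℂ} (hf : SmoothInt f) : SmoothInt (dz f) :=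
  fun z hz => contDiffAt_dz (hf z hz)

theorem SmoothInt.db {f : ℂ → ℂ} (hf : SmoothInt f) : SmoothInt (db f) :=
  fun z hz => contDiffAt_db (hf z hz)

theorem SmoothInt.euler {f : ℂ → ℂ} (hf : SmoothInt f) : SmoothInt (euler f) :=
  fun z hz => contDiffAt_euler (hf z hz)

theorem SmoothInt.mul {f g : ℂ → ℂ} (hf : SmoothInt f) (hg : SmoothInt g) :
    SmoothInt fun z => f z * g z :=
  fun z hz => (hf z hz).mul (hg z hz)

theorem SmoothInt.add {f g : ℂ → ℂ} (hf : SmoothInt f) (hg : SmoothInt g) :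
    SmoothInt fun z => f z + g z :=
  fun z hz => (hf z hz).add (hg z hz)

theorem SmoothInt.sub {f g : ℂ → ℂ} (hf : SmoothInt f) (hg : SmoothInt g) :
    SmoothInt fun z => f z - g z :=
  fun z hz => (hf z hz).sub (hg z hz)

theorem SmoothInt.conj {f : ℂ → ℂ} (hf : SmoothInt f) : SmoothInt fun z => conj (f z) :=
  fun z hz => Complex.conjCLE.contDiff.contDiffAt.comp z (hf z hz)

theorem smoothInt_of_contDiff {f : ℂ → ℂ} (hf : ContDiff ℝ ∞ f) : SmoothInt f :=
  fun _ _ => hf.contDiffAt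

theorem contDiff_conj : ContDiff ℝ ∞ fun z : ℂ => conj z := Complex.conjCLE.contDiff

theorem smoothInt_rpow (a : ℝ) : SmoothInt fun z => ((xr z ^ a : ℝ) : ℂ) := fun _ hz =>
  contDiffAt_radial (k := fun t : ℝ => t ^ a) (Real.contDiffAt_rpow_const_of_ne hz.ne')

theorem smoothInt_bform {f g : ℂ → ℂ} (hf : SmoothInt f) (hg : SmoothInt g) :
    SmoothInt (bform f g) :=
  ((smoothInt_of_contDiff contDiff_const).mul ((hf.dz.mul hg.db).add (hf.db.mul hg.dz))).sub
    (hf.euler.mul hg.euler)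

theorem smoothInt_keldysh (γ : ℝ) {f : ℂ → ℂ} (hf : SmoothInt f) : SmoothInt (keldysh γ f) := by
  intro z hz
  have h : keldysh γ f =ᶠ[𝓝 z] fun z => -4 * dz (db f) z + z ^ 2 * dz (dz f) z
      + 2 * z * conj z * dz (db f) z + conj z ^ 2 * db (db f) z + (3 + 2 * γ) * euler f z
      + (γ + 1) ^ 2 * f z := by
    filter_upwards [isOpen_xr_pos.mem_nhds hz] with w hw using keldysh_eq γ (hf w hw)
  refine ContDiffAt.congr_of_eventuallyEq ?_ h
  have h0 := hf z hz
  have h1 := contDiffAt_dz (contDiffAt_db h0)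
  have h2 := contDiffAt_dz (contDiffAt_dz h0)
  have h3 := contDiffAt_db (contDiffAt_db h0)
  have h4 := contDiffAt_euler h0
  have h5 : ContDiffAt ℝ ∞ (fun z : ℂ => conj z) z := contDiff_conj.contDiffAt
  fun_prop

theorem dz_euler {f : ℂ → ℂ} {z : ℂ} (hf : ContDiffAt ℝ ∞ f z) :
    dz (euler f) z = dz f z + z * dz (dz f) z + conj z * dz (db f) z := by
  have h4 := differentiableAt_of_smooth (contDiffAt_dz hf)
  have h5 := differentiableAt_of_smooth (contDiffAt_db hf)
  have hc : DifferentiableAt ℝ (fun z : ℂ => conj z) z := (hasFDerivAt_conj z).differentiableAt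
  have hid : DifferentiableAt ℝ (fun z : ℂ => z) z := differentiableAt_id
  have h6 : DifferentiableAt ℝ (fun w => w * dz f w) z := hid.mul h4
  have h7 : DifferentiableAt ℝ (fun w => conj w * db f w) z := hc.mul h5
  change dz (fun z => z * dz f z + conj z * db f z) z = _
  rw [dz_add h6 h7, dz_mul hid h4, dz_mul hc h5, dz_id, dz_conj]
  ring

theorem db_euler {f : ℂ → ℂ} {z : ℂ} (hf : ContDiffAt ℝ ∞ f z) :
    db (euler f) z = z * dz (db f) z + db f z + conj z * db (db f) z := by
  have h4 := differentiableAt_of_smooth (contDiffAt_dz hf)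
  have h5 := differentiableAt_of_smooth (contDiffAt_db hf)
  have hc : DifferentiableAt ℝ (fun z : ℂ => conj z) z := (hasFDerivAt_conj z).differentiableAt
  have hid : DifferentiableAt ℝ (fun z : ℂ => z) z := differentiableAt_id
  have h6 : DifferentiableAt ℝ (fun w => w * dz f w) z := hid.mul h4
  have h7 : DifferentiableAt ℝ (fun w => conj w * db f w) z := hc.mul h5
  change db (fun z => z * dz f z + conj z * db f z) z = _
  rw [db_add h6 h7, db_mul hid h4, db_mul hc h5, db_id, db_conj, db_dz_comm hf]
  ring

/-- Differentiating the weight x^γ produces a factor 1/x. It is cancelled because, with E = `euler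
f`, one has z̄(2∂̄f - zE) + z(2∂f - z̄E) = 2(1 - |z|²)E = 2xE. Derivatives falling on g give
`bform`, the remaining ones give the operator. -/
theorem divergence_flux (γ : ℝ) {f g : ℂ → ℂ} {z : ℂ} (hz : 0 < xr z) (hf : ContDiffAt ℝ ∞ f z)
    (hg : ContDiffAt ℝ ∞ g z) :
    dz (fun z => ((xr z ^ γ : ℝ) : ℂ) * ((2 * db f z + (-1) * (z * euler f z)) * g z)) z
      + db (fun z => ((xr z ^ γ : ℝ) : ℂ) * ((2 * dz f z + (-1) * (conj z * euler f z)) * g z)) z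
    = (xr z ^ γ : ℝ) * (bform f g z + (1 + γ) ^ 2 * (f z * g z) - keldysh γ f z * g z) := by
  have hkd : ContDiffAt ℝ ∞ (fun t : ℝ => t ^ γ) (xr z) := Real.contDiffAt_rpow_const_of_ne hz.ne'
  have hk := hkd.differentiableAt (by simp)
  have hK := differentiableAt_of_smooth (contDiffAt_radial hkd)
  have h1 : deriv (fun t : ℝ => t ^ γ) (xr z) = γ * (xr z ^ γ / xr z) := by
    rw [Real.deriv_rpow_const, Real.rpow_sub hz, Real.rpow_one]
  have h0 := differentiableAt_of_smooth hf
  have hg0 := differentiableAt_of_smooth hg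
  have h4 := differentiableAt_of_smooth (contDiffAt_dz hf)
  have h5 := differentiableAt_of_smooth (contDiffAt_db hf)
  have h6 := differentiableAt_of_smooth (contDiffAt_euler hf)
  have hc : DifferentiableAt ℝ (fun z : ℂ => conj z) z := (hasFDerivAt_conj z).differentiableAt
  have hid : DifferentiableAt ℝ (fun z : ℂ => z) z := differentiableAt_id
  have e1 : DifferentiableAt ℝ (fun z => z * euler f z) z := hid.mul h6
  have e2 : DifferentiableAt ℝ (fun z => conj z * euler f z) z := hc.mul h6
  have e3 : DifferentiableAt ℝ (fun z => 2 * db f z + (-1) * (z * euler f z)) z :=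
    (h5.const_mul 2).fun_add (e1.const_mul _)
  have e4 : DifferentiableAt ℝ (fun z => 2 * dz f z + (-1) * (conj z * euler f z)) z :=
    (h4.const_mul 2).fun_add (e2.const_mul _)
  have hxc : (xr z : ℂ) ≠ 0 := by exact_mod_cast hz.ne'
  rw [dz_mul hK (e3.fun_mul hg0), db_mul hK (e4.fun_mul hg0), dz_mul e3 hg0, db_mul e4 hg0,
    dz_add (h5.const_mul 2) (e1.const_mul _), db_add (h4.const_mul 2) (e2.const_mul _),
    dz_const_mul _ h5, dz_const_mul _ e1, db_const_mul _ h4, db_const_mul _ e2,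
    dz_mul hid h6, db_mul hc h6, dz_id, db_conj, dz_radial hk, db_radial hk, h1, dz_euler hf,
    db_euler hf, keldysh_eq γ hf, db_dz_comm hf, bform]
  have hE : conj z * (2 * db f z - z * euler f z) + z * (2 * dz f z - conj z * euler f z)
      = 2 * xr z * euler f z := by
    rw [euler, xr_eq]; ring
  have hE2 : -((γ * (xr z ^ γ / xr z) : ℝ) : ℂ) * conj z * ((2 * db f z + -1 * (z * euler f z)) * g z)
      + -((γ * (xr z ^ γ / xr z) : ℝ) : ℂ) * z * ((2 * dz f z + -1 * (conj z * euler f z)) * g z)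
      = ((xr z ^ γ : ℝ) : ℂ) * (-2 * γ * euler f z * g z) := by
    have : -((γ * (xr z ^ γ / xr z) : ℝ) : ℂ) * conj z * ((2 * db f z + -1 * (z * euler f z)) * g z)
      + -((γ * (xr z ^ γ / xr z) : ℝ) : ℂ) * z * ((2 * dz f z + -1 * (conj z * euler f z)) * g z)
      = -((γ * (xr z ^ γ / xr z) : ℝ) : ℂ) * g z *
        (conj z * (2 * db f z - z * euler f z) + z * (2 * dz f z - conj z * euler f z)) := by ring
    rw [this, hE]
    push_cast
    field_simp
  simp only [euler] at hE2 ⊢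
  linear_combination hE2

/-- The flux vanishes wherever either factor vanishes locally, so compact support of one of them is
enough to remove the boundary term. -/
theorem green {γ : ℝ} {f g : ℂ → ℂ} (hf : SmoothInt f) (hg : SmoothInt g)
    (hc : CompactlyIn f ∨ CompactlyIn g) :
    ∫ z, (bform f g z + (1 + γ) ^ 2 * (f z * g z)) ∂diskMeasure γ
      = ∫ z, keldysh γ f z * g z ∂diskMeasure γ := by
  have hcomp : ∀ A : ℂ → ℂ, ∀ h : ℂ → ℂ, (∀ z, f =ᶠ[𝓝 z] (fun _ => 0) ∨ g =ᶠ[𝓝 z] (fun _ => 0) → h z = 0)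
      → CompactlyIn h := by
    intro _ h hh
    rcases hc with hc | hc
    · exact hc.mono_nhds fun z hz => hh z (Or.inl hz)
    · exact hc.mono_nhds fun z hz => hh z (Or.inr hz)
  have key0 : ∀ z, f =ᶠ[𝓝 z] (fun _ => 0) → f z = 0 ∧ dz f z = 0 ∧ db f z = 0 ∧ keldysh γ f z = 0 := by
    intro z hz
    refine ⟨hz.eq_of_nhds, ?_, ?_, ?_⟩
    · rw [dz_congr hz, dz_const]
    · rw [db_congr hz, db_const]
    · rw [keldysh_congr γ hz, keldysh_eq γ contDiffAt_const]
      have h1 : dz (fun _ => (0 : ℂ)) = fun _ => 0 := by funext w; exact dz_const 0 w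
      have h2 : db (fun _ => (0 : ℂ)) = fun _ => 0 := by funext w; exact db_const 0 w
      simp [euler, h1, h2]
  have hid : SmoothInt fun z => z := smoothInt_of_contDiff contDiff_id
  have hcj : SmoothInt fun z => conj z := smoothInt_of_contDiff contDiff_conj
  have hct : ∀ c : ℂ, SmoothInt fun _ => c := fun c => smoothInt_of_contDiff contDiff_const
  have h0 := integral_dz_db_eq_zero
    (F := fun z => ((xr z ^ γ : ℝ) : ℂ) * ((2 * db f z + (-1) * (z * euler f z)) * g z))
    (G := fun z => ((xr z ^ γ : ℝ) : ℂ) * ((2 * dz f z + (-1) * (conj z * euler f z)) * g z))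
    ((smoothInt_rpow γ).mul ((((hct 2).mul hf.db).add ((hct _).mul (hid.mul hf.euler))).mul hg))
    (hcomp f _ fun z hz => by
      rcases hz with hz | hz
      · obtain ⟨-, e1, e2, -⟩ := key0 z hz; simp [euler, e1, e2]
      · simp [hz.eq_of_nhds])
    ((smoothInt_rpow γ).mul ((((hct 2).mul hf.dz).add ((hct _).mul (hcj.mul hf.euler))).mul hg))
    (hcomp f _ fun z hz => by
      rcases hz with hz | hz
      · obtain ⟨-, e1, e2, -⟩ := key0 z hz; simp [euler, e1, e2]
      · simp [hz.eq_of_nhds])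
  have h1 : ∫ z, (bform f g z + (1 + γ) ^ 2 * (f z * g z) - keldysh γ f z * g z) ∂diskMeasure γ = 0 := by
    rw [integral_diskMeasure]
    refine Eq.trans ?_ h0
    refine setIntegral_congr_fun measurableSet_ball fun z hz => ?_
    have hz' := mem_ball_iff_xr.1 hz
    change _ = dz (fun z => ((xr z ^ γ : ℝ) : ℂ) * ((2 * db f z + (-1) * (z * euler f z)) * g z)) z +
      db (fun z => ((xr z ^ γ : ℝ) : ℂ) * ((2 * dz f z + (-1) * (conj z * euler f z)) * g z)) z
    rw [divergence_flux γ hz' (hf z hz') (hg z hz')]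
    simp
  have keyg : ∀ z, g =ᶠ[𝓝 z] (fun _ => 0) → g z = 0 ∧ dz g z = 0 ∧ db g z = 0 := by
    intro z hz
    exact ⟨hz.eq_of_nhds, by rw [dz_congr hz, dz_const], by rw [db_congr hz, db_const]⟩
  have i1 : Integrable (fun z => bform f g z + (1 + γ) ^ 2 * (f z * g z)) (diskMeasure γ) := by
    refine integrable_of_compactlyIn (smoothInt_continuousOn ((smoothInt_bform hf hg).add
      ((hct _).mul (hf.mul hg)))) (hcomp f _ fun z hz => ?_)
    rcases hz with hz | hz
    · obtain ⟨e0, e1, e2, -⟩ := key0 z hz; simp [bform, euler, e0, e1, e2]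
    · obtain ⟨e0, e1, e2⟩ := keyg z hz; simp [bform, euler, e0, e1, e2]
  have i2 : Integrable (fun z => keldysh γ f z * g z) (diskMeasure γ) := by
    refine integrable_of_compactlyIn (smoothInt_continuousOn ((smoothInt_keldysh γ hf).mul hg))
      (hcomp f _ fun z hz => ?_)
    rcases hz with hz | hz
    · obtain ⟨e0, e1, e2, e3⟩ := key0 z hz; simp [e3]
    · simp [hz.eq_of_nhds]
  rw [integral_sub i1 i2] at h1
  exact sub_eq_zero.1 h1

theorem keldysh_conj (γ : ℝ) {f : ℂ → ℂ} {z : ℂ} (hf : ContDiffAt ℝ ∞ f z) :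
    keldysh γ (fun z => conj (f z)) z = conj (keldysh γ f z) := by
  have h1 : (dz fun z => conj (f z)) =ᶠ[𝓝 z] fun z => conj (db f z) := by
    filter_upwards [eventually_smooth hf] with w hw using (dz_db_conj_comp hw).1
  have h2 : (db fun z => conj (f z)) =ᶠ[𝓝 z] fun z => conj (dz f z) := by
    filter_upwards [eventually_smooth hf] with w hw using (dz_db_conj_comp hw).2
  have h3 := differentiableAt_of_smooth (contDiffAt_dz hf)
  have h4 := differentiableAt_of_smooth (contDiffAt_db hf)
  have hc : ContDiffAt ℝ ∞ (fun z => conj (f z)) z :=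
    Complex.conjCLE.contDiff.contDiffAt.comp z hf
  rw [keldysh_eq γ hc, keldysh_eq γ hf, euler, euler, h1.eq_of_nhds, h2.eq_of_nhds, dz_congr h1,
    dz_congr h2, db_congr h2, (dz_db_conj_comp h3).1, (dz_db_conj_comp h4).1, (dz_db_conj_comp h3).2,
    db_dz_comm hf]
  simp only [map_add, map_mul, map_neg, map_pow, Complex.conj_conj, Complex.conj_ofReal, map_ofNat,
    map_one]
  ring

/-- The form density is symmetric, so Green's formula applies in both orders. No behaviour of g at
the circle is assumed, since g will be a singular function. -/
theorem green_symm {γ : ℝ} {f g : ℂ → ℂ} (hf : TestFunction f) (hg : SmoothInt g) :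
    ∫ z, conj (g z) * keldysh γ f z ∂diskMeasure γ
      = ∫ z, conj (keldysh γ g z) * f z ∂diskMeasure γ := by
  have h1 := green (γ := γ) hf.smoothInt hg.conj (Or.inl hf.compactlyIn)
  have h2 := green (γ := γ) hg.conj hf.smoothInt (Or.inr hf.compactlyIn)
  have h3 : ∫ z, conj (g z) * keldysh γ f z ∂diskMeasure γ
      = ∫ z, keldysh γ f z * conj (g z) ∂diskMeasure γ := by simp only [mul_comm]
  have h4 : ∫ z, conj (keldysh γ g z) * f z ∂diskMeasure γ
      = ∫ z, keldysh γ (fun z => conj (g z)) z * f z ∂diskMeasure γ := by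
    refine integral_congr_ae ?_
    filter_upwards [ae_mem_ball γ] with z hz
    rw [keldysh_conj γ (hg z hz)]
  rw [h3, h4, ← h1, ← h2]
  refine integral_congr_ae (ae_of_all _ fun z => ?_)
  change bform f (fun z => conj (g z)) z + (1 + γ) ^ 2 * (f z * conj (g z)) = _
  rw [bform_comm, mul_comm (f z)]

/-! ### Elements of the form domain -/

theorem radialDeriv_eq (f : ℂ → ℂ) (z : ℂ) : radialDeriv f z = ((‖z‖⁻¹ : ℝ) : ℂ) * euler f z := by
  rw [radialDeriv, fderiv_apply_eq, euler, map_div₀, Complex.conj_ofReal]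
  push_cast
  ring

theorem angularDeriv_eq (f : ℂ → ℂ) (z : ℂ) :
    angularDeriv f z = Complex.I * (z * dz f z - conj z * db f z) := by
  rw [angularDeriv, fderiv_apply_eq, map_mul, Complex.conj_I]; ring

/-- The first component of the isometry defining the form domain. -/
def jet0 (γ : ℝ) (f : ℂ → ℂ) (z : ℂ) : ℂ := ((1 + γ : ℝ) : ℂ) * f z

/-- The second component of the isometry defining the form domain. -/
def jet1 (f : ℂ → ℂ) (z : ℂ) : ℂ := ((Real.sqrt (1 - ‖z‖ ^ 2) : ℝ) : ℂ) * radialDeriv f z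

/-- The third component of the isometry defining the form domain. -/
def jet2 (f : ℂ → ℂ) (z : ℂ) : ℂ := ((‖z‖⁻¹ : ℝ) : ℂ) * angularDeriv f z

/-- The isometry defining the form domain. -/
def jet (γ : ℝ) (f : ℂ → ℂ) : PiLp 2 (fun _ : Fin 3 => L2 γ) :=
  WithLp.toLp 2 ![vec γ (jet0 γ f), vec γ (jet1 f), vec γ (jet2 f)]

/-- Polarized form of x|∂_ρ f|² + ρ⁻²|∂_ω f|² = |∇f|² - |ρ∂_ρ f|², where |∇f|² = 2(|∂f|² + |∂̄f|²).
-/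
theorem jet_pointwise {f g : ℂ → ℂ} {z : ℂ} (hz : 0 < xr z) (hz0 : z ≠ 0)
    (hf : DifferentiableAt ℝ f z) :
    conj (jet1 f z) * jet1 g z + conj (jet2 f z) * jet2 g z = bform g (fun z => conj (f z)) z := by
  have hn : (‖z‖ : ℂ) ≠ 0 := by exact_mod_cast (norm_ne_zero_iff.2 hz0)
  have h1 : (((Real.sqrt (1 - ‖z‖ ^ 2) : ℝ) : ℂ)) ^ 2 = 1 - z * conj z := by
    rw [← xr_eq, ← Complex.ofReal_pow, Real.sq_sqrt (by exact hz.le)]; rfl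
  have h2 : z * conj z = (‖z‖ : ℂ) ^ 2 := by
    rw [Complex.mul_conj, Complex.normSq_eq_norm_sq]; push_cast; rfl
  obtain ⟨e1, e2⟩ := dz_db_conj_comp hf
  rw [jet1, jet1, jet2, jet2, radialDeriv_eq, radialDeriv_eq, angularDeriv_eq, angularDeriv_eq, bform,
    euler, euler, euler, e1, e2]
  simp only [map_add, map_mul, map_sub, Complex.conj_conj, Complex.conj_ofReal, Complex.conj_I]
  push_cast
  set r := (‖z‖ : ℂ)
  set s := ((Real.sqrt (1 - ‖z‖ ^ 2) : ℝ) : ℂ)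
  have h3 : s ^ 2 = 1 - r ^ 2 := by rw [h1, h2]
  field_simp
  ring_nf
  simp only [Complex.I_sq, h3, ← h2]
  ring

theorem aestronglyMeasurable_jet1 {γ : ℝ} {f : ℂ → ℂ} (hf : SmoothInt f) :
    AEStronglyMeasurable (jet1 f) (diskMeasure γ) := by
  have h : jet1 f = fun z => (((Real.sqrt (1 - ‖z‖ ^ 2) * ‖z‖⁻¹ : ℝ)) : ℂ) * euler f z := by
    funext z; rw [jet1, radialDeriv_eq]; push_cast; ring
  rw [h]
  refine AEStronglyMeasurable.mul ?_
    (aestronglyMeasurable_of_continuousOn (smoothInt_continuousOn hf.euler))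
  exact (by fun_prop : Measurable fun z : ℂ =>
    (((Real.sqrt (1 - ‖z‖ ^ 2) * ‖z‖⁻¹ : ℝ)) : ℂ)).aestronglyMeasurable

theorem aestronglyMeasurable_jet2 {γ : ℝ} {f : ℂ → ℂ} (hf : SmoothInt f) :
    AEStronglyMeasurable (jet2 f) (diskMeasure γ) := by
  have h : jet2 f = fun z => ((‖z‖⁻¹ : ℝ) : ℂ) * (Complex.I * (z * dz f z - conj z * db f z)) := by
    funext z; rw [jet2, angularDeriv_eq]
  rw [h]
  refine AEStronglyMeasurable.mul ?_
    (aestronglyMeasurable_of_continuousOn ?_)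
  · exact (by fun_prop : Measurable fun z : ℂ => ((‖z‖⁻¹ : ℝ) : ℂ)).aestronglyMeasurable
  · have h1 := smoothInt_continuousOn hf.dz
    have h2 := smoothInt_continuousOn hf.db
    have h3 : ContinuousOn (fun z : ℂ => conj z) (Metric.ball (0 : ℂ) 1) :=
      contDiff_conj.continuous.continuousOn
    fun_prop

theorem norm_jet1_sq_le {f : ℂ → ℂ} {z : ℂ} (hz : 0 < xr z) :
    ‖jet1 f z‖ ^ 2 ≤ xr z * (‖dz f z‖ + ‖db f z‖) ^ 2 := by
  have h1 : ‖jet1 f z‖ = Real.sqrt (xr z) * (‖z‖⁻¹ * ‖euler f z‖) := by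
    rw [jet1, radialDeriv_eq, norm_mul, norm_mul, Complex.norm_of_nonneg (Real.sqrt_nonneg _),
      Complex.norm_of_nonneg (by positivity)]
    rfl
  have h2 : ‖euler f z‖ ≤ ‖z‖ * (‖dz f z‖ + ‖db f z‖) := by
    rw [euler]
    refine (norm_add_le _ _).trans ?_
    rw [norm_mul, norm_mul, RCLike.norm_conj]; linarith
  rw [h1, mul_pow, Real.sq_sqrt hz.le]
  refine mul_le_mul_of_nonneg_left (pow_le_pow_left₀ (by positivity) ?_ 2) hz.le
  by_cases h0 : ‖z‖ = 0
  · simp [h0]; positivity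
  · rw [inv_mul_le_iff₀ (lt_of_le_of_ne (norm_nonneg z) (Ne.symm h0))]; exact h2

theorem norm_jet2_sq_le {f : ℂ → ℂ} {z : ℂ} {C : ℝ} (hC : 0 ≤ C)
    (h : ‖z * dz f z - conj z * db f z‖ ≤ ‖z‖ * C) : ‖jet2 f z‖ ^ 2 ≤ C ^ 2 := by
  have h1 : ‖jet2 f z‖ = ‖z‖⁻¹ * ‖z * dz f z - conj z * db f z‖ := by
    rw [jet2, angularDeriv_eq, norm_mul, norm_mul, Complex.norm_I, one_mul,
      Complex.norm_of_nonneg (by positivity)]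
  rw [h1]
  refine pow_le_pow_left₀ (by positivity) ?_ 2
  by_cases h0 : ‖z‖ = 0
  · simp [h0, hC]
  · rw [inv_mul_le_iff₀ (lt_of_le_of_ne (norm_nonneg z) (Ne.symm h0))]; exact h

/-- Square-integrability of all components of `jet γ f`. -/
structure JetL2 (γ : ℝ) (f : ℂ → ℂ) : Prop where
  smooth : SmoothInt f
  mem : MemLp f 2 (diskMeasure γ)
  mem1 : MemLp (jet1 f) 2 (diskMeasure γ)
  mem2 : MemLp (jet2 f) 2 (diskMeasure γ)

theorem TestFunction.dz {f : ℂ → ℂ} (hf : TestFunction f) : TestFunction (dz f) :=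
  testFunction_of_compactlyIn hf.smoothInt.dz (hf.compactlyIn.mono_nhds fun z hz => by
    rw [dz_congr hz, dz_const])

theorem TestFunction.db {f : ℂ → ℂ} (hf : TestFunction f) : TestFunction (db f) :=
  testFunction_of_compactlyIn hf.smoothInt.db (hf.compactlyIn.mono_nhds fun z hz => by
    rw [db_congr hz, db_const])

theorem TestFunction.keldysh {f : ℂ → ℂ} (γ : ℝ) (hf : TestFunction f) :
    TestFunction (keldysh γ f) := by
  refine testFunction_of_compactlyIn (smoothInt_keldysh γ hf.smoothInt)
    (hf.compactlyIn.mono_nhds fun z hz => ?_)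
  have h1 : KeldyshDisk.dz (fun _ => (0 : ℂ)) = fun _ => 0 := by funext w; exact dz_const 0 w
  have h2 : KeldyshDisk.db (fun _ => (0 : ℂ)) = fun _ => 0 := by funext w; exact db_const 0 w
  rw [keldysh_congr γ hz, keldysh_eq γ contDiffAt_const]
  simp [euler, h1, h2]

theorem TestFunction.bounded {f : ℂ → ℂ} (hf : TestFunction f) : ∃ C, 0 ≤ C ∧ ∀ z, ‖f z‖ ≤ C := by
  obtain ⟨C, hC⟩ := hf.2.1.exists_bound_of_continuous hf.1.continuous
  exact ⟨C, (norm_nonneg _).trans (hC 0), hC⟩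

theorem memLp_of_bounded {γ : ℝ} (hγ : -1 < γ) {f : ℂ → ℂ}
    (hf : AEStronglyMeasurable f (diskMeasure γ)) {C : ℝ} (h : ∀ z, 0 < xr z → ‖f z‖ ^ 2 ≤ C) :
    MemLp f 2 (diskMeasure γ) := by
  have := isFiniteMeasure_diskMeasure hγ
  exact memLp_of_sq_le hf (integrable_const C) h

theorem TestFunction.memLp {γ : ℝ} (hγ : -1 < γ) {f : ℂ → ℂ} (hf : TestFunction f) :
    MemLp f 2 (diskMeasure γ) := by
  obtain ⟨C, hC, h⟩ := hf.bounded
  exact memLp_of_bounded hγ (aestronglyMeasurable_of_continuousOn hf.1.continuous.continuousOn)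
    (C := C ^ 2) fun z _ => pow_le_pow_left₀ (norm_nonneg _) (h z) 2

theorem norm_angular_le (f : ℂ → ℂ) (z : ℂ) :
    ‖z * dz f z - conj z * db f z‖ ≤ ‖z‖ * (‖dz f z‖ + ‖db f z‖) := by
  refine (norm_sub_le _ _).trans ?_
  rw [norm_mul, norm_mul, RCLike.norm_conj]; linarith

theorem TestFunction.jetL2 {γ : ℝ} (hγ : -1 < γ) {f : ℂ → ℂ} (hf : TestFunction f) : JetL2 γ f := by
  obtain ⟨C1, hC1, h1⟩ := hf.dz.bounded
  obtain ⟨C2, hC2, h2⟩ := hf.db.bounded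
  refine ⟨hf.smoothInt, hf.memLp hγ, memLp_of_bounded hγ (aestronglyMeasurable_jet1 hf.smoothInt)
    (C := (C1 + C2) ^ 2) fun z hz => ?_,
    memLp_of_bounded hγ (aestronglyMeasurable_jet2 hf.smoothInt)
    (C := (C1 + C2) ^ 2) fun z _ => norm_jet2_sq_le (by positivity) ?_⟩
  · refine (norm_jet1_sq_le hz).trans ?_
    have h3 : (‖KeldyshDisk.dz f z‖ + ‖KeldyshDisk.db f z‖) ^ 2 ≤ (C1 + C2) ^ 2 :=
      pow_le_pow_left₀ (by positivity) (add_le_add (h1 z) (h2 z)) 2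
    have h4 := xr_le_one z
    nlinarith [sq_nonneg (‖KeldyshDisk.dz f z‖ + ‖KeldyshDisk.db f z‖)]
  · exact (norm_angular_le f z).trans
      (mul_le_mul_of_nonneg_left (add_le_add (h1 z) (h2 z)) (norm_nonneg z))

theorem JetL2.mem0 {γ : ℝ} {f : ℂ → ℂ} (hf : JetL2 γ f) : MemLp (jet0 γ f) 2 (diskMeasure γ) :=
  hf.mem.const_mul _

/-- Green's formula stated in the ambient Hilbert space of the form domain. Only f has compact
support, so this also applies to limits that are not test functions. -/
theorem inner_jet {γ : ℝ} {f g : ℂ → ℂ} (hf : TestFunction f) (hγ : -1 < γ) (hg : JetL2 γ g) :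
    ⟪jet γ f, jet γ g⟫_ℂ = ∫ z, conj (f z) * keldysh γ g z ∂diskMeasure γ := by
  have hj := hf.jetL2 hγ
  have hprod : ∀ a b : ℂ → ℂ, MemLp a 2 (diskMeasure γ) → MemLp b 2 (diskMeasure γ) →
      Integrable (fun z => conj (a z) * b z) (diskMeasure γ) := by
    intro a b ha hb
    have hc : MemLp (fun z => conj (a z)) 2 (diskMeasure γ) := by
      refine ha.of_le (Complex.continuous_conj.comp_aestronglyMeasurable ha.1) ?_
      exact ae_of_all _ fun z => by rw [RCLike.norm_conj]
    exact hc.integrable_mul hb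
  rw [PiLp.inner_apply, Fin.sum_univ_three]
  change ⟪vec γ (jet0 γ f), vec γ (jet0 γ g)⟫_ℂ + ⟪vec γ (jet1 f), vec γ (jet1 g)⟫_ℂ
    + ⟪vec γ (jet2 f), vec γ (jet2 g)⟫_ℂ = _
  rw [inner_vec hj.mem0 hg.mem0, inner_vec hj.mem1 hg.mem1, inner_vec hj.mem2 hg.mem2,
    ← integral_add (hprod _ _ hj.mem0 hg.mem0) (hprod _ _ hj.mem1 hg.mem1),
    ← integral_add ((hprod _ _ hj.mem0 hg.mem0).fun_add (hprod _ _ hj.mem1 hg.mem1))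
      (hprod _ _ hj.mem2 hg.mem2)]
  have h := green (γ := γ) hg.smooth hf.smoothInt.conj
    (Or.inr (hf.compactlyIn.mono fun z hz => by simp [hz]))
  have h2 : ∫ z, conj (f z) * keldysh γ g z ∂diskMeasure γ
      = ∫ z, keldysh γ g z * conj (f z) ∂diskMeasure γ := by simp only [mul_comm]
  rw [h2, ← h]
  refine integral_congr_ae ?_
  filter_upwards [ae_mem_ball γ, ae_ne_zero γ] with z hz hz0
  rw [← jet_pointwise hz hz0 (differentiableAt_of_smooth (hf.smoothInt z hz)), jet0, jet0]
  simp only [map_mul, Complex.conj_ofReal]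
  push_cast
  ring

theorem formSpace_generator {γ : ℝ} {U : PiLp 2 (fun _ : Fin 3 => L2 γ)} {f : ℂ → ℂ}
    (h0 : (U 0 : ℂ → ℂ) =ᵐ[diskMeasure γ] jet0 γ f) (h1 : (U 1 : ℂ → ℂ) =ᵐ[diskMeasure γ] jet1 f)
    (h2 : (U 2 : ℂ → ℂ) =ᵐ[diskMeasure γ] jet2 f) : U = jet γ f := by
  ext1 i
  fin_cases i
  · exact (vec_eq h0).symm
  · exact (vec_eq h1).symm
  · exact (vec_eq h2).symm

theorem jet_mem_of_test {γ : ℝ} (hγ : -1 < γ) {f : ℂ → ℂ} (hf : TestFunction f) :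
    jet γ f ∈ formSpace γ := by
  have hj := hf.jetL2 hγ
  exact Submodule.le_topologicalClosure _ (Submodule.subset_span
    ⟨f, hf, vec_ae hj.mem0, vec_ae hj.mem1, vec_ae hj.mem2⟩)

theorem formInclusion_jet {γ : ℝ} (hγ : -1 < γ) {f : ℂ → ℂ} (hf : MemLp f 2 (diskMeasure γ))
    (h : jet γ f ∈ formSpace γ) : formInclusion γ ⟨jet γ f, h⟩ = vec γ f := by
  have h1 : ((1 + γ : ℝ) : ℂ) ≠ 0 := by
    exact_mod_cast (by linarith : (0 : ℝ) < 1 + γ).ne'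
  change (((1 + γ : ℝ) : ℂ)⁻¹) • vec γ (jet0 γ f) = vec γ f
  have h2 : vec γ (jet0 γ f) = ((1 + γ : ℝ) : ℂ) • vec γ f := vec_const_mul _ hf
  rw [h2, smul_smul, inv_mul_cancel₀ h1, one_smul]

/-- A square-integrable function in the form domain with square-integrable image under `L_γ`
belongs to the domain of the Friedrichs extension. -/
theorem eq_dirichletInverse {γ : ℝ} (hγ : -1 < γ) {f : ℂ → ℂ} (hf : JetL2 γ f)
    (hj : jet γ f ∈ formSpace γ) (hL : MemLp (keldysh γ f) 2 (diskMeasure γ)) :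
    vec γ f = dirichletInverse γ (vec γ (keldysh γ f)) := by
  rw [← mem_dirichletGraph_iff]
  refine ⟨⟨jet γ f, hj⟩, formInclusion_jet hγ hf.mem hj, ?_⟩
  -- P extends the inclusion of the form domain to the ambient space. The weak equation then says
  -- that the defect y is orthogonal to the form domain. This is a closed condition, so jets of test
  -- functions suffice, and for them it is Green's formula.
  let P : PiLp 2 (fun _ : Fin 3 => L2 γ) →L[ℂ] L2 γ :=
    (((1 + γ : ℝ) : ℂ)⁻¹) • PiLp.proj 2 (fun _ : Fin 3 => L2 γ) 0
  set y := jet γ f - P.adjoint (vec γ (keldysh γ f)) with hy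
  have key : formSpace γ ≤ (Submodule.span ℂ {y})ᗮ := by
    refine Submodule.topologicalClosure_minimal _ ?_ (Submodule.isClosed_orthogonal _)
    rw [Submodule.span_le]
    rintro V ⟨v, hv, h0, h1, h2⟩
    have hV : V = jet γ v := formSpace_generator h0 h1 h2
    have hPV : P V = vec γ v := by
      rw [hV]
      exact formInclusion_jet hγ (hv.memLp hγ) (jet_mem_of_test hγ hv)
    change V ∈ (Submodule.span ℂ {y})ᗮ
    rw [Submodule.mem_orthogonal_singleton_iff_inner_left, hy, inner_sub_right,
      ContinuousLinearMap.adjoint_inner_right, hPV, hV, inner_jet hv hγ hf, inner_vec (hv.memLp hγ) hL,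
      sub_self]
  intro V
  have h := key V.2
  rw [Submodule.mem_orthogonal_singleton_iff_inner_left, hy, inner_sub_right,
    ContinuousLinearMap.adjoint_inner_right] at h
  exact sub_eq_zero.1 h

theorem test_eq_dirichletInverse {γ : ℝ} (hγ : -1 < γ) {f : ℂ → ℂ} (hf : TestFunction f) :
    vec γ f = dirichletInverse γ (vec γ (keldysh γ f)) :=
  eq_dirichletInverse hγ (hf.jetL2 hγ) (jet_mem_of_test hγ hf) ((hf.keldysh γ).memLp hγ)

/-! ### Radial factors and cutoff functions -/

/-- `k` is smooth on `(0, ∞)`, and `k, x k', x² k''` are bounded by `M` on `(0, 1]`. -/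
structure RadialBound (k M : ℝ → ℝ) : Prop where
  smooth : ∀ x, 0 < x → ContDiffAt ℝ ∞ k x
  bound0 : ∀ x, 0 < x → x ≤ 1 → |k x| ≤ M x
  bound1 : ∀ x, 0 < x → x ≤ 1 → |x * deriv k x| ≤ M x
  bound2 : ∀ x, 0 < x → x ≤ 1 → |x ^ 2 * deriv (deriv k) x| ≤ M x

/-- The weights x^j attached to the j-th derivatives are compatible with the Leibniz rule. The
factor 4 = 1 + 2 + 1 counts the terms of the second derivative. -/
theorem RadialBound.mul {k M l N : ℝ → ℝ} (hk : RadialBound k M) (hl : RadialBound l N) :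
    RadialBound (fun x => k x * l x) (fun x => 4 * (M x * N x)) := by
  have hd : ∀ x, 0 < x → deriv (fun x => k x * l x) x = deriv k x * l x + k x * deriv l x :=
    fun x hx => deriv_fun_mul ((hk.smooth x hx).differentiableAt (by simp))
      ((hl.smooth x hx).differentiableAt (by simp))
  have hd2 : ∀ x, 0 < x → deriv (deriv fun x => k x * l x) x
      = deriv (deriv k) x * l x + 2 * (deriv k x * deriv l x) + k x * deriv (deriv l) x := by
    intro x hx
    have h : deriv (fun x => k x * l x) =ᶠ[𝓝 x] fun x => deriv k x * l x + k x * deriv l x := by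
      filter_upwards [lt_mem_nhds hx] with y hy using hd y hy
    have k0 := (hk.smooth x hx).differentiableAt (by simp)
    have l0 := (hl.smooth x hx).differentiableAt (by simp)
    have k1 : DifferentiableAt ℝ (deriv k) x :=
      ((hk.smooth x hx).derivWithin (m := ∞) (by simp)).differentiableAt (by simp)
    have l1 : DifferentiableAt ℝ (deriv l) x :=
      ((hl.smooth x hx).derivWithin (m := ∞) (by simp)).differentiableAt (by simp)
    rw [h.deriv_eq, deriv_fun_add (k1.fun_mul l0) (k0.fun_mul l1), deriv_fun_mul k1 l0,
      deriv_fun_mul k0 l1]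
    ring
  refine ⟨fun x hx => (hk.smooth x hx).mul (hl.smooth x hx), fun x hx h1 => ?_, fun x hx h1 => ?_,
    fun x hx h1 => ?_⟩
  all_goals
    have a0 := hk.bound0 x hx h1
    have a1 := hk.bound1 x hx h1
    have a2 := hk.bound2 x hx h1
    have b0 := hl.bound0 x hx h1
    have b1 := hl.bound1 x hx h1
    have b2 := hl.bound2 x hx h1
    have hM : 0 ≤ M x := (abs_nonneg _).trans a0
    have hN : 0 ≤ N x := (abs_nonneg _).trans b0
    have c00 : |k x * l x| ≤ M x * N x := by
      rw [abs_mul]; exact mul_le_mul a0 b0 (abs_nonneg _) hM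
    have c10 : |(x * deriv k x) * l x| ≤ M x * N x := by
      rw [abs_mul]; exact mul_le_mul a1 b0 (abs_nonneg _) hM
    have c01 : |k x * (x * deriv l x)| ≤ M x * N x := by
      rw [abs_mul]; exact mul_le_mul a0 b1 (abs_nonneg _) hM
    have c11 : |(x * deriv k x) * (x * deriv l x)| ≤ M x * N x := by
      rw [abs_mul]; exact mul_le_mul a1 b1 (abs_nonneg _) hM
    have c20 : |(x ^ 2 * deriv (deriv k) x) * l x| ≤ M x * N x := by
      rw [abs_mul]; exact mul_le_mul a2 b0 (abs_nonneg _) hM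
    have c02 : |k x * (x ^ 2 * deriv (deriv l) x)| ≤ M x * N x := by
      rw [abs_mul]; exact mul_le_mul a0 b2 (abs_nonneg _) hM
    have hMN : 0 ≤ M x * N x := mul_nonneg hM hN
  · linarith
  · rw [hd x hx, show x * (deriv k x * l x + k x * deriv l x)
      = x * deriv k x * l x + k x * (x * deriv l x) by ring]
    exact (abs_add_le _ _).trans (by linarith)
  · rw [hd2 x hx, show x ^ 2 * (deriv (deriv k) x * l x + 2 * (deriv k x * deriv l x)
        + k x * deriv (deriv l) x)
      = x ^ 2 * deriv (deriv k) x * l x + x * deriv k x * (x * deriv l x)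
        + x * deriv k x * (x * deriv l x) + k x * (x ^ 2 * deriv (deriv l) x) by ring]
    refine (abs_add_le _ _).trans ?_
    have := (abs_add_le (x ^ 2 * deriv (deriv k) x * l x + x * deriv k x * (x * deriv l x))
      (x * deriv k x * (x * deriv l x)))
    have h3 := abs_add_le (x ^ 2 * deriv (deriv k) x * l x) (x * deriv k x * (x * deriv l x))
    linarith

/-- A smooth step: `0` for `y ≤ 1`, `1` for `y ≥ 2`. -/
def step (y : ℝ) : ℝ := Real.smoothTransition (y - 1)

theorem contDiff_step : ContDiff ℝ ∞ step :=
  Real.smoothTransition.contDiff.comp (contDiff_id.sub contDiff_const)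

theorem step_zero {y : ℝ} (h : y ≤ 1) : step y = 0 :=
  Real.smoothTransition.zero_of_nonpos (by linarith)

theorem step_one {y : ℝ} (h : 2 ≤ y) : step y = 1 :=
  Real.smoothTransition.one_of_one_le (by linarith)

/-- The cutoff at distance `1 / (n + 1)` from the boundary. -/
def cutoff (n : ℕ) (x : ℝ) : ℝ := step ((n + 1 : ℝ) * x)

theorem cutoff_zero {n : ℕ} {x : ℝ} (h : (n + 1 : ℝ) * x ≤ 1) : cutoff n x = 0 := step_zero h

theorem cutoff_one {n : ℕ} {x : ℝ} (h : 2 ≤ (n + 1 : ℝ) * x) : cutoff n x = 1 := step_one h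

/-- The quantities k, x k', x² k'' are invariant under dilation of x, so the bounds for `step` hold
for all cutoffs with one constant. -/
theorem exists_cutoff_bound : ∃ C : ℝ, 0 ≤ C ∧ ∀ n, RadialBound (cutoff n) fun _ => C := by
  have h1 : ContDiff ℝ ∞ (deriv step) := (contDiff_infty_iff_deriv.1 contDiff_step).2
  have h2 : ContDiff ℝ ∞ (deriv (deriv step)) := (contDiff_infty_iff_deriv.1 h1).2
  have e1 : ∀ y, 3 < y → step =ᶠ[𝓝 y] fun _ => 1 := by
    intro y hy
    filter_upwards [lt_mem_nhds hy] with t ht using step_one (by linarith)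
  have z1 : ∀ y, 3 < y → deriv step y = 0 := fun y hy => by
    rw [(e1 y hy).deriv_eq]; simp
  have z2 : ∀ y, 3 < y → deriv (deriv step) y = 0 := fun y hy => by
    have h : deriv step =ᶠ[𝓝 y] fun _ => 0 := by
      filter_upwards [lt_mem_nhds hy] with t ht using z1 t ht
    rw [h.deriv_eq]; simp
  have c1 : Continuous fun y => y * deriv step y := continuous_id.mul h1.continuous
  have c2 : Continuous fun y => y ^ 2 * deriv (deriv step) y := (continuous_pow 2).mul h2.continuous
  obtain ⟨C0, hC0⟩ := (isCompact_Icc (a := (0 : ℝ)) (b := 3)).exists_bound_of_continuousOn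
    contDiff_step.continuous.continuousOn
  obtain ⟨C1, hC1⟩ := (isCompact_Icc (a := (0 : ℝ)) (b := 3)).exists_bound_of_continuousOn
    c1.continuousOn
  obtain ⟨C2, hC2⟩ := (isCompact_Icc (a := (0 : ℝ)) (b := 3)).exists_bound_of_continuousOn
    c2.continuousOn
  have p0 : 0 ≤ C0 := (norm_nonneg _).trans (hC0 0 (by simp))
  have p1 : 0 ≤ C1 := (norm_nonneg _).trans (hC1 0 (by simp))
  have p2 : 0 ≤ C2 := (norm_nonneg _).trans (hC2 0 (by simp))
  have b0 : ∀ y, 0 ≤ y → |step y| ≤ C0 + 1 := by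
    intro y hy
    rcases le_or_gt y 3 with h | h
    · exact (hC0 y ⟨hy, h⟩).trans (by linarith)
    · rw [step_one (by linarith)]; simp [p0]
  have b1 : ∀ y, 0 ≤ y → |y * deriv step y| ≤ C1 := by
    intro y hy
    rcases le_or_gt y 3 with h | h
    · exact hC1 y ⟨hy, h⟩
    · rw [z1 y h]; simp [p1]
  have b2 : ∀ y, 0 ≤ y → |y ^ 2 * deriv (deriv step) y| ≤ C2 := by
    intro y hy
    rcases le_or_gt y 3 with h | h
    · exact hC2 y ⟨hy, h⟩
    · rw [z2 y h]; simp [p2]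
  refine ⟨C0 + 1 + C1 + C2, by positivity, fun n => ?_⟩
  have d1 : deriv (cutoff n) = fun x => (n + 1 : ℝ) * deriv step ((n + 1 : ℝ) * x) := by
    funext x
    exact deriv_comp_mul_left (n + 1 : ℝ) step x
  have d2 : deriv (deriv (cutoff n))
      = fun x => (n + 1 : ℝ) * ((n + 1 : ℝ) * deriv (deriv step) ((n + 1 : ℝ) * x)) := by
    funext x
    rw [d1, deriv_const_mul_field]
    congr 1
    exact deriv_comp_mul_left (n + 1 : ℝ) (deriv step) x
  refine ⟨fun x _ => (contDiff_step.comp (contDiff_const.mul contDiff_id)).contDiffAt,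
    fun x hx _ => ?_, fun x hx _ => ?_, fun x hx _ => ?_⟩
  · exact (b0 _ (by positivity)).trans (by linarith)
  · rw [d1]
    have := b1 ((n + 1 : ℝ) * x) (by positivity)
    rw [show (n + 1 : ℝ) * x * deriv step ((n + 1 : ℝ) * x)
      = x * ((n + 1 : ℝ) * deriv step ((n + 1 : ℝ) * x)) by ring] at this
    exact this.trans (by linarith)
  · rw [d2]
    have := b2 ((n + 1 : ℝ) * x) (by positivity)
    rw [show ((n + 1 : ℝ) * x) ^ 2 * deriv (deriv step) ((n + 1 : ℝ) * x)
      = x ^ 2 * ((n + 1 : ℝ) * ((n + 1 : ℝ) * deriv (deriv step) ((n + 1 : ℝ) * x))) by ring] at this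
    exact this.trans (by linarith)

theorem smoothInt_radial {k : ℝ → ℝ} (hk : ∀ x, 0 < x → ContDiffAt ℝ ∞ k x) :
    SmoothInt fun z => ((k (xr z) : ℝ) : ℂ) := fun _ hz => contDiffAt_radial (hk _ hz)

theorem testFunction_cutoff {k : ℝ → ℝ} {w : ℂ → ℂ} (hk : ∀ x, 0 < x → ContDiffAt ℝ ∞ k x)
    (hw : SmoothInt w) (n : ℕ) :
    TestFunction fun z => ((k (xr z) * cutoff n (xr z) : ℝ) : ℂ) * w z := by
  refine testFunction_of_compactlyIn ?_ ?_
  · refine SmoothInt.mul (smoothInt_radial (k := fun x => k x * cutoff n x) fun x hx => ?_) hw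
    exact (hk x hx).mul (contDiff_step.comp (contDiff_const.mul contDiff_id)).contDiffAt
  · have hn : (0 : ℝ) < n + 1 := by positivity
    refine ⟨{z | (n + 1 : ℝ)⁻¹ ≤ xr z}, ?_, fun _ hz => lt_of_lt_of_le (by positivity) hz,
      fun z hz => ?_⟩
    · refine Metric.isCompact_of_isClosed_isBounded (isClosed_le continuous_const continuous_xr) ?_
      refine (Metric.isBounded_ball (x := (0 : ℂ)) (r := 1)).subset fun z hz => ?_
      exact mem_ball_iff_xr.2 (lt_of_lt_of_le (by positivity) hz)
    · have h : (n + 1 : ℝ) * xr z ≤ 1 := by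
        have h1 : xr z < (n + 1 : ℝ)⁻¹ := not_le.1 hz
        have := mul_lt_mul_of_pos_left h1 hn
        rw [mul_inv_cancel₀ hn.ne'] at this
        exact this.le
      simp [cutoff_zero h]

theorem cutoff_eventually_one {z : ℂ} (hz : 0 < xr z) :
    ∀ᶠ n : ℕ in atTop, ∀ᶠ w in 𝓝 z, cutoff n (xr w) = 1 := by
  have h1 : Tendsto (fun n : ℕ => ((n : ℝ) + 1) * (xr z / 2)) atTop atTop :=
    (tendsto_atTop_add_const_right _ _ tendsto_natCast_atTop_atTop).atTop_mul_const (by positivity)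
  filter_upwards [h1.eventually_ge_atTop 2] with n hn
  have h2 : ∀ᶠ w in 𝓝 z, xr z / 2 < xr w :=
    (continuous_xr.tendsto z).eventually (lt_mem_nhds (by linarith))
  filter_upwards [h2] with w hw
  refine cutoff_one (hn.trans ?_)
  exact mul_le_mul_of_nonneg_left hw.le (by positivity)

/-! ### The closure of the operator on test functions -/

/-- The closure of the graph of `L_γ` on test functions. -/
def testGraph (γ : ℝ) : Submodule ℂ (L2 γ × L2 γ) :=
  (Submodule.span ℂ {p : L2 γ × L2 γ | ∃ f : ℂ → ℂ, TestFunction f ∧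
    p = (vec γ f, vec γ (keldysh γ f))}).topologicalClosure

theorem mem_testGraph {γ : ℝ} {f : ℂ → ℂ} (hf : TestFunction f) :
    (vec γ f, vec γ (keldysh γ f)) ∈ testGraph γ :=
  Submodule.le_topologicalClosure _ (Submodule.subset_span ⟨f, hf, rfl⟩)

theorem isClosed_testGraph (γ : ℝ) : IsClosed (testGraph γ : Set (L2 γ × L2 γ)) :=
  Submodule.isClosed_topologicalClosure _

theorem testGraph_le {γ : ℝ} {S : Submodule ℂ (L2 γ × L2 γ)} (hS : IsClosed (S : Set (L2 γ × L2 γ)))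
    (h : ∀ f, TestFunction f → (vec γ f, vec γ (keldysh γ f)) ∈ S) : testGraph γ ≤ S := by
  refine Submodule.topologicalClosure_minimal _ ?_ hS
  rw [Submodule.span_le]
  rintro p ⟨f, hf, rfl⟩
  exact h f hf

/-- The dangerous terms of the product formula are x k'' w and k' w. Each lacks one power of x, and
|w| ≤ C x supplies it. The constant is 21 = 1 + 4 + 4 + 4 + 8, one summand per term. -/
theorem norm_keldysh_radial_le {γ : ℝ} (hγ : γ ∈ Set.Ioo (-1 : ℝ) 1) {k M : ℝ → ℝ} {w : ℂ → ℂ} {C : ℝ}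
    (hk : RadialBound k M) (hw : SmoothInt w) {z : ℂ} (hz : 0 < xr z) (h0 : ‖w z‖ ≤ C * xr z)
    (h1 : ‖euler w z‖ ≤ C) (h2 : ‖keldysh γ w z‖ ≤ C) :
    ‖keldysh γ (fun z => ((k (xr z) : ℝ) : ℂ) * w z) z‖ ≤ 21 * C * M (xr z) := by
  have a0 := hk.bound0 _ hz (xr_le_one z)
  have a1 := hk.bound1 _ hz (xr_le_one z)
  have a2 := hk.bound2 _ hz (xr_le_one z)
  set x := xr z with hx
  have hx1 : x ≤ 1 := xr_le_one z
  have hM : 0 ≤ M x := (abs_nonneg _).trans a0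
  have hC : 0 ≤ C := (norm_nonneg _).trans h1
  have hzz : ‖z * conj z‖ ≤ 1 := by
    have : z * conj z = ((1 - x : ℝ) : ℂ) := by
      push_cast; rw [hx, xr_eq]; ring
    rw [this, Complex.norm_of_nonneg (by linarith)]; linarith
  rw [keldysh_radial_mul γ (hk.smooth _ hz) (hw z hz)]
  have t1 : ‖(k x : ℂ) * keldysh γ w z‖ ≤ M x * C := by
    rw [norm_mul, Complex.norm_real]
    exact mul_le_mul a0 h2 (norm_nonneg _) hM
  have t2 : ‖4 * (x : ℂ) * (deriv k x : ℝ) * euler w z‖ ≤ 4 * (M x * C) := by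
    have : 4 * (x : ℂ) * (deriv k x : ℝ) * euler w z = 4 * (((x * deriv k x : ℝ) : ℂ) * euler w z) := by
      push_cast; ring
    rw [this, norm_mul, norm_mul, Complex.norm_real, Complex.norm_ofNat]
    exact mul_le_mul_of_nonneg_left (mul_le_mul a1 h1 (norm_nonneg _) hM) (by norm_num)
  have t3 : ‖4 * (z * conj z) * (x : ℂ) * (deriv (deriv k) x : ℝ) * w z‖ ≤ 4 * (M x * C) := by
    have e : ‖4 * (z * conj z) * (x : ℂ) * (deriv (deriv k) x : ℝ) * w z‖
        = 4 * ‖z * conj z‖ * (|x * deriv (deriv k) x| * ‖w z‖) := by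
      rw [abs_mul]
      simp only [norm_mul, Complex.norm_real, Complex.norm_ofNat, Real.norm_eq_abs]; ring
    have e2 : |x * deriv (deriv k) x| * ‖w z‖ ≤ M x * C := by
      have : |x ^ 2 * deriv (deriv k) x| = |x * deriv (deriv k) x| * x := by
        rw [abs_mul, abs_mul, abs_pow, abs_of_pos hz]; ring
      rw [this] at a2
      calc _ ≤ |x * deriv (deriv k) x| * (C * x) := mul_le_mul_of_nonneg_left h0 (abs_nonneg _)
        _ = |x * deriv (deriv k) x| * x * C := by ring
        _ ≤ _ := mul_le_mul_of_nonneg_right a2 hC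
    rw [e]
    have e3 : 0 ≤ |x * deriv (deriv k) x| * ‖w z‖ := by positivity
    nlinarith
  have t4' : |x * deriv k x| * ‖w z‖ ≤ M x * C := by
    refine mul_le_mul a1 (h0.trans ?_) (norm_nonneg _) hM
    nlinarith
  have t4 : ‖4 * (x : ℂ) * (deriv k x : ℝ) * w z‖ ≤ 4 * (M x * C) := by
    have : ‖4 * (x : ℂ) * (deriv k x : ℝ) * w z‖ = 4 * (|x * deriv k x| * ‖w z‖) := by
      rw [abs_mul]
      simp only [norm_mul, Complex.norm_real, Complex.norm_ofNat, Real.norm_eq_abs]; ring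
    rw [this]; linarith
  have t5 : ‖4 * (1 + (γ : ℂ)) * (z * conj z) * (deriv k x : ℝ) * w z‖ ≤ 8 * (M x * C) := by
    have e : ‖4 * (1 + (γ : ℂ)) * (z * conj z) * (deriv k x : ℝ) * w z‖
        = 4 * (1 + γ) * ‖z * conj z‖ * (|deriv k x| * ‖w z‖) := by
      have : (1 + (γ : ℂ)) = ((1 + γ : ℝ) : ℂ) := by push_cast; rfl
      rw [this]
      simp only [norm_mul, Complex.norm_real, Complex.norm_ofNat, Real.norm_eq_abs]
      rw [abs_of_pos (by linarith [hγ.1] : (0 : ℝ) < 1 + γ)]; ring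
    have e2 : |deriv k x| * ‖w z‖ ≤ M x * C := by
      rw [abs_mul, abs_of_pos hz] at a1
      calc _ ≤ |deriv k x| * (C * x) := mul_le_mul_of_nonneg_left h0 (abs_nonneg _)
        _ = x * |deriv k x| * C := by ring
        _ ≤ _ := mul_le_mul_of_nonneg_right a1 hC
    rw [e]
    have e3 : 0 ≤ |deriv k x| * ‖w z‖ := by positivity
    have e4 : 4 * (1 + γ) * ‖z * conj z‖ ≤ 8 := by
      have := norm_nonneg (z * conj z)
      nlinarith [hγ.1, hγ.2]
    have e5 : 0 ≤ 4 * (1 + γ) * ‖z * conj z‖ := by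
      have := norm_nonneg (z * conj z)
      have := hγ.1
      exact mul_nonneg (by linarith) (norm_nonneg _)
    calc _ ≤ 8 * (|deriv k x| * ‖w z‖) := mul_le_mul_of_nonneg_right e4 e3
      _ ≤ _ := by linarith
  refine (norm_sub_le _ _).trans ?_
  refine (add_le_add (norm_add_le _ _) le_rfl).trans ?_
  refine (add_le_add (add_le_add (norm_sub_le _ _) le_rfl) le_rfl).trans ?_
  refine (add_le_add (add_le_add (add_le_add (norm_add_le _ _) le_rfl) le_rfl) le_rfl).trans ?_
  linarith

/-- Functions vanishing to first order at the boundary, with a controlled singular radial factor,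
belong to the closure of the operator on test functions. -/
theorem mem_testGraph_of_vanishing {γ : ℝ} (hγ : γ ∈ Set.Ioo (-1 : ℝ) 1) {k M : ℝ → ℝ} {w : ℂ → ℂ}
    {C : ℝ} (hk : RadialBound k M) (hM : Integrable (fun z => M (xr z) ^ 2) (diskMeasure γ))
    (hw : SmoothInt w) (h0 : ∀ z, 0 < xr z → ‖w z‖ ≤ C * xr z)
    (h1 : ∀ z, 0 < xr z → ‖euler w z‖ ≤ C) (h2 : ∀ z, 0 < xr z → ‖keldysh γ w z‖ ≤ C) :
    MemLp (fun z => ((k (xr z) : ℝ) : ℂ) * w z) 2 (diskMeasure γ) ∧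
    (vec γ (fun z => ((k (xr z) : ℝ) : ℂ) * w z),
      vec γ (keldysh γ fun z => ((k (xr z) : ℝ) : ℂ) * w z)) ∈ testGraph γ := by
  obtain ⟨D, hD, hcut⟩ := exists_cutoff_bound
  set F : ℕ → ℂ → ℂ := fun n z => ((k (xr z) * cutoff n (xr z) : ℝ) : ℂ) * w z with hF
  have hT : ∀ n, TestFunction (F n) := fun n => testFunction_cutoff hk.smooth hw n
  have hkb : ∀ n, RadialBound (fun x => k x * cutoff n x) fun x => 4 * (M x * D) :=
    fun n => hk.mul (hcut n)
  have hC : 0 ≤ C := (norm_nonneg _).trans (h1 0 (by simp [xr]))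
  have hev : ∀ z, 0 < xr z → ∀ᶠ n in atTop, F n =ᶠ[𝓝 z] fun z => ((k (xr z) : ℝ) : ℂ) * w z := by
    intro z hz
    filter_upwards [cutoff_eventually_one hz] with n hn
    filter_upwards [hn] with y hy
    simp [hF, hy]
  have l1 := tendsto_vec (γ := γ) (F := F) (f := fun z => ((k (xr z) : ℝ) : ℂ) * w z)
    (g := fun z => (4 * D * C) ^ 2 * M (xr z) ^ 2)
    (fun n => ((hT n).memLp hγ.1).1) (hM.const_mul _) (fun n z hz => by
      have a0 := (hkb n).bound0 _ hz (xr_le_one z)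
      have hb : ‖F n z‖ ≤ 4 * D * C * M (xr z) := by
        rw [hF]
        change ‖((k (xr z) * cutoff n (xr z) : ℝ) : ℂ) * w z‖ ≤ _
        rw [norm_mul, Complex.norm_real, Real.norm_eq_abs]
        have hMn : 0 ≤ 4 * (M (xr z) * D) := (abs_nonneg _).trans a0
        have hwz : ‖w z‖ ≤ C := (h0 z hz).trans (by nlinarith [xr_le_one z])
        calc _ ≤ 4 * (M (xr z) * D) * C := mul_le_mul a0 hwz (norm_nonneg _) hMn
          _ = _ := by ring
      rw [← mul_pow]
      exact pow_le_pow_left₀ (norm_nonneg _) hb 2)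
    (fun z hz _ => tendsto_const_nhds.congr' (by
      filter_upwards [hev z hz] with n hn using hn.eq_of_nhds.symm))
  -- The images stay dominated although derivatives fall on the cutoff, because w vanishes to first
  -- order. Here 84 = 21 · 4, the 4 coming from the product with the cutoff.
  have l2 := tendsto_vec (γ := γ) (F := fun n => keldysh γ (F n))
    (f := keldysh γ fun z => ((k (xr z) : ℝ) : ℂ) * w z)
    (g := fun z => (84 * D * C) ^ 2 * M (xr z) ^ 2)
    (fun n => (((hT n).keldysh γ).memLp hγ.1).1) (hM.const_mul _) (fun n z hz => by
      have hb := norm_keldysh_radial_le hγ (hkb n) hw hz (h0 z hz) (h1 z hz) (h2 z hz)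
      rw [← mul_pow]
      refine pow_le_pow_left₀ (norm_nonneg _) (hb.trans (le_of_eq ?_)) 2
      ring)
    (fun z hz _ => tendsto_const_nhds.congr' (by
      filter_upwards [hev z hz] with n hn using (keldysh_congr γ hn).symm))
  refine ⟨l1.1, (isClosed_testGraph γ).mem_of_tendsto (l1.2.prodMk_nhds l2.2)
    (Eventually.of_forall fun n => mem_testGraph (hT n))⟩

theorem testGraph_eq {γ : ℝ} (hγ : -1 < γ) {p : L2 γ × L2 γ} (hp : p ∈ testGraph γ) :
    p.1 = dirichletInverse γ p.2 := by
  have h : testGraph γ ≤ LinearMap.eqLocus (LinearMap.fst ℂ (L2 γ) (L2 γ))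
      ((dirichletInverse γ).toLinearMap.comp (LinearMap.snd ℂ (L2 γ) (L2 γ))) := by
    refine testGraph_le ?_ fun f hf => test_eq_dirichletInverse hγ hf
    exact isClosed_eq continuous_fst ((dirichletInverse γ).continuous.comp continuous_snd)
  exact h hp

/-! ### The Friedrichs domain contains `x^σ C^∞` -/

/-- Dominated convergence in the three components, combined with closedness of the form space. -/
theorem jet_limit {γ : ℝ} {F : ℕ → ℂ → ℂ} {f : ℂ → ℂ} {g : ℂ → ℝ} (hF : ∀ n, JetL2 γ (F n))
    (hFm : ∀ n, jet γ (F n) ∈ formSpace γ) (hf : SmoothInt f) (hg : Integrable g (diskMeasure γ))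
    (h0 : ∀ n z, 0 < xr z → ‖F n z‖ ^ 2 ≤ g z) (h1 : ∀ n z, 0 < xr z → ‖jet1 (F n) z‖ ^ 2 ≤ g z)
    (h2 : ∀ n z, 0 < xr z → ‖jet2 (F n) z‖ ^ 2 ≤ g z)
    (l0 : ∀ z, 0 < xr z → Tendsto (fun n => F n z) atTop (𝓝 (f z)))
    (l1 : ∀ z, 0 < xr z → Tendsto (fun n => dz (F n) z) atTop (𝓝 (dz f z)))
    (l2 : ∀ z, 0 < xr z → Tendsto (fun n => db (F n) z) atTop (𝓝 (db f z))) :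
    JetL2 γ f ∧ jet γ f ∈ formSpace γ := by
  have t0 := tendsto_vec (fun n => (hF n).mem.1) hg h0 (fun z hz _ => l0 z hz)
  have t00 := tendsto_vec (f := jet0 γ f) (g := fun z => (1 + γ) ^ 2 * g z)
    (fun n => (hF n).mem0.1) (hg.const_mul _)
    (fun n z hz => by
      rw [jet0, norm_mul, mul_pow, Complex.norm_real, Real.norm_eq_abs, sq_abs]
      exact mul_le_mul_of_nonneg_left (h0 n z hz) (sq_nonneg _))
    (fun z hz _ => (l0 z hz).const_mul _)
  have t1 := tendsto_vec (f := jet1 f) (fun n => (hF n).mem1.1) hg h1 (fun z hz _ => by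
    simp only [jet1, radialDeriv_eq, euler]
    exact ((((l1 z hz).const_mul _).add ((l2 z hz).const_mul _)).const_mul _).const_mul _)
  have t2 := tendsto_vec (f := jet2 f) (fun n => (hF n).mem2.1) hg h2 (fun z hz _ => by
    simp only [jet2, angularDeriv_eq]
    exact ((((l1 z hz).const_mul _).sub ((l2 z hz).const_mul _)).const_mul _).const_mul _)
  refine ⟨⟨hf, t0.1, t1.1, t2.1⟩, ?_⟩
  have hlim : Tendsto (fun n => jet γ (F n)) atTop (𝓝 (jet γ f)) := by
    refine ((PiLp.continuous_toLp 2 (fun _ : Fin 3 => L2 γ)).tendsto _).comp ?_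
    rw [tendsto_pi_nhds]
    intro i
    fin_cases i
    · exact t00.2
    · exact t1.2
    · exact t2.2
  exact (Submodule.isClosed_topologicalClosure _).mem_of_tendsto hlim
    (Eventually.of_forall hFm)

theorem RadialBound.rpow (δ : ℝ) : ∃ C : ℝ, 0 ≤ C ∧ RadialBound (fun x => x ^ δ) fun x => C * x ^ δ := by
  refine ⟨1 + |δ| + |δ * (δ - 1)|, by positivity, ?_, ?_, ?_, ?_⟩
  · exact fun x hx => Real.contDiffAt_rpow_const_of_ne hx.ne'
  all_goals
    intro x hx _
    have hp : 0 ≤ x ^ δ := Real.rpow_nonneg hx.le _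
    have hd : deriv (fun x : ℝ => x ^ δ) = fun x => δ * x ^ (δ - 1) := by
      funext t; exact Real.deriv_rpow_const ..
  · rw [abs_of_nonneg hp]
    nlinarith [abs_nonneg δ, abs_nonneg (δ * (δ - 1))]
  · rw [hd]
    have : x * (δ * x ^ (δ - 1)) = δ * x ^ δ := by
      rw [Real.rpow_sub hx, Real.rpow_one]; field_simp
    simp only [this, abs_mul, abs_of_nonneg hp]
    nlinarith [abs_nonneg δ, abs_nonneg (δ * (δ - 1)), mul_nonneg (abs_nonneg (δ * (δ - 1))) hp,
      abs_mul δ (δ - 1)]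
  · have : x ^ 2 * deriv (deriv (fun x : ℝ => x ^ δ)) x = δ * (δ - 1) * x ^ δ := by
      rw [hd, deriv_const_mul_field, Real.deriv_rpow_const, Real.rpow_sub hx, Real.rpow_sub hx,
        Real.rpow_one]
      field_simp
    rw [this, abs_mul, abs_of_nonneg hp]
    nlinarith [abs_nonneg δ, abs_nonneg (δ * (δ - 1)), mul_nonneg (abs_nonneg δ) hp]

/-- Bounds for the form-domain components of a product with a radial factor. -/
theorem jet_radial_bounds {k : ℝ → ℝ} {p : ℂ → ℂ} {C a b : ℝ} {z : ℂ} (hz : 0 < xr z)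
    (hk : ContDiffAt ℝ ∞ k (xr z)) (hp : ContDiffAt ℝ ∞ p z)
    (h0 : ‖p z‖ ≤ C) (h1 : ‖dz p z‖ ≤ C) (h2 : ‖db p z‖ ≤ C)
    (ha : |k (xr z)| ≤ a) (hb : |xr z * deriv k (xr z)| ≤ b) :
    ‖((k (xr z) : ℝ) : ℂ) * p z‖ ^ 2 ≤ C ^ 2 * a ^ 2 ∧
    ‖jet1 (fun z => ((k (xr z) : ℝ) : ℂ) * p z) z‖ ^ 2 ≤ 8 * C ^ 2 * (a ^ 2 + b ^ 2 / xr z) ∧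
    ‖jet2 (fun z => ((k (xr z) : ℝ) : ℂ) * p z) z‖ ^ 2 ≤ 4 * C ^ 2 * a ^ 2 := by
  have hC : 0 ≤ C := (norm_nonneg _).trans h0
  have ha0 : 0 ≤ a := (abs_nonneg _).trans ha
  have hb0 : 0 ≤ b := (abs_nonneg _).trans hb
  have hkd := differentiableAt_of_smooth (contDiffAt_radial hk)
  have hpd := differentiableAt_of_smooth hp
  have hk1 := hk.differentiableAt (by simp)
  have hzn : ‖z‖ ≤ 1 := (mem_ball_zero_iff.1 (mem_ball_iff_xr.2 hz)).le
  set x := xr z with hx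
  have hb' : |deriv k x| ≤ b / x := by
    rw [le_div_iff₀ hz, mul_comm]; rwa [abs_mul, abs_of_pos hz] at hb
  have hdz : dz (fun z => ((k (xr z) : ℝ) : ℂ) * p z) z
      = -((deriv k x : ℝ) : ℂ) * conj z * p z + k x * dz p z := by
    rw [dz_mul hkd hpd, dz_radial hk1]
  have hdb : db (fun z => ((k (xr z) : ℝ) : ℂ) * p z) z
      = -((deriv k x : ℝ) : ℂ) * z * p z + k x * db p z := by
    rw [db_mul hkd hpd, db_radial hk1]
  have t : |deriv k x| * ‖z‖ * ‖p z‖ ≤ b / x * C := by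
    have : |deriv k x| * ‖z‖ ≤ b / x := by
      calc _ ≤ |deriv k x| * 1 := mul_le_mul_of_nonneg_left hzn (abs_nonneg _)
        _ ≤ _ := by rw [mul_one]; exact hb'
    exact mul_le_mul this h0 (norm_nonneg _) (by positivity)
  have n1 : ‖dz (fun z => ((k (xr z) : ℝ) : ℂ) * p z) z‖ ≤ C * (a + b / x) := by
    rw [hdz]
    refine (norm_add_le _ _).trans ?_
    rw [norm_mul, norm_mul, norm_mul, norm_neg, Complex.norm_real, Complex.norm_real, RCLike.norm_conj,
      Real.norm_eq_abs, Real.norm_eq_abs]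
    have := mul_le_mul ha h1 (norm_nonneg _) ha0
    linarith
  have n2 : ‖db (fun z => ((k (xr z) : ℝ) : ℂ) * p z) z‖ ≤ C * (a + b / x) := by
    rw [hdb]
    refine (norm_add_le _ _).trans ?_
    rw [norm_mul, norm_mul, norm_mul, norm_neg, Complex.norm_real, Complex.norm_real,
      Real.norm_eq_abs, Real.norm_eq_abs]
    have := mul_le_mul ha h2 (norm_nonneg _) ha0
    linarith
  refine ⟨?_, ?_, ?_⟩
  · rw [norm_mul, Complex.norm_real, Real.norm_eq_abs, mul_pow, mul_comm]
    exact mul_le_mul (pow_le_pow_left₀ (norm_nonneg _) h0 2) (pow_le_pow_left₀ (abs_nonneg _) ha 2)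
      (sq_nonneg _) (sq_nonneg _)
  · refine (norm_jet1_sq_le hz).trans ?_
    have h3 : (‖dz (fun z => ((k (xr z) : ℝ) : ℂ) * p z) z‖
        + ‖db (fun z => ((k (xr z) : ℝ) : ℂ) * p z) z‖) ^ 2 ≤ (2 * (C * (a + b / x))) ^ 2 :=
      pow_le_pow_left₀ (by positivity) (by linarith) 2
    have h4 : (2 * (C * (a + b / x))) ^ 2 ≤ 8 * C ^ 2 * (a ^ 2 + (b / x) ^ 2) := by
      nlinarith [mul_nonneg (sq_nonneg C) (sq_nonneg (a - b / x))]
    have hx1 : x ≤ 1 := xr_le_one z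
    calc _ ≤ x * (8 * C ^ 2 * (a ^ 2 + (b / x) ^ 2)) := mul_le_mul_of_nonneg_left (h3.trans h4) hz.le
      _ = 8 * C ^ 2 * (x * a ^ 2 + b ^ 2 / x) := by
        field_simp
      _ ≤ _ := by
        refine mul_le_mul_of_nonneg_left ?_ (by positivity)
        nlinarith [sq_nonneg a]
  · have h3 : ‖z * dz (fun z => ((k (xr z) : ℝ) : ℂ) * p z) z
        - conj z * db (fun z => ((k (xr z) : ℝ) : ℂ) * p z) z‖ ≤ ‖z‖ * (2 * C * a) := by
      have e : z * dz (fun z => ((k (xr z) : ℝ) : ℂ) * p z) z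
        - conj z * db (fun z => ((k (xr z) : ℝ) : ℂ) * p z) z
        = k x * (z * dz p z - conj z * db p z) := by rw [hdz, hdb]; ring
      rw [e, norm_mul, Complex.norm_real, Real.norm_eq_abs]
      have e2 := norm_angular_le p z
      have e3 : ‖z‖ * (‖dz p z‖ + ‖db p z‖) ≤ ‖z‖ * (2 * C) :=
        mul_le_mul_of_nonneg_left (by linarith) (norm_nonneg _)
      calc _ ≤ a * (‖z‖ * (2 * C)) := mul_le_mul ha (e2.trans e3) (norm_nonneg _) ha0
        _ = _ := by ring
    refine (norm_jet2_sq_le (by positivity) h3).trans (le_of_eq ?_)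
    ring

/-- Smooth in the open disk, bounded together with its first order derivatives. -/
structure C1Bounded (p : ℂ → ℂ) (C : ℝ) : Prop where
  smooth : SmoothInt p
  b0 : ∀ z, 0 < xr z → ‖p z‖ ≤ C
  b1 : ∀ z, 0 < xr z → ‖dz p z‖ ≤ C
  b2 : ∀ z, 0 < xr z → ‖db p z‖ ≤ C

/-- After cutting off near the circle, the energy density is at most a constant times x^(2δ-1),
uniformly in the cutoff. This is integrable against x^γ precisely when 2δ + γ > 0. -/
theorem jet_rpow_mem {γ δ : ℝ} (hγ : -1 < γ) (hδ : 0 < 2 * δ + γ) {p : ℂ → ℂ} {C : ℝ}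
    (hp : C1Bounded p C) :
    JetL2 γ (fun z => ((xr z ^ δ : ℝ) : ℂ) * p z) ∧
      jet γ (fun z => ((xr z ^ δ : ℝ) : ℂ) * p z) ∈ formSpace γ := by
  obtain ⟨D, hD, hcut⟩ := exists_cutoff_bound
  obtain ⟨E, hE, hrp⟩ := RadialBound.rpow δ
  have hkb : ∀ n, RadialBound (fun x => x ^ δ * cutoff n x) fun x => 4 * (E * x ^ δ * D) :=
    fun n => hrp.mul (hcut n)
  set F : ℕ → ℂ → ℂ := fun n z => ((xr z ^ δ * cutoff n (xr z) : ℝ) : ℂ) * p z with hF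
  have hT : ∀ n, TestFunction (F n) := fun n => testFunction_cutoff hrp.smooth hp.smooth n
  have hev : ∀ z, 0 < xr z → ∀ᶠ n in atTop, F n =ᶠ[𝓝 z] fun z => ((xr z ^ δ : ℝ) : ℂ) * p z := by
    intro z hz
    filter_upwards [cutoff_eventually_one hz] with n hn
    filter_upwards [hn] with y hy
    simp [hF, hy]
  have hg : Integrable (fun z => 16 * C ^ 2 * (16 * E ^ 2 * D ^ 2) * xr z ^ (2 * δ - 1))
      (diskMeasure γ) := (integrable_rpow_diskMeasure (by linarith)).const_mul _
  have hbd : ∀ n z, 0 < xr z → ‖F n z‖ ^ 2 ≤ 16 * C ^ 2 * (16 * E ^ 2 * D ^ 2) * xr z ^ (2 * δ - 1) ∧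
      ‖jet1 (F n) z‖ ^ 2 ≤ 16 * C ^ 2 * (16 * E ^ 2 * D ^ 2) * xr z ^ (2 * δ - 1) ∧
      ‖jet2 (F n) z‖ ^ 2 ≤ 16 * C ^ 2 * (16 * E ^ 2 * D ^ 2) * xr z ^ (2 * δ - 1) := by
    intro n z hz
    obtain ⟨b0, b1, b2⟩ := jet_radial_bounds hz ((hkb n).smooth _ hz) (hp.smooth z hz) (hp.b0 z hz)
      (hp.b1 z hz) (hp.b2 z hz) ((hkb n).bound0 _ hz (xr_le_one z)) ((hkb n).bound1 _ hz (xr_le_one z))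
    have e1 : (4 * (E * xr z ^ δ * D)) ^ 2 = 16 * E ^ 2 * D ^ 2 * xr z ^ (2 * δ) := by
      rw [show 2 * δ = δ + δ by ring, Real.rpow_add hz]; ring
    have e2 : xr z ^ (2 * δ) / xr z = xr z ^ (2 * δ - 1) := by
      rw [Real.rpow_sub hz, Real.rpow_one]
    have e3 : xr z ^ (2 * δ) ≤ xr z ^ (2 * δ - 1) :=
      Real.rpow_le_rpow_of_exponent_ge hz (xr_le_one z) (by linarith)
    have e4 : (4 * (E * xr z ^ δ * D)) ^ 2 ≤ 16 * E ^ 2 * D ^ 2 * xr z ^ (2 * δ - 1) := by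
      rw [e1]; exact mul_le_mul_of_nonneg_left e3 (by positivity)
    have e5 : (4 * (E * xr z ^ δ * D)) ^ 2 / xr z = 16 * E ^ 2 * D ^ 2 * xr z ^ (2 * δ - 1) := by
      rw [e1, mul_div_assoc, e2]
    have hpos : 0 ≤ 16 * E ^ 2 * D ^ 2 * xr z ^ (2 * δ - 1) :=
      mul_nonneg (by positivity) (Real.rpow_nonneg hz.le _)
    have hpos2 := mul_nonneg (sq_nonneg C) hpos
    have e6 := mul_le_mul_of_nonneg_left e4 (sq_nonneg C)
    refine ⟨b0.trans ?_, b1.trans ?_, b2.trans ?_⟩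
    · nlinarith
    · rw [e5]; nlinarith
    · nlinarith
  refine jet_limit (fun n => (hT n).jetL2 hγ) (fun n => jet_mem_of_test hγ (hT n))
    ((smoothInt_rpow δ).mul hp.smooth) hg (fun n z hz => (hbd n z hz).1)
    (fun n z hz => (hbd n z hz).2.1) (fun n z hz => (hbd n z hz).2.2) ?_ ?_ ?_
  · intro z hz
    exact tendsto_const_nhds.congr' (by filter_upwards [hev z hz] with n hn using hn.eq_of_nhds.symm)
  · intro z hz
    exact tendsto_const_nhds.congr' (by filter_upwards [hev z hz] with n hn using (dz_congr hn).symm)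
  · intro z hz
    exact tendsto_const_nhds.congr' (by filter_upwards [hev z hz] with n hn using (db_congr hn).symm)

/-- The function has the bounded primitive (1 - log x)⁻¹, which tends to 0 at the origin. -/
theorem integrableOn_inv_mul_log : IntegrableOn (fun x : ℝ => x⁻¹ * ((1 - Real.log x)⁻¹) ^ 2)
    (Set.Ioo 0 1) := by
  have hlog : ∀ x : ℝ, 0 < x → x ≤ 1 → 0 < 1 - Real.log x := fun x h0 h1 => by
    linarith [Real.log_nonpos h0.le h1]
  -- With the convention log 0 = 0 the formula would take the value 1 at 0; the update installs the
  -- limit 0 and makes g continuous.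
  set g : ℝ → ℝ := Function.update (fun x => (1 - Real.log x)⁻¹) 0 0 with hg
  have h := intervalIntegral.integrableOn_deriv_of_nonneg (a := 0) (b := 1) (g := g)
    (g' := fun x : ℝ => x⁻¹ * ((1 - Real.log x)⁻¹) ^ 2) ?_ ?_ ?_
  · exact h.mono_set Set.Ioo_subset_Ioc_self
  · intro x hx
    by_cases h0 : x = 0
    · subst h0
      have : ContinuousWithinAt g (Set.Icc 0 1) 0 := by
        rw [hg, continuousWithinAt_update_same]
        have h1 : Tendsto (fun x : ℝ => 1 - Real.log x) (𝓝[>] 0) atTop :=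
          tendsto_atTop_add_const_left _ _ (tendsto_neg_atBot_atTop.comp Real.tendsto_log_nhdsGT_zero)
        have h2 := h1.inv_tendsto_atTop
        refine h2.mono_left (nhdsWithin_mono _ ?_)
        rintro y ⟨hy, hy0⟩
        exact lt_of_le_of_ne hy.1 (Ne.symm hy0)
      exact this
    · have hx0 : 0 < x := lt_of_le_of_ne hx.1 (Ne.symm h0)
      have : ContinuousAt g x := by
        rw [hg, continuousAt_update_of_ne h0]
        exact (continuousAt_const.sub (Real.continuousAt_log h0)).inv₀ (hlog x hx0 hx.2).ne'
      exact this.continuousWithinAt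
  · intro x hx
    have h1 : HasDerivAt (fun x => (1 - Real.log x)⁻¹) (x⁻¹ * ((1 - Real.log x)⁻¹) ^ 2) x := by
      have := ((Real.hasDerivAt_log hx.1.ne').const_sub 1).inv (hlog x hx.1 hx.2.le).ne'
      refine this.congr_deriv ?_
      field_simp
    refine h1.congr_of_eventuallyEq ?_
    filter_upwards [lt_mem_nhds hx.1] with y hy
    rw [hg, Function.update_of_ne hy.ne']
  · intro x hx
    have := hx.1
    positivity

/-- The borderline case δ = γ = 0, where `jet_rpow_mem` just fails. The functions x^ε p with ε =
1/(n+1) lie in the form space. Since ε x^ε ≤ (1 - log x)⁻¹ uniformly in ε, their energy densities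
have a common integrable bound. -/
theorem jet_zero_mem {p : ℂ → ℂ} {C : ℝ} (hp : C1Bounded p C) :
    JetL2 0 p ∧ jet 0 p ∈ formSpace 0 := by
  set F : ℕ → ℂ → ℂ := fun n z => ((xr z ^ ((n : ℝ) + 1)⁻¹ : ℝ) : ℂ) * p z with hF
  have hδ : ∀ n : ℕ, (0 : ℝ) < ((n : ℝ) + 1)⁻¹ := fun n => by positivity
  have hJ := fun n : ℕ => jet_rpow_mem (γ := 0) (δ := ((n : ℝ) + 1)⁻¹) (by norm_num)
    (by have := hδ n; linarith) hp
  set G : ℂ → ℝ := fun z => 16 * C ^ 2 * (1 + (xr z)⁻¹ * ((1 - Real.log (xr z))⁻¹) ^ 2) with hG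
  have hGi : Integrable G (diskMeasure 0) := by
    have := isFiniteMeasure_diskMeasure (γ := 0) (by norm_num)
    refine ((integrable_const (1 : ℝ)).add ?_).const_mul _
    rw [integrable_diskMeasure]
    simp only [Real.rpow_zero, one_smul]
    exact (integrableOn_radial (g := fun x : ℝ => x⁻¹ * ((1 - Real.log x)⁻¹) ^ 2)).2
      integrableOn_inv_mul_log
  have hbd : ∀ n z, 0 < xr z → ‖F n z‖ ^ 2 ≤ G z ∧ ‖jet1 (F n) z‖ ^ 2 ≤ G z ∧
      ‖jet2 (F n) z‖ ^ 2 ≤ G z := by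
    intro n z hz
    set ε := ((n : ℝ) + 1)⁻¹ with hε
    have hε0 : 0 < ε := hδ n
    have hε1 : ε ≤ 1 := inv_le_one_of_one_le₀ (by linarith [(Nat.cast_nonneg n : (0 : ℝ) ≤ n)])
    have hx1 := xr_le_one z
    have hlog : 0 < 1 - Real.log (xr z) := by linarith [Real.log_nonpos hz.le hx1]
    have hpow : 0 ≤ xr z ^ ε := Real.rpow_nonneg hz.le _
    have ha : |xr z ^ ε| ≤ 1 := by
      rw [abs_of_nonneg hpow]; exact Real.rpow_le_one hz.le hx1 hε0.le
    have hb : |xr z * deriv (fun x : ℝ => x ^ ε) (xr z)| ≤ (1 - Real.log (xr z))⁻¹ := by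
      have e1 : xr z * deriv (fun x : ℝ => x ^ ε) (xr z) = ε * xr z ^ ε := by
        rw [Real.deriv_rpow_const, Real.rpow_sub hz, Real.rpow_one]; field_simp
      rw [e1, abs_of_nonneg (mul_nonneg hε0.le hpow), le_inv_comm₀ (by positivity) hlog]
      have e2 : xr z ^ ε = Real.exp (ε * Real.log (xr z)) := by
        rw [Real.rpow_def_of_pos hz, mul_comm]
      have e3 : (ε * xr z ^ ε)⁻¹ = ε⁻¹ * Real.exp (-(ε * Real.log (xr z))) := by
        rw [mul_inv, e2, Real.exp_neg]
      rw [e3, ← div_eq_inv_mul, le_div_iff₀ hε0]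
      -- This gives ε⁻¹ x^(-ε) ≥ ε⁻¹ - log x ≥ 1 - log x, because ε ≤ 1.
      have e4 := Real.add_one_le_exp (-(ε * Real.log (xr z)))
      nlinarith
    obtain ⟨b0, b1, b2⟩ := jet_radial_bounds hz (Real.contDiffAt_rpow_const_of_ne hz.ne')
      (hp.smooth z hz) (hp.b0 z hz) (hp.b1 z hz) (hp.b2 z hz) ha hb
    have hq : 0 ≤ (xr z)⁻¹ * ((1 - Real.log (xr z))⁻¹) ^ 2 := by positivity
    have e5 : ((1 - Real.log (xr z))⁻¹) ^ 2 / xr z = (xr z)⁻¹ * ((1 - Real.log (xr z))⁻¹) ^ 2 := by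
      rw [div_eq_inv_mul]
    have hq2 := mul_nonneg (sq_nonneg C) hq
    refine ⟨b0.trans ?_, b1.trans ?_, b2.trans ?_⟩
    · rw [hG]; nlinarith [sq_nonneg C]
    · rw [hG, e5]; nlinarith [sq_nonneg C]
    · rw [hG]; nlinarith [sq_nonneg C]
  have hlimε : Tendsto (fun n : ℕ => ((n : ℝ) + 1)⁻¹) atTop (𝓝 0) :=
    (tendsto_atTop_add_const_right _ _ tendsto_natCast_atTop_atTop).inv_tendsto_atTop
  have hpw : ∀ z, 0 < xr z →
      Tendsto (fun n : ℕ => ((xr z ^ ((n : ℝ) + 1)⁻¹ : ℝ) : ℂ)) atTop (𝓝 1) := by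
    intro z hz
    have h1 : Tendsto (fun n : ℕ => xr z ^ ((n : ℝ) + 1)⁻¹) atTop (𝓝 (xr z ^ (0 : ℝ))) :=
      (Real.continuousAt_const_rpow hz.ne').tendsto.comp hlimε
    rw [Real.rpow_zero] at h1
    exact_mod_cast (Complex.continuous_ofReal.tendsto _).comp h1
  have hder : ∀ z, 0 < xr z → Tendsto
      (fun n : ℕ => ((deriv (fun x : ℝ => x ^ ((n : ℝ) + 1)⁻¹) (xr z) : ℝ) : ℂ)) atTop (𝓝 0) := by
    intro z hz
    have h1 : Tendsto (fun n : ℕ => ((n : ℝ) + 1)⁻¹ * xr z ^ (((n : ℝ) + 1)⁻¹ - 1)) atTop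
        (𝓝 (0 * xr z ^ ((0 : ℝ) - 1))) :=
      hlimε.mul ((Real.continuousAt_const_rpow hz.ne').tendsto.comp (hlimε.sub_const 1))
    rw [zero_mul] at h1
    have h2 := (Complex.continuous_ofReal.tendsto _).comp h1
    simp only [Complex.ofReal_zero] at h2
    refine h2.congr fun n => ?_
    simp only [Function.comp]
    rw [Real.deriv_rpow_const]
  refine jet_limit (F := F) (fun n => (hJ n).1) (fun n => (hJ n).2) hp.smooth hGi
    (fun n z hz => (hbd n z hz).1) (fun n z hz => (hbd n z hz).2.1) (fun n z hz => (hbd n z hz).2.2)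
    ?_ ?_ ?_
  · intro z hz
    simpa using (hpw z hz).mul_const (p z)
  · intro z hz
    have h1 : ∀ n : ℕ, dz (F n) z = -((deriv (fun x : ℝ => x ^ ((n : ℝ) + 1)⁻¹) (xr z) : ℝ) : ℂ)
        * conj z * p z + ((xr z ^ ((n : ℝ) + 1)⁻¹ : ℝ) : ℂ) * dz p z := by
      intro n
      have hk : ContDiffAt ℝ ∞ (fun x : ℝ => x ^ ((n : ℝ) + 1)⁻¹) (xr z) :=
        Real.contDiffAt_rpow_const_of_ne hz.ne'
      rw [hF, dz_mul (differentiableAt_of_smooth (contDiffAt_radial hk))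
        (differentiableAt_of_smooth (hp.smooth z hz)), dz_radial (hk.differentiableAt (by simp))]
    simp only [h1]
    simpa using (((hder z hz).neg.mul_const (conj z)).mul_const (p z)).add
      ((hpw z hz).mul_const (dz p z))
  · intro z hz
    have h1 : ∀ n : ℕ, db (F n) z = -((deriv (fun x : ℝ => x ^ ((n : ℝ) + 1)⁻¹) (xr z) : ℝ) : ℂ)
        * z * p z + ((xr z ^ ((n : ℝ) + 1)⁻¹ : ℝ) : ℂ) * db p z := by
      intro n
      have hk : ContDiffAt ℝ ∞ (fun x : ℝ => x ^ ((n : ℝ) + 1)⁻¹) (xr z) :=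
        Real.contDiffAt_rpow_const_of_ne hz.ne'
      rw [hF, db_mul (differentiableAt_of_smooth (contDiffAt_radial hk))
        (differentiableAt_of_smooth (hp.smooth z hz)), db_radial (hk.differentiableAt (by simp))]
    simp only [h1]
    simpa using (((hder z hz).neg.mul_const z).mul_const (p z)).add
      ((hpw z hz).mul_const (db p z))

/-- The exponent of the Friedrichs boundary behaviour `x^σ`. -/
abbrev sig (γ : ℝ) : ℝ := max (-γ) 0

/-- `x^σ p`. -/
def wt (γ : ℝ) (p : ℂ → ℂ) (z : ℂ) : ℂ := ((xr z ^ sig γ : ℝ) : ℂ) * p z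

/-- The factor x^σ, squared and integrated against x^γ, gives the weight x^|γ|. This is why both
signs of γ lead to the same estimates. -/
theorem add_two_sig (γ : ℝ) : γ + 2 * sig γ = |γ| := by
  rcases le_total 0 γ with h | h
  · rw [sig, max_eq_right (by linarith), abs_of_nonneg h]; ring
  · rw [sig, max_eq_left (by linarith), abs_of_nonpos h]; ring

/-- Nothing happens for γ ≥ 0, where σ = 0; for γ < 0 this is the intertwining by x^(-γ). Only |γ|
matters once the weight has been removed. -/
theorem keldysh_wt {γ : ℝ} {p : ℂ → ℂ} {z : ℂ} (hz : 0 < xr z) (hp : ContDiffAt ℝ ∞ p z) :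
    keldysh γ (wt γ p) z = wt γ (keldysh |γ| p) z := by
  rcases le_or_gt 0 γ with h | h
  · have hs : sig γ = 0 := by rw [sig, max_eq_right (by linarith)]
    have : wt γ p = p := by funext w; rw [wt, hs, Real.rpow_zero]; simp
    rw [this, wt, hs, Real.rpow_zero, abs_of_nonneg h]; simp
  · have hs : sig γ = -γ := by rw [sig, max_eq_left (by linarith)]
    have : wt γ p = fun w => ((xr w ^ (-γ) : ℝ) : ℂ) * p w := by funext w; rw [wt, hs]
    rw [this, keldysh_rpow_mul γ hz hp, wt, hs, abs_of_neg h]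

theorem memLp_wt {γ : ℝ} {p : ℂ → ℂ} {C : ℝ}
    (hp : ContinuousOn p (Metric.ball (0 : ℂ) 1)) (hb : ∀ z, 0 < xr z → ‖p z‖ ≤ C) :
    MemLp (wt γ p) 2 (diskMeasure γ) := by
  refine memLp_of_sq_le (g := fun z => C ^ 2 * xr z ^ (2 * sig γ)) ?_
    ((integrable_rpow_diskMeasure ?_).const_mul _) fun z hz => ?_
  · exact aestronglyMeasurable_of_continuousOn
      ((smoothInt_continuousOn (smoothInt_rpow _)).mul hp)
  · have h := add_two_sig γ
    have := abs_nonneg γ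
    linarith
  · rw [wt, norm_mul, mul_pow, Complex.norm_of_nonneg (Real.rpow_nonneg hz.le _), mul_comm,
      show 2 * sig γ = sig γ + sig γ by ring, Real.rpow_add hz, ← sq]
    exact mul_le_mul_of_nonneg_right (pow_le_pow_left₀ (norm_nonneg _) (hb z hz) 2) (sq_nonneg _)

/-- `x^σ p` belongs to the domain of the Friedrichs extension, with the expected image. -/
theorem wt_eq_dirichletInverse {γ : ℝ} (hγ : γ ∈ Set.Ioo (-1 : ℝ) 1) {p : ℂ → ℂ} {C : ℝ}
    (hp : C1Bounded p C) (hL : ∀ z, 0 < xr z → ‖keldysh |γ| p z‖ ≤ C) :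
    vec γ (wt γ p) = dirichletInverse γ (vec γ (wt γ (keldysh |γ| p))) := by
  have hj : JetL2 γ (wt γ p) ∧ jet γ (wt γ p) ∈ formSpace γ := by
    -- For γ ≠ 0 there is room, since 2σ + γ = |γ| > 0. The case γ = 0 needs the logarithmic
    -- argument.
    rcases eq_or_ne γ 0 with h0 | h0
    · subst h0
      have : wt 0 p = p := by funext w; simp [wt, sig]
      rw [this]
      exact jet_zero_mem hp
    · refine jet_rpow_mem hγ.1 ?_ hp
      have := abs_pos.2 h0
      have := add_two_sig γ
      linarith
  have hm := memLp_wt (γ := γ) (smoothInt_continuousOn (smoothInt_keldysh |γ| hp.smooth)) hL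
  have he : ∀ z, 0 < xr z → keldysh γ (wt γ p) z = wt γ (keldysh |γ| p) z :=
    fun z hz => keldysh_wt hz (hp.smooth z hz)
  rw [eq_dirichletInverse hγ.1 hj.1 hj.2 (memLp_congr hm he), vec_congr hm he]

/-! ### Monomials -/

/-- `z^a z̄^b`. -/
def zpw (a b : ℕ) (z : ℂ) : ℂ := z ^ a * conj z ^ b

theorem contDiff_zpw (a b : ℕ) : ContDiff ℝ ∞ (zpw a b) :=
  (contDiff_id.pow a).mul (contDiff_conj.pow b)

theorem dz_db_zpw (a b : ℕ) (z : ℂ) :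
    dz (zpw a b) z = a * zpw (a - 1) b z ∧ db (zpw a b) z = b * zpw a (b - 1) z := by
  have h1 : HasFDerivAt (fun z : ℂ => z ^ a * conj z ^ b) _ z :=
    ((hasFDerivAt_id (𝕜 := ℝ) z).pow a).mul ((hasFDerivAt_conj z).pow b)
  refine dz_db_of_hasFDerivAt h1 fun v => ?_
  simp [zpw]
  ring

theorem dz_zpw (a b : ℕ) : dz (zpw a b) = fun z => a * zpw (a - 1) b z :=
  funext fun z => (dz_db_zpw a b z).1

theorem db_zpw (a b : ℕ) : db (zpw a b) = fun z => b * zpw a (b - 1) z :=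
  funext fun z => (dz_db_zpw a b z).2

theorem differentiable_zpw (a b : ℕ) (z : ℂ) : DifferentiableAt ℝ (zpw a b) z :=
  (contDiff_zpw a b).contDiffAt.differentiableAt (by simp)

theorem nat_mul_pow_pred (a : ℕ) (z : ℂ) : z * ((a : ℂ) * z ^ (a - 1)) = a * z ^ a := by
  rcases a with _ | a
  · simp
  · simp [pow_succ]; ring

theorem euler_zpw (a b : ℕ) (z : ℂ) : euler (zpw a b) z = (a + b) * zpw a b z := by
  rw [euler, dz_zpw, db_zpw]
  simp only [zpw]
  linear_combination conj z ^ b * nat_mul_pow_pred a z + z ^ a * nat_mul_pow_pred b (conj z)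

/-- The degree is preserved by every term except -4∂∂̄, which lowers both exponents, so the operator
is triangular on monomials. Truncated subtraction is harmless because the coefficient ab vanishes
with a or b. -/
theorem keldysh_zpw (β : ℝ) (a b : ℕ) (z : ℂ) :
    keldysh β (zpw a b) z = (a + b + 1 + β) ^ 2 * zpw a b z
      - 4 * a * b * zpw (a - 1) (b - 1) z := by
  have hd := fun a b => differentiable_zpw a b z
  rw [keldysh_eq β (contDiff_zpw a b).contDiffAt, euler_zpw, dz_zpw, db_zpw, dz_const_mul _ (hd _ _),
    dz_const_mul _ (hd _ _), db_const_mul _ (hd _ _), dz_zpw, dz_zpw, db_zpw]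
  simp only [zpw]
  have e1 := nat_mul_pow_pred a z
  have e2 := nat_mul_pow_pred b (conj z)
  have e3 : z ^ 2 * ((a : ℂ) * (((a - 1 : ℕ) : ℂ) * z ^ (a - 1 - 1))) = a * (a - 1) * z ^ a := by
    rcases a with _ | a
    · simp
    · have := nat_mul_pow_pred a z
      simp only [Nat.add_sub_cancel] at this ⊢
      push_cast
      rw [pow_succ z a]
      linear_combination z * (a + 1) * this
  have e4 : conj z ^ 2 * ((b : ℂ) * (((b - 1 : ℕ) : ℂ) * conj z ^ (b - 1 - 1)))
      = b * (b - 1) * conj z ^ b := by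
    rcases b with _ | b
    · simp
    · have := nat_mul_pow_pred b (conj z)
      simp only [Nat.add_sub_cancel] at this ⊢
      push_cast
      rw [pow_succ (conj z) b]
      linear_combination conj z * (b + 1) * this
  linear_combination conj z ^ b * e3 + z ^ a * e4 + 2 * (z * ((a : ℂ) * z ^ (a - 1))) * e2
    + 2 * b * conj z ^ b * e1

/-- `x^i z^a z̄^b`. -/
def xzpw (i a b : ℕ) (z : ℂ) : ℂ := ((xr z ^ i : ℝ) : ℂ) * zpw a b z

theorem contDiff_xzpw (i a b : ℕ) : ContDiff ℝ ∞ (xzpw i a b) :=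
  (Complex.ofRealCLM.contDiff.comp (contDiff_xr.pow i)).mul (contDiff_zpw a b)

/-- The lower monomial is rewritten with 1 = x + |z|². Part of it cancels the large diagonal
coefficient, which becomes (a - b)² + O(a + b), and the remainder carries an extra factor x. This
gain is used in `exists_iterate_lift`. -/
theorem keldysh_xzpw (β : ℝ) (i a b : ℕ) (z : ℂ) :
    keldysh β (xzpw i a b) z = -4 * a * b * xzpw (i + 1) (a - 1) (b - 1) z
      + ((a + b + 1 + β) ^ 2 - 4 * a * b + 4 * i * (a + b) + 4 * i * (i - 1) + 4 * i
        + 4 * (1 + β) * i) * xzpw i a b z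
      - 4 * i * (i + β) * xzpw (i - 1) a b z := by
  have hk : ContDiffAt ℝ ∞ (fun t : ℝ => t ^ i) (xr z) := (contDiff_id.pow i).contDiffAt
  change keldysh β (fun z => (((fun t : ℝ => t ^ i) (xr z) : ℝ) : ℂ) * zpw a b z) z = _
  have d1 : deriv (fun t : ℝ => t ^ i) = fun t => (i : ℝ) * t ^ (i - 1) := by
    funext t; simp
  have d2 : deriv (deriv (fun t : ℝ => t ^ i)) (xr z) = (i : ℝ) * (((i - 1 : ℕ) : ℝ) * xr z ^ (i - 1 - 1)) := by
    rw [d1, deriv_const_mul_field]; simp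
  rw [keldysh_radial_mul β hk (contDiff_zpw a b).contDiffAt, d2, d1, keldysh_zpw, euler_zpw]
  have e1 : (xr z : ℂ) * ((i : ℂ) * (xr z : ℂ) ^ (i - 1)) = i * (xr z : ℂ) ^ i :=
    nat_mul_pow_pred i _
  have e2 : (xr z : ℂ) * ((i : ℂ) * (((i - 1 : ℕ) : ℂ) * (xr z : ℂ) ^ (i - 1 - 1)))
      = i * (i - 1) * (xr z : ℂ) ^ (i - 1) := by
    rcases i with _ | i
    · simp
    · have := nat_mul_pow_pred i (xr z : ℂ)
      simp only [Nat.add_sub_cancel] at this ⊢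
      push_cast
      linear_combination (i + 1) * this
  have e3 : (i : ℂ) * (i - 1) * ((xr z : ℂ) * (xr z : ℂ) ^ (i - 1)) = i * (i - 1) * (xr z : ℂ) ^ i := by
    linear_combination (i - 1) * e1
  have e4 : (4 : ℂ) * a * b * zpw (a - 1) (b - 1) z
      = 4 * a * b * xr z * zpw (a - 1) (b - 1) z + 4 * a * b * zpw a b z := by
    have h1 := nat_mul_pow_pred a z
    have h2 := nat_mul_pow_pred b (conj z)
    rw [xr_eq]
    simp only [zpw]
    linear_combination 4 * b * conj z ^ b * h1 + 4 * (z * ((a : ℂ) * z ^ (a - 1))) * h2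
  have hzz : z * conj z = 1 - xr z := by rw [xr_eq]; ring
  simp only [xzpw, hzz]
  push_cast
  rw [pow_succ]
  set X := (xr z : ℂ)
  set P := zpw a b z
  linear_combination (-X ^ i) * e4 + 4 * (a + b) * P * e1 - 4 * (1 - X) * P * e2
    + 4 * P * e1 + 4 * P * e3 + 4 * (1 + β) * P * e1

theorem bounded_of_contDiff {f : ℂ → ℂ} (hf : Continuous f) : ∃ C, ∀ z, 0 < xr z → ‖f z‖ ≤ C := by
  obtain ⟨C, hC⟩ := (isCompact_closedBall (0 : ℂ) 1).exists_bound_of_continuousOn hf.continuousOn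
  exact ⟨C, fun z hz => hC z (Metric.ball_subset_closedBall (mem_ball_iff_xr.2 hz))⟩

theorem contDiff_dz {f : ℂ → ℂ} (hf : ContDiff ℝ ∞ f) : ContDiff ℝ ∞ (dz f) :=
  contDiff_iff_contDiffAt.2 fun _ => contDiffAt_dz hf.contDiffAt

theorem contDiff_db {f : ℂ → ℂ} (hf : ContDiff ℝ ∞ f) : ContDiff ℝ ∞ (db f) :=
  contDiff_iff_contDiffAt.2 fun _ => contDiffAt_db hf.contDiffAt

theorem continuous_keldysh (β : ℝ) {f : ℂ → ℂ} (hf : ContDiff ℝ ∞ f) : Continuous (keldysh β f) := by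
  have h : keldysh β f = fun z => -4 * dz (db f) z + z ^ 2 * dz (dz f) z
      + 2 * z * conj z * dz (db f) z + conj z ^ 2 * db (db f) z
      + (3 + 2 * β) * (z * dz f z + conj z * db f z) + (β + 1) ^ 2 * f z := by
    funext z; exact keldysh_eq β hf.contDiffAt
  have h1 := (contDiff_dz (contDiff_db hf)).continuous
  have h2 := (contDiff_dz (contDiff_dz hf)).continuous
  have h3 := (contDiff_db (contDiff_db hf)).continuous
  have h4 := (contDiff_dz hf).continuous
  have h5 := (contDiff_db hf).continuous
  have h6 := hf.continuous
  have h7 := contDiff_conj.continuous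
  rw [h]
  fun_prop

theorem memLp_wt_of_continuous {γ : ℝ} {p : ℂ → ℂ} (hp : Continuous p) :
    MemLp (wt γ p) 2 (diskMeasure γ) := by
  obtain ⟨C, hC⟩ := bounded_of_contDiff hp
  exact memLp_wt hp.continuousOn hC

theorem wt_eq_dirichletInverse_of_contDiff {γ : ℝ} (hγ : γ ∈ Set.Ioo (-1 : ℝ) 1) {p : ℂ → ℂ}
    (hp : ContDiff ℝ ∞ p) :
    vec γ (wt γ p) = dirichletInverse γ (vec γ (wt γ (keldysh |γ| p))) := by
  obtain ⟨C0, h0⟩ := bounded_of_contDiff hp.continuous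
  obtain ⟨C1, h1⟩ := bounded_of_contDiff (contDiff_dz hp).continuous
  obtain ⟨C2, h2⟩ := bounded_of_contDiff (contDiff_db hp).continuous
  obtain ⟨C3, h3⟩ := bounded_of_contDiff (continuous_keldysh |γ| hp)
  have hz : 0 < xr 0 := by simp [xr]
  have p0 := (norm_nonneg _).trans (h0 0 hz)
  have p1 := (norm_nonneg _).trans (h1 0 hz)
  have p2 := (norm_nonneg _).trans (h2 0 hz)
  have p3 := (norm_nonneg _).trans (h3 0 hz)
  refine wt_eq_dirichletInverse hγ (C := C0 + C1 + C2 + C3) ⟨smoothInt_of_contDiff hp, ?_, ?_, ?_⟩ ?_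
  · exact fun z hz => (h0 z hz).trans (by linarith)
  · exact fun z hz => (h1 z hz).trans (by linarith)
  · exact fun z hz => (h2 z hz).trans (by linarith)
  · exact fun z hz => (h3 z hz).trans (by linarith)

theorem vec_wt_add {γ : ℝ} {p q : ℂ → ℂ} (hp : Continuous p) (hq : Continuous q) :
    vec γ (wt γ fun z => p z + q z) = vec γ (wt γ p) + vec γ (wt γ q) := by
  rw [← vec_add (memLp_wt_of_continuous hp) (memLp_wt_of_continuous hq)]
  congr 1; funext z; simp only [wt]; ring

theorem vec_wt_const_mul {γ : ℝ} (c : ℂ) {p : ℂ → ℂ} (hp : Continuous p) :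
    vec γ (wt γ fun z => c * p z) = c • vec γ (wt γ p) := by
  rw [← vec_const_mul c (memLp_wt_of_continuous hp)]
  congr 1; funext z; simp only [wt]; ring

theorem norm_vec_wt_le {γ : ℝ} {p : ℂ → ℂ} {ε : ℝ} (hp : ContinuousOn p (Metric.ball (0 : ℂ) 1))
    (h : ∀ z, 0 < xr z → ‖p z‖ ≤ ε) :
    ‖vec γ (wt γ p)‖ ^ 2 ≤ ε ^ 2 * ∫ z, xr z ^ (2 * sig γ) ∂diskMeasure γ := by
  rw [← integral_const_mul]
  refine norm_sq_vec_le (memLp_wt hp h) ((integrable_rpow_diskMeasure ?_).const_mul _) fun z hz => ?_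
  · have h := add_two_sig γ
    have := abs_nonneg γ
    linarith
  · rw [wt, norm_mul, mul_pow, Complex.norm_of_nonneg (Real.rpow_nonneg hz.le _), mul_comm,
      show 2 * sig γ = sig γ + sig γ by ring, Real.rpow_add hz, ← sq]
    exact mul_le_mul_of_nonneg_right (pow_le_pow_left₀ (norm_nonneg _) (h z hz) 2) (sq_nonneg _)

/-- The closed linear span of the monomials, weighted with `x^σ`. -/
def monoSpan (γ : ℝ) : Submodule ℂ (L2 γ) :=
  (Submodule.span ℂ (Set.range fun q : ℕ × ℕ => vec γ (wt γ (zpw q.1 q.2)))).topologicalClosure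

theorem isClosed_monoSpan (γ : ℝ) : IsClosed (monoSpan γ : Set (L2 γ)) :=
  Submodule.isClosed_topologicalClosure _

/-- Uniform approximation in the disk implies approximation in L²_γ after multiplication by x^σ,
since x^(2σ+γ) = x^|γ| is integrable. -/
theorem tendsto_vec_wt_of_uniform {γ : ℝ} {p : ℂ → ℂ} {S : Submodule ℂ (L2 γ)}
    (hS : IsClosed (S : Set (L2 γ))) (hp : Continuous p)
    (h : ∀ ε > 0, ∃ q : ℂ → ℂ, Continuous q ∧ vec γ (wt γ q) ∈ S ∧ ∀ z, 0 < xr z → ‖q z - p z‖ ≤ ε) :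
    vec γ (wt γ p) ∈ S := by
  set I := ∫ z, xr z ^ (2 * sig γ) ∂diskMeasure γ
  have hI : 0 ≤ I := integral_nonneg_of_ae (by
    filter_upwards [ae_mem_ball γ] with z hz using Real.rpow_nonneg hz.le _)
  rw [← SetLike.mem_coe, ← hS.closure_eq, Metric.mem_closure_iff]
  intro ε hε
  obtain ⟨q, hq, hqS, hqp⟩ := h (ε / (2 * (1 + I))) (by positivity)
  refine ⟨_, hqS, ?_⟩
  have h1 := norm_vec_wt_le (γ := γ) (hq.sub hp).continuousOn hqp
  have h2 : vec γ (wt γ (q - p)) = vec γ (wt γ q) - vec γ (wt γ p) := by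
    rw [← vec_sub (memLp_wt_of_continuous hq) (memLp_wt_of_continuous hp)]
    congr 1; funext z; simp only [wt, Pi.sub_apply]; ring
  rw [dist_comm, dist_eq_norm, ← h2]
  refine lt_of_pow_lt_pow_left₀ 2 hε.le (h1.trans_lt ?_)
  rw [div_pow, mul_pow, div_mul_eq_mul_div, div_lt_iff₀ (by positivity)]
  have : I < 2 ^ 2 * (1 + I) ^ 2 := by nlinarith
  exact mul_lt_mul_of_pos_left this (by positivity)

/-- Stone-Weierstrass on the closed disk: the star algebra generated by z is spanned by the
monomials z^a z̄^b. -/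
theorem vec_wt_mem_monoSpan {γ : ℝ} {p : ℂ → ℂ} (hp : Continuous p) :
    vec γ (wt γ p) ∈ monoSpan γ := by
  refine tendsto_vec_wt_of_uniform (isClosed_monoSpan γ) hp fun ε hε => ?_
  let D : Set ℂ := Metric.closedBall 0 1
  have : CompactSpace D := isCompact_iff_compactSpace.1 (isCompact_closedBall 0 1)
  let f : C(D, ℂ) := ⟨fun z => p z, hp.comp continuous_subtype_val⟩
  have hf : f ∈ (polynomialFunctions D).starClosure.topologicalClosure := by
    rw [polynomialFunctions.starClosure_topologicalClosure]; trivial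
  rw [← SetLike.mem_coe, StarSubalgebra.topologicalClosure_coe, Metric.mem_closure_iff] at hf
  obtain ⟨g, hg, hfg⟩ := hf ε hε
  have key : ∃ q : ℂ → ℂ, Continuous q ∧ vec γ (wt γ q) ∈ monoSpan γ ∧ ∀ z : D, q z = g z := by
    clear hfg
    rw [polynomialFunctions.starClosure_eq_adjoin_X, SetLike.mem_coe,
      ← StarSubalgebra.mem_toSubalgebra, StarAlgebra.adjoin_toSubalgebra, ← Subalgebra.mem_toSubmodule,
      Algebra.adjoin_eq_span] at hg
    induction hg using Submodule.span_induction with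
    | mem g hg =>
      rw [Set.star_singleton, Set.singleton_union, SetLike.mem_coe, Submonoid.mem_closure_pair] at hg
      obtain ⟨m, n, rfl⟩ := hg
      refine ⟨zpw m n, (contDiff_zpw m n).continuous,
        Submodule.le_topologicalClosure _ (Submodule.subset_span ⟨(m, n), rfl⟩), fun z => ?_⟩
      simp [zpw]
    | zero =>
      refine ⟨fun _ => 0, continuous_const, ?_, fun z => rfl⟩
      have : vec γ (wt γ fun _ => 0) = 0 := by
        have := vec_wt_const_mul (γ := γ) 0 (continuous_const (y := (0 : ℂ)) (X := ℂ))
        simpa using this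
      rw [this]; exact Submodule.zero_mem _
    | add g h _ _ hg hh =>
      obtain ⟨q, hq, hqS, hqg⟩ := hg
      obtain ⟨r, hr, hrS, hrg⟩ := hh
      refine ⟨fun z => q z + r z, hq.add hr, ?_, fun z => by simp [hqg, hrg]⟩
      rw [vec_wt_add hq hr]; exact Submodule.add_mem _ hqS hrS
    | smul c g _ hg =>
      obtain ⟨q, hq, hqS, hqg⟩ := hg
      refine ⟨fun z => c * q z, hq.const_mul c, ?_, fun z => by simp [hqg]⟩
      rw [vec_wt_const_mul c hq]; exact Submodule.smul_mem _ _ hqS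
  obtain ⟨q, hq, hqS, hqg⟩ := key
  refine ⟨q, hq, hqS, fun z hz => ?_⟩
  have hzD : z ∈ D := Metric.ball_subset_closedBall (mem_ball_iff_xr.2 hz)
  have h1 := (ContinuousMap.dist_apply_le_dist (f := f) (g := g) ⟨z, hzD⟩).trans hfg.le
  rw [dist_comm, dist_eq_norm] at h1
  rw [hqg ⟨z, hzD⟩]
  exact h1

/-- Bounded continuous functions are dense. Such a function, cut off near the circle, can be divided
by x^σ and is then x^σ times a continuous function. -/
theorem monoSpan_eq_top {γ : ℝ} (hγ : -1 < γ) : monoSpan γ = ⊤ := by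
  have := isFiniteMeasure_diskMeasure hγ
  have hd := BoundedContinuousFunction.toLp_denseRange (p := 2) (α := ℂ) (E := ℂ) (μ := diskMeasure γ) ℂ
    (by simp)
  rw [← SetLike.coe_set_eq, Submodule.top_coe, ← (isClosed_monoSpan γ).closure_eq]
  refine Set.eq_univ_of_univ_subset ?_
  rw [← hd.closure_range]
  refine closure_minimal ?_ isClosed_closure
  rintro _ ⟨G, rfl⟩
  rw [(isClosed_monoSpan γ).closure_eq]
  obtain ⟨D, hD, hcut⟩ := exists_cutoff_bound
  have hsm : ∀ x : ℝ, 0 < x → ContDiffAt ℝ ∞ (fun x : ℝ => x ^ (-sig γ)) x :=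
    fun x hx => Real.contDiffAt_rpow_const_of_ne hx.ne'
  set p : ℕ → ℂ → ℂ := fun n z => (((xr z ^ (-sig γ) * cutoff n (xr z) : ℝ) : ℂ) * 1) * G z
  have hpc : ∀ n, Continuous (p n) := fun n =>
    ((testFunction_cutoff hsm (smoothInt_of_contDiff contDiff_const) n).1.continuous).mul
      G.continuous
  have heq : ∀ n z, 0 < xr z → wt γ (p n) z = (cutoff n (xr z) : ℝ) * G z := by
    intro n z hz
    have : xr z ^ sig γ * xr z ^ (-sig γ) = 1 := by
      rw [← Real.rpow_add hz, add_neg_cancel, Real.rpow_zero]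
    have hc : ((xr z ^ sig γ : ℝ) : ℂ) * ((xr z ^ (-sig γ) : ℝ) : ℂ) = 1 := by exact_mod_cast this
    simp only [wt, p]
    push_cast at hc ⊢
    linear_combination (cutoff n (xr z) : ℂ) * G z * hc
  have hlim := tendsto_vec (γ := γ) (F := fun n => wt γ (p n)) (f := G)
    (g := fun _ => (D * ‖G‖) ^ 2)
    (fun n => (memLp_wt_of_continuous (hpc n)).1) (integrable_const _) (fun n z hz => by
      rw [heq n z hz, norm_mul, Complex.norm_real]
      refine pow_le_pow_left₀ (by positivity) ?_ 2
      exact mul_le_mul ((hcut n).bound0 _ hz (xr_le_one z)) (G.norm_coe_le_norm z) (norm_nonneg _) hD)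
    (fun z hz _ => tendsto_const_nhds.congr' (by
      filter_upwards [cutoff_eventually_one hz] with n hn
      rw [heq n z hz, hn.self_of_nhds]; simp))
  have hG : vec γ G = BoundedContinuousFunction.toLp 2 (diskMeasure γ) ℂ G :=
    vec_eq (BoundedContinuousFunction.coeFn_toLp ..)
  have hmem := (isClosed_monoSpan γ).mem_of_tendsto hlim.2
    (Eventually.of_forall fun n => vec_wt_mem_monoSpan (hpc n))
  rw [hG] at hmem
  exact hmem

/-! ### Functional calculus on eigenvectors -/

/-- The functions g with g(A)e = g(μ)e form a closed algebra containing constants and the identity,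
hence all continuous functions on the spectrum, to which μ belongs. -/
theorem cfc_eigenvector {H : Type*} [NormedAddCommGroup H] [InnerProductSpace ℂ H] [CompleteSpace H]
    {A : H →L[ℂ] H} (hA : IsSelfAdjoint A) {μ : ℝ} {e : H} (he : A e = (μ : ℂ) • e) (h0 : e ≠ 0)
    {f : ℝ → ℝ} (hf : ContinuousOn f (spectrum ℝ A)) : cfc f A e = (f μ : ℂ) • e := by
  -- A left inverse of μ - A would send (μ - A)e = 0 to e, against e ≠ 0.
  have hμ : μ ∈ spectrum ℝ A := by
    intro hu
    refine h0 ?_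
    obtain ⟨B, hB⟩ := hu.exists_left_inv
    have h1 : (algebraMap ℝ (H →L[ℂ] H) μ - A) e = 0 := by
      rw [sub_apply, he, Algebra.algebraMap_eq_smul_one]
      simp
    have h2 := congrArg (fun T : H →L[ℂ] H => T e) hB
    simpa [h1] using h2.symm
  have hc : CompactSpace (spectrum ℝ A) := isCompact_iff_compactSpace.1 (spectrum.isCompact A)
  have key : ∀ g : C(spectrum ℝ A, ℝ), cfcHom hA g e = (g ⟨μ, hμ⟩ : ℂ) • e := by
    intro g
    refine ContinuousMap.induction_on_of_compact (p := fun g : C(spectrum ℝ A, ℝ) =>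
      cfcHom hA g e = (g ⟨μ, hμ⟩ : ℂ) • e) ?_ ?_ ?_ ?_ ?_ ?_ g
    · intro r
      have : ContinuousMap.const (spectrum ℝ A) r = algebraMap ℝ C(spectrum ℝ A, ℝ) r := rfl
      rw [this, AlgHomClass.commutes (cfcHom hA), Algebra.algebraMap_eq_smul_one]
      simp
    · rw [cfcHom_id hA]; simpa using he
    · rw [star_trivial, cfcHom_id hA]; simpa using he
    · intro f g hf hg
      rw [map_add, add_apply, hf, hg, ← add_smul]; simp
    · intro f g hf hg
      rw [map_mul, mul_apply_eq_comp, hg, map_smul, hf, smul_smul]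
      simp [mul_comm]
    · intro f hfr
      have hcl : IsClosed {g : C(spectrum ℝ A, ℝ) | cfcHom hA g e = (g ⟨μ, hμ⟩ : ℂ) • e} := by
        refine isClosed_eq ?_ ?_
        · exact (ContinuousLinearMap.apply ℂ H e).continuous.comp (cfcHom_continuous hA)
        · exact (Complex.continuous_ofReal.comp (continuous_eval_const _)).smul continuous_const
      exact hcl.closure_subset (mem_closure_iff_frequently.2 hfr)
  rw [cfc_apply f A hA hf, key]
  rfl

theorem dirichletInverse_nonneg (γ : ℝ) : 0 ≤ dirichletInverse γ :=
  (ContinuousLinearMap.nonneg_iff_isPositive _).2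
    (ContinuousLinearMap.isPositive_self_comp_adjoint _)

theorem dirichletInverse_inner (γ : ℝ) (u v : L2 γ) :
    ⟪dirichletInverse γ u, v⟫_ℂ = ⟪u, dirichletInverse γ v⟫_ℂ :=
  ((ContinuousLinearMap.isPositive_self_comp_adjoint (formInclusion γ)).isSymmetric) u v

theorem opPow_eigenvector {H : Type*} [NormedAddCommGroup H] [InnerProductSpace ℂ H]
    [CompleteSpace H] {A : H →L[ℂ] H} (hA : 0 ≤ A) {μ r : ℝ} (hr : 0 ≤ r) {e : H}
    (he : A e = (μ : ℂ) • e) (h0 : e ≠ 0) : opPow A r e = ((μ ^ r : ℝ) : ℂ) • e := by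
  have h := CFC.rpow_eq_cfc_real (y := r) hA
  rw [← CFC.rpow_eq_pow] at h
  rw [opPow, h]
  exact cfc_eigenvector (IsSelfAdjoint.of_nonneg hA) he h0
    (Real.continuous_rpow_const hr).continuousOn

theorem opPow_one {H : Type*} [NormedAddCommGroup H] [InnerProductSpace ℂ H]
    [CompleteSpace H] {A : H →L[ℂ] H} (hA : 0 ≤ A) : opPow A 1 = A := CFC.rpow_one _ hA

theorem dirichletNegPow_eigenvector {γ s μ : ℝ} (hs : 0 < s) {e : L2 γ} (h0 : e ≠ 0)
    (he : dirichletInverse γ e = (μ : ℂ) • e) :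
    dirichletNegPow γ s e = ((μ ^ (s / 2) : ℝ) : ℂ) • e :=
  opPow_eigenvector (dirichletInverse_nonneg γ) (by positivity) he h0

theorem dirichletNegPow_two (γ : ℝ) : dirichletNegPow γ 2 = dirichletInverse γ := by
  rw [dirichletNegPow, div_self two_ne_zero, opPow_one (dirichletInverse_nonneg γ)]

theorem dirichletSobolev_two (γ : ℝ) : dirichletSobolev γ 2 = dirichletDomain γ := by
  ext u
  rw [dirichletSobolev, dirichletNegPow_two, dirichletDomain, Submodule.mem_map]
  constructor
  · rintro ⟨v, rfl⟩
    exact ⟨(_, v), (mem_dirichletGraph_iff γ _ v).2 rfl, rfl⟩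
  · rintro ⟨⟨a, b⟩, h, rfl⟩
    exact ⟨b, ((mem_dirichletGraph_iff γ a b).1 h).symm⟩

/-! ### Eigenvectors -/

/-- `z^{m₊ + j} z̄^{m₋ + j}`, `m` the Fourier mode. -/
def mono (m : ℤ) (j : ℕ) : ℂ → ℂ := zpw (m.toNat + j) ((-m).toNat + j)

/-- The vector `x^σ z^{m₊ + j} z̄^{m₋ + j}`. -/
def monoVec (γ : ℝ) (m : ℤ) (j : ℕ) : L2 γ := vec γ (wt γ (mono m j))

/-- The eigenvalues of `L_{γ,D}`. -/
def lam (γ : ℝ) (m : ℤ) (j : ℕ) : ℝ := (|(m : ℝ)| + 2 * j + 1 + |γ|) ^ 2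

/-- The coefficient of `mono m (j - 1)` in `L (mono m j)`. -/
def dco (m : ℤ) (j : ℕ) : ℝ := 4 * j * (j + |(m : ℝ)|)

theorem contDiff_mono (m : ℤ) (j : ℕ) : ContDiff ℝ ∞ (mono m j) := contDiff_zpw _ _

theorem toNat_add (m : ℤ) : ((m.toNat : ℕ) : ℝ) + (((-m).toNat : ℕ) : ℝ) = |(m : ℝ)| := by
  have h : ((m.toNat : ℕ) : ℤ) + (((-m).toNat : ℕ) : ℤ) = |m| := by
    have := Int.toNat_add_toNat_neg_eq_natAbs m; rw [← Int.natCast_natAbs]; exact_mod_cast this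
  exact_mod_cast h

theorem toNat_mul (m : ℤ) : ((m.toNat : ℕ) : ℝ) * (((-m).toNat : ℕ) : ℝ) = 0 := by
  rcases le_total 0 m with h | h
  · simp [Int.toNat_of_nonpos (show -m ≤ 0 by omega)]
  · simp [Int.toNat_of_nonpos h]

/-- Since m₊ m₋ = 0 and m₊ + m₋ = |m|, the product (m₊ + j)(m₋ + j) equals j(j + |m|). -/
theorem keldysh_mono_eq (β : ℝ) (m : ℤ) (j : ℕ) (z : ℂ) :
    keldysh β (mono m j) z = (((|(m : ℝ)| + 2 * j + 1 + β) ^ 2 : ℝ) : ℂ) * mono m j z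
      - (dco m j : ℂ) * mono m (j - 1) z := by
  have h1 : ((m.toNat : ℕ) : ℂ) + (((-m).toNat : ℕ) : ℂ) = ((|(m : ℝ)| : ℝ) : ℂ) := by
    exact_mod_cast congrArg (fun r : ℝ => (r : ℂ)) (toNat_add m)
  have h2 : ((m.toNat : ℕ) : ℂ) * (((-m).toNat : ℕ) : ℂ) = 0 := by
    exact_mod_cast congrArg (fun r : ℝ => (r : ℂ)) (toNat_mul m)
  rw [mono, keldysh_zpw, dco]
  rcases j with _ | j
  · push_cast
    simp only [mono]
    rw [← h1]
    linear_combination (-4) * zpw (m.toNat + 0 - 1) ((-m).toNat + 0 - 1) z * h2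
  · have e1 : m.toNat + (j + 1) - 1 = m.toNat + j := by omega
    have e2 : (-m).toNat + (j + 1) - 1 = (-m).toNat + j := by omega
    rw [e1, e2]
    push_cast
    simp only [mono]
    rw [← h1]
    linear_combination (-4) * zpw (m.toNat + j) ((-m).toNat + j) z * h2

theorem keldysh_mono (γ : ℝ) (m : ℤ) (j : ℕ) (z : ℂ) :
    keldysh |γ| (mono m j) z = (lam γ m j : ℂ) * mono m j z - (dco m j : ℂ) * mono m (j - 1) z :=
  keldysh_mono_eq |γ| m j z

theorem lam_pos (γ : ℝ) (m : ℤ) (j : ℕ) : 0 < lam γ m j := by rw [lam]; positivity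

theorem lam_strictMono (γ : ℝ) (m : ℤ) : StrictMono (lam γ m) := by
  intro i j hij
  have : (i : ℝ) < j := by exact_mod_cast hij
  rw [lam, lam]
  exact pow_lt_pow_left₀ (by linarith) (by positivity) two_ne_zero

/-- The vector `L M`, for `M = monoVec γ m j`. -/
def lmonoVec (γ : ℝ) (m : ℤ) (j : ℕ) : L2 γ :=
  (lam γ m j : ℂ) • monoVec γ m j - (dco m j : ℂ) • monoVec γ m (j - 1)

theorem vec_wt_keldysh_mono (γ : ℝ) (m : ℤ) (j : ℕ) :
    vec γ (wt γ (keldysh |γ| (mono m j))) = lmonoVec γ m j := by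
  have h : keldysh |γ| (mono m j) =
      fun z => (lam γ m j : ℂ) * mono m j z + (-(dco m j : ℂ)) * mono m (j - 1) z := by
    funext z; rw [keldysh_mono]; ring
  have c1 := (contDiff_mono m j).continuous
  have c2 := (contDiff_mono m (j - 1)).continuous
  rw [h, vec_wt_add (c1.const_mul _) (c2.const_mul _), vec_wt_const_mul _ c1, vec_wt_const_mul _ c2,
    neg_smul, ← sub_eq_add_neg]
  rfl

theorem dirichletInverse_lmonoVec {γ : ℝ} (hγ : γ ∈ Set.Ioo (-1 : ℝ) 1) (m : ℤ) (j : ℕ) :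
    dirichletInverse γ (lmonoVec γ m j) = monoVec γ m j := by
  rw [← vec_wt_keldysh_mono]
  exact (wt_eq_dirichletInverse_of_contDiff hγ (contDiff_mono m j)).symm

/-- Coefficients of the eigenvectors, from the top degree downwards. -/
def gco (γ : ℝ) (m : ℤ) (k : ℕ) : ℕ → ℝ
  | 0 => 1
  | i + 1 => -gco γ m k i * dco m (k - i) / (lam γ m k - lam γ m (k - i - 1))

/-- An eigenvector of `L_{γ,D}` for the eigenvalue `lam γ m k`. -/
def ev (γ : ℝ) (m : ℤ) (k : ℕ) : L2 γ :=
  ∑ i ∈ Finset.range (k + 1), (gco γ m k i : ℂ) • monoVec γ m (k - i)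

/-- The triangular eigenvalue equation is solved from the top degree downwards. Division by λ_k -
λ_{k-i-1} is possible because the eigenvalues of a mode increase strictly, and the recursion closes
since `dco m 0` = 0. -/
theorem sum_lmonoVec (γ : ℝ) (m : ℤ) (k : ℕ) :
    ∑ i ∈ Finset.range (k + 1), (gco γ m k i : ℂ) • lmonoVec γ m (k - i)
      = (lam γ m k : ℂ) • ev γ m k := by
  have h0 : dco m 0 = 0 := by simp [dco]
  simp only [lmonoVec, smul_sub, Finset.sum_sub_distrib, ev, Finset.smul_sum]
  rw [Finset.sum_range_succ' (fun i => (gco γ m k i : ℂ) • (lam γ m (k - i) : ℂ) • monoVec γ m (k - i)),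
    Finset.sum_range_succ' (fun i => (lam γ m k : ℂ) • (gco γ m k i : ℂ) • monoVec γ m (k - i)),
    Finset.sum_range_succ (fun i => (gco γ m k i : ℂ) • (dco m (k - i) : ℂ) • monoVec γ m (k - i - 1))]
  simp only [Nat.sub_self, h0, Complex.ofReal_zero, zero_smul, smul_zero, add_zero, Nat.sub_zero]
  rw [add_sub_right_comm, ← Finset.sum_sub_distrib]
  congr 1
  · refine Finset.sum_congr rfl fun i hi => ?_
    have hi := Finset.mem_range.1 hi
    have hne : lam γ m k - lam γ m (k - i - 1) ≠ 0 :=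
      (sub_pos.2 (lam_strictMono γ m (by omega))).ne'
    have hg : gco γ m k (i + 1) * lam γ m (k - i - 1) - gco γ m k i * dco m (k - i)
        = lam γ m k * gco γ m k (i + 1) := by
      rw [gco]; field_simp; ring
    have hg' := congrArg (fun r : ℝ => (r : ℂ)) hg
    push_cast at hg'
    rw [show k - (i + 1) = k - i - 1 by omega, smul_smul, smul_smul, smul_smul, ← sub_smul, hg']
  · rw [smul_comm]

theorem dirichletInverse_ev {γ : ℝ} (hγ : γ ∈ Set.Ioo (-1 : ℝ) 1) (m : ℤ) (k : ℕ) :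
    dirichletInverse γ (ev γ m k) = (((lam γ m k)⁻¹ : ℝ) : ℂ) • ev γ m k := by
  have h := congrArg (dirichletInverse γ) (sum_lmonoVec γ m k)
  simp only [map_sum, map_smul, dirichletInverse_lmonoVec hγ] at h
  have hl : (lam γ m k : ℂ) ≠ 0 := by exact_mod_cast (lam_pos γ m k).ne'
  rw [← smul_right_injective _ hl |>.eq_iff, ← h, smul_smul]
  push_cast
  rw [mul_inv_cancel₀ hl, one_smul]
  rfl

theorem eq_zero_of_vec_eq_zero {γ : ℝ} {p : ℂ → ℂ} (hp : Continuous p) (h : vec γ (wt γ p) = 0)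
    {z : ℂ} (hz : 0 < xr z) : p z = 0 := by
  have h1 := vec_ae (memLp_wt_of_continuous (γ := γ) hp)
  rw [h] at h1
  have h2 : ∀ᵐ z ∂diskMeasure γ, p z = 0 := by
    filter_upwards [h1, Lp.coeFn_zero ℂ 2 (diskMeasure γ), ae_mem_ball γ] with z h1 h2 hz
    rw [h2] at h1
    have : (xr z ^ sig γ : ℝ) ≠ 0 := (Real.rpow_pos_of_pos hz _).ne'
    simpa [wt, this] using h1.symm
  rw [diskMeasure, ae_withDensity_iff (measurable_density γ)] at h2
  have h3 : p =ᵐ[volume.restrict (Metric.ball (0 : ℂ) 1)] 0 := by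
    filter_upwards [h2, ae_restrict_mem Metric.isOpen_ball.measurableSet] with z hz hzb
    refine hz ?_
    have := Real.rpow_pos_of_pos (mem_ball_iff_xr.1 hzb) γ
    rw [Ne, ENNReal.ofReal_eq_zero, not_le]
    exact this
  exact Measure.eqOn_open_of_ae_eq h3 Metric.isOpen_ball hp.continuousOn continuousOn_const
    (mem_ball_iff_xr.2 hz)

theorem mono_real (m : ℤ) (j : ℕ) (r : ℝ) :
    mono m j r = (r : ℂ) ^ (m.toNat + (-m).toNat) * ((r : ℂ) ^ 2) ^ j := by
  rw [mono, zpw, Complex.conj_ofReal]; ring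

theorem ev_eq_vec (γ : ℝ) (m : ℤ) (k : ℕ) (c : ℕ → ℂ) (n : ℕ) :
    ∑ i ∈ Finset.range n, c i • monoVec γ m (k - i)
      = vec γ (wt γ fun z => ∑ i ∈ Finset.range n, c i * mono m (k - i) z) := by
  induction n with
  | zero =>
    have := vec_wt_const_mul (γ := γ) 0 (continuous_const (y := (0 : ℂ)) (X := ℂ))
    simpa using this.symm
  | succ n ih =>
    simp only [Finset.sum_range_succ]
    rw [vec_wt_add (by
        have := fun j => (contDiff_mono m j).continuous
        fun_prop) ((contDiff_mono m _).continuous.const_mul _),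
      vec_wt_const_mul _ (contDiff_mono m _).continuous, ih]
    rfl

/-- On the positive real axis the polynomial factor is r^|m| times a polynomial in r² whose
coefficient of degree k is `gco γ m k 0` = 1. -/
theorem ev_ne_zero (γ : ℝ) (m : ℤ) (k : ℕ) : ev γ m k ≠ 0 := by
  intro h
  rw [ev, ev_eq_vec] at h
  have hz := fun z hz => eq_zero_of_vec_eq_zero (by
    have := fun j => (contDiff_mono m j).continuous
    fun_prop) h (z := z) hz
  set P : Polynomial ℂ := ∑ i ∈ Finset.range (k + 1), Polynomial.C (gco γ m k i : ℂ) * Polynomial.X ^ (k - i)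
  have hP : P = 0 := by
    refine Polynomial.eq_zero_of_infinite_isRoot P ?_
    have hinj : Set.InjOn (fun r : ℝ => ((r : ℂ) ^ 2)) (Set.Ioo 0 1) := by
      intro a ha b hb hab
      have hab : (a : ℂ) ^ 2 = (b : ℂ) ^ 2 := hab
      have : a ^ 2 = b ^ 2 := by exact_mod_cast hab
      exact (pow_left_inj₀ ha.1.le hb.1.le two_ne_zero).1 this
    refine ((Set.Ioo_infinite (zero_lt_one (α := ℝ))).image hinj).mono ?_
    rintro _ ⟨r, hr, rfl⟩
    have h1 := hz (r : ℂ) (by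
      rw [xr, Complex.norm_real, Real.norm_eq_abs, sq_abs]; nlinarith [hr.1, hr.2])
    simp only [mono_real] at h1
    have h2 : (r : ℂ) ^ (m.toNat + (-m).toNat) * P.eval ((r : ℂ) ^ 2) = 0 := by
      rw [← h1, Polynomial.eval_finsetSum, Finset.mul_sum]
      refine Finset.sum_congr rfl fun i _ => ?_
      simp; ring
    have hr0 : (r : ℂ) ≠ 0 := by exact_mod_cast hr.1.ne'
    exact (mul_eq_zero.1 h2).resolve_left (pow_ne_zero _ hr0)
  have hc := congrArg (fun p : Polynomial ℂ => p.coeff k) hP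
  simp only [P, Polynomial.finsetSum_coeff, Polynomial.coeff_C_mul, Polynomial.coeff_X_pow,
    Polynomial.coeff_zero] at hc
  rw [Finset.sum_eq_single 0] at hc
  · simp [gco] at hc
  · intro i hi hi0
    have := Finset.mem_range.1 hi
    rw [if_neg (by omega), mul_zero]
  · intro h; simp at h

/-- The normalized eigenvectors. -/
def eig (γ : ℝ) (q : ℤ × ℕ) : L2 γ := ((‖ev γ q.1 q.2‖⁻¹ : ℝ) : ℂ) • ev γ q.1 q.2

/-- The boundary values of the normalized eigenvectors, divided by `x^σ`. -/
def bv (γ : ℝ) (m : ℤ) (k : ℕ) : ℝ := ‖ev γ m k‖⁻¹ * ∑ i ∈ Finset.range (k + 1), gco γ m k i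

theorem norm_eig (γ : ℝ) (q : ℤ × ℕ) : ‖eig γ q‖ = 1 := by
  have h := norm_pos_iff.2 (ev_ne_zero γ q.1 q.2)
  rw [eig, norm_smul, Complex.norm_real, norm_inv, norm_norm, inv_mul_cancel₀ h.ne']

theorem eig_ne_zero (γ : ℝ) (q : ℤ × ℕ) : eig γ q ≠ 0 := by
  rw [← norm_pos_iff, norm_eig]; exact one_pos

theorem dirichletInverse_eig {γ : ℝ} (hγ : γ ∈ Set.Ioo (-1 : ℝ) 1) (q : ℤ × ℕ) :
    dirichletInverse γ (eig γ q) = (((lam γ q.1 q.2)⁻¹ : ℝ) : ℂ) • eig γ q := by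
  rw [eig, map_smul, dirichletInverse_ev hγ, smul_comm]

/-- Every monomial of the mode has boundary value 1 on the positive axis, up to x^σ. A pairing equal
to κ on all of them is thus κ times the boundary value on their combinations, in particular on the
eigenvectors. -/
theorem inner_sub_eig {γ : ℝ} {m : ℤ} {ψ χ : L2 γ} {κ : ℂ}
    (h : ∀ j, ⟪ψ, lmonoVec γ m j⟫_ℂ - ⟪χ, monoVec γ m j⟫_ℂ = κ) (k : ℕ) :
    (lam γ m k : ℂ) * ⟪ψ, eig γ (m, k)⟫_ℂ - ⟪χ, eig γ (m, k)⟫_ℂ = κ * bv γ m k := by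
  have h1 : (lam γ m k : ℂ) * ⟪ψ, ev γ m k⟫_ℂ - ⟪χ, ev γ m k⟫_ℂ
      = κ * ((∑ i ∈ Finset.range (k + 1), gco γ m k i : ℝ) : ℂ) := by
    rw [← inner_smul_right, ← sum_lmonoVec, ev, inner_sum, inner_sum, ← Finset.sum_sub_distrib,
      Complex.ofReal_sum, Finset.mul_sum]
    refine Finset.sum_congr rfl fun i _ => ?_
    rw [inner_smul_right, inner_smul_right, ← mul_sub, h, mul_comm]
  simp only [eig, bv, inner_smul_right]
  push_cast at h1 ⊢
  linear_combination ((‖ev γ m k‖ : ℂ)⁻¹) * h1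

theorem toNat_sub (m : ℤ) : (m.toNat : ℤ) - ((-m).toNat : ℤ) = m := Int.toNat_sub_toNat_neg m

theorem mono_rotate {w : ℂ} (hw : ‖w‖ = 1) (m : ℤ) (j : ℕ) (z : ℂ) :
    mono m j (w * z) = w ^ m * mono m j z := by
  have h0 : w ≠ 0 := norm_ne_zero_iff.1 (by rw [hw]; exact one_ne_zero)
  have h1 : conj w = w⁻¹ := by rw [Complex.inv_def, Complex.normSq_eq_norm_sq, hw]; simp
  have h2 : w ^ (m.toNat + j) * w⁻¹ ^ ((-m).toNat + j) = w ^ m := by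
    rw [inv_pow, ← zpow_natCast, ← zpow_natCast, ← zpow_neg, ← zpow_add₀ h0]
    congr 1
    have := toNat_sub m
    push_cast
    omega
  rw [mono, zpw, map_mul, mul_pow, mul_pow, h1, ← h2, zpw]
  ring

theorem xr_rotate {w : ℂ} (hw : ‖w‖ = 1) (z : ℂ) : xr (w * z) = xr z := by
  rw [xr, xr, norm_mul, hw, one_mul]

theorem exists_zpow_ne {m n : ℤ} (h : m ≠ n) : ∃ w : ℂ, ‖w‖ = 1 ∧ w ^ m ≠ w ^ n := by
  have h0 : (m - n : ℝ) ≠ 0 := sub_ne_zero.2 (by exact_mod_cast h)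
  have h1 : (m - n : ℂ) ≠ 0 := by exact_mod_cast h0
  -- The angle π/(m - n) makes the ratio of the two powers equal to -1.
  refine ⟨Complex.exp ((Real.pi / (m - n) : ℝ) * Complex.I), Complex.norm_exp_ofReal_mul_I _, fun hh => ?_⟩
  have h2 : Complex.exp ((Real.pi / (m - n) : ℝ) * Complex.I) ^ (m - n) = 1 := by
    rw [zpow_sub₀ (Complex.exp_ne_zero _), hh, div_self (zpow_ne_zero _ (Complex.exp_ne_zero _))]
  rw [← Complex.exp_int_mul] at h2
  have h3 : ((m - n : ℤ) : ℂ) * ((Real.pi / (m - n) : ℝ) * Complex.I) = Real.pi * Complex.I := by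
    push_cast; field_simp
  rw [h3, Complex.exp_pi_mul_I] at h2
  norm_num at h2

/-- Functions in different Fourier modes are orthogonal. -/
theorem inner_eq_zero_of_modes {γ : ℝ} {f g : ℂ → ℂ} {m n : ℤ} (h : m ≠ n)
    (hfL : MemLp f 2 (diskMeasure γ)) (hgL : MemLp g 2 (diskMeasure γ))
    (hf : ∀ w z : ℂ, ‖w‖ = 1 → f (w * z) = w ^ m * f z)
    (hg : ∀ w z : ℂ, ‖w‖ = 1 → g (w * z) = w ^ n * g z) : ⟪vec γ f, vec γ g⟫_ℂ = 0 := by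
  obtain ⟨w, hw, hne⟩ := exists_zpow_ne h
  have h0 : w ≠ 0 := norm_ne_zero_iff.1 (by rw [hw]; exact one_ne_zero)
  rw [inner_vec hfL hgL]
  refine integral_eq_zero_of_rotation hw (c := conj (w ^ m) * w ^ n) ?_ fun z => ?_
  · intro hc
    have h1 : w ^ m * conj (w ^ m) = 1 := by
      rw [Complex.mul_conj, Complex.normSq_eq_norm_sq, norm_zpow, hw]; simp
    refine hne ?_
    calc w ^ m = w ^ m * (conj (w ^ m) * w ^ n) := by rw [hc, mul_one]
      _ = w ^ n := by rw [← mul_assoc, h1, one_mul]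
  · rw [hf w z hw, hg w z hw, map_mul]; ring

theorem wt_rotate {γ : ℝ} {p : ℂ → ℂ} {m : ℤ} (hp : ∀ w z : ℂ, ‖w‖ = 1 → p (w * z) = w ^ m * p z)
    (w z : ℂ) (hw : ‖w‖ = 1) : wt γ p (w * z) = w ^ m * wt γ p z := by
  rw [wt, wt, xr_rotate hw, hp w z hw]; ring

theorem inner_monoVec_of_ne {γ : ℝ} {m n : ℤ} (h : m ≠ n) (i j : ℕ) :
    ⟪monoVec γ m i, monoVec γ n j⟫_ℂ = 0 :=
  inner_eq_zero_of_modes h (memLp_wt_of_continuous (contDiff_mono m i).continuous)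
    (memLp_wt_of_continuous (contDiff_mono n j).continuous)
    (wt_rotate fun _ z hw => mono_rotate hw m i z) (wt_rotate fun _ z hw => mono_rotate hw n j z)

theorem inner_eig_eq_zero {γ : ℝ} {m : ℤ} {ψ : L2 γ} (h : ∀ j, ⟪ψ, monoVec γ m j⟫_ℂ = 0) (k : ℕ) :
    ⟪ψ, eig γ (m, k)⟫_ℂ = 0 := by
  simp only [eig, ev, inner_sum, inner_smul_right, h, mul_zero, Finset.sum_const_zero]

/-- Different modes are orthogonal by rotation invariance. Within a mode the vectors belong to
distinct eigenvalues of a symmetric operator. -/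
theorem orthonormal_eig {γ : ℝ} (hγ : γ ∈ Set.Ioo (-1 : ℝ) 1) : Orthonormal ℂ (eig γ) := by
  refine ⟨norm_eig γ, ?_⟩
  rintro ⟨m, k⟩ ⟨n, l⟩ hne
  by_cases hmn : m = n
  · subst hmn
    have hkl : k ≠ l := fun h => hne (by rw [h])
    have h := dirichletInverse_inner γ (eig γ (m, k)) (eig γ (m, l))
    rw [dirichletInverse_eig hγ, dirichletInverse_eig hγ, inner_smul_left, inner_smul_right,
      Complex.conj_ofReal] at h
    by_contra h0
    have h1 := mul_right_cancel₀ h0 h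
    have h2 : (lam γ m k)⁻¹ = (lam γ m l)⁻¹ := by exact_mod_cast h1
    exact hkl ((lam_strictMono γ m).injective (inv_injective h2))
  · change ⟪eig γ (m, k), eig γ (n, l)⟫_ℂ = 0
    refine inner_eig_eq_zero (fun j => ?_) l
    rw [← inner_conj_symm, inner_eig_eq_zero fun i => inner_monoVec_of_ne (Ne.symm hmn) j i, map_zero]

/-- The passage from monomials to eigenvectors is unitriangular up to normalization, hence
invertible by induction on the degree. -/
theorem monoVec_mem_span (γ : ℝ) (m : ℤ) (k : ℕ) :
    monoVec γ m k ∈ Submodule.span ℂ (Set.range (eig γ)) := by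
  induction k using Nat.strong_induction_on with
  | _ k ih =>
    have h0 : ev γ m k = (‖ev γ m k‖ : ℂ) • eig γ (m, k) := by
      have h := norm_pos_iff.2 (ev_ne_zero γ m k)
      rw [eig, smul_smul, ← Complex.ofReal_mul, mul_inv_cancel₀ h.ne', Complex.ofReal_one, one_smul]
    have h1 : monoVec γ m k = ev γ m k
        - ∑ i ∈ Finset.range k, (gco γ m k (i + 1) : ℂ) • monoVec γ m (k - (i + 1)) := by
      rw [ev, Finset.sum_range_succ', gco]; simp
    rw [h1]
    refine Submodule.sub_mem _ ?_ (Submodule.sum_mem _ fun i hi => Submodule.smul_mem _ _ (ih _ ?_))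
    · rw [h0]; exact Submodule.smul_mem _ _ (Submodule.subset_span ⟨_, rfl⟩)
    · have := Finset.mem_range.1 hi; omega

theorem zpw_eq_mono (a b : ℕ) : zpw a b = mono ((a : ℤ) - b) (min a b) := by
  rw [mono]; congr 1 <;> omega

theorem top_le_span_eig {γ : ℝ} (hγ : -1 < γ) :
    ⊤ ≤ (Submodule.span ℂ (Set.range (eig γ))).topologicalClosure := by
  rw [← monoSpan_eq_top hγ, monoSpan]
  refine Submodule.topologicalClosure_mono (Submodule.span_le.2 ?_)
  rintro _ ⟨⟨a, b⟩, rfl⟩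
  simp only [zpw_eq_mono]
  exact monoVec_mem_span γ _ _

/-- The Hilbert basis of eigenvectors. -/
def eigBasis {γ : ℝ} (hγ : γ ∈ Set.Ioo (-1 : ℝ) 1) : HilbertBasis (ℤ × ℕ) ℂ (L2 γ) :=
  HilbertBasis.mk (orthonormal_eig hγ) (top_le_span_eig hγ.1)

theorem eigBasis_apply {γ : ℝ} (hγ : γ ∈ Set.Ioo (-1 : ℝ) 1) (q : ℤ × ℕ) :
    eigBasis hγ q = eig γ q := by
  rw [eigBasis, HilbertBasis.coe_mk]

/-! ### Coordinates in the eigenbasis -/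

theorem opPow_inner {H : Type*} [NormedAddCommGroup H] [InnerProductSpace ℂ H]
    [CompleteSpace H] (A : H →L[ℂ] H) (r : ℝ) (u v : H) :
    ⟪opPow A r u, v⟫_ℂ = ⟪u, opPow A r v⟫_ℂ := by
  have h : 0 ≤ opPow A r := CFC.rpow_nonneg
  exact ((ContinuousLinearMap.nonneg_iff_isPositive _).1 h).isSymmetric u v

theorem inner_eig_dirichletNegPow {γ s : ℝ} (hγ : γ ∈ Set.Ioo (-1 : ℝ) 1) (hs : 0 < s) (q : ℤ × ℕ)
    (v : L2 γ) : ⟪eig γ q, dirichletNegPow γ s v⟫_ℂ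
      = ((lam γ q.1 q.2 ^ (-(s / 2)) : ℝ) : ℂ) * ⟪eig γ q, v⟫_ℂ := by
  have h := dirichletNegPow_eigenvector hs (eig_ne_zero γ q) (dirichletInverse_eig hγ q)
  rw [Real.inv_rpow (lam_pos γ _ _).le, ← Real.rpow_neg (lam_pos γ _ _).le] at h
  rw [dirichletNegPow, ← opPow_inner, ← dirichletNegPow, h, inner_smul_left, Complex.conj_ofReal]

theorem inner_eig_dirichletInverse {γ : ℝ} (hγ : γ ∈ Set.Ioo (-1 : ℝ) 1) (q : ℤ × ℕ)
    (v : L2 γ) : ⟪eig γ q, dirichletInverse γ v⟫_ℂ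
      = (((lam γ q.1 q.2)⁻¹ : ℝ) : ℂ) * ⟪eig γ q, v⟫_ℂ := by
  rw [← dirichletInverse_inner, dirichletInverse_eig hγ, inner_smul_left, Complex.conj_ofReal]

theorem ext_eig {γ : ℝ} (hγ : γ ∈ Set.Ioo (-1 : ℝ) 1) {u v : L2 γ}
    (h : ∀ q, ⟪eig γ q, u⟫_ℂ = ⟪eig γ q, v⟫_ℂ) : u = v := by
  refine (eigBasis hγ).repr.injective (lp.ext (funext fun q => ?_))
  rw [HilbertBasis.repr_apply_apply, HilbertBasis.repr_apply_apply, eigBasis_apply, h]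

theorem dirichletNegPow_injective {γ s : ℝ} (hγ : γ ∈ Set.Ioo (-1 : ℝ) 1) (hs : 0 < s) :
    Function.Injective (dirichletNegPow γ s) := by
  intro u v h
  refine ext_eig hγ fun q => ?_
  have h1 := congrArg (fun w => ⟪eig γ q, w⟫_ℂ) h
  simp only [inner_eig_dirichletNegPow hγ hs] at h1
  have h2 : (lam γ q.1 q.2 ^ (-(s / 2)) : ℝ) ≠ 0 := (Real.rpow_pos_of_pos (lam_pos γ _ _) _).ne'
  exact mul_left_cancel₀ (by exact_mod_cast h2) h1

theorem hasSum_inner_eig {γ : ℝ} (hγ : γ ∈ Set.Ioo (-1 : ℝ) 1) (u v : L2 γ) :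
    HasSum (fun q => ⟪u, eig γ q⟫_ℂ * ⟪eig γ q, v⟫_ℂ) ⟪u, v⟫_ℂ := by
  have h := (eigBasis hγ).hasSum_inner_mul_inner u v
  simpa only [eigBasis_apply] using h

theorem hasSum_norm_sq_eig {γ : ℝ} (hγ : γ ∈ Set.Ioo (-1 : ℝ) 1) (u : L2 γ) :
    HasSum (fun q => ‖⟪eig γ q, u⟫_ℂ‖ ^ 2) (‖u‖ ^ 2) := by
  have h := Complex.hasSum_re (hasSum_inner_eig hγ u u)
  convert h using 1
  · funext q
    rw [← inner_conj_symm, Complex.mul_conj, Complex.ofReal_re, Complex.normSq_eq_norm_sq,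
      RCLike.norm_conj]
  · exact norm_sq_eq_re_inner (𝕜 := ℂ) u

theorem exists_of_coeff {γ : ℝ} (hγ : γ ∈ Set.Ioo (-1 : ℝ) 1) {c : ℤ × ℕ → ℂ}
    (hc : Summable fun q => ‖c q‖ ^ 2) : ∃ u : L2 γ, ∀ q, ⟪eig γ q, u⟫_ℂ = c q := by
  have hm : Memℓp c 2 := memℓp_gen (by simpa using hc)
  refine ⟨(eigBasis hγ).repr.symm ⟨c, hm⟩, fun q => ?_⟩
  rw [← eigBasis_apply hγ, ← HilbertBasis.repr_apply_apply, LinearIsometryEquiv.apply_symm_apply]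

theorem dirichletSobolevNorm_eq {γ s : ℝ} (hγ : γ ∈ Set.Ioo (-1 : ℝ) 1) (hs : 0 < s)
    (u : dirichletSobolev γ s) {v : L2 γ} (hv : dirichletNegPow γ s v = u) :
    dirichletSobolevNorm γ s u = ‖v‖ := by
  have h : {r : ℝ | ∃ v : L2 γ, dirichletNegPow γ s v = u ∧ r = ‖v‖} = {‖v‖} := by
    ext r
    constructor
    · rintro ⟨w, hw, rfl⟩
      rw [dirichletNegPow_injective hγ hs (hw.trans hv.symm)]; rfl
    · rintro rfl
      exact ⟨v, hv, rfl⟩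
  rw [dirichletSobolevNorm, h, csInf_singleton]

/-! ### Singular solutions of the adjoint problem -/

/-- The more singular radial factor. -/
def hfun (γ ℓ x : ℝ) : ℝ := if γ = 0 then Real.log x + ℓ else x ^ (-max γ 0)

/-- `p` multiplied by the more singular radial factor. -/
def dual (γ ℓ : ℝ) (p : ℂ → ℂ) (z : ℂ) : ℂ := ((hfun γ ℓ (xr z) : ℝ) : ℂ) * p z

/-- The formula for `L (dual γ ℓ p)`. -/
def dualL (γ ℓ : ℝ) (p : ℂ → ℂ) (z : ℂ) : ℂ :=
  dual γ ℓ (keldysh (-|γ|) p) z + (if γ = 0 then 4 else 0) * (euler p z + p z)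

/-- The exponents 0 and -γ are the indicial roots at the circle, so applying the operator creates no
stronger singularity. The logarithm for γ = 0 adds only the smooth term 4(`euler p` + p). -/
theorem keldysh_dual {γ ℓ : ℝ} {p : ℂ → ℂ} {z : ℂ} (hz : 0 < xr z) (hp : ContDiffAt ℝ ∞ p z) :
    keldysh γ (dual γ ℓ p) z = dualL γ ℓ p z := by
  rw [dualL]
  rcases lt_trichotomy γ 0 with h | h | h
  · have h1 : ∀ f, dual γ ℓ f = f := fun f => by
      funext z; simp [dual, hfun, h.ne, max_eq_right h.le]
    rw [h1, h1, if_neg h.ne, abs_of_neg h, neg_neg]; ring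
  · subst h
    have h1 : ∀ f, dual 0 ℓ f = fun z => ((Real.log (xr z) + ℓ : ℝ) : ℂ) * f z := fun f => by
      funext z; simp [dual, hfun]
    rw [h1, h1, keldysh_log_mul ℓ hz hp]; simp
  · have h1 : ∀ f, dual γ ℓ f = fun z => ((xr z ^ (-γ) : ℝ) : ℂ) * f z := fun f => by
      funext z; simp [dual, hfun, h.ne', max_eq_left h.le]
    rw [h1, h1, keldysh_rpow_mul γ hz hp, if_neg h.ne', abs_of_pos h]; simp

/-- The singular factor is square integrable because 2 max(γ, 0) < 1 + γ when -1 < γ < 1. For γ = 0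
the logarithm is dominated by x^(-1/4). -/
theorem exists_radialBound_hfun {γ : ℝ} (hγ : γ ∈ Set.Ioo (-1 : ℝ) 1) (ℓ : ℝ) :
    ∃ M : ℝ → ℝ, RadialBound (hfun γ ℓ) M ∧ (∀ x, 0 < x → x ≤ 1 → 0 ≤ M x) ∧
      Integrable (fun z => M (xr z) ^ 2) (diskMeasure γ) := by
  have key : ∀ C δ : ℝ, 2 * δ < 1 + γ →
      Integrable (fun z => (C * xr z ^ (-δ)) ^ 2) (diskMeasure γ) := by
    intro C δ hδ
    have h1 := (integrable_rpow_diskMeasure (γ := γ) (a := -(2 * δ)) (by linarith)).const_mul (C ^ 2)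
    refine h1.congr ?_
    filter_upwards [ae_mem_ball γ] with z hz
    rw [mul_pow, ← Real.rpow_mul_natCast hz.le]
    congr 2; push_cast; ring
  have h14 : γ = 0 → 2 * (1 / 4 : ℝ) < 1 + γ := fun h => by subst h; norm_num
  by_cases h : γ = 0
  · have hi := key (5 + |ℓ|) (1 / 4) (h14 h)
    have hh : hfun γ ℓ = fun x => Real.log x + ℓ := by funext y; simp [hfun, h]
    have hd : deriv (hfun γ ℓ) = fun y => y⁻¹ := by
      funext y; rw [hh, deriv_add_const, Real.deriv_log]
    have h1 : ∀ x : ℝ, 0 < x → x ≤ 1 → 1 ≤ x ^ (-(1 / 4 : ℝ)) := fun x hx hx1 =>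
      Real.one_le_rpow_of_pos_of_le_one_of_nonpos hx hx1 (by norm_num)
    have hs : ∀ x : ℝ, 0 < x → ContDiffAt ℝ ∞ (fun x => Real.log x + ℓ) x := fun x hx =>
      (Real.contDiffAt_log.2 hx.ne').add contDiffAt_const
    have h0 := abs_nonneg ℓ
    have h5 : ∀ x : ℝ, 0 < x → x ≤ 1 → 1 ≤ (5 + |ℓ|) * x ^ (-(1 / 4 : ℝ)) := fun x hx hx1 => by
      nlinarith [h1 x hx hx1]
    have hlog : ∀ x : ℝ, 0 < x → x ≤ 1 → |Real.log x + ℓ| ≤ (5 + |ℓ|) * x ^ (-(1 / 4 : ℝ)) := by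
      intro x hx hx1
      have h2 : Real.log x⁻¹ ≤ x⁻¹ ^ (1 / 4 : ℝ) / (1 / 4) :=
        Real.log_le_rpow_div (by positivity) (by norm_num)
      rw [Real.log_inv, Real.inv_rpow hx.le, ← Real.rpow_neg hx.le] at h2
      have h3 := abs_add_le (Real.log x) ℓ
      rw [abs_of_nonpos (Real.log_nonpos hx.le hx1)] at h3
      have h4 := h1 x hx hx1
      have h6 := mul_le_mul_of_nonneg_left h4 h0
      linarith
    have hlog1 : ∀ x : ℝ, 0 < x → x ≤ 1 → |x * deriv (hfun γ ℓ) x| ≤ (5 + |ℓ|) * x ^ (-(1 / 4 : ℝ)) := by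
      intro x hx hx1
      rw [hd, mul_inv_cancel₀ hx.ne', abs_one]
      exact h5 x hx hx1
    have hlog2 : ∀ x : ℝ, 0 < x → x ≤ 1 →
        |x ^ 2 * deriv (deriv (hfun γ ℓ)) x| ≤ (5 + |ℓ|) * x ^ (-(1 / 4 : ℝ)) := by
      intro x hx hx1
      rw [hd]
      simp only [deriv_inv]
      rw [show x ^ 2 * -(x ^ 2)⁻¹ = -1 by field_simp, abs_neg, abs_one]
      exact h5 x hx hx1
    rw [← hh] at hs
    have hlog0 : ∀ x : ℝ, 0 < x → x ≤ 1 → |hfun γ ℓ x| ≤ (5 + |ℓ|) * x ^ (-(1 / 4 : ℝ)) := by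
      rw [hh]; exact hlog
    generalize hM : (fun x : ℝ => (5 + |ℓ|) * x ^ (-(1 / 4 : ℝ))) = M at *
    have hMx : ∀ x, (5 + |ℓ|) * x ^ (-(1 / 4 : ℝ)) = M x := fun x => by rw [← hM]
    simp only [hMx] at hlog0 hlog1 hlog2 hi
    have hpos : ∀ x, 0 < x → x ≤ 1 → 0 ≤ M x := fun x hx hx1 => (abs_nonneg _).trans (hlog0 x hx hx1)
    exact ⟨M, ⟨hs, hlog0, hlog1, hlog2⟩, hpos, hi⟩
  · obtain ⟨C, hC, hb⟩ := RadialBound.rpow (-max γ 0)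
    have hh : hfun γ ℓ = fun x => x ^ (-max γ 0) := by funext x; simp [hfun, h]
    rw [hh]
    refine ⟨fun x => C * x ^ (-max γ 0), hb, fun x hx _ => mul_nonneg hC (Real.rpow_nonneg hx.le _),
      key _ _ ?_⟩
    rcases max_cases γ 0 with h | h <;> rw [h.1] <;> linarith [hγ.1, hγ.2]

theorem continuousOn_hfun (γ ℓ : ℝ) :
    ContinuousOn (fun z => ((hfun γ ℓ (xr z) : ℝ) : ℂ)) (Metric.ball (0 : ℂ) 1) := by
  have h : ContinuousOn (hfun γ ℓ) {x | 0 < x} := by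
    unfold hfun
    split_ifs
    · exact (Real.continuousOn_log.mono fun x hx => (ne_of_gt hx)).add continuousOn_const
    · exact fun x hx => (Real.continuousAt_rpow_const _ _ (Or.inl (ne_of_gt hx))).continuousWithinAt
  exact Complex.continuous_ofReal.comp_continuousOn
    (h.comp continuous_xr.continuousOn fun z hz => mem_ball_iff_xr.1 hz)

theorem memLp_dual {γ : ℝ} (hγ : γ ∈ Set.Ioo (-1 : ℝ) 1) (ℓ : ℝ) {p : ℂ → ℂ} {C : ℝ}
    (hp : ContinuousOn p (Metric.ball (0 : ℂ) 1)) (hb : ∀ z, 0 < xr z → ‖p z‖ ≤ C) :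
    MemLp (dual γ ℓ p) 2 (diskMeasure γ) := by
  obtain ⟨M, hM, -, hMi⟩ := exists_radialBound_hfun hγ ℓ
  refine memLp_of_sq_le (g := fun z => C ^ 2 * M (xr z) ^ 2)
    (aestronglyMeasurable_of_continuousOn ((continuousOn_hfun γ ℓ).mul hp)) (hMi.const_mul _) fun z hz => ?_
  rw [dual, norm_mul, mul_comm, mul_pow, Complex.norm_real, Real.norm_eq_abs]
  exact mul_le_mul (pow_le_pow_left₀ (norm_nonneg _) (hb z hz) 2)
    (pow_le_pow_left₀ (abs_nonneg _) (hM.bound0 _ hz (xr_le_one z)) 2) (sq_nonneg _) (sq_nonneg _)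

theorem memLp_dual_of_continuous {γ : ℝ} (hγ : γ ∈ Set.Ioo (-1 : ℝ) 1) (ℓ : ℝ) {p : ℂ → ℂ}
    (hp : Continuous p) : MemLp (dual γ ℓ p) 2 (diskMeasure γ) := by
  obtain ⟨C, hC⟩ := bounded_of_contDiff hp
  exact memLp_dual hγ ℓ hp.continuousOn hC

theorem memLp_bounded {γ : ℝ} (hγ : -1 < γ) {p : ℂ → ℂ} {C : ℝ}
    (hp : ContinuousOn p (Metric.ball (0 : ℂ) 1)) (hb : ∀ z, 0 < xr z → ‖p z‖ ≤ C) :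
    MemLp p 2 (diskMeasure γ) := by
  have := isFiniteMeasure_diskMeasure hγ
  exact memLp_of_sq_le (g := fun _ => C ^ 2) (aestronglyMeasurable_of_continuousOn hp)
    (integrable_const _) fun z hz => pow_le_pow_left₀ (norm_nonneg _) (hb z hz) 2

theorem continuous_euler {p : ℂ → ℂ} (hp : ContDiff ℝ ∞ p) : Continuous (euler p) :=
  (continuous_id.mul (contDiff_dz hp).continuous).add
    (contDiff_conj.continuous.mul (contDiff_db hp).continuous)

theorem memLp_dualL {γ : ℝ} (hγ : γ ∈ Set.Ioo (-1 : ℝ) 1) (ℓ : ℝ) {p : ℂ → ℂ}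
    (hp : ContDiff ℝ ∞ p) : MemLp (dualL γ ℓ p) 2 (diskMeasure γ) := by
  have hc : Continuous fun z => (if γ = 0 then 4 else 0) * (euler p z + p z) :=
    continuous_const.mul ((continuous_euler hp).add hp.continuous)
  obtain ⟨C, hC⟩ := bounded_of_contDiff hc
  exact (memLp_dual_of_continuous hγ ℓ (continuous_keldysh _ hp)).add
    (memLp_bounded hγ.1 hc.continuousOn hC)

/-- The Wronskian-type pairing vanishes on the closure of the test functions. -/
theorem inner_testGraph {γ : ℝ} (hγ : γ ∈ Set.Ioo (-1 : ℝ) 1) {ℓ : ℝ} {p : ℂ → ℂ}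
    (hp : ContDiff ℝ ∞ p) {P : L2 γ × L2 γ} (hP : P ∈ testGraph γ) :
    ⟪vec γ (dual γ ℓ p), P.2⟫_ℂ = ⟪vec γ (dualL γ ℓ p), P.1⟫_ℂ := by
  have hs : SmoothInt (dual γ ℓ p) := by
    obtain ⟨M, hM, -⟩ := exists_radialBound_hfun hγ ℓ
    exact (smoothInt_radial hM.smooth).mul (smoothInt_of_contDiff hp)
  -- The identity defines a closed subspace of pairs, so it is enough to verify it on test
  -- functions, where it is `green_symm`.
  let S : Submodule ℂ (L2 γ × L2 γ) := LinearMap.ker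
    ((innerₛₗ ℂ (vec γ (dual γ ℓ p))).comp (LinearMap.snd ℂ _ _)
      - (innerₛₗ ℂ (vec γ (dualL γ ℓ p))).comp (LinearMap.fst ℂ _ _))
  have hmem : ∀ P, P ∈ S ↔ ⟪vec γ (dual γ ℓ p), P.2⟫_ℂ = ⟪vec γ (dualL γ ℓ p), P.1⟫_ℂ := fun P => by
    rw [LinearMap.mem_ker, LinearMap.sub_apply, sub_eq_zero]; rfl
  have hS : IsClosed (S : Set (L2 γ × L2 γ)) := by
    have : (S : Set (L2 γ × L2 γ))
        = {P | ⟪vec γ (dual γ ℓ p), P.2⟫_ℂ = ⟪vec γ (dualL γ ℓ p), P.1⟫_ℂ} := Set.ext hmem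
    rw [this]
    exact isClosed_eq (continuous_const.inner continuous_snd) (continuous_const.inner continuous_fst)
  refine (hmem P).1 (testGraph_le hS (fun f hf => (hmem _).2 ?_) hP)
  rw [inner_vec (memLp_dual_of_continuous hγ ℓ hp.continuous) ((hf.keldysh γ).memLp hγ.1),
    inner_vec (memLp_dualL hγ ℓ hp) (hf.memLp hγ.1), green_symm hf hs]
  refine integral_congr_ae ?_
  filter_upwards [ae_mem_ball γ] with z hz
  rw [keldysh_dual hz hp.contDiffAt]

/-! ### Norm bounds for concentrating functions -/

theorem integral_disk_radial (γ : ℝ) (G : ℝ → ℝ) :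
    ∫ z, G (xr z) ∂diskMeasure γ = Real.pi * ∫ x in Set.Ioo (0 : ℝ) 1, x ^ γ * G x := by
  rw [integral_diskMeasure]
  exact integral_radial fun x : ℝ => x ^ γ * G x

theorem integrable_disk_radial {γ : ℝ} {G : ℝ → ℝ} :
    Integrable (fun z => G (xr z)) (diskMeasure γ)
      ↔ IntegrableOn (fun x : ℝ => x ^ γ * G x) (Set.Ioo 0 1) := by
  rw [integrable_diskMeasure]
  exact integrableOn_radial (g := fun x : ℝ => x ^ γ * G x)

theorem norm_sq_zpw (a b : ℕ) (z : ℂ) : ‖zpw a b z‖ ^ 2 = (1 - xr z) ^ (a + b) := by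
  rw [zpw, norm_mul, norm_pow, norm_pow, RCLike.norm_conj, xr, ← pow_add, sub_sub_cancel]
  ring

theorem log_sq_le {y : ℝ} (hy : 0 < y) : Real.log y ^ 2 ≤ 16 * (y ^ (-(1 / 2) : ℝ) + y ^ (1 : ℝ)) := by
  have h1 : 0 ≤ y ^ (-(1 / 2) : ℝ) := Real.rpow_nonneg hy.le _
  rw [Real.rpow_one]
  rcases le_total 1 y with h | h
  · have h2 : Real.log y ≤ y ^ (1 / 2 : ℝ) / (1 / 2) := Real.log_le_rpow_div hy.le (by norm_num)
    have h3 := Real.log_nonneg h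
    have h4 : (y ^ (1 / 2 : ℝ)) ^ 2 = y := by
      rw [← Real.rpow_mul_natCast hy.le]; norm_num
    nlinarith [pow_le_pow_left₀ h3 h2 2]
  · have h2 : Real.log y⁻¹ ≤ y⁻¹ ^ (1 / 4 : ℝ) / (1 / 4) :=
      Real.log_le_rpow_div (inv_pos.2 hy).le (by norm_num)
    rw [Real.log_inv, Real.inv_rpow hy.le, ← Real.rpow_neg hy.le] at h2
    have h3 : 0 ≤ -Real.log y := neg_nonneg.2 (Real.log_nonpos hy.le h)
    have h4 : (y ^ (-(1 / 4) : ℝ)) ^ 2 = y ^ (-(1 / 2) : ℝ) := by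
      rw [← Real.rpow_mul_natCast hy.le]; norm_num
    nlinarith [pow_le_pow_left₀ h3 h2 2]

/-- The choice ℓ = log N turns log x + ℓ into log(Nx). The weight x^γ h² is then N^|γ| times a
function of Nx, bounded by two powers that are integrable at 0; two are needed to control log² near
0 and near infinity. -/
theorem exists_hfun_sq_le {γ : ℝ} (hγ : γ ∈ Set.Ioo (-1 : ℝ) 1) : ∃ C a b : ℝ, 0 ≤ C ∧ -1 < a ∧ -1 < b ∧
    ∀ N x : ℝ, 0 < N → 0 < x →
      x ^ γ * hfun γ (Real.log N) x ^ 2 ≤ C * N ^ |γ| * (N ^ a * x ^ a + N ^ b * x ^ b) := by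
  by_cases h : γ = 0
  · refine ⟨16, -(1 / 2), 1, by norm_num, by norm_num, by norm_num, fun N x hN hx => ?_⟩
    have h1 := log_sq_le (mul_pos hN hx)
    rw [Real.log_mul hN.ne' hx.ne', Real.mul_rpow hN.le hx.le, Real.mul_rpow hN.le hx.le] at h1
    simp only [hfun, h, if_true, abs_zero, Real.rpow_zero, one_mul, mul_one]
    rw [add_comm (Real.log x)]
    exact h1
  · have hb : |γ| < 1 := abs_lt.2 hγ
    refine ⟨1, -|γ|, -|γ|, by norm_num, by linarith, by linarith, fun N x hN hx => ?_⟩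
    have h1 : x ^ γ * hfun γ (Real.log N) x ^ 2 = x ^ (-|γ|) := by
      rw [hfun, if_neg h, ← Real.rpow_mul_natCast hx.le, ← Real.rpow_add hx]
      congr 1
      rcases lt_or_gt_of_ne h with h | h
      · rw [max_eq_right h.le, abs_of_neg h]; simp
      · rw [max_eq_left h.le, abs_of_pos h]; push_cast; ring
    have h2 : N ^ |γ| * N ^ (-|γ|) = 1 := by rw [← Real.rpow_add hN, add_neg_cancel, Real.rpow_zero]
    have h3 : 0 ≤ x ^ (-|γ|) := Real.rpow_nonneg hx.le _
    rw [h1]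
    calc x ^ (-|γ|) ≤ 2 * (N ^ |γ| * N ^ (-|γ|)) * x ^ (-|γ|) := by rw [h2]; linarith
      _ = _ := by ring

theorem measurable_hfun (γ ℓ : ℝ) : Measurable (hfun γ ℓ) := by
  unfold hfun
  split_ifs <;> fun_prop

theorem integral_rpow_pow_concentrated {α N : ℝ} {n : ℕ} (hα : -1 < α) (hN : 0 < N) (h : N ≤ n + 1) :
    ∫ x in Set.Ioo (0 : ℝ) 1, x ^ α * (1 - x) ^ n
      ≤ Real.exp 1 * Real.Gamma (α + 1) * N ^ (-(α + 1)) := by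
  refine (integral_rpow_mul_pow_le hα n).trans ?_
  have h1 : 0 < Real.Gamma (α + 1) := Real.Gamma_pos_of_pos (by linarith)
  exact mul_le_mul_of_nonneg_left (Real.rpow_le_rpow_of_nonpos hN h (by linarith)) (by positivity)

/-- The factor (1 - x)^n with n + 1 ≥ N confines p to x ≲ 1/N. Rescaling y = Nx then gives the power
of N, each factor x² in |p|² contributing N⁻². -/
theorem exists_norm_dual_le {γ : ℝ} (hγ : γ ∈ Set.Ioo (-1 : ℝ) 1) (l : ℕ) : ∃ C : ℝ, 0 ≤ C ∧
    ∀ (N : ℝ) (n : ℕ) (p : ℂ → ℂ), 0 < N → N ≤ n + 1 → Continuous p →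
      (∀ z, 0 < xr z → ‖p z‖ ^ 2 ≤ xr z ^ (2 * l) * (1 - xr z) ^ n) →
      ‖vec γ (dual γ (Real.log N) p)‖ ^ 2 ≤ C * N ^ (|γ| - 1 - 2 * l) := by
  obtain ⟨C, a, b, hC, ha, hb, hle⟩ := exists_hfun_sq_le hγ
  have ha' : -1 < a + 2 * l := by have : (0 : ℝ) ≤ l := l.cast_nonneg; linarith
  have hb' : -1 < b + 2 * l := by have : (0 : ℝ) ≤ l := l.cast_nonneg; linarith
  have ga : 0 < Real.Gamma (a + 2 * l + 1) := Real.Gamma_pos_of_pos (by linarith)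
  have gb : 0 < Real.Gamma (b + 2 * l + 1) := Real.Gamma_pos_of_pos (by linarith)
  refine ⟨Real.pi * (C * (Real.exp 1 * Real.Gamma (a + 2 * l + 1) + Real.exp 1 * Real.Gamma (b + 2 * l + 1))),
    by positivity, fun N n p hN hn hp hpz => ?_⟩
  set h := hfun γ (Real.log N)
  set G : ℝ → ℝ := fun x => h x ^ 2 * (x ^ (2 * l) * (1 - x) ^ n)
  set U : ℝ → ℝ := fun x => C * N ^ |γ| * (N ^ a * (x ^ (a + 2 * l) * (1 - x) ^ n)
    + N ^ b * (x ^ (b + 2 * l) * (1 - x) ^ n))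
  have ia := integrableOn_rpow_mul_pow ha' n
  have ib := integrableOn_rpow_mul_pow hb' n
  have hU : IntegrableOn U (Set.Ioo 0 1) := ((ia.const_mul _).add (ib.const_mul _)).const_mul _
  have hGU : ∀ x ∈ Set.Ioo (0 : ℝ) 1, x ^ γ * G x ≤ U x := by
    intro x hx
    have e : ∀ c : ℝ, x ^ (c + 2 * l) = x ^ c * x ^ (2 * l) := fun c => by
      rw [← Real.rpow_add_natCast hx.1.ne']; push_cast; rfl
    have h1 : 0 ≤ x ^ (2 * l) * (1 - x) ^ n :=
      mul_nonneg (pow_nonneg hx.1.le _) (pow_nonneg (by linarith [hx.2]) _)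
    calc x ^ γ * G x = x ^ γ * h x ^ 2 * (x ^ (2 * l) * (1 - x) ^ n) := by simp only [G]; ring
      _ ≤ C * N ^ |γ| * (N ^ a * x ^ a + N ^ b * x ^ b) * (x ^ (2 * l) * (1 - x) ^ n) :=
        mul_le_mul_of_nonneg_right (hle N x hN hx.1) h1
      _ = U x := by simp only [U, e]; ring
  have hG0 : ∀ x ∈ Set.Ioo (0 : ℝ) 1, 0 ≤ x ^ γ * G x := fun x hx =>
    mul_nonneg (Real.rpow_nonneg hx.1.le _) (mul_nonneg (sq_nonneg _)
      (mul_nonneg (pow_nonneg hx.1.le _) (pow_nonneg (by linarith [hx.2]) _)))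
  have hGi : IntegrableOn (fun x : ℝ => x ^ γ * G x) (Set.Ioo 0 1) := by
    refine hU.mono' ?_ ?_
    · have := measurable_hfun γ (Real.log N)
      exact (by fun_prop : Measurable fun x : ℝ => x ^ γ * G x).aestronglyMeasurable
    · filter_upwards [ae_restrict_mem measurableSet_Ioo] with x hx
      rw [Real.norm_of_nonneg (hG0 x hx)]
      exact hGU x hx
  have hn2 := norm_sq_vec_le (memLp_dual_of_continuous hγ (Real.log N) hp) (g := fun z => G (xr z))
    (integrable_disk_radial.2 hGi) fun z hz => by
      rw [dual, norm_mul, mul_pow, Complex.norm_real, Real.norm_eq_abs, sq_abs]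
      exact mul_le_mul_of_nonneg_left (hpz z hz) (sq_nonneg _)
  refine hn2.trans ?_
  rw [integral_disk_radial, mul_assoc]
  refine mul_le_mul_of_nonneg_left ?_ Real.pi_pos.le
  refine (setIntegral_mono_on hGi hU measurableSet_Ioo hGU).trans ?_
  simp only [U]
  rw [integral_const_mul, integral_add (ia.const_mul _) (ib.const_mul _), integral_const_mul,
    integral_const_mul]
  have e : ∀ c : ℝ, N ^ |γ| * (N ^ c * N ^ (-(c + 2 * l + 1))) = N ^ (|γ| - 1 - 2 * l) := fun c => by
    rw [← Real.rpow_add hN, ← Real.rpow_add hN]; congr 1; ring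
  have ja := mul_le_mul_of_nonneg_left (integral_rpow_pow_concentrated ha' hN hn) (Real.rpow_nonneg hN.le a)
  have jb := mul_le_mul_of_nonneg_left (integral_rpow_pow_concentrated hb' hN hn) (Real.rpow_nonneg hN.le b)
  calc _ ≤ C * N ^ |γ| * (N ^ a * (Real.exp 1 * Real.Gamma (a + 2 * l + 1) * N ^ (-(a + 2 * l + 1)))
        + N ^ b * (Real.exp 1 * Real.Gamma (b + 2 * l + 1) * N ^ (-(b + 2 * l + 1)))) :=
        mul_le_mul_of_nonneg_left (add_le_add ja jb) (mul_nonneg hC (Real.rpow_nonneg hN.le _))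
    _ = C * (Real.exp 1 * Real.Gamma (a + 2 * l + 1) * (N ^ |γ| * (N ^ a * N ^ (-(a + 2 * l + 1))))
        + Real.exp 1 * Real.Gamma (b + 2 * l + 1) * (N ^ |γ| * (N ^ b * N ^ (-(b + 2 * l + 1))))) := by ring
    _ = _ := by rw [e, e]; ring

/-- The same scaling with the weight x^|γ| that comes from x^γ and x^(2σ). -/
theorem exists_norm_wt_le (γ : ℝ) (l : ℕ) : ∃ C : ℝ, 0 ≤ C ∧
    ∀ (N : ℝ) (n : ℕ) (p : ℂ → ℂ), 0 < N → N ≤ n + 1 → Continuous p →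
      (∀ z, 0 < xr z → ‖p z‖ ^ 2 ≤ xr z ^ (2 * l) * (1 - xr z) ^ n) →
      ‖vec γ (wt γ p)‖ ^ 2 ≤ C * N ^ (-(|γ| + 2 * l + 1)) := by
  have hα : -1 < |γ| + 2 * l := by
    have := abs_nonneg γ
    have : (0 : ℝ) ≤ l := l.cast_nonneg
    linarith
  have hg : 0 < Real.Gamma (|γ| + 2 * l + 1) := Real.Gamma_pos_of_pos (by linarith)
  refine ⟨Real.pi * (Real.exp 1 * Real.Gamma (|γ| + 2 * l + 1)), by positivity,
    fun N n p hN hn hp hpz => ?_⟩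
  set G : ℝ → ℝ := fun x => x ^ (2 * sig γ) * (x ^ (2 * l) * (1 - x) ^ n)
  have hG : Set.EqOn (fun x : ℝ => x ^ (|γ| + 2 * l) * (1 - x) ^ n) (fun x => x ^ γ * G x)
      (Set.Ioo 0 1) := fun x hx => by
    have e : x ^ (|γ| + 2 * (l : ℝ)) = x ^ γ * (x ^ (2 * sig γ) * x ^ (2 * l)) := by
      rw [← Real.rpow_natCast x (2 * l), ← Real.rpow_add hx.1, ← Real.rpow_add hx.1, ← add_two_sig γ]
      congr 1; push_cast; ring
    simp only [G, e]; ring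
  have hn2 := norm_sq_vec_le (memLp_wt_of_continuous (γ := γ) hp) (g := fun z => G (xr z))
    (integrable_disk_radial.2 ((integrableOn_congr_fun hG measurableSet_Ioo).1
      (integrableOn_rpow_mul_pow hα n))) fun z hz => by
      rw [wt, norm_mul, mul_pow, Complex.norm_of_nonneg (Real.rpow_nonneg hz.le _),
        ← Real.rpow_mul_natCast hz.le, mul_comm (sig γ)]
      exact mul_le_mul_of_nonneg_left (hpz z hz) (Real.rpow_nonneg hz.le _)
  refine hn2.trans ?_
  rw [integral_disk_radial, ← setIntegral_congr_fun measurableSet_Ioo hG, mul_assoc Real.pi]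
  exact mul_le_mul_of_nonneg_left (integral_rpow_pow_concentrated hα hN hn) Real.pi_pos.le

/-! ### The pairing with the eigenvectors -/

theorem integral_one_sub_pow (n : ℕ) :
    ∫ x in Set.Ioo (0 : ℝ) 1, (1 - x) ^ n = 1 / (n + 1) := by
  rw [← integral_Ioc_eq_integral_Ioo, ← intervalIntegral.integral_of_le zero_le_one,
    intervalIntegral.integral_comp_sub_left (fun x : ℝ => x ^ n)]
  simp

theorem integrableOn_one_sub_pow (n : ℕ) :
    IntegrableOn (fun x : ℝ => (1 - x) ^ n) (Set.Ioo 0 1) :=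
  ((by fun_prop : Continuous fun x : ℝ => (1 - x) ^ n).integrableOn_Icc (a := 0) (b := 1)).mono_set
    Set.Ioo_subset_Icc_self

theorem integrableOn_log_mul {f : ℝ → ℝ} (hf : Continuous f) :
    IntegrableOn (fun x : ℝ => Real.log x * f x) (Set.Ioo 0 1) := by
  have h1 : IntervalIntegrable (fun x : ℝ => Real.log x * f x) volume 0 1 :=
    intervalIntegral.intervalIntegrable_log'.mul_continuousOn hf.continuousOn
  exact ((intervalIntegrable_iff_integrableOn_Ioc_of_le zero_le_one).1 h1).mono_set
    Set.Ioo_subset_Ioc_self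

theorem integrableOn_log_one_sub (ℓ : ℝ) (S : ℕ) :
    IntegrableOn (fun x : ℝ => (Real.log x + ℓ) * ((1 - x) ^ S - S * x * (1 - x) ^ (S - 1)))
      (Set.Ioo 0 1) := by
  have hf : Continuous fun x : ℝ => (1 - x) ^ S - S * x * (1 - x) ^ (S - 1) := by fun_prop
  have h2 : IntegrableOn (fun x : ℝ => ℓ * ((1 - x) ^ S - S * x * (1 - x) ^ (S - 1))) (Set.Ioo 0 1) :=
    ((continuous_const.mul hf).integrableOn_Icc (a := 0) (b := 1)).mono_set Set.Ioo_subset_Icc_self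
  refine ((integrableOn_log_mul hf).add h2).congr_fun (fun x _ => ?_) measurableSet_Ioo
  simp only [Pi.add_apply]; ring

/-- The polynomial factor is the derivative of x(1 - x)^S, so this is integration by parts. The
boundary term at x = 1 is ℓ · 0^S, present only for S = 0. -/
theorem integral_log_mul (ℓ : ℝ) (S : ℕ) :
    ∫ x in Set.Ioo (0 : ℝ) 1, (Real.log x + ℓ) * ((1 - x) ^ S - S * x * (1 - x) ^ (S - 1))
      = -(1 / (S + 1)) + ℓ * (0 : ℝ) ^ S := by
  set f : ℝ → ℝ := fun x => (1 - x) ^ S - S * x * (1 - x) ^ (S - 1)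
  have hf : Continuous f := by fun_prop
  have hd : ∀ x, HasDerivAt (fun x : ℝ => x * (1 - x) ^ S) (f x) x := by
    intro x
    have h1 := (hasDerivAt_id x).mul (((hasDerivAt_id x).const_sub 1).pow S)
    refine h1.congr_deriv ?_
    simp [f]; ring
  -- Grouping log x · x makes the primitive continuous at the endpoint 0.
  have hG : ContinuousOn (fun x : ℝ => (Real.log x * x) * (1 - x) ^ S + ℓ * (x * (1 - x) ^ S))
      (Set.Icc 0 1) := by
    have h0 : Continuous fun x : ℝ => Real.log x * x := by
      simpa only [mul_comm] using Real.continuous_mul_log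
    exact Continuous.continuousOn (by fun_prop)
  have hi : IntegrableOn (fun x : ℝ => (Real.log x + ℓ) * f x) (Set.Ioo 0 1) :=
    integrableOn_log_one_sub ℓ S
  have hI := hi.add (integrableOn_one_sub_pow S)
  have h3 : ∫ x in Set.Ioo (0 : ℝ) 1, ((Real.log x + ℓ) * f x + (1 - x) ^ S) = ℓ * (0 : ℝ) ^ S := by
    have h4 := intervalIntegral.integral_eq_sub_of_hasDerivAt_of_le zero_le_one hG
      (f' := fun x => (Real.log x + ℓ) * f x + (1 - x) ^ S) (fun x hx => ?_) ?_
    · rw [intervalIntegral.integral_of_le zero_le_one, integral_Ioc_eq_integral_Ioo] at h4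
      rw [h4]; simp
    · have h5 := ((Real.hasDerivAt_log hx.1.ne').mul (hd x)).add ((hd x).const_mul ℓ)
      convert h5 using 1
      · funext y; simp; ring
      · have : x ≠ 0 := hx.1.ne'
        field_simp
        ring
    · rw [intervalIntegrable_iff_integrableOn_Ioc_of_le zero_le_one, integrableOn_Ioc_iff_integrableOn_Ioo]
      exact hI
  rw [integral_add hi (integrableOn_one_sub_pow S), integral_one_sub_pow] at h3
  linarith

theorem conj_mono_mul_mono (m : ℤ) (j i : ℕ) (z : ℂ) :
    conj (mono m j z) * mono m i z = (((1 - xr z) ^ (m.toNat + (-m).toNat + i + j) : ℝ) : ℂ) := by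
  have h : ((1 - xr z : ℝ) : ℂ) = z * conj z := by push_cast; rw [xr_eq]; ring
  rw [Complex.ofReal_pow, h]
  simp only [mono, zpw, map_mul, map_pow, Complex.conj_conj]
  ring

theorem conj_mono_mul_keldysh (β : ℝ) (m : ℤ) (j i : ℕ) (z : ℂ) :
    conj (mono m j z) * keldysh β (mono m i) z
      = (((|(m : ℝ)| + 2 * i + 1 + β) ^ 2 * (1 - xr z) ^ (m.toNat + (-m).toNat + i + j)
        - dco m i * (1 - xr z) ^ (m.toNat + (-m).toNat + i + j - 1) : ℝ) : ℂ) := by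
  rw [keldysh_mono_eq, mul_sub, mul_left_comm, conj_mono_mul_mono, mul_left_comm, conj_mono_mul_mono]
  rcases i with _ | i
  · simp [dco]
  · rw [show m.toNat + (-m).toNat + (i + 1) + j - 1 = m.toNat + (-m).toNat + (i + 1 - 1) + j by omega]
    push_cast; ring

/-- The value of the pairing of the singular solutions with the boundary values. -/
def kap (γ : ℝ) : ℝ := if γ = 0 then -4 * Real.pi else 4 * Real.pi * |γ|

theorem kap_ne_zero (γ : ℝ) : kap γ ≠ 0 := by
  have := Real.pi_pos.ne'
  rw [kap]
  split_ifs with h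
  · exact mul_ne_zero (by norm_num) this
  · exact mul_ne_zero (mul_ne_zero (by norm_num) this) (abs_ne_zero.2 h)

/-- In a single mode the integrand depends only on x. The coefficients factor: (|m|+2i+1+β)² -
(|m|+2j+1-β)² = 4(i-j+β)(|m|+i+j+1) with β = |γ|, and `dco m i` - `dco m j` = 4(i-j)(|m|+i+j). -/
theorem conj_dual_sub {γ ℓ : ℝ} (m : ℤ) (j i : ℕ) (z : ℂ) :
    conj (dual γ ℓ (mono m j) z) * wt γ (keldysh |γ| (mono m i)) z
        - conj (dualL γ ℓ (mono m j) z) * wt γ (mono m i) z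
      = ((hfun γ ℓ (xr z) * xr z ^ sig γ *
          (4 * (i - j + |γ|) * (|(m : ℝ)| + i + j + 1) * (1 - xr z) ^ (m.toNat + (-m).toNat + i + j)
            - 4 * (i - j) * (|(m : ℝ)| + i + j) * (1 - xr z) ^ (m.toNat + (-m).toNat + i + j - 1))
          - (if γ = 0 then 4 else 0) * (|(m : ℝ)| + 2 * j + 1) * xr z ^ sig γ
            * (1 - xr z) ^ (m.toNat + (-m).toNat + i + j) : ℝ) : ℂ) := by
  have e1 := conj_mono_mul_keldysh |γ| m j i z
  have e2 := congrArg conj (conj_mono_mul_keldysh (-|γ|) m i j z)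
  have e3 := conj_mono_mul_mono m j i z
  have e4 : euler (mono m j) z = ((|(m : ℝ)| + 2 * j : ℝ) : ℂ) * mono m j z := by
    rw [mono, euler_zpw, ← toNat_add]; push_cast; ring
  rw [add_right_comm _ j i, map_mul, Complex.conj_conj, Complex.conj_ofReal] at e2
  have e5 : conj (if γ = 0 then 4 else 0 : ℂ) = ((if γ = 0 then 4 else 0 : ℝ) : ℂ) := by
    split_ifs
    · simp [Complex.conj_ofNat]
    · simp
  simp only [dual, dualL, wt, map_add, map_mul, Complex.conj_ofReal, e4, e5]
  generalize (if γ = 0 then 4 else 0 : ℝ) = c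
  generalize m.toNat + (-m).toNat + i + j = S at *
  have hdco : ∀ k, dco m k = (|(m : ℝ)| + 2 * k) ^ 2 - |(m : ℝ)| ^ 2 := fun k => by rw [dco]; ring
  simp only [hdco] at e1 e2
  push_cast at e1 e2 e3 ⊢
  linear_combination (hfun γ ℓ (xr z) : ℂ) * (xr z ^ sig γ : ℝ) * (e1 - e2)
    - c * (((|(m : ℝ)| : ℝ) : ℂ) + 2 * j + 1) * (xr z ^ sig γ : ℝ) * e3

/-- The boundary term of Green's formula, evaluated by explicit integrals instead of a limit. For γ
≠ 0 the powers of x cancel, and integrating (1 - x)^S and (1 - x)^(S-1) leaves 4(i-j+|γ|) - 4(i-j) =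
4|γ|; for γ = 0 the logarithmic integral plays this role. -/
theorem dual_pairing {γ : ℝ} (hγ : γ ∈ Set.Ioo (-1 : ℝ) 1) (ℓ : ℝ) (m : ℤ) (j i : ℕ) :
    ⟪vec γ (dual γ ℓ (mono m j)), lmonoVec γ m i⟫_ℂ
      - ⟪vec γ (dualL γ ℓ (mono m j)), monoVec γ m i⟫_ℂ = kap γ := by
  have hL : MemLp (wt γ (keldysh |γ| (mono m i))) 2 (diskMeasure γ) :=
    memLp_wt_of_continuous (continuous_keldysh _ (contDiff_mono m i))
  have hM : MemLp (wt γ (mono m i)) 2 (diskMeasure γ) :=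
    memLp_wt_of_continuous (contDiff_mono m i).continuous
  have hd := memLp_dual_of_continuous hγ ℓ (contDiff_mono m j).continuous
  have hdL := memLp_dualL hγ ℓ (contDiff_mono m j)
  have hint : ∀ {f g : ℂ → ℂ}, MemLp f 2 (diskMeasure γ) → MemLp g 2 (diskMeasure γ) →
      Integrable (fun z => conj (f z) * g z) (diskMeasure γ) := fun hf hg =>
    hf.star.integrable_mul hg
  rw [← vec_wt_keldysh_mono, monoVec, inner_vec hd hL, inner_vec hdL hM,
    ← integral_sub (hint hd hL) (hint hdL hM)]
  simp only [conj_dual_sub]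
  rw [integral_complex_ofReal, integral_disk_radial γ (fun x => hfun γ ℓ x * x ^ sig γ *
          (4 * (i - j + |γ|) * (|(m : ℝ)| + i + j + 1) * (1 - x) ^ (m.toNat + (-m).toNat + i + j)
            - 4 * (i - j) * (|(m : ℝ)| + i + j) * (1 - x) ^ (m.toNat + (-m).toNat + i + j - 1))
          - (if γ = 0 then 4 else 0) * (|(m : ℝ)| + 2 * j + 1) * x ^ sig γ
            * (1 - x) ^ (m.toNat + (-m).toNat + i + j))]
  congr 1
  have hSr : ((m.toNat + (-m).toNat + i + j : ℕ) : ℝ) = |(m : ℝ)| + i + j := by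
    push_cast; rw [toNat_add]
  -- When S = 0 the truncated exponent S - 1 and the term 0^S need care; both come with the factor i
  -- - j, which is then zero.
  have hS0 : m.toNat + (-m).toNat + i + j = 0 → i = j := by omega
  generalize m.toNat + (-m).toNat + i + j = S at *
  have hS1 : (S : ℝ) + 1 ≠ 0 := by positivity
  rw [← hSr]
  have hT : ∀ x : ℝ, (S : ℝ) * (1 - x) ^ S = S * ((1 - x) * (1 - x) ^ (S - 1)) := fun x => by
    rcases S with _ | S
    · simp
    · rw [Nat.add_sub_cancel, pow_succ']
  have hij : ((i : ℝ) - j) * (0 : ℝ) ^ S = 0 := by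
    rcases Nat.eq_zero_or_pos S with h | h
    · simp [hS0 h]
    · simp [h.ne']
  rw [kap]
  split_ifs with h
  · subst h
    have e : Set.EqOn (fun x : ℝ => x ^ (0 : ℝ) * (hfun 0 ℓ x * x ^ sig 0 *
          (4 * (i - j + |0|) * (S + 1) * (1 - x) ^ S - 4 * (i - j) * S * (1 - x) ^ (S - 1))
          - 4 * (|(m : ℝ)| + 2 * j + 1) * x ^ sig 0 * (1 - x) ^ S))
        (fun x : ℝ => 4 * ((i : ℝ) - j) *
          ((Real.log x + ℓ) * ((1 - x) ^ S - S * x * (1 - x) ^ (S - 1)))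
          - 4 * (|(m : ℝ)| + 2 * j + 1) * (1 - x) ^ S) (Set.Ioo 0 1) := fun x hx => by
      simp only [hfun, sig, neg_zero, max_self, Real.rpow_zero, if_true, abs_zero]
      linear_combination 4 * ((i : ℝ) - j) * (Real.log x + ℓ) * hT x
    rw [setIntegral_congr_fun measurableSet_Ioo e,
      integral_sub ((integrableOn_log_one_sub ℓ S).const_mul _)
        ((integrableOn_one_sub_pow S).const_mul _),
      integral_const_mul, integral_const_mul, integral_log_mul, integral_one_sub_pow]
    have h1 : |(m : ℝ)| = S - i - j := by linarith
    rw [h1]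
    field_simp
    linear_combination ℓ * (S + 1) * hij
  · have e : Set.EqOn (fun x : ℝ => x ^ γ * (hfun γ ℓ x * x ^ sig γ *
          (4 * (i - j + |γ|) * (S + 1) * (1 - x) ^ S - 4 * (i - j) * S * (1 - x) ^ (S - 1))
          - 0 * (|(m : ℝ)| + 2 * j + 1) * x ^ sig γ * (1 - x) ^ S))
        (fun x : ℝ => 4 * (i - j + |γ|) * (S + 1) * (1 - x) ^ S
          - 4 * (i - j) * S * (1 - x) ^ (S - 1)) (Set.Ioo 0 1) := fun x hx => by
      have h1 : x ^ γ * (x ^ (-max γ 0) * x ^ sig γ) = 1 := by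
        rw [← Real.rpow_add hx.1, ← Real.rpow_add hx.1, sig]
        rcases lt_or_gt_of_ne h with h | h
        · rw [max_eq_right h.le, max_eq_left (by linarith)]; simp
        · rw [max_eq_left h.le, max_eq_right (by linarith)]; simp
      simp only [hfun, if_neg h]
      linear_combination (4 * (i - j + |γ|) * (S + 1) * (1 - x) ^ S
          - 4 * (i - j) * S * (1 - x) ^ (S - 1)) * h1
    rw [setIntegral_congr_fun measurableSet_Ioo e,
      integral_sub ((integrableOn_one_sub_pow S).const_mul _)
        ((integrableOn_one_sub_pow (S - 1)).const_mul _),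
      integral_const_mul, integral_const_mul, integral_one_sub_pow, integral_one_sub_pow]
    rcases Nat.eq_zero_or_pos S with h0 | h0
    · simp only [h0, hS0 h0]; simp; ring
    · rw [Nat.cast_sub h0, Nat.cast_one, sub_add_cancel]
      have : (S : ℝ) ≠ 0 := by exact_mod_cast h0.ne'
      field_simp
      ring

/-! ### Bounds for the boundary values of the eigenfunctions -/

theorem norm_sq_mono (m : ℤ) (j : ℕ) (z : ℂ) :
    ‖mono m j z‖ ^ 2 = (1 - xr z) ^ (m.toNat + j + ((-m).toNat + j)) := norm_sq_zpw _ _ z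

/-- Substituting M_{j-1} = M_j + x M_{j-1} replaces the diagonal coefficient by a difference of
linear size in j, when m² is at most j. The quadratic coefficient is left in front of x M_{j-1},
which is smaller by one power in the boundary layer. -/
theorem keldysh_mono_concentrated (β : ℝ) (m : ℤ) {j : ℕ} (hj : 0 < j) (z : ℂ) :
    keldysh β (mono m j) z
      = (((|(m : ℝ)| + 2 * j + 1 + β) ^ 2 - dco m j : ℝ) : ℂ) * mono m j z
        + (-(dco m j : ℂ)) * ((xr z : ℂ) * mono m (j - 1) z) := by
  have h : mono m j z = (1 - (xr z : ℂ)) * mono m (j - 1) z := by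
    obtain ⟨i, rfl⟩ := Nat.exists_eq_succ_of_ne_zero hj.ne'
    rw [xr_eq, Nat.succ_sub_one]
    simp only [mono, zpw, Nat.succ_eq_add_one, ← add_assoc, pow_succ]
    ring
  rw [keldysh_mono_eq]
  push_cast
  linear_combination (dco m j : ℂ) * h

theorem norm_add_three_sq_le {E : Type*} [SeminormedAddCommGroup E] (a b c : E) :
    ‖a + b + c‖ ^ 2 ≤ 3 * (‖a‖ ^ 2 + ‖b‖ ^ 2 + ‖c‖ ^ 2) := by
  have h := norm_add₃_le (a := a) (b := b) (c := c)
  have h2 := pow_le_pow_left₀ (norm_nonneg _) h 2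
  nlinarith [sq_nonneg (‖a‖ - ‖b‖), sq_nonneg (‖a‖ - ‖c‖), sq_nonneg (‖b‖ - ‖c‖)]

/-- The test function lives in x ≲ 1/N, where applying the operator costs one power of N in norm
provided m² ≲ N. The constants are 64 = 8² from A ≤ 8N, 81 = 9² from D ≤ 9N², and 256 = 16² from the
logarithmic correction. -/
theorem exists_dual_bounds {γ : ℝ} (hγ : γ ∈ Set.Ioo (-1 : ℝ) 1) : ∃ C : ℝ, 0 ≤ C ∧
    ∀ (m : ℤ) (N : ℕ), 1 + (m : ℝ) ^ 2 ≤ N →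
      ‖vec γ (dual γ (Real.log N) (mono m N))‖ ^ 2 ≤ C * (N : ℝ) ^ (|γ| - 1) ∧
      ‖vec γ (dualL γ (Real.log N) (mono m N))‖ ^ 2 ≤ C * (N : ℝ) ^ (|γ| + 1) := by
  obtain ⟨C0, h0, H0⟩ := exists_norm_dual_le hγ 0
  obtain ⟨C1, h1, H1⟩ := exists_norm_dual_le hγ 1
  obtain ⟨C2, h2, H2⟩ := exists_norm_wt_le γ 0
  refine ⟨C0 + 3 * (64 * C0 + 81 * C1 + 256 * C2), by positivity, fun m N hN => ?_⟩
  set ℓ := Real.log N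
  have hN1 : (1 : ℝ) ≤ N := by nlinarith [sq_nonneg (m : ℝ)]
  have hN0 : (0 : ℝ) < N := by linarith
  have hNn : 0 < N := by exact_mod_cast hN0
  have hcm := (contDiff_mono m N).continuous
  have hcx : Continuous fun z => (xr z : ℂ) * mono m (N - 1) z :=
    (Complex.continuous_ofReal.comp continuous_xr).mul (contDiff_mono m (N - 1)).continuous
  have e0 : (N : ℝ) ≤ (m.toNat + N + ((-m).toNat + N) : ℕ) + 1 := by
    exact_mod_cast (by omega : N ≤ m.toNat + N + ((-m).toNat + N) + 1)
  have e1 : (N : ℝ) ≤ (m.toNat + (N - 1) + ((-m).toNat + (N - 1)) : ℕ) + 1 := by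
    exact_mod_cast (by omega : N ≤ m.toNat + (N - 1) + ((-m).toNat + (N - 1)) + 1)
  have b0 := H0 N _ (mono m N) hN0 e0 hcm
    (fun z _ => by rw [norm_sq_mono]; simp)
  have b1 := H1 N _ (fun z => (xr z : ℂ) * mono m (N - 1) z) hN0
    e1 hcx
    (fun z _ => by
      rw [norm_mul, mul_pow, Complex.norm_real, Real.norm_eq_abs, sq_abs, norm_sq_mono])
  have b2 := H2 N _ (mono m N) hN0 e0 hcm
    (fun z _ => by rw [norm_sq_mono]; simp)
  have hr : ∀ r : ℝ, 0 ≤ (N : ℝ) ^ r := fun r => Real.rpow_nonneg hN0.le r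
  simp only [Nat.cast_zero, mul_zero, sub_zero, add_zero, Nat.cast_one, mul_one] at b0 b1 b2
  refine ⟨b0.trans (mul_le_mul_of_nonneg_right (by linarith) (hr _)), ?_⟩
  set A : ℝ := (|(m : ℝ)| + 2 * N + 1 + -|γ|) ^ 2 - dco m N
  set D : ℝ := dco m N
  set c : ℝ := if γ = 0 then 4 else 0
  set K : ℝ := c * (|(m : ℝ)| + 2 * N + 1)
  have hm1 : |(m : ℝ)| ≤ (m : ℝ) ^ 2 := by
    rcases eq_or_ne m 0 with h | h
    · simp [h]
    · have h3 : (1 : ℝ) ≤ |(m : ℝ)| := by exact_mod_cast Int.one_le_abs h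
      rw [← sq_abs]; nlinarith
  have hm0 := abs_nonneg (m : ℝ)
  have hg0 := abs_nonneg γ
  have hg1 : |γ| < 1 := abs_lt.2 hγ
  have hD : D = (|(m : ℝ)| + 2 * N) ^ 2 - (m : ℝ) ^ 2 := by
    simp only [D, dco]; rw [← sq_abs (m : ℝ)]; ring
  have hDn : 0 ≤ D := by simp only [D, dco]; positivity
  have hDle : D ≤ 9 * (N : ℝ) ^ 2 := by rw [hD]; nlinarith [sq_nonneg (m : ℝ)]
  have hA : A = 2 * (|(m : ℝ)| + 2 * N) * (1 - |γ|) + (1 - |γ|) ^ 2 + (m : ℝ) ^ 2 := by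
    have : A = (|(m : ℝ)| + 2 * N + 1 + -|γ|) ^ 2 - D := rfl
    rw [this, hD]; ring
  have hAn : 0 ≤ A := by rw [hA]; have : 0 ≤ 1 - |γ| := by linarith
                         positivity
  have hAle : A ≤ 8 * N := by
    rw [hA]
    have e1 : 2 * (|(m : ℝ)| + 2 * N) * (1 - |γ|) ≤ 2 * (|(m : ℝ)| + 2 * N) * 1 :=
      mul_le_mul_of_nonneg_left (by linarith) (by positivity)
    have e2 : (1 - |γ|) ^ 2 ≤ 1 := pow_le_one₀ (by linarith) (by linarith)
    linarith
  have hfun : vec γ (dualL γ ℓ (mono m N)) = (A : ℂ) • vec γ (dual γ ℓ (mono m N))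
      + (-(D : ℂ)) • vec γ (dual γ ℓ fun z => (xr z : ℂ) * mono m (N - 1) z)
      + (K : ℂ) • vec γ (mono m N) := by
    have l0 := memLp_dual_of_continuous hγ ℓ hcm
    have l1 := memLp_dual_of_continuous hγ ℓ hcx
    obtain ⟨Cm, hCm⟩ := bounded_of_contDiff hcm
    have l2 := memLp_bounded hγ.1 hcm.continuousOn hCm
    have l01 : MemLp (fun z => (A : ℂ) * dual γ ℓ (mono m N) z
        + -(D : ℂ) * dual γ ℓ (fun z => (xr z : ℂ) * mono m (N - 1) z) z) 2 (diskMeasure γ) :=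
      (l0.const_mul _).add (l1.const_mul _)
    rw [← vec_const_mul _ l0, ← vec_const_mul _ l1, ← vec_const_mul _ l2,
      ← vec_add (l0.const_mul _) (l1.const_mul _), ← vec_add l01 (l2.const_mul _)]
    congr 1
    funext z
    have e4 : euler (mono m N) z = ((|(m : ℝ)| + 2 * N : ℝ) : ℂ) * mono m N z := by
      rw [mono, euler_zpw, ← toNat_add]; push_cast; ring
    have e5 : (if γ = 0 then 4 else 0 : ℂ) = (c : ℂ) := by simp only [c]; split_ifs <;> simp
    rw [dualL, e4, e5]
    simp only [dual]
    rw [keldysh_mono_concentrated _ m hNn]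
    simp only [K, A, D]
    push_cast
    ring
  have hK : K ^ 2 * ‖vec γ (mono m N)‖ ^ 2 ≤ 256 * C2 * (N : ℝ) ^ (|γ| + 1) := by
    by_cases h : γ = 0
    · subst h
      have hw : wt 0 (mono m N) = mono m N := by funext z; simp [wt, sig]
      rw [hw] at b2
      have hKle : K ≤ 16 * N := by simp only [K, c, if_true]; linarith
      have hKn : 0 ≤ K := by simp only [K, c, if_true]; positivity
      calc K ^ 2 * ‖vec 0 (mono m N)‖ ^ 2 ≤ (16 * N) ^ 2 * (C2 * (N : ℝ) ^ (-(|(0 : ℝ)| + 1))) :=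
            mul_le_mul (pow_le_pow_left₀ hKn hKle 2) b2 (sq_nonneg _) (sq_nonneg _)
        _ = 256 * C2 * ((N : ℝ) ^ (-(|(0 : ℝ)| + 1)) * (N : ℝ) ^ 2) := by ring
        _ = _ := by
            rw [← Real.rpow_add_natCast hN0.ne']; congr 2; push_cast; simp; norm_num
    · simp only [K, c, if_neg h, zero_mul]
      rw [zero_pow two_ne_zero, zero_mul]
      exact mul_nonneg (by positivity) (hr _)
  have hA2 : A ^ 2 * ‖vec γ (dual γ ℓ (mono m N))‖ ^ 2 ≤ 64 * C0 * (N : ℝ) ^ (|γ| + 1) := by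
    calc _ ≤ (8 * N) ^ 2 * (C0 * (N : ℝ) ^ (|γ| - 1)) :=
          mul_le_mul (pow_le_pow_left₀ hAn hAle 2) b0 (sq_nonneg _) (sq_nonneg _)
      _ = 64 * C0 * ((N : ℝ) ^ (|γ| - 1) * (N : ℝ) ^ 2) := by ring
      _ = _ := by rw [← Real.rpow_add_natCast hN0.ne']; congr 2; push_cast; ring
  have hD2 : D ^ 2 * ‖vec γ (dual γ ℓ fun z => (xr z : ℂ) * mono m (N - 1) z)‖ ^ 2
      ≤ 81 * C1 * (N : ℝ) ^ (|γ| + 1) := by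
    calc _ ≤ (9 * (N : ℝ) ^ 2) ^ 2 * (C1 * (N : ℝ) ^ (|γ| - 1 - 2)) :=
          mul_le_mul (pow_le_pow_left₀ hDn hDle 2) b1 (sq_nonneg _) (sq_nonneg _)
      _ = 81 * C1 * ((N : ℝ) ^ (|γ| - 1 - 2) * (N : ℝ) ^ 4) := by ring
      _ = _ := by rw [← Real.rpow_add_natCast hN0.ne']; congr 2; push_cast; ring
  rw [hfun]
  refine (norm_add_three_sq_le _ _ _).trans ?_
  have hn : ∀ (r : ℝ) (v : L2 γ), ‖(r : ℂ) • v‖ ^ 2 = r ^ 2 * ‖v‖ ^ 2 := fun r v => by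
    rw [norm_smul, mul_pow, Complex.norm_real, Real.norm_eq_abs, sq_abs]
  rw [neg_smul, norm_neg, hn, hn, hn]
  have hr1 := mul_nonneg h0 (hr (|γ| + 1))
  nlinarith

/-- `kap γ` · bv_k = λ_k⟨ψ, e_k⟩ - ⟨χ, e_k⟩ by Green's formula. With λ_k ≤ N, Bessel's inequality
bounds the sum of squares by 2N²‖ψ‖² + 2‖χ‖², and both terms have order N^(1+|γ|). -/
theorem exists_bv_block_bound {γ : ℝ} (hγ : γ ∈ Set.Ioo (-1 : ℝ) 1) : ∃ C : ℝ, 0 ≤ C ∧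
    ∀ (m : ℤ) (N : ℕ), 1 + (m : ℝ) ^ 2 ≤ N → ∀ F : Finset ℕ, (∀ k ∈ F, lam γ m k ≤ N) →
      ∑ k ∈ F, bv γ m k ^ 2 ≤ C * (N : ℝ) ^ (|γ| + 1) := by
  obtain ⟨C, hC, H⟩ := exists_dual_bounds hγ
  have hκ : 0 < kap γ ^ 2 := sq_pos_of_ne_zero (kap_ne_zero γ)
  refine ⟨4 * C / kap γ ^ 2, by positivity, fun m N hN F hF => ?_⟩
  obtain ⟨b0, b1⟩ := H m N hN
  set ψ := vec γ (dual γ (Real.log N) (mono m N))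
  set χ := vec γ (dualL γ (Real.log N) (mono m N))
  have hN0 : (0 : ℝ) < N := by nlinarith [sq_nonneg (m : ℝ)]
  have hon : Orthonormal ℂ fun k : ℕ => eig γ (m, k) :=
    (orthonormal_eig hγ).comp (fun k : ℕ => (m, k)) fun a b h => by simpa using h
  have B0 := hon.sum_inner_products_le (x := ψ) (s := F)
  have B1 := hon.sum_inner_products_le (x := χ) (s := F)
  have hk : ∀ k ∈ F, kap γ ^ 2 * bv γ m k ^ 2
      ≤ 2 * (N : ℝ) ^ 2 * ‖⟪eig γ (m, k), ψ⟫_ℂ‖ ^ 2 + 2 * ‖⟪eig γ (m, k), χ⟫_ℂ‖ ^ 2 := by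
    intro k hk
    have h := inner_sub_eig (fun j => dual_pairing hγ (Real.log N) m N j) k
    have h2 : kap γ ^ 2 * bv γ m k ^ 2 = ‖(kap γ : ℂ) * bv γ m k‖ ^ 2 := by
      rw [← Complex.ofReal_mul, Complex.norm_real, Real.norm_eq_abs, sq_abs, mul_pow]
    rw [h2, ← h, norm_inner_symm (eig γ (m, k)) ψ, norm_inner_symm (eig γ (m, k)) χ]
    have h3 := norm_sub_le ((lam γ m k : ℂ) * ⟪ψ, eig γ (m, k)⟫_ℂ) ⟪χ, eig γ (m, k)⟫_ℂ
    rw [norm_mul, Complex.norm_of_nonneg (lam_pos γ m k).le] at h3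
    have h4 : lam γ m k * ‖⟪ψ, eig γ (m, k)⟫_ℂ‖ ≤ N * ‖⟪ψ, eig γ (m, k)⟫_ℂ‖ :=
      mul_le_mul_of_nonneg_right (hF k hk) (norm_nonneg _)
    have h5 := pow_le_pow_left₀ (norm_nonneg _) (h3.trans (add_le_add_left h4 _)) 2
    nlinarith [sq_nonneg (N * ‖⟪ψ, eig γ (m, k)⟫_ℂ‖ - ‖⟪χ, eig γ (m, k)⟫_ℂ‖)]
  have hs := Finset.sum_le_sum hk
  rw [← Finset.mul_sum, Finset.sum_add_distrib, ← Finset.mul_sum, ← Finset.mul_sum] at hs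
  have e : (N : ℝ) ^ (|γ| - 1) * (N : ℝ) ^ 2 = (N : ℝ) ^ (|γ| + 1) := by
    rw [← Real.rpow_add_natCast hN0.ne']; congr 1; push_cast; ring
  rw [div_mul_eq_mul_div, le_div_iff₀ hκ, mul_comm]
  calc _ ≤ _ := hs
    _ ≤ 2 * (N : ℝ) ^ 2 * (C * (N : ℝ) ^ (|γ| - 1)) + 2 * (C * (N : ℝ) ^ (|γ| + 1)) :=
      add_le_add (mul_le_mul_of_nonneg_left (B0.trans b0) (by positivity))
        (mul_le_mul_of_nonneg_left (B1.trans b1) (by positivity))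
    _ = _ := by rw [← e]; ring

theorem le_lam (γ : ℝ) (m : ℤ) (k : ℕ) : 1 + (m : ℝ) ^ 2 ≤ lam γ m k := by
  rw [lam, ← sq_abs (m : ℝ)]
  have h1 := abs_nonneg (m : ℝ)
  have h2 := abs_nonneg γ
  have h3 : (0 : ℝ) ≤ k := k.cast_nonneg
  nlinarith [mul_nonneg h1 h2, mul_nonneg h1 h3]

/-- The eigenvalues are grouped by 4^i ≤ λ/Λ < 4^(i+1) with Λ = 1 + m². The block bound yields a
geometric series of ratio 4^(1+|γ|-s), which is less than 1 because s > 1 + |γ|. -/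
theorem exists_bv_sum_bound {γ s : ℝ} (hγ : γ ∈ Set.Ioo (-1 : ℝ) 1) (hs : 1 + |γ| < s) :
    ∃ C : ℝ, 0 ≤ C ∧ ∀ (m : ℤ) (F : Finset ℕ),
      ∑ k ∈ F, bv γ m k ^ 2 * lam γ m k ^ (-s) ≤ C * (1 + (m : ℝ) ^ 2) ^ (1 + |γ| - s) := by
  obtain ⟨C, hC, H⟩ := exists_bv_block_bound hγ
  set r : ℝ := 4 ^ (1 + |γ| - s)
  have hr0 : 0 ≤ r := Real.rpow_nonneg (by norm_num) _
  have hr1 : r < 1 := Real.rpow_lt_one_of_one_lt_of_neg (by norm_num) (by linarith)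
  have hs0 : 0 < s := by linarith [abs_nonneg γ]
  refine ⟨C * 4 ^ (|γ| + 1) * (1 - r)⁻¹, mul_nonneg (by positivity) (inv_nonneg.2 (by linarith)),
    fun m F => ?_⟩
  -- Λ is kept a natural number, so that Λ 4^(i+1) is an admissible degree N in the block bound.
  set Λ : ℕ := 1 + m.natAbs ^ 2
  have hΛ : (Λ : ℝ) = 1 + (m : ℝ) ^ 2 := by
    simp only [Λ]; push_cast; rw [Nat.cast_natAbs, Int.cast_abs, sq_abs]
  rw [← hΛ]
  have hΛ0 : (0 : ℝ) < Λ := by rw [hΛ]; positivity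
  have hex : ∀ k, ∃ i : ℕ, (4 : ℝ) ^ i ≤ lam γ m k / Λ ∧ lam γ m k / Λ < 4 ^ (i + 1) := fun k =>
    exists_nat_pow_near (by rw [one_le_div hΛ0, hΛ]; exact le_lam γ m k) (by norm_num)
  choose idx hidx using hex
  have hblock : ∀ i, ∑ k ∈ F.filter (fun k => idx k = i), bv γ m k ^ 2 * lam γ m k ^ (-s)
      ≤ C * 4 ^ (|γ| + 1) * (Λ : ℝ) ^ (1 + |γ| - s) * r ^ i := by
    intro i
    have h1 := H m (Λ * 4 ^ (i + 1)) (by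
      push_cast; rw [← hΛ]
      exact le_mul_of_one_le_right hΛ0.le (one_le_pow₀ (by norm_num))) (F.filter fun k => idx k = i)
      (fun k hk => by
        have := (hidx k).2
        rw [(Finset.mem_filter.1 hk).2, div_lt_iff₀ hΛ0] at this
        push_cast
        linarith)
    have h2 : ∀ k ∈ F.filter (fun k => idx k = i), bv γ m k ^ 2 * lam γ m k ^ (-s)
        ≤ bv γ m k ^ 2 * ((Λ : ℝ) * 4 ^ i) ^ (-s) := fun k hk => by
      have := (hidx k).1
      rw [(Finset.mem_filter.1 hk).2, le_div_iff₀ hΛ0, mul_comm] at this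
      exact mul_le_mul_of_nonneg_left (Real.rpow_le_rpow_of_nonpos (by positivity) this (by linarith))
        (sq_nonneg _)
    refine (Finset.sum_le_sum h2).trans ?_
    rw [← Finset.sum_mul]
    refine (mul_le_mul_of_nonneg_right h1 (Real.rpow_nonneg (by positivity) _)).trans (le_of_eq ?_)
    push_cast
    have e1 : ((4 : ℝ) ^ (i + 1)) ^ (|γ| + 1) = 4 ^ (|γ| + 1) * ((4 : ℝ) ^ (|γ| + 1)) ^ i := by
      rw [← Real.rpow_natCast, ← Real.rpow_mul (by norm_num), ← Real.rpow_natCast ((4 : ℝ) ^ (|γ| + 1)),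
        ← Real.rpow_mul (by norm_num), ← Real.rpow_add (by norm_num)]
      congr 1; push_cast; ring
    have e2 : ((4 : ℝ) ^ i) ^ (-s) = ((4 : ℝ) ^ (-s)) ^ i := by
      rw [← Real.rpow_natCast, ← Real.rpow_mul (by norm_num), ← Real.rpow_natCast ((4 : ℝ) ^ (-s)),
        ← Real.rpow_mul (by norm_num), mul_comm]
    have e3 : r ^ i = ((4 : ℝ) ^ (|γ| + 1)) ^ i * ((4 : ℝ) ^ (-s)) ^ i := by
      rw [← mul_pow, ← Real.rpow_add (by norm_num)]
      simp only [r]; congr 2; ring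
    have e4 : (Λ : ℝ) ^ (1 + |γ| - s) = (Λ : ℝ) ^ (|γ| + 1) * (Λ : ℝ) ^ (-s) := by
      rw [← Real.rpow_add hΛ0]; congr 1; ring
    rw [Real.mul_rpow hΛ0.le (by positivity), Real.mul_rpow hΛ0.le (by positivity), e1, e2, e3, e4]
    ring
  rw [← Finset.sum_fiberwise_of_maps_to (fun k hk => Finset.mem_image_of_mem idx hk)]
  refine (Finset.sum_le_sum fun i _ => hblock i).trans ?_
  rw [← Finset.mul_sum, ← tsum_geometric_of_lt_one hr0 hr1]
  have h3 := (summable_geometric_of_lt_one hr0 hr1).sum_le_tsum (F.image idx) fun i _ => pow_nonneg hr0 i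
  calc _ ≤ C * 4 ^ (|γ| + 1) * (Λ : ℝ) ^ (1 + |γ| - s) * ∑' i, r ^ i :=
        mul_le_mul_of_nonneg_left h3 (mul_nonneg (by positivity) (Real.rpow_nonneg hΛ0.le _))
    _ = _ := by ring

theorem cauchy_schwarz_tsum {a : ℕ → ℝ} {c : ℕ → ℂ} {A B : ℝ} (ha : ∀ F : Finset ℕ, ∑ k ∈ F, a k ^ 2 ≤ A)
    (hc : ∀ F : Finset ℕ, ∑ k ∈ F, ‖c k‖ ^ 2 ≤ B) :
    Summable (fun k => (a k : ℂ) * c k) ∧ ‖∑' k, (a k : ℂ) * c k‖ ^ 2 ≤ A * B := by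
  have sa : Summable fun k => a k ^ 2 := summable_of_sum_le (fun _ => sq_nonneg _) ha
  have sc : Summable fun k => ‖c k‖ ^ 2 := summable_of_sum_le (fun _ => sq_nonneg _) hc
  have hs : Summable fun k => (a k : ℂ) * c k := by
    refine Summable.of_norm_bounded (sa.add sc) fun k => ?_
    rw [norm_mul, Complex.norm_real, Real.norm_eq_abs, ← sq_abs (a k)]
    nlinarith [sq_nonneg (|a k| - ‖c k‖), sq_nonneg (|a k| + ‖c k‖)]
  refine ⟨hs, le_of_tendsto ((continuous_norm.pow 2).continuousAt.tendsto.comp hs.hasSum)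
    (Eventually.of_forall fun F => ?_)⟩
  have hA : 0 ≤ A := by simpa using ha ∅
  have h1 : ‖∑ k ∈ F, (a k : ℂ) * c k‖ ≤ ∑ k ∈ F, |a k| * ‖c k‖ :=
    (norm_sum_le _ _).trans (le_of_eq (Finset.sum_congr rfl fun k _ => by
      rw [norm_mul, Complex.norm_real, Real.norm_eq_abs]))
  calc ‖∑ k ∈ F, (a k : ℂ) * c k‖ ^ 2 ≤ (∑ k ∈ F, |a k| * ‖c k‖) ^ 2 :=
        pow_le_pow_left₀ (norm_nonneg _) h1 2
    _ ≤ (∑ k ∈ F, |a k| ^ 2) * ∑ k ∈ F, ‖c k‖ ^ 2 := Finset.sum_mul_sq_le_sq_mul_sq ..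
    _ ≤ A * B := by
      simp only [sq_abs]
      exact mul_le_mul (ha F) (hc F) (Finset.sum_nonneg fun _ _ => sq_nonneg _) hA

/-! ### Frequency localization of concentrating monomials -/

theorem le_of_sq_le_mul_rpow {x C Λ e : ℝ} (hC : 0 ≤ C) (hΛ : 0 < Λ) (h : x ^ 2 ≤ C * Λ ^ (2 * e)) :
    x ≤ Real.sqrt C * Λ ^ e := by
  refine le_of_sq_le_sq ?_ (mul_nonneg (Real.sqrt_nonneg _) (Real.rpow_nonneg hΛ.le _))
  rw [mul_pow, Real.sq_sqrt hC, ← Real.rpow_mul_natCast hΛ.le, mul_comm e]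
  exact_mod_cast h

/-- The vector w is L^J applied to x^σ x^i z^a z̄^b, and each application costs a factor Λ. Raising
i costs ab ≲ Λ² but gains Λ⁻¹ in norm, keeping i costs Λ, and lowering i costs O(1) but loses Λ. The
induction needs all i at once. -/
theorem exists_iterate_lift {γ : ℝ} (hγ : γ ∈ Set.Ioo (-1 : ℝ) 1) (J : ℕ) : ∀ (i : ℕ) (c : ℝ), 1 ≤ c →
    ∃ C : ℝ, 0 ≤ C ∧ ∀ (m : ℤ) (a b : ℕ) (Λ : ℝ), (a : ℤ) - b = m → 1 + (m : ℝ) ^ 2 ≤ Λ →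
      Λ ≤ c * (a + b + 1) → (a + b : ℝ) ≤ c * Λ →
      ∃ w : L2 γ, (dirichletInverse γ ^ J) w = vec γ (wt γ (xzpw i a b)) ∧
        ‖w‖ ≤ C * Λ ^ ((J : ℝ) - i - (1 + |γ|) / 2) := by
  induction J with
  | zero =>
    intro i c hc
    obtain ⟨C, hC, H⟩ := exists_norm_wt_le γ i
    have hc0 : 0 < c := by linarith
    refine ⟨Real.sqrt (C * c ^ (|γ| + 2 * i + 1)), Real.sqrt_nonneg _, fun m a b Λ _ hΛ h1 _ => ?_⟩
    have hΛ0 : 0 < Λ := by nlinarith [sq_nonneg (m : ℝ)]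
    refine ⟨vec γ (wt γ (xzpw i a b)), by simp, ?_⟩
    refine le_of_sq_le_mul_rpow (mul_nonneg hC (Real.rpow_nonneg hc0.le _)) hΛ0 ?_
    have h2 := H (Λ / c) (a + b) (xzpw i a b) (by positivity)
      (by rw [div_le_iff₀ hc0]; push_cast; linarith) (contDiff_xzpw i a b).continuous
      (fun z _ => by
        rw [xzpw, norm_mul, mul_pow, Complex.norm_real, Real.norm_eq_abs, sq_abs, norm_sq_zpw,
          ← pow_mul, mul_comm i])
    refine h2.trans (le_of_eq ?_)
    rw [Real.div_rpow hΛ0.le hc0.le, Real.rpow_neg hc0.le, div_inv_eq_mul, mul_assoc, mul_comm (Λ ^ _)]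
    congr 3
    push_cast; ring
  | succ J ih =>
    intro i c hc
    -- The exponents become a - 1 and b - 1 with a, b ≥ 1, and a + b + 1 ≤ 3(a + b - 1); this
    -- accounts for 3c.
    obtain ⟨C1, hC1, H1⟩ := ih (i + 1) (3 * c) (by linarith)
    obtain ⟨C2, hC2, H2⟩ := ih i c hc
    obtain ⟨C3, hC3, H3⟩ := ih (i - 1) c hc
    refine ⟨c ^ 2 * C1 + (5 + 4 * c + 4 * i * c + 4 * i ^ 2 + 8 * i) * C2 + 4 * i * (i + 1) * C3,
      by positivity, fun m a b Λ hab hΛ h1 h2 => ?_⟩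
    have hΛ1 : 1 ≤ Λ := by nlinarith [sq_nonneg (m : ℝ)]
    have hΛ0 : 0 < Λ := by linarith
    have hg0 := abs_nonneg γ
    have hg1 : |γ| < 1 := abs_lt.2 hγ
    set e : ℝ := (((J + 1 : ℕ) : ℝ)) - i - (1 + |γ|) / 2
    have habr : (a : ℝ) - b = m := by exact_mod_cast hab
    set A : ℝ := (a + b + 1 + |γ|) ^ 2 - 4 * a * b + 4 * i * (a + b) + 4 * i * (i - 1) + 4 * i
        + 4 * (1 + |γ|) * i with hAdef
    -- The quadratic parts combine to (a - b)² = m², which is why A = O(Λ).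
    have hA : A = 2 * (a + b) * (1 + |γ|) + (1 + |γ|) ^ 2 + (m : ℝ) ^ 2 + 4 * i * (a + b) + 4 * i ^ 2
        + 4 * (1 + |γ|) * i := by rw [hAdef, ← habr]; ring
    have hA0 : 0 ≤ A := by rw [hA]; positivity
    have hAle : A ≤ (5 + 4 * c + 4 * i * c + 4 * i ^ 2 + 8 * i) * Λ := by
      have hi : (0 : ℝ) ≤ i := i.cast_nonneg
      have e1 : 2 * (a + b : ℝ) * (1 + |γ|) ≤ 2 * (c * Λ) * 2 :=
        mul_le_mul (by linarith) (by linarith) (by positivity) (by positivity)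
      have e2 : (1 + |γ|) ^ 2 ≤ 4 * Λ := by nlinarith
      have e3 : 4 * (i : ℝ) * (a + b) ≤ 4 * i * (c * Λ) := mul_le_mul_of_nonneg_left h2 (by positivity)
      have e4 : 4 * (i : ℝ) ^ 2 ≤ 4 * i ^ 2 * Λ := le_mul_of_one_le_right (by positivity) hΛ1
      have e5 : 4 * (1 + |γ|) * i ≤ 8 * i * Λ := by
        have : 4 * (1 + |γ|) * i ≤ 8 * i := by nlinarith
        exact this.trans (le_mul_of_one_le_right (by positivity) hΛ1)
      rw [hA]; nlinarith
    have X1 : ∃ w : L2 γ, (4 * a * b : ℂ) • (dirichletInverse γ ^ J) w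
        = (4 * a * b : ℂ) • vec γ (wt γ (xzpw (i + 1) (a - 1) (b - 1))) ∧
        4 * a * b * ‖w‖ ≤ c ^ 2 * C1 * Λ ^ e := by
      -- If a or b is zero the coefficient vanishes and w = 0 serves; otherwise the reduced
      -- exponents are true differences.
      by_cases h0 : a = 0 ∨ b = 0
      · refine ⟨0, ?_, ?_⟩
        · rcases h0 with h0 | h0 <;> simp [h0]
        · rw [norm_zero, mul_zero]
          have := Real.rpow_nonneg hΛ0.le e
          positivity
      · have ha : 1 ≤ a := Nat.one_le_iff_ne_zero.2 fun h => h0 (Or.inl h)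
        have hb : 1 ≤ b := Nat.one_le_iff_ne_zero.2 fun h => h0 (Or.inr h)
        have har : (1 : ℝ) ≤ a := by exact_mod_cast ha
        have hbr : (1 : ℝ) ≤ b := by exact_mod_cast hb
        obtain ⟨w, hw, hwn⟩ := H1 m (a - 1) (b - 1) Λ (by omega) hΛ
          (by push_cast [ha, hb]; nlinarith) (by push_cast [ha, hb]; nlinarith)
        refine ⟨w, by rw [hw], ?_⟩
        have e1 : 4 * (a : ℝ) * b ≤ (c * Λ) ^ 2 := by
          have := pow_le_pow_left₀ (by positivity) h2 2
          nlinarith [sq_nonneg ((a : ℝ) - b)]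
        calc 4 * (a : ℝ) * b * ‖w‖ ≤ (c * Λ) ^ 2 * (C1 * Λ ^ ((J : ℝ) - (i + 1 : ℕ) - (1 + |γ|) / 2)) :=
              mul_le_mul e1 hwn (norm_nonneg _) (by positivity)
          _ = c ^ 2 * C1 * (Λ ^ ((J : ℝ) - (i + 1 : ℕ) - (1 + |γ|) / 2) * Λ ^ 2) := by ring
          _ = _ := by
            rw [← Real.rpow_add_natCast hΛ0.ne']; congr 2; simp only [e]; push_cast; ring
    have X3 : ∃ w : L2 γ, (4 * i * (i + |γ|) : ℂ) • (dirichletInverse γ ^ J) w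
        = (4 * i * (i + |γ|) : ℂ) • vec γ (wt γ (xzpw (i - 1) a b)) ∧
        4 * i * (i + |γ|) * ‖w‖ ≤ 4 * i * (i + 1) * C3 * Λ ^ e := by
      by_cases h0 : i = 0
      · exact ⟨0, by simp [h0], by simp [h0]⟩
      · obtain ⟨w, hw, hwn⟩ := H3 m a b Λ hab hΛ h1 h2
        refine ⟨w, by rw [hw], ?_⟩
        rw [Nat.cast_sub (Nat.one_le_iff_ne_zero.2 h0)] at hwn
        have e1 : (J : ℝ) - (i - (1 : ℕ)) - (1 + |γ|) / 2 = e := by simp only [e]; push_cast; ring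
        rw [e1] at hwn
        have hi : (0 : ℝ) ≤ i := i.cast_nonneg
        calc 4 * i * (i + |γ|) * ‖w‖ ≤ 4 * i * (i + 1) * (C3 * Λ ^ e) :=
              mul_le_mul (mul_le_mul_of_nonneg_left (by linarith) (by positivity)) hwn (norm_nonneg _)
                (by positivity)
          _ = _ := by ring
    obtain ⟨w1, hw1, hn1⟩ := X1
    obtain ⟨w2, hw2, hn2⟩ := H2 m a b Λ hab hΛ h1 h2
    obtain ⟨w3, hw3, hn3⟩ := X3
    refine ⟨(-1 : ℂ) • ((4 * a * b : ℂ) • w1) + (A : ℂ) • w2 + (-1 : ℂ) • ((4 * i * (i + |γ|) : ℂ) • w3),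
      ?_, ?_⟩
    · have c1 := (contDiff_xzpw (i + 1) (a - 1) (b - 1)).continuous
      have c2 := (contDiff_xzpw i a b).continuous
      have c3 := (contDiff_xzpw (i - 1) a b).continuous
      have hk : keldysh |γ| (xzpw i a b) = fun z => ((-1 * (4 * a * b) : ℂ) * xzpw (i + 1) (a - 1) (b - 1) z
          + (A : ℂ) * xzpw i a b z) + (-1 * (4 * i * (i + |γ|)) : ℂ) * xzpw (i - 1) a b z := by
        funext z
        rw [keldysh_xzpw, hAdef]
        push_cast
        ring
      have c12 : Continuous fun z => (-1 * (4 * a * b) : ℂ) * xzpw (i + 1) (a - 1) (b - 1) z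
          + (A : ℂ) * xzpw i a b z := (c1.const_mul _).add (c2.const_mul _)
      rw [pow_succ', mul_apply_eq_comp, wt_eq_dirichletInverse_of_contDiff hγ (contDiff_xzpw i a b), hk,
        vec_wt_add c12 (c3.const_mul _),
        vec_wt_add (c1.const_mul _) (c2.const_mul _), vec_wt_const_mul _ c1, vec_wt_const_mul _ c2,
        vec_wt_const_mul _ c3]
      congr 1
      simp only [mul_smul] at hw1 hw3
      simp only [map_add, map_smul, hw2, mul_smul, hw1, hw3]
    · refine (norm_add₃_le).trans ?_
      have k1 : ‖(4 * a * b : ℂ)‖ = 4 * a * b := by simp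
      have k3 : ‖(4 * i * (i + |γ|) : ℂ)‖ = 4 * i * (i + |γ|) := by
        have : (4 * i * (i + |γ|) : ℂ) = ((4 * i * (i + |γ|) : ℝ) : ℂ) := by push_cast; rfl
        rw [this, Complex.norm_of_nonneg (by positivity)]
      rw [norm_smul, norm_smul, norm_smul, norm_smul, norm_smul, k1, k3, norm_neg, norm_one, one_mul,
        one_mul, Complex.norm_of_nonneg hA0]
      have e1 : A * ‖w2‖ ≤ (5 + 4 * c + 4 * i * c + 4 * i ^ 2 + 8 * i) * C2 * Λ ^ e := by
        calc A * ‖w2‖ ≤ ((5 + 4 * c + 4 * i * c + 4 * i ^ 2 + 8 * i) * Λ)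
              * (C2 * Λ ^ ((J : ℝ) - i - (1 + |γ|) / 2)) :=
              mul_le_mul hAle hn2 (norm_nonneg _) (by positivity)
          _ = (5 + 4 * c + 4 * i * c + 4 * i ^ 2 + 8 * i) * C2
              * (Λ ^ ((J : ℝ) - i - (1 + |γ|) / 2) * Λ ^ 1) := by ring
          _ = _ := by
            rw [← Real.rpow_add_natCast hΛ0.ne']; congr 2; simp only [e]; push_cast; ring
      linarith

theorem inner_eig_iterate {γ : ℝ} (hγ : γ ∈ Set.Ioo (-1 : ℝ) 1) (q : ℤ × ℕ) (J : ℕ) (w : L2 γ) :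
    ⟪eig γ q, (dirichletInverse γ ^ J) w⟫_ℂ = (((lam γ q.1 q.2) ^ J)⁻¹ : ℝ) * ⟪eig γ q, w⟫_ℂ := by
  induction J with
  | zero => simp
  | succ J ih =>
    rw [pow_succ', mul_apply_eq_comp, inner_eig_dirichletInverse hγ, ih, pow_succ', mul_inv]
    push_cast
    ring

/-- For λ ≤ Λ the plain norm suffices, with λ^s ≤ Λ^s. For λ ≥ Λ the norm of L^J is used with 2J ≥
s, where λ^(s-2J) ≤ Λ^(s-2J). Both parts have order Λ^(s-1-|γ|). -/
theorem exists_frequency_bound {γ s c : ℝ} (hγ : γ ∈ Set.Ioo (-1 : ℝ) 1) (hs : 0 ≤ s) (hc : 1 ≤ c) :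
    ∃ C : ℝ, 0 ≤ C ∧ ∀ (m : ℤ) (a b : ℕ) (Λ : ℝ), (a : ℤ) - b = m → 1 + (m : ℝ) ^ 2 ≤ Λ →
      Λ ≤ c * (a + b + 1) → (a + b : ℝ) ≤ c * Λ → ∀ F : Finset (ℤ × ℕ),
      ∑ q ∈ F, lam γ q.1 q.2 ^ s * ‖⟪eig γ q, vec γ (wt γ (zpw a b))⟫_ℂ‖ ^ 2
        ≤ C * Λ ^ (s - 1 - |γ|) := by
  obtain ⟨J, hJ⟩ := exists_nat_ge (s / 2)
  obtain ⟨C0, h0, H0⟩ := exists_iterate_lift hγ 0 0 c hc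
  obtain ⟨C1, h1, H1⟩ := exists_iterate_lift hγ J 0 c hc
  refine ⟨C0 ^ 2 + C1 ^ 2, by positivity, fun m a b Λ hab hΛ ha hb F => ?_⟩
  have hΛ0 : 0 < Λ := by nlinarith [sq_nonneg (m : ℝ)]
  have hx : xzpw 0 a b = zpw a b := by funext z; simp [xzpw]
  obtain ⟨w0, e0, n0⟩ := H0 m a b Λ hab hΛ ha hb
  obtain ⟨w1, e1, n1⟩ := H1 m a b Λ hab hΛ ha hb
  rw [hx] at e0 e1
  simp only [pow_zero] at e0
  have e0' : w0 = vec γ (wt γ (zpw a b)) := e0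
  have hq : ∀ q ∈ F, lam γ q.1 q.2 ^ s * ‖⟪eig γ q, vec γ (wt γ (zpw a b))⟫_ℂ‖ ^ 2
      ≤ Λ ^ s * ‖⟪eig γ q, w0⟫_ℂ‖ ^ 2 + Λ ^ (s - 2 * J) * ‖⟪eig γ q, w1⟫_ℂ‖ ^ 2 := by
    intro q _
    have hl := lam_pos γ q.1 q.2
    rcases le_total (lam γ q.1 q.2) Λ with h | h
    · rw [e0']
      refine le_add_of_le_of_nonneg (mul_le_mul_of_nonneg_right (Real.rpow_le_rpow hl.le h hs)
        (sq_nonneg _)) (mul_nonneg (Real.rpow_nonneg hΛ0.le _) (sq_nonneg _))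
    · rw [← e1, inner_eig_iterate hγ, norm_mul, mul_pow, Complex.norm_of_nonneg (by positivity)]
      refine le_add_of_nonneg_of_le (mul_nonneg (Real.rpow_nonneg hΛ0.le _) (sq_nonneg _)) ?_
      rw [← mul_assoc]
      refine mul_le_mul_of_nonneg_right ?_ (sq_nonneg _)
      have e : lam γ q.1 q.2 ^ s * ((lam γ q.1 q.2 ^ J)⁻¹) ^ 2 = lam γ q.1 q.2 ^ (s - 2 * J) := by
        rw [Real.rpow_sub hl, inv_pow, ← pow_mul, div_eq_mul_inv, ← Real.rpow_natCast _ (J * 2)]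
        congr 3; push_cast; ring
      rw [e]
      exact Real.rpow_le_rpow_of_nonpos hΛ0 h (by linarith)
  refine (Finset.sum_le_sum hq).trans ?_
  rw [Finset.sum_add_distrib, ← Finset.mul_sum, ← Finset.mul_sum]
  have B0 := (orthonormal_eig hγ).sum_inner_products_le (x := w0) (s := F)
  have B1 := (orthonormal_eig hγ).sum_inner_products_le (x := w1) (s := F)
  have m0 := B0.trans (pow_le_pow_left₀ (norm_nonneg _) n0 2)
  have m1 := B1.trans (pow_le_pow_left₀ (norm_nonneg _) n1 2)
  refine (add_le_add (mul_le_mul_of_nonneg_left m0 (Real.rpow_nonneg hΛ0.le _))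
    (mul_le_mul_of_nonneg_left m1 (Real.rpow_nonneg hΛ0.le _))).trans (le_of_eq ?_)
  rw [mul_pow, mul_pow, ← Real.rpow_mul_natCast hΛ0.le, ← Real.rpow_mul_natCast hΛ0.le,
    mul_left_comm, mul_left_comm (Λ ^ (s - 2 * J)), ← Real.rpow_add hΛ0, ← Real.rpow_add hΛ0, add_mul]
  congr 3 <;> (push_cast; ring)

/-! ### Sequences and Sobolev spaces on the circle -/

theorem bracket_rpow (r : ℝ) (m : ℤ) : bracket m ^ (2 * r) = (1 + (m : ℝ) ^ 2) ^ r := by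
  rw [bracket, Real.sqrt_eq_rpow, ← Real.rpow_mul (by positivity)]
  congr 1; ring

theorem circle_ext {f g : L2S1} (h : ∀ m, fourierCoeff f m = fourierCoeff g m) : f = g := by
  refine fourierBasis.repr.injective (lp.ext (funext fun m => ?_))
  rw [fourierBasis_repr, fourierBasis_repr, h]

theorem fourierCoeff_add_L2 (f g : L2S1) (m : ℤ) :
    fourierCoeff (f + g : L2S1) m = fourierCoeff f m + fourierCoeff g m := by
  simp only [← fourierBasis_repr]; simp

theorem fourierCoeff_smul_L2 (c : ℂ) (f : L2S1) (m : ℤ) :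
    fourierCoeff (c • f : L2S1) m = c * fourierCoeff f m := by
  simp only [← fourierBasis_repr]; simp

theorem exists_circle_map {V : Type*} [AddCommGroup V] [Module ℂ V] {r : ℝ} (hr : 0 ≤ r)
    (Φ : V →ₗ[ℂ] (ℤ → ℂ)) (h : ∀ v, Summable fun m => bracket m ^ (2 * r) * ‖Φ v m‖ ^ 2) :
    ∃ T : V →ₗ[ℂ] circleSobolev r, ∀ v m, fourierCoeff (T v : L2S1) m = Φ v m := by
  have hm : ∀ v, Memℓp (Φ v) 2 := fun v => memℓp_gen (by
    refine Summable.of_nonneg_of_le (fun m => by positivity) (fun m => ?_) (h v)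
    simp only [ENNReal.toReal_ofNat, Real.rpow_ofNat]
    refine le_mul_of_one_le_left (sq_nonneg _) ?_
    rw [bracket_rpow]
    exact Real.one_le_rpow (by nlinarith [sq_nonneg (m : ℝ)]) hr)
  have hc : ∀ v m, fourierCoeff (fourierBasis.repr.symm ⟨Φ v, hm v⟩ : L2S1) m = Φ v m := fun v m => by
    rw [← fourierBasis_repr, LinearIsometryEquiv.apply_symm_apply]
  have hmem : ∀ v, (fourierBasis.repr.symm ⟨Φ v, hm v⟩ : L2S1) ∈ circleSobolev r := fun v => by
    change Summable _
    simpa only [hc] using h v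
  refine ⟨⟨⟨fun v => ⟨_, hmem v⟩, fun v w => ?_⟩, fun c v => ?_⟩, hc⟩
  · refine Subtype.ext (circle_ext fun m => ?_)
    rw [Submodule.coe_add, fourierCoeff_add_L2, hc, hc, hc, map_add, Pi.add_apply]
  · refine Subtype.ext (circle_ext fun m => ?_)
    simp only [RingHom.id_apply]
    rw [Submodule.coe_smul, fourierCoeff_smul_L2, hc, hc, map_smul, Pi.smul_apply, smul_eq_mul]

theorem exists_synthesis {V : Type*} [AddCommGroup V] [Module ℂ V] {γ : ℝ} (hγ : γ ∈ Set.Ioo (-1 : ℝ) 1)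
    (Φ : V →ₗ[ℂ] (ℤ × ℕ → ℂ)) (h : ∀ v, Summable fun q => ‖Φ v q‖ ^ 2) :
    ∃ T : V →ₗ[ℂ] L2 γ, ∀ v q, ⟪eig γ q, T v⟫_ℂ = Φ v q := by
  choose T hT using fun v => exists_of_coeff hγ (h v)
  refine ⟨⟨⟨T, fun v w => ext_eig hγ fun q => ?_⟩, fun c v => ext_eig hγ fun q => ?_⟩, hT⟩
  · rw [inner_add_right, hT, hT, hT, map_add, Pi.add_apply]
  · simp only [RingHom.id_apply]
    rw [inner_smul_right, hT, hT, map_smul, Pi.smul_apply, smul_eq_mul]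

/-! ### Boundary values -/

/-- The Fourier coefficients of the boundary value of `x^(-σ) u`. -/
def bt (γ : ℝ) (m : ℤ) (u : L2 γ) : ℂ := ∑' k, (bv γ m k : ℂ) * ⟪eig γ (m, k), u⟫_ℂ

theorem hasSum_fiber {γ : ℝ} (hγ : γ ∈ Set.Ioo (-1 : ℝ) 1) (v : L2 γ) :
    (∀ m, Summable fun k => ‖⟪eig γ (m, k), v⟫_ℂ‖ ^ 2) ∧
      HasSum (fun m => ∑' k, ‖⟪eig γ (m, k), v⟫_ℂ‖ ^ 2) (‖v‖ ^ 2) := by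
  have h := hasSum_norm_sq_eig hγ v
  exact ⟨fun m => h.summable.prod_factor m,
    h.prod_fiberwise fun m => (h.summable.prod_factor m).hasSum⟩

/-- Cauchy-Schwarz within a mode, with λ^(-s/2) attached to the boundary values. The powers of 1 +
m² then cancel exactly. -/
theorem exists_bt_bound {γ s : ℝ} (hγ : γ ∈ Set.Ioo (-1 : ℝ) 1) (hs : 1 + |γ| < s) :
    ∃ C : ℝ, 0 ≤ C ∧ ∀ (m : ℤ) (v : L2 γ),
      Summable (fun k => (bv γ m k : ℂ) * ⟪eig γ (m, k), dirichletNegPow γ s v⟫_ℂ) ∧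
      bracket m ^ (2 * (s - 1 - |γ|)) * ‖bt γ m (dirichletNegPow γ s v)‖ ^ 2
        ≤ C * ∑' k, ‖⟪eig γ (m, k), v⟫_ℂ‖ ^ 2 := by
  obtain ⟨C, hC, H⟩ := exists_bv_sum_bound hγ hs
  have hs0 : 0 < s := by linarith [abs_nonneg γ]
  refine ⟨C, hC, fun m v => ?_⟩
  have hsum := (hasSum_fiber hγ v).1 m
  have h := cauchy_schwarz_tsum (a := fun k => bv γ m k * lam γ m k ^ (-(s / 2)))
    (c := fun k => ⟪eig γ (m, k), v⟫_ℂ) (fun F => (le_of_eq (Finset.sum_congr rfl fun k _ => by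
      rw [mul_pow, ← Real.rpow_mul_natCast (lam_pos γ m k).le]
      congr 2; push_cast; ring)).trans (H m F))
    (fun F => hsum.sum_le_tsum F fun k _ => sq_nonneg _)
  have e : ∀ k, (bv γ m k : ℂ) * ⟪eig γ (m, k), dirichletNegPow γ s v⟫_ℂ
      = ((bv γ m k * lam γ m k ^ (-(s / 2)) : ℝ) : ℂ) * ⟪eig γ (m, k), v⟫_ℂ := fun k => by
    rw [inner_eig_dirichletNegPow hγ hs0]; push_cast; ring
  simp only [bt, e]
  refine ⟨h.1, ?_⟩
  have hp : (0 : ℝ) < 1 + (m : ℝ) ^ 2 := by positivity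
  rw [bracket_rpow]
  refine (mul_le_mul_of_nonneg_left h.2 (Real.rpow_nonneg hp.le _)).trans (le_of_eq ?_)
  have e2 : (1 + (m : ℝ) ^ 2) ^ (s - 1 - |γ|) * (1 + (m : ℝ) ^ 2) ^ (1 + |γ| - s) = 1 := by
    rw [← Real.rpow_add hp, show s - 1 - |γ| + (1 + |γ| - s) = 0 by ring, Real.rpow_zero]
  linear_combination (C * ∑' k, ‖⟪eig γ (m, k), v⟫_ℂ‖ ^ 2) * e2

/-- The normalization constant of the Neumann trace. -/
def tauC (γ : ℝ) : ℝ := if γ = 0 then -2 else 2 * |γ|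

theorem kap_eq (γ : ℝ) : kap γ = 2 * Real.pi * tauC γ := by
  rw [kap, tauC]; split_ifs <;> ring

theorem tauC_ne_zero (γ : ℝ) : tauC γ ≠ 0 := fun h => kap_ne_zero γ (by rw [kap_eq, h, mul_zero])

theorem exists_neumann_map {γ s : ℝ} (hγ : γ ∈ Set.Ioo (-1 : ℝ) 1) (hs : 1 + |γ| < s) :
    ∃ T : dirichletSobolev γ s →ₗ[ℂ] circleSobolev (s - 1 - |γ|),
      (∀ u m, fourierCoeff (T u : L2S1) m = tauC γ * bt γ m u) ∧
      ∃ C : ℝ, ∀ u, circleSobolevNorm _ (T u) ≤ C * dirichletSobolevNorm γ s u := by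
  obtain ⟨C, hC, H⟩ := exists_bt_bound hγ hs
  have hs0 : 0 < s := by linarith [abs_nonneg γ]
  let Φ : dirichletSobolev γ s →ₗ[ℂ] (ℤ → ℂ) :=
    { toFun := fun u m => tauC γ * bt γ m u
      map_add' := by
        rintro ⟨_, v, rfl⟩ ⟨_, w, rfl⟩
        funext m
        have h1 := (H m v).1
        have h2 := (H m w).1
        simp only [Pi.add_apply]
        rw [← mul_add]
        congr 1
        simp only [bt]
        exact (tsum_congr fun k => by
          rw [Submodule.coe_add, inner_add_right, mul_add]; rfl).trans (h1.tsum_add h2)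
      map_smul' := by
        rintro c ⟨_, v, rfl⟩
        funext m
        simp only [Pi.smul_apply, RingHom.id_apply, smul_eq_mul]
        rw [mul_left_comm]
        congr 1
        simp only [bt]
        rw [← tsum_mul_left]
        exact tsum_congr fun k => by
          rw [Submodule.coe_smul, inner_smul_right, mul_left_comm] }
  have key : ∀ (v : L2 γ) (m : ℤ), bracket m ^ (2 * (s - 1 - |γ|))
      * ‖(tauC γ : ℂ) * bt γ m (dirichletNegPow γ s v)‖ ^ 2
      ≤ tauC γ ^ 2 * C * ∑' k, ‖⟪eig γ (m, k), v⟫_ℂ‖ ^ 2 := fun v m => by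
    rw [norm_mul, mul_pow, Complex.norm_real, Real.norm_eq_abs, sq_abs, mul_left_comm, mul_assoc]
    exact mul_le_mul_of_nonneg_left (H m v).2 (sq_nonneg _)
  have hnn : ∀ (m : ℤ) (c : ℂ), 0 ≤ bracket m ^ (2 * (s - 1 - |γ|)) * ‖c‖ ^ 2 := fun m c =>
    mul_nonneg (Real.rpow_nonneg (Real.sqrt_nonneg _) _) (sq_nonneg _)
  have hsum : ∀ v : L2 γ, HasSum (fun m => tauC γ ^ 2 * C * ∑' k, ‖⟪eig γ (m, k), v⟫_ℂ‖ ^ 2)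
      (tauC γ ^ 2 * C * ‖v‖ ^ 2) := fun v => (hasSum_fiber hγ v).2.mul_left _
  have hS : ∀ u, Summable fun m => bracket m ^ (2 * (s - 1 - |γ|)) * ‖Φ u m‖ ^ 2 := by
    rintro ⟨_, v, rfl⟩
    exact Summable.of_nonneg_of_le (fun m => hnn m _) (key v) (hsum v).summable
  obtain ⟨T, hT⟩ := exists_circle_map (by linarith) Φ hS
  refine ⟨T, hT, Real.sqrt (tauC γ ^ 2 * C), ?_⟩
  rintro ⟨u, v, hv⟩
  rw [dirichletSobolevNorm_eq hγ hs0 ⟨u, v, hv⟩ hv, circleSobolevNorm, ← Real.sqrt_sq (norm_nonneg v),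
    ← Real.sqrt_mul (by positivity)]
  refine Real.sqrt_le_sqrt ?_
  rw [← (hsum v).tsum_eq]
  refine Summable.tsum_le_tsum (fun m => ?_) ?_ (hsum v).summable
  · rw [hT]
    change bracket m ^ (2 * (s - 1 - |γ|)) * ‖(tauC γ : ℂ) * bt γ m u‖ ^ 2 ≤ _
    rw [← hv]
    exact key v m
  · simp only [hT]
    exact hS _

theorem dual_rotate {γ ℓ : ℝ} {p : ℂ → ℂ} {m : ℤ} (hp : ∀ w z : ℂ, ‖w‖ = 1 → p (w * z) = w ^ m * p z)
    (w z : ℂ) (hw : ‖w‖ = 1) : dual γ ℓ p (w * z) = w ^ m * dual γ ℓ p z := by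
  rw [dual, dual, xr_rotate hw, hp w z hw]; ring

theorem dualL_mono_rotate {γ ℓ : ℝ} (m : ℤ) (j : ℕ) (w z : ℂ) (hw : ‖w‖ = 1) :
    dualL γ ℓ (mono m j) (w * z) = w ^ m * dualL γ ℓ (mono m j) z := by
  have h1 : ∀ w z : ℂ, ‖w‖ = 1 → keldysh (-|γ|) (mono m j) (w * z)
      = w ^ m * keldysh (-|γ|) (mono m j) z := fun w z hw => by
    rw [keldysh_mono_eq, keldysh_mono_eq, mono_rotate hw, mono_rotate hw]; ring
  rw [dualL, dualL, dual_rotate h1 w z hw, mono, euler_zpw, euler_zpw, ← mono, mono_rotate hw]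
  ring

theorem inner_dual_eig {γ : ℝ} (hγ : γ ∈ Set.Ioo (-1 : ℝ) 1) (ℓ : ℝ) {m n : ℤ} (h : m ≠ n) (j k : ℕ) :
    ⟪vec γ (dual γ ℓ (mono m j)), eig γ (n, k)⟫_ℂ = 0 ∧
      ⟪vec γ (dualL γ ℓ (mono m j)), eig γ (n, k)⟫_ℂ = 0 := by
  have hM : ∀ i, MemLp (wt γ (mono n i)) 2 (diskMeasure γ) := fun i =>
    memLp_wt_of_continuous (contDiff_mono n i).continuous
  have hr : ∀ i, ∀ w z : ℂ, ‖w‖ = 1 → wt γ (mono n i) (w * z) = w ^ n * wt γ (mono n i) z :=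
    fun i => wt_rotate fun _ z hw => mono_rotate hw n i z
  exact ⟨inner_eig_eq_zero (fun i => inner_eq_zero_of_modes h
      (memLp_dual_of_continuous hγ ℓ (contDiff_mono m j).continuous) (hM i)
      (dual_rotate fun _ z hw => mono_rotate hw m j z) (hr i)) k,
    inner_eig_eq_zero (fun i => inner_eq_zero_of_modes h
      (memLp_dualL hγ ℓ (contDiff_mono m j)) (hM i) (dualL_mono_rotate m j) (hr i)) k⟩

/-- The boundary value through Green's formula. -/
theorem kap_mul_bt {γ : ℝ} (hγ : γ ∈ Set.Ioo (-1 : ℝ) 1) (ℓ : ℝ) (m : ℤ) (j : ℕ) (w : L2 γ) :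
    (kap γ : ℂ) * bt γ m (dirichletInverse γ w)
      = ⟪vec γ (dual γ ℓ (mono m j)), w⟫_ℂ
        - ⟪vec γ (dualL γ ℓ (mono m j)), dirichletInverse γ w⟫_ℂ := by
  set ψ := vec γ (dual γ ℓ (mono m j))
  set χ := vec γ (dualL γ ℓ (mono m j))
  have h := (hasSum_inner_eig hγ ψ w).sub (hasSum_inner_eig hγ χ (dirichletInverse γ w))
  -- Only the fibre of the mode m contributes to the two Parseval sums, by orthogonality of modes.
  have hinj : Function.Injective fun k : ℕ => ((m, k) : ℤ × ℕ) := fun a b h => by simpa using h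
  rw [← hinj.hasSum_iff] at h
  · rw [← h.tsum_eq, bt, ← tsum_mul_left]
    refine tsum_congr fun k => ?_
    have h1 := inner_sub_eig (fun i => dual_pairing hγ ℓ m j i) k
    have hl : (lam γ m k : ℂ) ≠ 0 := by exact_mod_cast (lam_pos γ m k).ne'
    simp only [Function.comp_apply]
    rw [inner_eig_dirichletInverse hγ, ← mul_assoc, ← h1]
    push_cast
    field_simp
    ring
  · rintro ⟨n, k⟩ hq
    have hne : m ≠ n := fun h => hq ⟨k, by rw [h]⟩
    rw [(inner_dual_eig hγ ℓ hne j k).1, (inner_dual_eig hγ ℓ hne j k).2]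
    ring

theorem bt_monoVec {γ : ℝ} (hγ : γ ∈ Set.Ioo (-1 : ℝ) 1) (m : ℤ) (j : ℕ) :
    bt γ m (monoVec γ m j) = 1 := by
  have h := kap_mul_bt hγ 0 m 0 (lmonoVec γ m j)
  rw [dirichletInverse_lmonoVec hγ, dual_pairing hγ] at h
  have : (kap γ : ℂ) ≠ 0 := by exact_mod_cast kap_ne_zero γ
  exact mul_left_cancel₀ this (h.trans (mul_one _).symm)

/-! ### The right inverse -/

/-- The exponent of the monomial used for the extension of `e^{imθ}`. -/
def ext (m : ℤ) : ℂ → ℂ := mono m (m.natAbs ^ 2)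

/-- The exponent m² places the extension in a layer of width 1/m², that is at spectral scale Λ = 1 +
m², comparable to the least eigenvalue of the mode. With a + b = |m| + 2m² the comparison constant 4
works in both directions. -/
theorem exists_ext_bound {γ s : ℝ} (hγ : γ ∈ Set.Ioo (-1 : ℝ) 1) (hs : 0 ≤ s) :
    ∃ C : ℝ, 0 ≤ C ∧ ∀ (m : ℤ), (Summable fun k => lam γ m k ^ s
        * ‖⟪eig γ (m, k), vec γ (wt γ (ext m))⟫_ℂ‖ ^ 2) ∧
      ∑' k, lam γ m k ^ s * ‖⟪eig γ (m, k), vec γ (wt γ (ext m))⟫_ℂ‖ ^ 2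
        ≤ C * (1 + (m : ℝ) ^ 2) ^ (s - 1 - |γ|) := by
  obtain ⟨C, hC, H⟩ := exists_frequency_bound hγ hs (c := 4) (by norm_num)
  refine ⟨C, hC, fun m => ?_⟩
  have hn : ((m.natAbs : ℕ) : ℝ) = |(m : ℝ)| := by rw [Nat.cast_natAbs, Int.cast_abs]
  have hab : ((m.toNat + m.natAbs ^ 2 : ℕ) : ℝ) + ((-m).toNat + m.natAbs ^ 2 : ℕ)
      = |(m : ℝ)| + 2 * (m : ℝ) ^ 2 := by
    push_cast; rw [hn, sq_abs, ← toNat_add]; ring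
  have hb : ∀ F : Finset ℕ, ∑ k ∈ F, lam γ m k ^ s * ‖⟪eig γ (m, k), vec γ (wt γ (ext m))⟫_ℂ‖ ^ 2
      ≤ C * (1 + (m : ℝ) ^ 2) ^ (s - 1 - |γ|) := fun F => by
    have h := H m (m.toNat + m.natAbs ^ 2) ((-m).toNat + m.natAbs ^ 2) (1 + (m : ℝ) ^ 2)
      (by have := toNat_sub m; push_cast; omega) le_rfl
      (by rw [hab]; nlinarith [abs_nonneg (m : ℝ), sq_nonneg (m : ℝ)])
      (by rw [hab]; nlinarith [sq_abs (m : ℝ), sq_nonneg (|(m : ℝ)| - 1)])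
      (F.map ⟨fun k => (m, k), fun a b h => by simpa using h⟩)
    rw [Finset.sum_map] at h
    exact h
  have hs := summable_of_sum_le (fun k => mul_nonneg (Real.rpow_nonneg (lam_pos γ m k).le s)
    (sq_nonneg _)) hb
  exact ⟨hs, hs.tsum_le_of_sum_le hb⟩

/-- The lift is built as L^(-s/2) applied to the vector with coefficients multiplied by λ^(s/2), so
its Sobolev norm is the L² norm of that vector, summed mode by mode with `exists_ext_bound`. -/
theorem exists_lift_map {γ s : ℝ} (hγ : γ ∈ Set.Ioo (-1 : ℝ) 1) (hs : 1 + |γ| < s) :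
    ∃ R : circleSobolev (s - 1 - |γ|) →ₗ[ℂ] dirichletSobolev γ s,
      (∀ h m k, ⟪eig γ (m, k), (R h : L2 γ)⟫_ℂ
        = fourierCoeff (h : L2S1) m / tauC γ * ⟪eig γ (m, k), vec γ (wt γ (ext m))⟫_ℂ) ∧
      ∃ C : ℝ, ∀ h, dirichletSobolevNorm γ s (R h) ≤ C * circleSobolevNorm _ h := by
  have hs0 : 0 < s := by linarith [abs_nonneg γ]
  obtain ⟨C, hC, H⟩ := exists_ext_bound hγ hs0.le
  let Φ : circleSobolev (s - 1 - |γ|) →ₗ[ℂ] (ℤ × ℕ → ℂ) :=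
    { toFun := fun h q => fourierCoeff (h : L2S1) q.1 * ((((tauC γ)⁻¹ * lam γ q.1 q.2 ^ (s / 2) : ℝ) : ℂ)
        * ⟪eig γ q, vec γ (wt γ (ext q.1))⟫_ℂ)
      map_add' := fun h g => funext fun q => by
        simp only [Pi.add_apply]
        rw [Submodule.coe_add, fourierCoeff_add_L2, add_mul]
      map_smul' := fun c h => funext fun q => by
        simp only [Pi.smul_apply, RingHom.id_apply, smul_eq_mul]
        rw [Submodule.coe_smul, fourierCoeff_smul_L2, mul_assoc] }
  have hΦ : ∀ h m k, ‖Φ h (m, k)‖ ^ 2 = (‖fourierCoeff (h : L2S1) m‖ ^ 2 * ((tauC γ)⁻¹) ^ 2)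
      * (lam γ m k ^ s * ‖⟪eig γ (m, k), vec γ (wt γ (ext m))⟫_ℂ‖ ^ 2) := fun h m k => by
    have e : (lam γ m k ^ (s / 2)) ^ 2 = lam γ m k ^ s := by
      rw [← Real.rpow_mul_natCast (lam_pos γ m k).le]; congr 1; push_cast; ring
    change ‖fourierCoeff (h : L2S1) m * ((((tauC γ)⁻¹ * lam γ m k ^ (s / 2) : ℝ) : ℂ)
        * ⟪eig γ (m, k), vec γ (wt γ (ext m))⟫_ℂ)‖ ^ 2 = _
    rw [norm_mul, norm_mul, mul_pow, mul_pow, Complex.norm_real, Real.norm_eq_abs, sq_abs, mul_pow, e]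
    ring
  have hle : ∀ h m, ∑' k, ‖Φ h (m, k)‖ ^ 2 ≤ ((tauC γ)⁻¹) ^ 2 * C
      * (bracket m ^ (2 * (s - 1 - |γ|)) * ‖fourierCoeff (h : L2S1) m‖ ^ 2) := fun h m => by
    simp only [hΦ]
    rw [tsum_mul_left, bracket_rpow]
    refine (mul_le_mul_of_nonneg_left (H m).2 (by positivity)).trans (le_of_eq (by ring))
  have hfib : ∀ h m, Summable fun k => ‖Φ h (m, k)‖ ^ 2 := fun h m => by
    simp only [hΦ]
    exact (H m).1.mul_left _
  have hout : ∀ h : circleSobolev (s - 1 - |γ|), Summable fun m => ∑' k, ‖Φ h (m, k)‖ ^ 2 := fun h =>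
    Summable.of_nonneg_of_le (fun m => tsum_nonneg fun k => sq_nonneg _) (hle h)
      (Summable.mul_left _ h.2)
  have hS : ∀ h, Summable fun q => ‖Φ h q‖ ^ 2 := fun h =>
    (summable_prod_of_nonneg fun q => sq_nonneg _).2 ⟨hfib h, hout h⟩
  obtain ⟨T, hT⟩ := exists_synthesis hγ Φ hS
  refine ⟨(dirichletNegPow γ s).toLinearMap.rangeRestrict.comp T, fun h m k => ?_,
    Real.sqrt (((tauC γ)⁻¹) ^ 2 * C), fun h => ?_⟩
  · change ⟪eig γ (m, k), dirichletNegPow γ s (T h)⟫_ℂ = _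
    rw [inner_eig_dirichletNegPow hγ hs0, hT]
    change ((lam γ m k ^ (-(s / 2)) : ℝ) : ℂ) * (fourierCoeff (h : L2S1) m * ((((tauC γ)⁻¹ * lam γ m k ^ (s / 2) : ℝ) : ℂ)
        * ⟪eig γ (m, k), vec γ (wt γ (ext m))⟫_ℂ)) = _
    have e : lam γ m k ^ (-(s / 2)) * lam γ m k ^ (s / 2) = 1 := by
      rw [← Real.rpow_add (lam_pos γ m k), neg_add_cancel, Real.rpow_zero]
    have e' : ((lam γ m k ^ (-(s / 2)) : ℝ) : ℂ) * ((lam γ m k ^ (s / 2) : ℝ) : ℂ) = 1 := by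
      exact_mod_cast e
    rw [Complex.ofReal_mul, Complex.ofReal_inv, div_eq_mul_inv]
    have alg : ∀ x y f t i : ℂ, x * y = 1 → x * (f * (t * y * i)) = f * t * i := fun x y f t i h => by
      linear_combination (f * t * i) * h
    exact alg _ _ _ _ _ e'
  · rw [dirichletSobolevNorm_eq hγ hs0 _ (v := T h) rfl, circleSobolevNorm,
      ← Real.sqrt_mul (by positivity)]
    refine Real.le_sqrt_of_sq_le ?_
    rw [← (hasSum_norm_sq_eig hγ (T h)).tsum_eq, ← tsum_mul_left]
    simp only [hT]
    rw [(hS h).tsum_prod' (hfib h)]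
    exact Summable.tsum_le_tsum (hle h) (hout h) (Summable.mul_left _ h.2)

theorem bt_lift {γ : ℝ} (hγ : γ ∈ Set.Ioo (-1 : ℝ) 1) {u : L2 γ} {m : ℤ} {c : ℂ}
    (h : ∀ k, ⟪eig γ (m, k), u⟫_ℂ = c * ⟪eig γ (m, k), vec γ (wt γ (ext m))⟫_ℂ) : bt γ m u = c := by
  have h1 := bt_monoVec hγ m (m.natAbs ^ 2)
  rw [bt] at h1 ⊢
  simp only [h]
  have e : ∀ k, (bv γ m k : ℂ) * (c * ⟪eig γ (m, k), vec γ (wt γ (ext m))⟫_ℂ)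
      = c * ((bv γ m k : ℂ) * ⟪eig γ (m, k), monoVec γ m (m.natAbs ^ 2)⟫_ℂ) := fun k =>
    mul_left_comm _ _ _
  rw [tsum_congr e, tsum_mul_left, h1, mul_one]

/-! ### Differentiation of series on a convex set -/

section Series

variable {E F ι : Type*} [NormedAddCommGroup E] [NormedSpace ℝ E] [NormedAddCommGroup F]
  [NormedSpace ℝ F] [CompleteSpace F]

/-- On a convex set the mean value inequality bounds each difference quotient by 2u_i, and dominated
convergence for series applies. The derivative is taken within s, so boundary points are included.
-/
theorem hasFDerivWithinAt_tsum {s : Set E} (hs : Convex ℝ s) {g : ι → E → F} {g' : ι → E → E →L[ℝ] F}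
    {v u : ι → ℝ} (hv : Summable v) (hu : Summable u) (hg : ∀ i x, HasFDerivAt (g i) (g' i x) x)
    (hgv : ∀ i, ∀ x ∈ s, ‖g i x‖ ≤ v i) (hgu : ∀ i, ∀ x ∈ s, ‖g' i x‖ ≤ u i) {x : E} (hx : x ∈ s) :
    HasFDerivWithinAt (fun y => ∑' i, g i y) (∑' i, g' i x) s x := by
  rw [hasFDerivWithinAt_iff_tendsto, tendsto_iff_norm_sub_tendsto_zero]
  have hS : ∀ y ∈ s, Summable fun i => g i y := fun y hy =>
    Summable.of_norm_bounded hv fun i => hgv i y hy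
  have hS' : Summable fun i => g' i x := Summable.of_norm_bounded hu fun i => hgu i x hx
  have h := tendsto_tsum_of_dominated_convergence (𝓕 := 𝓝[s] x) (bound := fun i => 2 * u i)
    (f := fun y i => ‖y - x‖⁻¹ • (g i y - g i x - g' i x (y - x))) (g := fun _ => (0 : F))
    (hu.mul_left 2) (fun i => by
      rw [tendsto_zero_iff_norm_tendsto_zero]
      simp only [norm_smul, norm_inv, norm_norm]
      exact hasFDerivWithinAt_iff_tendsto.1 (hg i x).hasFDerivWithinAt)
    (by
      filter_upwards [self_mem_nhdsWithin] with y hy i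
      have h1 : ‖g i y - g i x‖ ≤ u i * ‖y - x‖ :=
        hs.norm_image_sub_le_of_norm_hasFDerivWithin_le
          (fun z _ => (hg i z).hasFDerivWithinAt) (hgu i) hx hy
      have h2 : ‖g' i x (y - x)‖ ≤ u i * ‖y - x‖ :=
        ((g' i x).le_opNorm _).trans (mul_le_mul_of_nonneg_right (hgu i x hx) (norm_nonneg _))
      have h0 : 0 ≤ u i := (norm_nonneg _).trans (hgu i x hx)
      rw [norm_smul, norm_inv, norm_norm]
      rcases eq_or_ne ‖y - x‖ 0 with h | h
      · rw [h]; simpa using h0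
      · rw [inv_mul_le_iff₀ (lt_of_le_of_ne (norm_nonneg _) h.symm)]
        refine (norm_sub_le _ _).trans ?_
        linarith)
  rw [tsum_zero] at h
  have h := h.norm
  rw [norm_zero] at h
  refine h.congr' ?_
  filter_upwards [self_mem_nhdsWithin] with y hy
  have e : (∑' i, g' i x) (y - x) = ∑' i, g' i x (y - x) :=
    (ContinuousLinearMap.apply ℝ F (y - x)).map_tsum hS'
  have hS'' : Summable fun i => g' i x (y - x) :=
    ((ContinuousLinearMap.apply ℝ F (y - x)).hasSum hS'.hasSum).summable
  rw [sub_zero, Real.norm_of_nonneg (by positivity), e, ← (hS y hy).tsum_sub (hS x hx),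
    ← ((hS y hy).sub (hS x hx)).tsum_sub hS'', Summable.tsum_const_smul, norm_smul, norm_inv, norm_norm]
  exact ((hS y hy).sub (hS x hx)).sub hS''

theorem hasFTaylorSeriesUpToOn_tsum {s : Set E} (hs : Convex ℝ s) {f : ι → E → F} {v : ℕ → ι → ℝ}
    (hv : ∀ k, Summable (v k)) (hf : ∀ i, ContDiff ℝ ∞ (f i))
    (hb : ∀ k i, ∀ x ∈ s, ‖iteratedFDeriv ℝ k (f i) x‖ ≤ v k i) :
    HasFTaylorSeriesUpToOn ∞ (fun x => ∑' i, f i x)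
      (fun x k => ∑' i, iteratedFDeriv ℝ k (f i) x) s := by
  have hS : ∀ k, ∀ x ∈ s, Summable fun i => iteratedFDeriv ℝ k (f i) x := fun k x hx =>
    Summable.of_norm_bounded (hv k) fun i => hb k i x hx
  have hd : ∀ k i, Differentiable ℝ (iteratedFDeriv ℝ k (f i)) := fun k i =>
    (hf i).differentiable_iteratedFDeriv (by exact_mod_cast ENat.natCast_lt_top k)
  refine ⟨fun x hx => ?_, fun k _ x hx => ?_, fun k _ => ?_⟩
  · change (continuousMultilinearCurryFin0 ℝ E F) (∑' i, iteratedFDeriv ℝ 0 (f i) x) = _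
    exact (continuousMultilinearCurryFin0 ℝ E F).toContinuousLinearEquiv.map_tsum
      (f := fun i => iteratedFDeriv ℝ 0 (f i) x)
  · have h := hasFDerivWithinAt_tsum hs (hv k) (hv (k + 1)) (fun i y => (hd k i y).hasFDerivAt) (hb k)
      (fun i y hy => by rw [norm_fderiv_iteratedFDeriv]; exact hb (k + 1) i y hy) hx
    refine h.congr_fderiv (Eq.symm ?_)
    exact ((continuousMultilinearCurryLeftEquiv ℝ (fun _ : Fin (k + 1) => E)
      F).toContinuousLinearEquiv.map_tsum (f := fun i => iteratedFDeriv ℝ (k + 1) (f i) x))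
  · exact continuousOn_tsum (fun i => (hd k i).continuous.continuousOn) (hv k) (hb k)

end Series

/-! ### Derivatives of monomials -/

/-- The differential is expressed by monomials composed with two fixed contractions, so an induction
on the order of differentiation only has to track exponents. -/
theorem exists_fderiv_zpw : ∃ A B : ℂ →L[ℝ] ℂ →L[ℝ] ℂ, ‖A‖ ≤ 1 ∧ ‖B‖ ≤ 1 ∧ ∀ a b : ℕ,
    fderiv ℝ (zpw a b) = (a : ℝ) • (A ∘ zpw (a - 1) b) + (b : ℝ) • (B ∘ zpw a (b - 1)) := by
  refine ⟨ContinuousLinearMap.mul ℝ ℂ, ((ContinuousLinearMap.compL ℝ ℂ ℂ ℂ).flip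
    (Complex.conjCLE : ℂ →L[ℝ] ℂ)).comp (ContinuousLinearMap.mul ℝ ℂ), ?_, ?_, fun a b => ?_⟩
  · exact ContinuousLinearMap.opNorm_mul_le ℝ ℂ
  · refine ContinuousLinearMap.opNorm_le_bound _ zero_le_one fun c => ?_
    rw [one_mul]
    refine ContinuousLinearMap.opNorm_le_bound _ (norm_nonneg c) fun w => ?_
    simp
  · funext z
    ext1 w
    rw [fderiv_apply_eq, dz_zpw, db_zpw]
    simp
    ring

theorem norm_iteratedFDeriv_zpw_le (k : ℕ) : ∀ (a b : ℕ), ∀ z ∈ disk,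
    ‖iteratedFDeriv ℝ k (zpw a b) z‖ ≤ ((a : ℝ) + b) ^ k := by
  obtain ⟨A, B, hA, hB, H⟩ := exists_fderiv_zpw
  induction k with
  | zero =>
    intro a b z hz
    have hz : ‖z‖ ≤ 1 := by simpa using hz
    rw [norm_iteratedFDeriv_zero, pow_zero, zpw, norm_mul, norm_pow, norm_pow, RCLike.norm_conj]
    exact mul_le_one₀ (pow_le_one₀ (norm_nonneg _) hz) (by positivity) (pow_le_one₀ (norm_nonneg _) hz)
  | succ k ih =>
    intro a b z hz
    have hc : ∀ (L : ℂ →L[ℝ] ℂ →L[ℝ] ℂ) (a b : ℕ), ContDiff ℝ ∞ (L ∘ zpw a b) := fun L a b =>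
      L.contDiff.comp (contDiff_zpw a b)
    have hk : ((k : ℕ) : WithTop ℕ∞) ≤ ∞ := by exact_mod_cast le_top
    have hcomp : ∀ (L : ℂ →L[ℝ] ℂ →L[ℝ] ℂ) (a b : ℕ), ‖L‖ ≤ 1 →
        ‖iteratedFDeriv ℝ k (L ∘ zpw a b) z‖ ≤ ((a : ℝ) + b) ^ k := fun L a b hL =>
      (L.norm_iteratedFDeriv_comp_left (contDiff_zpw a b).contDiffAt hk).trans
        ((mul_le_mul hL (ih a b z hz) (norm_nonneg _) zero_le_one).trans (one_mul _).le)
    have e1 : (a : ℝ) * (((a - 1 : ℕ) : ℝ) + b) ^ k ≤ a * ((a : ℝ) + b) ^ k := by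
      have : (((a - 1 : ℕ) : ℝ)) ≤ a := by exact_mod_cast Nat.sub_le a 1
      gcongr
    have e2 : (b : ℝ) * ((a : ℝ) + (b - 1 : ℕ)) ^ k ≤ b * ((a : ℝ) + b) ^ k := by
      have : (((b - 1 : ℕ) : ℝ)) ≤ b := by exact_mod_cast Nat.sub_le b 1
      gcongr
    have hs : ∀ n : ℕ, ‖(n : ℝ)‖ = n := fun n => by simp
    rw [← norm_iteratedFDeriv_fderiv, H, iteratedFDeriv_add_apply
      (f := (a : ℝ) • (A ∘ zpw (a - 1) b)) (g := (b : ℝ) • (B ∘ zpw a (b - 1)))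
      (((hc A _ _).const_smul (a : ℝ)).contDiffAt.of_le hk)
      (((hc B _ _).const_smul (b : ℝ)).contDiffAt.of_le hk),
      iteratedFDeriv_const_smul_apply ((hc A _ _).contDiffAt.of_le hk),
      iteratedFDeriv_const_smul_apply ((hc B _ _).contDiffAt.of_le hk)]
    refine (norm_add_le _ _).trans ?_
    rw [norm_smul, norm_smul, hs, hs, pow_succ']
    have h1 := mul_le_mul_of_nonneg_left (hcomp A (a - 1) b hA) (Nat.cast_nonneg (α := ℝ) a)
    have h2 := mul_le_mul_of_nonneg_left (hcomp B a (b - 1) hB) (Nat.cast_nonneg (α := ℝ) b)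
    linarith

/-! ### Decay of Fourier coefficients -/

theorem norm_fourierCoeffOn_le {f : ℝ → ℂ} {M : ℝ} (h : ∀ t, ‖f t‖ ≤ M) (n : ℤ) :
    ‖fourierCoeffOn Real.two_pi_pos f n‖ ≤ M := by
  have hp := Real.two_pi_pos
  rw [fourierCoeffOn_eq_integral, norm_smul]
  have := intervalIntegral.norm_integral_le_of_norm_le_const (a := 0) (b := 2 * Real.pi) (C := M)
    (f := fun x : ℝ => fourier (-n) (x : S1) • f x) fun x _ => by
      rw [norm_smul, fourier_apply, Circle.norm_coe, one_mul]; exact h x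
  rw [sub_zero, abs_of_pos hp] at this
  rw [sub_zero, norm_div, norm_one, Real.norm_of_nonneg hp.le, one_div, inv_mul_le_iff₀ hp]
  exact this.trans (mul_comm _ _).le

theorem periodic_deriv {f : ℝ → ℂ} {c : ℝ} (h : Function.Periodic f c) :
    Function.Periodic (deriv f) c := fun t => by
  rw [← deriv_comp_add_const f c t]
  congr 1
  exact funext h

/-- N integrations by parts over a period, whose boundary terms cancel by periodicity. -/
theorem pow_mul_norm_fourierCoeffOn_le (N : ℕ) : ∀ {f : ℝ → ℂ} {M : ℝ}, ContDiff ℝ ∞ f →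
    Function.Periodic f (2 * Real.pi) → (∀ t, ‖iteratedDeriv N f t‖ ≤ M) → ∀ n : ℤ,
    |(n : ℝ)| ^ N * ‖fourierCoeffOn Real.two_pi_pos f n‖ ≤ M := by
  induction N with
  | zero =>
    intro f M _ _ hM n
    rw [pow_zero, one_mul]
    exact norm_fourierCoeffOn_le (by simpa using hM) n
  | succ N ih =>
    intro f M hf hper hM n
    have hM0 : 0 ≤ M := (norm_nonneg _).trans (hM 0)
    rcases eq_or_ne n 0 with rfl | hn
    · simpa using hM0
    have hf' : ContDiff ℝ ∞ (deriv f) := ((contDiff_infty_iff_deriv (𝕜 := ℝ)).1 hf).2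
    have hd : ∀ t, HasDerivAt f (deriv f t) t := fun t =>
      (hf.differentiable (by simp) t).hasDerivAt
    have h := ih hf' (periodic_deriv hper) (by rw [← iteratedDeriv_succ']; exact hM) n
    have hc := fourierCoeffOn_of_hasDerivAt Real.two_pi_pos hn (fun x _ => hd x)
      (hf'.continuous.intervalIntegrable _ _)
    have h0 : f (2 * Real.pi) = f 0 := by simpa using hper 0
    rw [h0, sub_self, mul_zero, zero_sub] at hc
    have hn' : (n : ℂ) ≠ 0 := by exact_mod_cast hn
    have hpi : (Real.pi : ℂ) ≠ 0 := by exact_mod_cast Real.pi_ne_zero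
    have key : (n : ℂ) * fourierCoeffOn Real.two_pi_pos f n
        = -Complex.I * fourierCoeffOn Real.two_pi_pos (deriv f) n := by
      rw [hc]
      push_cast
      field_simp
      rw [Complex.I_sq]; ring
    have hk := congrArg norm key
    rw [norm_mul, norm_mul, norm_neg, Complex.norm_I, one_mul, Complex.norm_intCast] at hk
    rw [pow_succ, mul_assoc, hk]
    exact h

theorem fourierCoeff_eq_fourierCoeffOn (a : S1 → ℂ) (n : ℤ) :
    fourierCoeff a n = fourierCoeffOn Real.two_pi_pos (fun t : ℝ => a (t : S1)) n := by
  rw [fourierCoeff_eq_intervalIntegral a n 0, fourierCoeffOn_eq_integral, zero_add, sub_zero]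

theorem periodic_circle (a : S1 → ℂ) : Function.Periodic (fun t : ℝ => a (t : S1)) (2 * Real.pi) :=
  fun t => by simp

theorem exists_bound_iteratedDeriv {a : S1 → ℂ} (ha : SmoothOnCircle a) (N : ℕ) :
    ∃ M : ℝ, ∀ j ≤ N, ∀ t : ℝ, ‖iteratedDeriv j (fun t : ℝ => a (t : S1)) t‖ ≤ M := by
  have h1 : ∀ j, ∃ M, ∀ t : ℝ, ‖iteratedDeriv j (fun t : ℝ => a (t : S1)) t‖ ≤ M := fun j => by
    have hper : Function.Periodic (iteratedDeriv j fun t : ℝ => a (t : S1)) (2 * Real.pi) := by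
      induction j with
      | zero => simp
      | succ j ih => rw [iteratedDeriv_succ]; exact periodic_deriv ih
    have hcont : Continuous (iteratedDeriv j fun t : ℝ => a (t : S1)) :=
      ContDiff.continuous_iteratedDeriv j ha (by exact_mod_cast le_top)
    obtain ⟨M, hM⟩ := (hper.compact_of_continuous Real.two_pi_pos.ne' hcont).isBounded.exists_norm_le
    exact ⟨M, fun t => hM _ ⟨t, rfl⟩⟩
  choose M hM using h1
  refine ⟨∑ j ∈ Finset.range (N + 1), |M j|, fun j hj t => (hM j t).trans ((le_abs_self _).trans ?_)⟩
  exact Finset.single_le_sum (f := fun j => |M j|) (fun i _ => abs_nonneg _) (by simpa using Nat.lt_succ_of_le hj)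

/-! ### The smooth extension operator -/

/-- `∑ a_m / τ · z^{m⁺+m²} z̄^{m⁻+m²}`, `a_m` the Fourier coefficients of `a`. -/
def smoothLift (γ : ℝ) (a : S1 → ℂ) (z : ℂ) : ℂ := ∑' m : ℤ, fourierCoeff a m / tauC γ * ext m z

theorem contDiff_ext (m : ℤ) : ContDiff ℝ ∞ (ext m) := contDiff_mono m _

/-- A summable weight on the frequencies. -/
def decay (m : ℤ) : ℝ := 1 / (m : ℝ) ^ 2 + if m = 0 then 1 else 0

theorem summable_decay : Summable decay :=
  (Real.summable_one_div_int_pow.2 one_lt_two).add (hasSum_ite_eq (0 : ℤ) (1 : ℝ)).summable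

theorem norm_iteratedFDeriv_ext_le (k : ℕ) (m : ℤ) {z : ℂ} (hz : z ∈ disk) :
    ‖iteratedFDeriv ℝ k (ext m) z‖ ≤ (3 * (m : ℝ) ^ 2) ^ k := by
  refine (norm_iteratedFDeriv_zpw_le k _ _ z hz).trans (pow_le_pow_left₀ (by positivity) ?_ k)
  have hn : ((m.natAbs : ℕ) : ℝ) = |(m : ℝ)| := by rw [Nat.cast_natAbs, Int.cast_abs]
  have h1 : |(m : ℝ)| ≤ (m : ℝ) ^ 2 := by
    rw [← hn, ← sq_abs, ← hn]
    exact_mod_cast Nat.le_self_pow two_ne_zero _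
  push_cast
  rw [hn, sq_abs]
  have := toNat_add m
  linarith

/-- k derivatives of `ext m` cost (m²)^k, hence 2k derivatives of a. Two further derivatives provide
the summable factor 1/m². -/
theorem norm_fourierCoeff_mul_le {a : S1 → ℂ} (ha : SmoothOnCircle a) {k : ℕ} {M : ℝ}
    (hM : ∀ j ≤ 2 * k + 2, ∀ t : ℝ, ‖iteratedDeriv j (fun t : ℝ => a (t : S1)) t‖ ≤ M) (m : ℤ) :
    ‖fourierCoeff a m‖ * (3 * (m : ℝ) ^ 2) ^ k ≤ 3 ^ k * M * decay m := by
  have hM0 : 0 ≤ M := (norm_nonneg _).trans (hM 0 (by omega) 0)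
  rw [fourierCoeff_eq_fourierCoeffOn]
  rcases eq_or_ne m 0 with rfl | hm
  · have h := pow_mul_norm_fourierCoeffOn_le 0 ha (periodic_circle a) (hM 0 (by omega)) 0
    have h3 : (1 : ℝ) ≤ 3 ^ k := one_le_pow₀ (by norm_num)
    rw [pow_zero, one_mul] at h
    have e : decay 0 = 1 := by simp [decay]
    have h4 : ((3 : ℝ) * ((0 : ℤ) : ℝ) ^ 2) ^ k ≤ 1 := pow_le_one₀ (by simp) (by simp)
    rw [e, mul_one]
    calc _ ≤ M * 1 := mul_le_mul h h4 (by simp) hM0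
      _ ≤ _ := by nlinarith
  · have h := pow_mul_norm_fourierCoeffOn_le (2 * k + 2) ha (periodic_circle a) (hM _ le_rfl) m
    have hm2 : (0 : ℝ) < (m : ℝ) ^ 2 := by positivity
    rw [decay, if_neg hm, add_zero, mul_one_div, le_div_iff₀ hm2]
    have e : |(m : ℝ)| ^ (2 * k + 2) = ((m : ℝ) ^ 2) ^ k * (m : ℝ) ^ 2 := by
      rw [show 2 * k + 2 = 2 * (k + 1) by ring, pow_mul, sq_abs, pow_succ]
    rw [e] at h
    rw [mul_pow]
    have h3 : (0 : ℝ) ≤ 3 ^ k := by positivity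
    nlinarith [mul_le_mul_of_nonneg_left h h3]

theorem norm_iteratedFDeriv_term_le {γ : ℝ} {a : S1 → ℂ} (ha : SmoothOnCircle a) {k : ℕ} {M : ℝ}
    (hM : ∀ j ≤ 2 * k + 2, ∀ t : ℝ, ‖iteratedDeriv j (fun t : ℝ => a (t : S1)) t‖ ≤ M) (m : ℤ) {z : ℂ}
    (hz : z ∈ disk) :
    ‖iteratedFDeriv ℝ k (fun z => fourierCoeff a m / tauC γ * ext m z) z‖
      ≤ |tauC γ|⁻¹ * 3 ^ k * M * decay m := by
  have hk : ((k : ℕ) : WithTop ℕ∞) ≤ ∞ := by exact_mod_cast le_top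
  have h : iteratedFDeriv ℝ k (fun z => fourierCoeff a m / tauC γ * ext m z) z
      = (fourierCoeff a m / tauC γ) • iteratedFDeriv ℝ k (ext m) z :=
    iteratedFDeriv_const_smul_apply (a := fourierCoeff a m / tauC γ) (f := ext m) ((contDiff_ext m).contDiffAt.of_le hk)
  rw [h, norm_smul, norm_div, Complex.norm_real, Real.norm_eq_abs]
  have h1 := (mul_le_mul_of_nonneg_left (norm_iteratedFDeriv_ext_le k m hz)
    (norm_nonneg (fourierCoeff a m))).trans (norm_fourierCoeff_mul_le ha hM m)
  have h2 := mul_le_mul_of_nonneg_left h1 (inv_nonneg.2 (abs_nonneg (tauC γ)))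
  rw [div_eq_inv_mul, mul_assoc]
  exact h2.trans (le_of_eq (by ring))

theorem hasFTaylor_smoothLift (γ : ℝ) {a : S1 → ℂ} (ha : SmoothOnCircle a) :
    HasFTaylorSeriesUpToOn ∞ (smoothLift γ a) (fun z k => ∑' m : ℤ,
      iteratedFDeriv ℝ k (fun z => fourierCoeff a m / tauC γ * ext m z) z) disk := by
  choose M hM using fun k => exists_bound_iteratedDeriv ha (2 * k + 2)
  exact hasFTaylorSeriesUpToOn_tsum (convex_closedBall 0 1)
    (v := fun k m => |tauC γ|⁻¹ * 3 ^ k * M k * decay m)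
    (fun k => summable_decay.mul_left _) (fun m => contDiff_const.mul (contDiff_ext m))
    fun k m z hz => norm_iteratedFDeriv_term_le ha (hM k) m hz

theorem uniqueDiffOn_disk : UniqueDiffOn ℝ disk :=
  uniqueDiffOn_convex (convex_closedBall 0 1) (by
    rw [interior_closedBall _ one_ne_zero]; exact ⟨0, by simp⟩)

theorem smoothOnDisk_smoothLift (γ : ℝ) {a : S1 → ℂ} (ha : SmoothOnCircle a) :
    SmoothOnDisk (smoothLift γ a) :=
  (hasFTaylor_smoothLift γ ha).contDiffOn

theorem exists_norm_term_le (γ : ℝ) {a : S1 → ℂ} (ha : SmoothOnCircle a) :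
    ∃ C : ℝ, ∀ m, ∀ z ∈ disk, ‖fourierCoeff a m / tauC γ * ext m z‖ ≤ C * decay m := by
  obtain ⟨M, hM⟩ := exists_bound_iteratedDeriv ha (2 * 0 + 2)
  exact ⟨_, fun m z hz => by
    simpa only [norm_iteratedFDeriv_zero] using norm_iteratedFDeriv_term_le (γ := γ) ha hM m hz⟩

theorem summable_term (γ : ℝ) {a : S1 → ℂ} (ha : SmoothOnCircle a) {z : ℂ} (hz : z ∈ disk) :
    Summable fun m => fourierCoeff a m / tauC γ * ext m z := by
  obtain ⟨C, hC⟩ := exists_norm_term_le γ ha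
  exact Summable.of_norm_bounded (summable_decay.mul_left C) fun m => hC m z hz

theorem continuous_of_smoothOnCircle {a : S1 → ℂ} (ha : SmoothOnCircle a) : Continuous a :=
  isQuotientMap_quotient_mk'.continuous_iff.2 ha.continuous

theorem integrable_of_smoothOnCircle {a : S1 → ℂ} (ha : SmoothOnCircle a) :
    Integrable a AddCircle.haarAddCircle :=
  (continuous_of_smoothOnCircle ha).integrable_of_hasCompactSupport
    (HasCompactSupport.of_compactSpace a)

theorem isContinuousSmoothOperator_smoothLift (γ : ℝ) :
    IsContinuousSmoothOperator (smoothLift γ) := by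
  refine ⟨fun a ha => smoothOnDisk_smoothLift γ ha, fun c a b ha hb z hz => ?_, fun k => ?_⟩
  · have h : ∀ m, fourierCoeff (fun θ => c * a θ + b θ) m = c * fourierCoeff a m + fourierCoeff b m := by
      intro m
      rw [← fourierCoeff.const_mul]
      exact congrFun (fourierCoeff.add ((integrable_of_smoothOnCircle ha).const_mul c)
        (integrable_of_smoothOnCircle hb)) m
    simp only [smoothLift]
    rw [← tsum_mul_left, ← ((summable_term γ ha hz).mul_left c).tsum_add (summable_term γ hb hz)]
    exact tsum_congr fun m => by rw [h]; ring
  · refine ⟨2 * k + 2, |tauC γ|⁻¹ * 3 ^ k * ∑' m, decay m, fun a M ha hM z hz => ?_⟩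
    have hk : ((k : ℕ) : WithTop ℕ∞) ≤ ∞ := by exact_mod_cast le_top
    rw [← (hasFTaylor_smoothLift γ ha).eq_iteratedFDerivWithin_of_uniqueDiffOn hk uniqueDiffOn_disk hz]
    refine (tsum_of_norm_bounded (summable_decay.hasSum.mul_left (|tauC γ|⁻¹ * 3 ^ k * M))
      fun m => norm_iteratedFDeriv_term_le ha hM m hz).trans (le_of_eq (by ring))

theorem ext_polar (m : ℤ) (θ : ℝ) : ext m (polar 1 θ) = fourier m (θ : S1) := by
  have hw : ‖polar 1 θ‖ = 1 := by
    rw [polar, Complex.ofReal_one, one_mul, Complex.norm_exp_ofReal_mul_I]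
  have h := mono_rotate hw m (m.natAbs ^ 2) 1
  rw [mul_one] at h
  rw [ext, h, fourier_coe_apply, polar, Complex.ofReal_one, one_mul, ← Complex.exp_int_mul]
  have : mono m (m.natAbs ^ 2) 1 = 1 := by simp [mono, zpw]
  rw [this, mul_one]
  congr 1
  have hpi : (Real.pi : ℂ) ≠ 0 := by exact_mod_cast Real.pi_ne_zero
  push_cast
  field_simp

/-- The boundary values of `smoothLift γ a`. -/
theorem smoothLift_polar (γ : ℝ) {a : S1 → ℂ} (ha : SmoothOnCircle a) (θ : ℝ) :
    tauC γ * smoothLift γ a (polar 1 θ) = a (θ : S1) := by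
  have hτ : (tauC γ : ℂ) ≠ 0 := by exact_mod_cast tauC_ne_zero γ
  let f : C(S1, ℂ) := ⟨a, continuous_of_smoothOnCircle ha⟩
  obtain ⟨M, hM⟩ := exists_bound_iteratedDeriv ha (2 * 0 + 2)
  have hs : Summable (fourierCoeff ⇑f) :=
    Summable.of_norm_bounded (summable_decay.mul_left (3 ^ 0 * M)) fun m => by
      have h := norm_fourierCoeff_mul_le ha hM m
      rw [pow_zero, mul_one] at h
      exact h
  have h := (has_pointwise_sum_fourier_series_of_summable hs (θ : S1)).tsum_eq
  rw [smoothLift, ← tsum_mul_left]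
  refine Eq.trans (tsum_congr fun m => ?_) h
  rw [ext_polar, smul_eq_mul, ← mul_assoc, mul_div_cancel₀ _ hτ]
  rfl

theorem mem_disk_of_xr {z : ℂ} (hz : 0 < xr z) : z ∈ disk :=
  Metric.ball_subset_closedBall (mem_ball_iff_xr.2 hz)

theorem memLp_wt_smoothOnDisk {γ : ℝ} {p : ℂ → ℂ} (hp : SmoothOnDisk p) :
    MemLp (wt γ p) 2 (diskMeasure γ) := by
  obtain ⟨C, hC⟩ := (isCompact_closedBall (0 : ℂ) 1).exists_bound_of_continuousOn hp.continuousOn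
  exact memLp_wt (hp.continuousOn.mono Metric.ball_subset_closedBall) fun z hz =>
    hC z (mem_disk_of_xr hz)

/-! ### Expansion of a radial multiple of the extension -/

theorem exists_radialBound_wt (γ : ℝ) :
    ∃ M : ℝ → ℝ, RadialBound (fun x => x ^ sig γ) M ∧
      Integrable (fun z => M (xr z) ^ 2) (diskMeasure γ) := by
  obtain ⟨C, hC, hb⟩ := RadialBound.rpow (sig γ)
  refine ⟨_, hb, ?_⟩
  have h := add_two_sig γ
  have h1 := (integrable_rpow_diskMeasure (γ := γ) (a := 2 * sig γ)
    (by linarith [abs_nonneg γ])).const_mul (C ^ 2)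
  refine h1.congr ?_
  filter_upwards [ae_mem_ball γ] with z hz
  rw [mul_pow, ← Real.rpow_mul_natCast hz.le]
  congr 2; push_cast; ring

/-- `p` multiplied by the radial factor `k (1 - |z|²)`. -/
def radMul (k : ℝ → ℝ) (p : ℂ → ℂ) (z : ℂ) : ℂ := ((k (xr z) : ℝ) : ℂ) * p z

theorem memLp_radMul {γ : ℝ} {k M : ℝ → ℝ} (hk : RadialBound k M)
    (hM : Integrable (fun z => M (xr z) ^ 2) (diskMeasure γ)) {p : ℂ → ℂ} {ε : ℝ}
    (hp : ContinuousOn p (Metric.ball (0 : ℂ) 1)) (hb : ∀ z, 0 < xr z → ‖p z‖ ≤ ε) :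
    MemLp (radMul k p) 2 (diskMeasure γ) ∧
      ‖vec γ (radMul k p)‖ ^ 2 ≤ ε ^ 2 * ∫ z, M (xr z) ^ 2 ∂diskMeasure γ := by
  have hle : ∀ z, 0 < xr z → ‖radMul k p z‖ ^ 2 ≤ ε ^ 2 * M (xr z) ^ 2 := fun z hz => by
    rw [radMul, norm_mul, mul_comm, mul_pow, Complex.norm_real, Real.norm_eq_abs]
    exact mul_le_mul (pow_le_pow_left₀ (norm_nonneg _) (hb z hz) 2)
      (pow_le_pow_left₀ (abs_nonneg _) (hk.bound0 _ hz (xr_le_one z)) 2) (sq_nonneg _) (sq_nonneg _)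
  have hm := memLp_of_sq_le (aestronglyMeasurable_of_continuousOn
    ((smoothInt_continuousOn (smoothInt_radial hk.smooth)).mul hp)) (hM.const_mul (ε ^ 2)) hle
  exact ⟨hm, (norm_sq_vec_le hm (hM.const_mul _) hle).trans (integral_const_mul _ _).le⟩

theorem SmoothOnDisk.memLp_radMul {γ : ℝ} {k M : ℝ → ℝ} (hk : RadialBound k M)
    (hM : Integrable (fun z => M (xr z) ^ 2) (diskMeasure γ)) {p : ℂ → ℂ} (hp : SmoothOnDisk p) :
    MemLp (radMul k p) 2 (diskMeasure γ) := by
  obtain ⟨C, hC⟩ := (isCompact_closedBall (0 : ℂ) 1).exists_bound_of_continuousOn hp.continuousOn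
  exact (KeldyshDisk.memLp_radMul hk hM (hp.continuousOn.mono Metric.ball_subset_closedBall) fun z hz =>
    hC z (mem_disk_of_xr hz)).1

/-- The series converges uniformly on the closed disk and the radial factor is square integrable.
The factor is left general because both x^σ and the singular h are needed. -/
theorem hasSum_vec_smoothLift {γ : ℝ} {k M : ℝ → ℝ} (hk : RadialBound k M)
    (hM : Integrable (fun z => M (xr z) ^ 2) (diskMeasure γ)) {a : S1 → ℂ} (ha : SmoothOnCircle a) :
    HasSum (fun m => (fourierCoeff a m / tauC γ) • vec γ (radMul k (ext m)))
      (vec γ (radMul k (smoothLift γ a))) := by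
  obtain ⟨C, hC⟩ := exists_norm_term_le γ ha
  have hext : ∀ m, MemLp (radMul k (ext m)) 2 (diskMeasure γ) := fun m =>
    SmoothOnDisk.memLp_radMul hk hM (contDiff_ext m).contDiffOn
  set I := ∫ z, M (xr z) ^ 2 ∂diskMeasure γ
  have hS : Summable fun m => C * decay m := summable_decay.mul_left C
  have hcont : ∀ F : Finset ℤ, ContDiff ℝ ∞ fun z => ∑ m ∈ F, fourierCoeff a m / tauC γ * ext m z :=
    fun F => ContDiff.sum fun i _ => contDiff_const.mul (contDiff_ext i)
  have hfin : ∀ F : Finset ℤ, MemLp (radMul k fun z => ∑ m ∈ F, fourierCoeff a m / tauC γ * ext m z) 2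
      (diskMeasure γ) := fun F => SmoothOnDisk.memLp_radMul hk hM (hcont F).contDiffOn
  have hpart : ∀ F : Finset ℤ, ∑ m ∈ F, (fourierCoeff a m / tauC γ) • vec γ (radMul k (ext m))
      = vec γ (radMul k fun z => ∑ m ∈ F, fourierCoeff a m / tauC γ * ext m z) := fun F => by
    induction F using Finset.induction_on with
    | empty =>
      have : radMul k (fun z => ∑ m ∈ (∅ : Finset ℤ), fourierCoeff a m / tauC γ * ext m z)
          = fun z => 0 := by
        funext z; simp [radMul]
      rw [Finset.sum_empty, this]
      have h0 := vec_const_mul (γ := γ) 0 (hext 0)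
      simp only [zero_mul, zero_smul] at h0
      exact h0.symm
    | insert m F hm ih =>
      rw [Finset.sum_insert hm, ih, ← vec_const_mul _ (hext m),
        ← vec_add ((hext m).const_mul _) (hfin F)]
      congr 1
      funext z
      simp only [radMul, Finset.sum_insert hm]
      ring
  rw [HasSum, tendsto_iff_norm_sub_tendsto_zero]
  have hT : Tendsto (fun F : Finset ℤ => ((∑' m, C * decay m) - ∑ m ∈ F, C * decay m) ^ 2 * I)
      atTop (𝓝 0) := by
    have := ((tendsto_const_nhds (x := ∑' m, C * decay m)).sub hS.hasSum).pow 2 |>.mul_const I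
    simpa using this
  have hT := hT.sqrt
  rw [Real.sqrt_zero] at hT
  refine squeeze_zero (fun _ => norm_nonneg _) (fun F => Real.le_sqrt_of_sq_le ?_) hT
  have hd : (∑ m ∈ F, (fourierCoeff a m / tauC γ) • vec γ (radMul k (ext m)))
      - vec γ (radMul k (smoothLift γ a)) = vec γ (radMul k fun z =>
        (∑ m ∈ F, fourierCoeff a m / tauC γ * ext m z) - smoothLift γ a z) := by
    rw [hpart, ← vec_sub (hfin F) ((smoothOnDisk_smoothLift γ ha).memLp_radMul hk hM)]
    congr 1; funext z; simp only [radMul]; ring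
  rw [hd]
  refine (memLp_radMul hk hM ((hcont F).continuous.continuousOn.sub
    ((smoothOnDisk_smoothLift γ ha).continuousOn.mono Metric.ball_subset_closedBall)) fun z hz => ?_).2
  have hz' := mem_disk_of_xr hz
  have hsz := summable_term γ ha hz'
  have e1 := hsz.sum_add_tsum_compl (s := F)
  have e2 := hS.sum_add_tsum_compl (s := F)
  rw [Pi.sub_apply, norm_sub_rev, smoothLift, ← e1, add_sub_cancel_left, ← e2, add_sub_cancel_left]
  exact tsum_of_norm_bounded (hS.subtype _).hasSum fun m => hC m z hz'

theorem inner_eig_smoothLift {γ : ℝ} {a : S1 → ℂ} (ha : SmoothOnCircle a) (m : ℤ) (k : ℕ) :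
    ⟪eig γ (m, k), vec γ (wt γ (smoothLift γ a))⟫_ℂ
      = fourierCoeff a m / tauC γ * ⟪eig γ (m, k), vec γ (wt γ (ext m))⟫_ℂ := by
  obtain ⟨M, hb, hM⟩ := exists_radialBound_wt γ
  have h := (innerSL ℂ (eig γ (m, k))).hasSum (hasSum_vec_smoothLift hb hM ha)
  change HasSum _ (innerSL ℂ (eig γ (m, k)) (vec γ (wt γ (smoothLift γ a)))) at h
  rw [innerSL_apply_apply] at h
  rw [← h.tsum_eq, tsum_eq_single m]
  · simp only [innerSL_apply_apply, inner_smul_right]; rfl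
  · intro n hn
    have h0 : ⟪vec γ (wt γ (ext n)), eig γ (m, k)⟫_ℂ = 0 :=
      inner_eig_eq_zero (fun j => inner_monoVec_of_ne hn (n.natAbs ^ 2) j) k
    rw [innerSL_apply_apply, inner_smul_right]
    exact (congrArg _ (inner_eq_zero_symm.1 h0)).trans (mul_zero _)

/-! ### Functions smooth up to the boundary -/

theorem SmoothOnDisk.smoothInt {w : ℂ → ℂ} (hw : SmoothOnDisk w) : SmoothInt w := fun _ hz =>
  hw.contDiffAt (mem_of_superset (Metric.isOpen_ball.mem_nhds (mem_ball_iff_xr.2 hz))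
    Metric.ball_subset_closedBall)

theorem smoothOnDisk_of_contDiff {w : ℂ → ℂ} (hw : ContDiff ℝ ∞ w) : SmoothOnDisk w := hw.contDiffOn

theorem SmoothOnDisk.exists_norm_le {w : ℂ → ℂ} (hw : SmoothOnDisk w) : ∃ C, ∀ z ∈ disk, ‖w z‖ ≤ C :=
  (isCompact_closedBall (0 : ℂ) 1).exists_bound_of_continuousOn hw.continuousOn

theorem SmoothOnDisk.sub {v w : ℂ → ℂ} (hv : SmoothOnDisk v) (hw : SmoothOnDisk w) :
    SmoothOnDisk fun z => v z - w z := ContDiffOn.sub hv hw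

theorem SmoothOnDisk.const_mul {w : ℂ → ℂ} (c : ℂ) (hw : SmoothOnDisk w) :
    SmoothOnDisk fun z => c * w z := ContDiffOn.mul contDiffOn_const hw

theorem fderivWithin_disk (w : ℂ → ℂ) {z : ℂ} (hz : 0 < xr z) :
    fderivWithin ℝ w disk z = fderiv ℝ w z :=
  fderivWithin_of_mem_nhds (mem_of_superset (Metric.isOpen_ball.mem_nhds (mem_ball_iff_xr.2 hz))
    Metric.ball_subset_closedBall)

theorem SmoothOnDisk.fderivWithin {w : ℂ → ℂ} (hw : SmoothOnDisk w) :
    ContDiffOn ℝ ∞ (fderivWithin ℝ w disk) disk :=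
  ContDiffOn.fderivWithin hw uniqueDiffOn_disk (by simp)

/-- The Wirtinger derivatives extend smoothly to the closed disk. -/
theorem SmoothOnDisk.exists_wirtinger {w : ℂ → ℂ} (hw : SmoothOnDisk w) :
    ∃ A B : ℂ → ℂ, SmoothOnDisk A ∧ SmoothOnDisk B ∧ ∀ z, 0 < xr z → dz w z = A z ∧ db w z = B z := by
  have h : ∀ v : ℂ, ContDiffOn ℝ ∞ (fun z => _root_.fderivWithin ℝ w disk z v) disk := fun v =>
    hw.fderivWithin.clm_apply contDiffOn_const
  refine ⟨fun z => (_root_.fderivWithin ℝ w disk z 1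
      - Complex.I * _root_.fderivWithin ℝ w disk z Complex.I) / 2,
    fun z => (_root_.fderivWithin ℝ w disk z 1
      + Complex.I * _root_.fderivWithin ℝ w disk z Complex.I) / 2,
    ((h 1).sub (contDiffOn_const.mul (h Complex.I))).div_const 2,
    ((h 1).add (contDiffOn_const.mul (h Complex.I))).div_const 2, fun z hz => ?_⟩
  simp only [fderivWithin_disk w hz]
  exact ⟨rfl, rfl⟩

theorem eventually_xr {z : ℂ} (hz : 0 < xr z) : ∀ᶠ w in 𝓝 z, 0 < xr w :=
  continuous_xr.continuousAt.eventually (lt_mem_nhds hz)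

theorem SmoothOnDisk.exists_bounds {w : ℂ → ℂ} (hw : SmoothOnDisk w) (β : ℝ) :
    ∃ C : ℝ, C1Bounded w C ∧ (∀ z, 0 < xr z → ‖euler w z‖ ≤ C) ∧
      ∀ z, 0 < xr z → ‖keldysh β w z‖ ≤ C := by
  obtain ⟨A, B, hA, hB, hAB⟩ := hw.exists_wirtinger
  obtain ⟨A1, B1, hA1, hB1, hAB1⟩ := hA.exists_wirtinger
  obtain ⟨A2, B2, hA2, hB2, hAB2⟩ := hB.exists_wirtinger
  have hc : ContinuousOn (fun z : ℂ => conj z) disk := contDiff_conj.continuous.continuousOn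
  have hi : ContinuousOn (fun z : ℂ => z) disk := continuousOn_id
  have hE : ContinuousOn (fun z => z * A z + conj z * B z) disk :=
    (hi.mul hA.continuousOn).add (hc.mul hB.continuousOn)
  have hL : ContinuousOn (fun z => -4 * A2 z + z ^ 2 * A1 z + 2 * z * conj z * A2 z
      + conj z ^ 2 * B2 z + (3 + 2 * β) * (z * A z + conj z * B z) + (β + 1) ^ 2 * w z) disk :=
    ((((((continuousOn_const.mul hA2.continuousOn).add ((hi.pow 2).mul hA1.continuousOn)).add
      (((continuousOn_const.mul hi).mul hc).mul hA2.continuousOn)).add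
      ((hc.pow 2).mul hB2.continuousOn)).add (continuousOn_const.mul hE)).add
      (continuousOn_const.mul hw.continuousOn))
  have hK := isCompact_closedBall (0 : ℂ) 1
  obtain ⟨C0, h0⟩ := hw.exists_norm_le
  obtain ⟨C1, h1⟩ := hA.exists_norm_le
  obtain ⟨C2, h2⟩ := hB.exists_norm_le
  obtain ⟨C3, h3⟩ := hK.exists_bound_of_continuousOn hE
  obtain ⟨C4, h4⟩ := hK.exists_bound_of_continuousOn hL
  have hd : (0 : ℂ) ∈ disk := by simp
  have p0 := (norm_nonneg _).trans (h0 0 hd)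
  have p1 := (norm_nonneg _).trans (h1 0 hd)
  have p2 := (norm_nonneg _).trans (h2 0 hd)
  have p3 := (norm_nonneg _).trans (h3 0 hd)
  have p4 := (norm_nonneg _).trans (h4 0 hd)
  refine ⟨C0 + C1 + C2 + C3 + C4, ⟨hw.smoothInt, fun z hz => ?_, fun z hz => ?_, fun z hz => ?_⟩,
    fun z hz => ?_, fun z hz => ?_⟩
  · exact (h0 z (mem_disk_of_xr hz)).trans (by linarith)
  · rw [(hAB z hz).1]; exact (h1 z (mem_disk_of_xr hz)).trans (by linarith)
  · rw [(hAB z hz).2]; exact (h2 z (mem_disk_of_xr hz)).trans (by linarith)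
  · rw [euler, (hAB z hz).1, (hAB z hz).2]; exact (h3 z (mem_disk_of_xr hz)).trans (by linarith)
  · have eA : dz w =ᶠ[𝓝 z] A := (eventually_xr hz).mono fun y hy => (hAB y hy).1
    have eB : db w =ᶠ[𝓝 z] B := (eventually_xr hz).mono fun y hy => (hAB y hy).2
    rw [keldysh_eq β (hw.smoothInt z hz), dz_congr eA, dz_congr eB, db_congr eB, euler, (hAB z hz).1,
      (hAB z hz).2, (hAB1 z hz).1, (hAB2 z hz).1, (hAB2 z hz).2]
    exact (h4 z (mem_disk_of_xr hz)).trans (by linarith)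

theorem SmoothOnDisk.exists_lipschitz {w : ℂ → ℂ} (hw : SmoothOnDisk w) :
    ∃ C : ℝ, ∀ y ∈ disk, ∀ z ∈ disk, ‖w y - w z‖ ≤ C * ‖y - z‖ := by
  obtain ⟨C, hC⟩ := (isCompact_closedBall (0 : ℂ) 1).exists_bound_of_continuousOn
    hw.fderivWithin.continuousOn
  exact ⟨C, fun y hy z hz => (convex_closedBall (0 : ℂ) 1).norm_image_sub_le_of_norm_hasFDerivWithin_le
    (fun x hx => (hw.differentiableOn (by simp) x hx).hasFDerivWithinAt) hC hz hy⟩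

/-- w is Lipschitz on the closed disk, and the distance to the circle is 1 - |z| ≤ 1 - |z|². -/
theorem SmoothOnDisk.exists_le_xr {w : ℂ → ℂ} (hw : SmoothOnDisk w) (h : ∀ z, ‖z‖ = 1 → w z = 0) :
    ∃ C : ℝ, 0 ≤ C ∧ ∀ z ∈ disk, ‖w z‖ ≤ C * xr z := by
  obtain ⟨C, hC⟩ := hw.exists_lipschitz
  have hC0 : 0 ≤ C := by
    have := (norm_nonneg _).trans (hC 0 (by simp) 1 (by simp))
    simpa using this
  refine ⟨C, hC0, fun z hz => ?_⟩
  have hz1 : ‖z‖ ≤ 1 := by simpa using hz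
  have key : ∃ y : ℂ, ‖y‖ = 1 ∧ ‖z - y‖ = 1 - ‖z‖ := by
    rcases eq_or_ne z 0 with rfl | h0
    · exact ⟨1, by simp, by simp⟩
    · have hn : (‖z‖ : ℂ) ≠ 0 := by exact_mod_cast norm_ne_zero_iff.2 h0
      have hn' : ‖z‖ ≠ 0 := norm_ne_zero_iff.2 h0
      refine ⟨z / ‖z‖, by simp [hn'], ?_⟩
      have : z - z / ‖z‖ = z / ‖z‖ * ((‖z‖ - 1 : ℝ) : ℂ) := by
        push_cast; field_simp
      rw [this, norm_mul, norm_div, Complex.norm_real, Complex.norm_real, norm_norm, div_self hn',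
        one_mul, Real.norm_eq_abs, abs_of_nonpos (by linarith)]
      ring
  obtain ⟨y, hy, hzy⟩ := key
  have := hC z hz y (by simp [hy])
  rw [h y hy, sub_zero, hzy] at this
  refine this.trans (mul_le_mul_of_nonneg_left ?_ hC0)
  rw [xr]
  nlinarith [norm_nonneg z]

theorem SmoothOnDisk.wt_eq_dirichletInverse {γ : ℝ} (hγ : γ ∈ Set.Ioo (-1 : ℝ) 1) {p : ℂ → ℂ}
    (hp : SmoothOnDisk p) :
    vec γ (wt γ p) = dirichletInverse γ (vec γ (wt γ (keldysh |γ| p))) := by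
  obtain ⟨C, h1, -, h2⟩ := hp.exists_bounds |γ|
  exact KeldyshDisk.wt_eq_dirichletInverse hγ h1 h2

theorem SmoothOnDisk.mem_testGraph {γ : ℝ} (hγ : γ ∈ Set.Ioo (-1 : ℝ) 1) {k M : ℝ → ℝ} {w : ℂ → ℂ}
    (hk : RadialBound k M) (hM : Integrable (fun z => M (xr z) ^ 2) (diskMeasure γ))
    (hw : SmoothOnDisk w) (h : ∀ z, ‖z‖ = 1 → w z = 0) :
    MemLp (fun z => ((k (xr z) : ℝ) : ℂ) * w z) 2 (diskMeasure γ) ∧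
    (vec γ (fun z => ((k (xr z) : ℝ) : ℂ) * w z),
      vec γ (keldysh γ fun z => ((k (xr z) : ℝ) : ℂ) * w z)) ∈ testGraph γ := by
  obtain ⟨C, hC0, hC⟩ := hw.exists_le_xr h
  obtain ⟨D, -, h1, h2⟩ := hw.exists_bounds γ
  refine mem_testGraph_of_vanishing hγ hk hM hw.smoothInt (C := max C D) (fun z hz => ?_)
    (fun z hz => (h1 z hz).trans (le_max_right _ _)) (fun z hz => (h2 z hz).trans (le_max_right _ _))
  exact (hC z (mem_disk_of_xr hz)).trans (mul_le_mul_of_nonneg_right (le_max_left _ _) hz.le)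

theorem SmoothOnDisk.memLp_dual {γ : ℝ} (hγ : γ ∈ Set.Ioo (-1 : ℝ) 1) (ℓ : ℝ) {p : ℂ → ℂ}
    (hp : SmoothOnDisk p) : MemLp (dual γ ℓ p) 2 (diskMeasure γ) := by
  obtain ⟨C, hC⟩ := hp.exists_norm_le
  exact KeldyshDisk.memLp_dual hγ ℓ (hp.continuousOn.mono Metric.ball_subset_closedBall)
    fun z hz => hC z (mem_disk_of_xr hz)

/-! ### The minimal operator -/

theorem smoothFlat_of_testFunction {f : ℂ → ℂ} (hf : TestFunction f) : SmoothFlat f := by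
  refine ⟨hf.1.contDiffOn, fun k z hz => ?_⟩
  have hz' : z ∉ tsupport f := fun h => by
    have := hf.2.2 h
    rw [mem_ball_zero_iff, hz] at this
    exact lt_irrefl _ this
  have h : f =ᶠ[𝓝 z] fun _ => 0 := notMem_tsupport_iff_eventuallyEq.1 hz'
  rw [(h.filter_mono nhdsWithin_le_nhds).iteratedFDerivWithin_eq h.eq_of_nhds]
  simp

/-- Test functions are flat. Conversely a flat function vanishes on the circle, and this alone makes
it a graph limit of test functions. -/
theorem minimalGraph_eq {γ : ℝ} (hγ : γ ∈ Set.Ioo (-1 : ℝ) 1) : minimalGraph γ = testGraph γ := by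
  refine le_antisymm ?_ (testGraph_le (Submodule.isClosed_topologicalClosure _) fun f hf => ?_)
  · refine Submodule.topologicalClosure_minimal _ (Submodule.span_le.2 ?_) (isClosed_testGraph γ)
    rintro ⟨u, v⟩ ⟨f, hf, hu, hv⟩
    -- The exponent 0 gives the trivial radial factor 1.
    obtain ⟨C, hC, hb⟩ := RadialBound.rpow 0
    have := isFiniteMeasure_diskMeasure hγ.1
    have h := hf.1.mem_testGraph hγ hb (by simp) fun z hz => by
      have := hf.2 0 z hz
      have h0 := iteratedFDerivWithin_zero_apply (𝕜 := ℝ) (s := disk) (f := f) (x := z) 0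
      rw [this] at h0
      exact h0.symm
    have e : (fun z => ((xr z ^ (0 : ℝ) : ℝ) : ℂ) * f z) = f := by funext z; simp
    rw [e] at h
    rw [vec_eq hu, vec_eq hv] at h
    exact h.2
  · exact Submodule.le_topologicalClosure _ (Submodule.subset_span
      ⟨f, smoothFlat_of_testFunction hf, vec_ae (hf.memLp hγ.1), vec_ae ((hf.keldysh γ).memLp hγ.1)⟩)

/-! ### Restriction to the circle -/

theorem norm_polar_one (θ : ℝ) : ‖polar 1 θ‖ = 1 := by
  rw [polar, Complex.ofReal_one, one_mul, Complex.norm_exp_ofReal_mul_I]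

theorem exists_polar_one {z : ℂ} (hz : ‖z‖ = 1) : ∃ θ : ℝ, z = polar 1 θ := by
  refine ⟨z.arg, ?_⟩
  have h := Complex.norm_mul_exp_arg_mul_I z
  rw [hz] at h
  exact h.symm

/-- The restriction of `w` to the unit circle. -/
def circ (w : ℂ → ℂ) (θ : S1) : ℂ := w (AddCircle.toCircle θ : ℂ)

theorem circ_coe (w : ℂ → ℂ) (t : ℝ) : circ w (t : S1) = w (polar 1 t) := by
  rw [circ, AddCircle.toCircle_apply_mk, Circle.coe_exp, polar, div_self Real.two_pi_pos.ne', one_mul,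
    Complex.ofReal_one, one_mul]

theorem SmoothOnDisk.smoothOnCircle {w : ℂ → ℂ} (hw : SmoothOnDisk w) : SmoothOnCircle (circ w) := by
  have h : (fun t : ℝ => circ w (t : S1)) = w ∘ polar 1 := funext fun t => circ_coe w t
  rw [SmoothOnCircle, h]
  refine ContDiffOn.comp_contDiff hw ?_ fun t => by simp [norm_polar_one]
  exact contDiff_const.mul (Complex.contDiff_exp.comp
    (Complex.ofRealCLM.contDiff.mul contDiff_const))

theorem eq_zero_of_circ {w : ℂ → ℂ} (h : ∀ θ : ℝ, circ w (θ : S1) = 0) {z : ℂ} (hz : ‖z‖ = 1) :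
    w z = 0 := by
  obtain ⟨θ, rfl⟩ := exists_polar_one hz
  exact (circ_coe w θ).symm.trans (h θ)

/-- The smooth extension with prescribed boundary values. -/
def fill (γ : ℝ) (a : S1 → ℂ) (z : ℂ) : ℂ := tauC γ * smoothLift γ a z

theorem smoothOnDisk_fill (γ : ℝ) {a : S1 → ℂ} (ha : SmoothOnCircle a) : SmoothOnDisk (fill γ a) :=
  (smoothOnDisk_smoothLift γ ha).const_mul _

theorem sub_fill_eq_zero (γ : ℝ) {w : ℂ → ℂ} (hw : SmoothOnDisk w) {z : ℂ} (hz : ‖z‖ = 1) :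
    w z - fill γ (circ w) z = 0 := by
  obtain ⟨θ, rfl⟩ := exists_polar_one hz
  rw [fill, smoothLift_polar γ hw.smoothOnCircle, circ_coe, sub_self]

/-! ### Vanishing of the Dirichlet data -/

/-- Moving L^(1-s/2) to the monomial, whose spectral mass sits at Λ = |m| + 2n + 1, bounds the
squared pairing by a multiple of Λ^(1-r-|γ|) with r = min(s, 2). This decays since r > 1 - |γ|. -/
theorem tendsto_inner_lmonoVec {γ s : ℝ} (hγ : γ ∈ Set.Ioo (-1 : ℝ) 1) (hs : 1 + |γ| < s) (m : ℤ)
    (v : L2 γ) : Tendsto (fun n : ℕ => ⟪lmonoVec γ m n, dirichletNegPow γ s v⟫_ℂ) atTop (𝓝 0) := by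
  have hβ : |γ| < 1 := abs_lt.2 hγ
  have h0 := abs_nonneg γ
  have hs0 : 0 < s := by linarith
  -- Capping at 2 keeps the order 2 - r in `exists_frequency_bound` nonnegative; it only weakens the
  -- smoothness that is used.
  set r := min s 2 with hr
  have hr1 : 1 + |γ| < r := lt_min hs (by linarith)
  obtain ⟨C, hC, H⟩ := exists_frequency_bound (s := 2 - r) (c := 1) hγ
    (by have := min_le_right s 2; linarith) le_rfl
  have key : ∀ n : ℕ, m.natAbs ^ 2 ≤ n → ‖⟪lmonoVec γ m n, dirichletNegPow γ s v⟫_ℂ‖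
      ≤ Real.sqrt (C * (|(m : ℝ)| + 2 * n + 1) ^ (2 - r - 1 - |γ|)) * ‖v‖ := by
    intro n hn
    have hn' : (m : ℝ) ^ 2 ≤ n := by
      rw [← sq_abs, ← Int.cast_abs, ← Nat.cast_natAbs]; exact_mod_cast hn
    let c : ℤ × ℕ → ℂ := fun q => ((lam γ q.1 q.2 ^ (1 - s / 2) : ℝ) : ℂ) * ⟪eig γ q, monoVec γ m n⟫_ℂ
    have hab : ((m.toNat + n : ℕ) : ℝ) + ((-m).toNat + n : ℕ) = |(m : ℝ)| + 2 * n := by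
      push_cast; rw [← toNat_add]; ring
    have hb : ∀ F : Finset (ℤ × ℕ), ∑ q ∈ F, ‖c q‖ ^ 2
        ≤ C * (|(m : ℝ)| + 2 * n + 1) ^ (2 - r - 1 - |γ|) := fun F => by
      refine (Finset.sum_le_sum fun q _ => ?_).trans (H m (m.toNat + n) ((-m).toNat + n)
        (|(m : ℝ)| + 2 * n + 1) (by have := toNat_sub m; push_cast; omega)
        (by nlinarith [abs_nonneg (m : ℝ), sq_nonneg (m : ℝ)]) (by rw [hab, one_mul])
        (by rw [hab]; linarith) F)
      have hl := lam_pos γ q.1 q.2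
      simp only [c]
      rw [norm_mul, mul_pow, Complex.norm_of_nonneg (Real.rpow_nonneg hl.le _),
        ← Real.rpow_mul_natCast hl.le]
      refine mul_le_mul_of_nonneg_right (Real.rpow_le_rpow_of_exponent_le ?_ ?_) (sq_nonneg _)
      · have := le_lam γ q.1 q.2
        nlinarith [sq_nonneg (q.1 : ℝ)]
      · have := min_le_left s 2
        push_cast
        linarith
    have hsum : Summable fun q => ‖c q‖ ^ 2 := summable_of_sum_le (fun _ => sq_nonneg _) hb
    obtain ⟨w, hw⟩ := exists_of_coeff hγ hsum
    have hwn : ‖w‖ ≤ Real.sqrt (C * (|(m : ℝ)| + 2 * n + 1) ^ (2 - r - 1 - |γ|)) := by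
      refine Real.le_sqrt_of_sq_le ?_
      rw [← (hasSum_norm_sq_eig hγ w).tsum_eq]
      simp only [hw]
      exact hsum.tsum_le_of_sum_le hb
    have e : ⟪lmonoVec γ m n, dirichletNegPow γ s v⟫_ℂ = ⟪w, v⟫_ℂ := by
      rw [← (hasSum_inner_eig hγ _ _).tsum_eq, ← (hasSum_inner_eig hγ w v).tsum_eq]
      refine tsum_congr fun q => ?_
      have hl := lam_pos γ q.1 q.2
      have h1 : ⟪eig γ q, lmonoVec γ m n⟫_ℂ = (lam γ q.1 q.2 : ℂ) * ⟪eig γ q, monoVec γ m n⟫_ℂ := by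
        have hl' : (lam γ q.1 q.2 : ℂ) ≠ 0 := by exact_mod_cast hl.ne'
        rw [← dirichletInverse_lmonoVec hγ, inner_eig_dirichletInverse hγ]
        push_cast
        rw [mul_inv_cancel_left₀ hl']
      have h2 : lam γ q.1 q.2 * lam γ q.1 q.2 ^ (-(s / 2)) = lam γ q.1 q.2 ^ (1 - s / 2) := by
        rw [sub_eq_add_neg, Real.rpow_add hl, Real.rpow_one]
      rw [inner_eig_dirichletNegPow hγ hs0, ← inner_conj_symm (lmonoVec γ m n), h1,
        ← inner_conj_symm w, hw]
      simp only [c]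
      rw [map_mul, map_mul, Complex.conj_ofReal, Complex.conj_ofReal, ← h2]
      push_cast
      ring
    rw [e]
    exact (norm_inner_le_norm w v).trans (mul_le_mul_of_nonneg_right hwn (norm_nonneg v))
  have hT : Tendsto (fun n : ℕ => Real.sqrt (C * (|(m : ℝ)| + 2 * n + 1) ^ (2 - r - 1 - |γ|)) * ‖v‖)
      atTop (𝓝 0) := by
    have h1 : Tendsto (fun n : ℕ => |(m : ℝ)| + 2 * n + 1) atTop atTop :=
      tendsto_atTop_add_const_right _ _ (tendsto_atTop_add_const_left _ _
        (tendsto_natCast_atTop_atTop.const_mul_atTop two_pos))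
    have h2 := ((tendsto_rpow_neg_atTop (y := r + |γ| - 1) (by linarith)).comp h1).const_mul C
    have h3 := h2.sqrt.mul_const ‖v‖
    rw [mul_zero, Real.sqrt_zero, zero_mul] at h3
    refine h3.congr fun n => ?_
    simp only [Function.comp_apply]
    congr 4
    ring
  refine squeeze_zero_norm' ?_ hT
  filter_upwards [eventually_ge_atTop (m.natAbs ^ 2)] with n hn using key n hn

theorem tendsto_inner_lmonoVec_inverse {γ : ℝ} (hγ : γ ∈ Set.Ioo (-1 : ℝ) 1) (m : ℤ) (w : L2 γ) :
    Tendsto (fun n : ℕ => ⟪lmonoVec γ m n, dirichletInverse γ w⟫_ℂ) atTop (𝓝 0) := by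
  have h : |γ| < 1 := abs_lt.2 hγ
  rw [← dirichletNegPow_two]
  exact tendsto_inner_lmonoVec hγ (by linarith) m w

/-- By Green's formula the pairing is `kap γ` plus a pairing of the monomial itself, which tends to
0. The limit therefore detects the singular coefficient that elements of the Sobolev spaces do not
have. -/
theorem tendsto_inner_lmonoVec_dual {γ : ℝ} (hγ : γ ∈ Set.Ioo (-1 : ℝ) 1) (ℓ : ℝ) (m : ℤ) (j : ℕ) :
    Tendsto (fun n : ℕ => ⟪lmonoVec γ m n, vec γ (dual γ ℓ (mono m j))⟫_ℂ) atTop (𝓝 (kap γ)) := by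
  have h := (tendsto_inner_lmonoVec_inverse hγ m (vec γ (dualL γ ℓ (mono m j)))).const_add (kap γ : ℂ)
  rw [add_zero] at h
  refine h.congr fun n => ?_
  rw [← dirichletInverse_inner, dirichletInverse_lmonoVec hγ]
  have e := congrArg conj (dual_pairing hγ ℓ m j n)
  rw [map_sub, inner_conj_symm, inner_conj_symm, Complex.conj_ofReal] at e
  rw [← e]
  ring

theorem inner_lmonoVec_dual_of_ne {γ : ℝ} (hγ : γ ∈ Set.Ioo (-1 : ℝ) 1) (ℓ : ℝ) {m n : ℤ} (h : m ≠ n)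
    (i j : ℕ) : ⟪lmonoVec γ m i, vec γ (dual γ ℓ (mono n j))⟫_ℂ = 0 := by
  have h1 : ∀ i, ⟪monoVec γ m i, vec γ (dual γ ℓ (mono n j))⟫_ℂ = 0 := fun i =>
    inner_eq_zero_of_modes h (memLp_wt_of_continuous (contDiff_mono m i).continuous)
      (memLp_dual_of_continuous hγ ℓ (contDiff_mono n j).continuous)
      (wt_rotate fun _ z hw => mono_rotate hw m i z) (dual_rotate fun _ z hw => mono_rotate hw n j z)
  rw [lmonoVec, inner_sub_left, inner_smul_left, inner_smul_left, h1, h1]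
  ring

theorem inner_lmonoVec_dual_fill {γ : ℝ} (hγ : γ ∈ Set.Ioo (-1 : ℝ) 1) (ℓ : ℝ) {a : S1 → ℂ}
    (ha : SmoothOnCircle a) (m : ℤ) (i : ℕ) : ⟪lmonoVec γ m i, vec γ (dual γ ℓ (fill γ a))⟫_ℂ
      = fourierCoeff a m * ⟪lmonoVec γ m i, vec γ (dual γ ℓ (ext m))⟫_ℂ := by
  have hτ : (tauC γ : ℂ) ≠ 0 := by exact_mod_cast tauC_ne_zero γ
  obtain ⟨M, hb, -, hM⟩ := exists_radialBound_hfun hγ ℓ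
  have h := (innerSL ℂ (lmonoVec γ m i)).hasSum (hasSum_vec_smoothLift hb hM ha)
  change HasSum _ (innerSL ℂ (lmonoVec γ m i) (vec γ (dual γ ℓ (smoothLift γ a)))) at h
  rw [innerSL_apply_apply] at h
  have e1 : dual γ ℓ (fill γ a) = fun z => (tauC γ : ℂ) * dual γ ℓ (smoothLift γ a) z := by
    funext z; simp only [dual, fill]; ring
  rw [e1, vec_const_mul _ ((smoothOnDisk_smoothLift γ ha).memLp_dual hγ ℓ), inner_smul_right,
    ← h.tsum_eq, tsum_eq_single m]
  · simp only [innerSL_apply_apply, inner_smul_right]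
    rw [← mul_assoc, mul_div_cancel₀ _ hτ]
    rfl
  · intro n hn
    rw [innerSL_apply_apply, inner_smul_right]
    exact (congrArg _ (inner_lmonoVec_dual_of_ne hγ ℓ hn.symm i _)).trans (mul_zero _)

/-- A smooth function is the boundary value of its lift, and the lift depends only on the Fourier
coefficients. -/
theorem eq_zero_of_fourierCoeff {γ : ℝ} {a : S1 → ℂ} (ha : SmoothOnCircle a)
    (h : ∀ m, fourierCoeff a m = 0) (θ : ℝ) : a (θ : S1) = 0 := by
  rw [← smoothLift_polar γ ha, smoothLift]
  simp [h]

/-- A always carries the factor that is smaller at the circle and B the more singular one, so the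
two summands trade places for γ < 0. -/
theorem Conormal.exists_decomposition {γ : ℝ} {f : ℂ → ℂ} (hf : Conormal γ f) :
    ∃ A B : ℂ → ℂ, SmoothOnDisk A ∧ SmoothOnDisk B ∧
      ∀ z, 0 < xr z → f z = wt γ A z + dual γ 0 B z := by
  obtain ⟨f₀, f₁, h0, h1, h⟩ := hf
  rcases lt_or_ge γ 0 with hγ | hγ
  · refine ⟨f₁, f₀, h1, h0, fun z hz => ?_⟩
    rw [h z (mem_ball_iff_xr.2 hz), if_neg hγ.ne, wt, dual, hfun, if_neg hγ.ne, sig,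
      max_eq_left (by linarith), max_eq_right hγ.le]
    simp [xr, add_comm]
  · refine ⟨f₀, f₁, h0, h1, fun z hz => ?_⟩
    rw [h z (mem_ball_iff_xr.2 hz), wt, dual, hfun, sig, max_eq_right (by linarith), max_eq_left hγ,
      Real.rpow_zero, add_zero]
    simp [xr]

/-- The boundary data of a conormal element of a Sobolev space of large enough order. -/
theorem conormal_data {γ s : ℝ} (hγ : γ ∈ Set.Ioo (-1 : ℝ) 1) (hs : 1 + |γ| < s) {A B : ℂ → ℂ}
    (hA : SmoothOnDisk A) (hB : SmoothOnDisk B) {u : L2 γ} (hu : u ∈ dirichletSobolev γ s)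
    (h : u = vec γ (wt γ A) + vec γ (dual γ 0 B)) :
    (∀ z, ‖z‖ = 1 → B z = 0) ∧ ∀ m, bt γ m u = fourierCoeff (circ A) m := by
  obtain ⟨v, rfl⟩ := hu
  have hκ : (kap γ : ℂ) ≠ 0 := by exact_mod_cast kap_ne_zero γ
  obtain ⟨M, hb, -, hM⟩ := exists_radialBound_hfun hγ 0
  obtain ⟨M', hb', hM'⟩ := exists_radialBound_wt γ
  have ha := hA.smoothOnCircle
  have hb2 := hB.smoothOnCircle
  have hQA := smoothOnDisk_fill γ ha
  have hQB := smoothOnDisk_fill γ hb2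
  -- Subtracting an explicit smooth extension of the boundary values leaves functions that vanish on
  -- the circle, hence elements of the minimal domain even after multiplication by x^σ or h.
  obtain ⟨-, hP1⟩ := (hA.sub hQA).mem_testGraph hγ hb' hM' fun z hz => sub_fill_eq_zero γ hA hz
  obtain ⟨-, hP2⟩ := (hB.sub hQB).mem_testGraph hγ hb hM fun z hz => sub_fill_eq_zero γ hB hz
  have e1 : vec γ (wt γ A) = vec γ (wt γ fun z => A z - fill γ (circ A) z)
      + vec γ (wt γ (fill γ (circ A))) := by
    rw [← vec_add (memLp_wt_smoothOnDisk (hA.sub hQA)) (memLp_wt_smoothOnDisk hQA)]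
    congr 1; funext z; simp only [wt]; ring
  have e2 : vec γ (dual γ 0 B) = vec γ (dual γ 0 fun z => B z - fill γ (circ B) z)
      + vec γ (dual γ 0 (fill γ (circ B))) := by
    rw [← vec_add ((hB.sub hQB).memLp_dual hγ 0) (hQB.memLp_dual hγ 0)]
    congr 1; funext z; simp only [dual]; ring
  have k1 := testGraph_eq hγ.1 hP1
  have k2 := testGraph_eq hγ.1 hP2
  have k3 := hQA.wt_eq_dirichletInverse hγ
  change vec γ (wt γ fun z => A z - fill γ (circ A) z) = _ at k1
  change vec γ (dual γ 0 fun z => B z - fill γ (circ B) z) = _ at k2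
  -- Every part of u except h times the extension of B lies in the range of L_{γ,D}⁻¹ and pairs to 0
  -- in the limit, as does u itself. What remains is `kap γ` times a Fourier coefficient of B.
  have hzero : ∀ m, fourierCoeff (circ B) m = 0 := fun m => by
    have t1 := tendsto_inner_lmonoVec hγ hs m v
    have t2 : Tendsto (fun n : ℕ => ⟪lmonoVec γ m n, dirichletNegPow γ s v⟫_ℂ) atTop
        (𝓝 (0 + 0 + (0 + fourierCoeff (circ B) m * kap γ))) := by
      have hh := ((tendsto_inner_lmonoVec_inverse hγ m (vec γ (keldysh γ fun z =>
        ((xr z ^ sig γ : ℝ) : ℂ) * (A z - fill γ (circ A) z)))).add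
        (tendsto_inner_lmonoVec_inverse hγ m (vec γ (wt γ (keldysh |γ| (fill γ (circ A))))))).add
        ((tendsto_inner_lmonoVec_inverse hγ m (vec γ (keldysh γ fun z =>
          ((hfun γ 0 (xr z) : ℝ) : ℂ) * (B z - fill γ (circ B) z)))).add
          ((tendsto_inner_lmonoVec_dual hγ 0 m (m.natAbs ^ 2)).const_mul (fourierCoeff (circ B) m)))
      refine hh.congr fun n => ?_
      have h' : dirichletNegPow γ s v = _ := h
      rw [h', e1, e2, k1, k2, k3, inner_add_right, inner_add_right, inner_add_right,
        inner_lmonoVec_dual_fill hγ 0 hb2]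
      rfl
    have := tendsto_nhds_unique t1 t2
    rw [add_zero, zero_add, zero_add] at this
    exact (mul_eq_zero.1 this.symm).resolve_right hκ
  have hB0 : ∀ z, ‖z‖ = 1 → B z = 0 := fun z hz =>
    eq_zero_of_circ (eq_zero_of_fourierCoeff (γ := γ) hb2 hzero) hz
  refine ⟨hB0, fun m => ?_⟩
  obtain ⟨-, hP3⟩ := hB.mem_testGraph hγ hb hM hB0
  have k4 := testGraph_eq hγ.1 hP3
  change vec γ (dual γ 0 B) = _ at k4
  -- The two minimal parts have no boundary term in Green's formula, so only the extension of A
  -- contributes to the boundary coefficients of u.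
  have i1 := inner_testGraph hγ (ℓ := 0) (contDiff_mono m 0) hP1
  have i2 := inner_testGraph hγ (ℓ := 0) (contDiff_mono m 0) hP3
  have b1 := kap_mul_bt hγ 0 m 0 (vec γ (wt γ (keldysh |γ| (fill γ (circ A)))))
  set y1 := vec γ (keldysh γ fun z => ((xr z ^ sig γ : ℝ) : ℂ) * (A z - fill γ (circ A) z))
  set y2 := vec γ (keldysh γ fun z => ((hfun γ 0 (xr z) : ℝ) : ℂ) * B z)
  set y3 := vec γ (wt γ (keldysh |γ| (fill γ (circ A))))
  have hsum : (dirichletNegPow γ s v : L2 γ) = dirichletInverse γ (y1 + y3 + y2) := by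
    rw [map_add, map_add, ← k4, ← k3]
    exact h.trans (by rw [e1, k1])
  have b2 := kap_mul_bt hγ 0 m 0 (y1 + y3 + y2)
  have e3 : bt γ m (dirichletInverse γ y3) = fourierCoeff (circ A) m := by
    refine bt_lift hγ fun k => ?_
    have hτ : (tauC γ : ℂ) ≠ 0 := by exact_mod_cast tauC_ne_zero γ
    have e4 : wt γ (fill γ (circ A)) = fun z => (tauC γ : ℂ) * wt γ (smoothLift γ (circ A)) z := by
      funext z; simp only [wt, fill]; ring
    rw [← k3, e4, vec_const_mul _ (memLp_wt_smoothOnDisk (smoothOnDisk_smoothLift γ ha)),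
      inner_smul_right, inner_eig_smoothLift ha, ← mul_assoc, mul_div_cancel₀ _ hτ]
  refine mul_left_cancel₀ hκ ?_
  change (kap γ : ℂ) * bt γ m (dirichletNegPow γ s v) = _
  rw [hsum, b2, ← e3, b1]
  simp only [map_add, inner_add_right]
  rw [← k1, ← k4]
  change _ = ⟪_, vec γ (wt γ fun z => A z - fill γ (circ A) z)⟫_ℂ at i1
  change _ = ⟪_, vec γ (dual γ 0 B)⟫_ℂ at i2
  linear_combination i1 + i2

/-! ### The radial solution -/

theorem phi_of_neg (c : ℝ) {γ : ℝ} (h : γ < 0) (x : ℝ) : phi c γ x = 1 := if_pos h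

theorem phi_zero (c x : ℝ) : phi c 0 x = Real.log x - Real.log (1 - x) - c := by simp [phi]

theorem phi_of_pos (c : ℝ) {γ : ℝ} (h : 0 < γ) :
    phi c γ = fun x => -γ * ∑' k : ℕ, x ^ ((k : ℝ) - γ) / ((k : ℝ) - γ) := by
  funext x; rw [phi, if_neg (by linarith), if_neg h.ne']

theorem natCast_sub_ne_zero {γ : ℝ} (hγ : γ ∈ Set.Ioo (0 : ℝ) 1) (k : ℕ) : (k : ℝ) - γ ≠ 0 := by
  rcases Nat.eq_zero_or_pos k with rfl | hk
  · have := hγ.1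
    simp [this.ne']
  · have : (1 : ℝ) ≤ k := by exact_mod_cast hk
    have := hγ.2
    exact ne_of_gt (by linarith)

theorem le_abs_natCast_sub (γ : ℝ) (k : ℕ) :
    min γ (1 - γ) ≤ |(k : ℝ) - γ| := by
  rcases Nat.eq_zero_or_pos k with rfl | hk
  · rw [Nat.cast_zero, zero_sub, abs_neg]
    exact (min_le_left _ _).trans (le_abs_self _)
  · have : (1 : ℝ) ≤ k := by exact_mod_cast hk
    exact (min_le_right _ _).trans (le_trans (by linarith) (le_abs_self _))

/-- x^γ φ_γ is the power series -γ ∑ x^k/(k - γ), with denominators at least min(γ, 1 - γ) in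
modulus. It stays bounded away from x = 1. -/
theorem exists_phi_bound (c : ℝ) {γ : ℝ} (hγ : γ ∈ Set.Ioo (0 : ℝ) 1) :
    ∃ K : ℝ, 0 ≤ K ∧ ∀ x, 0 < x → x ≤ 3 / 4 → |x ^ γ * phi c γ x| ≤ K := by
  have hm : 0 < min γ (1 - γ) := lt_min hγ.1 (by linarith [hγ.2])
  have hg := (hasSum_geometric_of_lt_one (r := (3 / 4 : ℝ)) (by norm_num) (by norm_num)).div_const
    (min γ (1 - γ))
  refine ⟨γ * ((1 - 3 / 4 : ℝ)⁻¹ / min γ (1 - γ)), ?_, fun x hx hx1 => ?_⟩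
  · have := hγ.1
    positivity
  · rw [phi_of_pos c hγ.1, mul_left_comm, ← tsum_mul_left, abs_mul, abs_neg, abs_of_pos hγ.1]
    refine mul_le_mul_of_nonneg_left ((Real.norm_eq_abs _).symm.le.trans
      (tsum_of_norm_bounded hg fun k => ?_)) hγ.1.le
    rw [← mul_div_assoc, ← Real.rpow_add hx, add_sub_cancel, Real.rpow_natCast, Real.norm_eq_abs, abs_div,
      abs_of_nonneg (pow_nonneg hx.le k)]
    exact div_le_div₀ (by positivity) (pow_le_pow_left₀ hx.le hx1 k) hm (le_abs_natCast_sub γ k)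

/-- Termwise differentiation leaves a geometric series. Since 1 - x = ρ², it follows that ρ x^(γ+1)
∂_ρ φ_γ is the constant 2γ. -/
theorem hasDerivAt_phi (c : ℝ) {γ : ℝ} (hγ : γ ∈ Set.Ioo (0 : ℝ) 1) {x : ℝ} (hx : x ∈ Set.Ioo (0 : ℝ) 1) :
    HasDerivAt (phi c γ) (-γ * (x ^ (-γ - 1) / (1 - x))) x := by
  obtain ⟨b, hxb, hb⟩ := exists_between hx.2
  obtain ⟨a, ha, hax⟩ := exists_between hx.1
  have hm : 0 < min γ (1 - γ) := lt_min hγ.1 (by linarith [hγ.2])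
  have e : ∀ y : ℝ, 0 < y → ∀ k : ℕ, y ^ ((k : ℝ) - γ - 1) = y ^ (-γ - 1) * y ^ k := fun y hy k => by
    rw [← Real.rpow_natCast, ← Real.rpow_add hy]; congr 1; ring
  have hs : Summable fun k : ℕ => x ^ ((k : ℝ) - γ) / ((k : ℝ) - γ) := by
    refine Summable.of_norm_bounded (g := fun k : ℕ => x ^ (-γ) / min γ (1 - γ) * x ^ k)
      ((summable_geometric_of_lt_one hx.1.le hx.2).mul_left _) fun k => ?_
    have e1 : x ^ ((k : ℝ) - γ) = x ^ (-γ) * x ^ k := by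
      rw [← Real.rpow_natCast, ← Real.rpow_add hx.1]; congr 1; ring
    rw [norm_div, Real.norm_of_nonneg (Real.rpow_nonneg hx.1.le _), Real.norm_eq_abs, e1, div_mul_eq_mul_div]
    have := Real.rpow_nonneg hx.1.le (-γ)
    exact div_le_div_of_nonneg_left (mul_nonneg this (pow_nonneg hx.1.le k)) hm (le_abs_natCast_sub γ k)
  have h := hasDerivAt_tsum_of_isPreconnected (t := Set.Ioo a b)
    (u := fun k : ℕ => a ^ (-γ - 1) * b ^ k)
    (g := fun (k : ℕ) (y : ℝ) => y ^ ((k : ℝ) - γ) / ((k : ℝ) - γ))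
    (g' := fun (k : ℕ) (y : ℝ) => y ^ ((k : ℝ) - γ - 1)) (y₀ := x) (y := x)
    ((summable_geometric_of_lt_one (hx.1.trans hxb).le hb).mul_left _) isOpen_Ioo isPreconnected_Ioo
    (fun k y hy => by
      have hy0 : y ≠ 0 := (ha.trans hy.1).ne'
      have h1 := (Real.hasDerivAt_rpow_const (p := (k : ℝ) - γ) (Or.inl hy0)).div_const ((k : ℝ) - γ)
      refine h1.congr_deriv ?_
      exact mul_div_cancel_left₀ _ (natCast_sub_ne_zero hγ k)) (fun k y hy => by
      have hy0 := ha.trans hy.1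
      rw [Real.norm_of_nonneg (Real.rpow_nonneg hy0.le _), e y hy0 k]
      exact mul_le_mul (Real.rpow_le_rpow_of_nonpos ha hy.1.le (by linarith [hγ.1]))
        (pow_le_pow_left₀ hy0.le hy.2.le k) (by positivity) (Real.rpow_nonneg ha.le _))
    ⟨hax, hxb⟩ hs ⟨hax, hxb⟩
  rw [phi_of_pos c hγ.1]
  refine (h.const_mul (-γ)).congr_deriv ?_
  rw [tsum_congr fun k => e x hx.1 k, tsum_mul_left, tsum_geometric_of_lt_one hx.1.le hx.2, div_eq_mul_inv]

/-! ### Radial limits -/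

theorem xr_polar (ρ θ : ℝ) : xr (polar ρ θ) = 1 - ρ ^ 2 := by
  rw [xr, polar, norm_mul, Complex.norm_exp_ofReal_mul_I, mul_one, Complex.norm_real, Real.norm_eq_abs,
    sq_abs]

theorem polar_mem_disk {ρ : ℝ} (hρ : ρ ∈ Set.Icc (0 : ℝ) 1) (θ : ℝ) : polar ρ θ ∈ disk := by
  rw [mem_closedBall_zero_iff, polar, norm_mul, Complex.norm_exp_ofReal_mul_I, mul_one,
    Complex.norm_real, Real.norm_eq_abs, abs_of_nonneg hρ.1]
  exact hρ.2

theorem tendsto_polar (θ : ℝ) : Tendsto (fun ρ => polar ρ θ) (𝓝[<] 1) (𝓝[disk] (polar 1 θ)) := by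
  have hc : Continuous fun ρ => polar ρ θ := Complex.continuous_ofReal.mul continuous_const
  refine tendsto_nhdsWithin_iff.2 ⟨hc.continuousAt.continuousWithinAt, ?_⟩
  filter_upwards [Ioo_mem_nhdsLT (zero_lt_one' ℝ)] with ρ hρ
  exact polar_mem_disk ⟨hρ.1.le, hρ.2.le⟩ θ

theorem SmoothOnDisk.tendsto_radial {w : ℂ → ℂ} (hw : SmoothOnDisk w) (θ : ℝ) :
    Tendsto (fun ρ => w (polar ρ θ)) (𝓝[<] 1) (𝓝 (w (polar 1 θ))) :=
  (hw.continuousOn _ (polar_mem_disk ⟨zero_le_one, le_rfl⟩ θ)).tendsto.comp (tendsto_polar θ)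

theorem SmoothOnDisk.exists_radial_deriv {w : ℂ → ℂ} (hw : SmoothOnDisk w) (θ : ℝ) :
    ∃ (w' : ℝ → ℂ) (C : ℝ), 0 ≤ C ∧ ∀ ρ ∈ Set.Ioo (0 : ℝ) 1,
      HasDerivAt (fun t => w (polar t θ)) (w' ρ) ρ ∧ ‖w' ρ‖ ≤ C := by
  obtain ⟨C, hC⟩ := (isCompact_closedBall (0 : ℂ) 1).exists_bound_of_continuousOn
    hw.fderivWithin.continuousOn
  refine ⟨fun ρ => fderiv ℝ w (polar ρ θ) (Complex.exp (θ * Complex.I)), C,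
    (norm_nonneg _).trans (hC 0 (by simp)), fun ρ hρ => ?_⟩
  have hx : 0 < xr (polar ρ θ) := by rw [xr_polar]; nlinarith [hρ.1, hρ.2]
  constructor
  · have h1 : HasDerivAt (fun t => polar t θ) (Complex.exp (θ * Complex.I)) ρ := by
      have := (Complex.ofRealCLM.hasDerivAt (x := ρ)).mul_const (Complex.exp (θ * Complex.I))
      simpa [polar] using this
    exact (differentiableAt_of_smooth (hw.smoothInt _ hx)).hasFDerivAt.comp_hasDerivAt ρ h1
  · have h2 := hC (polar ρ θ) (mem_disk_of_xr hx)
    rw [fderivWithin_disk w hx] at h2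
    refine ((fderiv ℝ w (polar ρ θ)).le_opNorm _).trans ?_
    rw [Complex.norm_exp_ofReal_mul_I, mul_one]
    exact h2

theorem tendsto_one_sub_sq : Tendsto (fun ρ : ℝ => 1 - ρ ^ 2) (𝓝[<] 1) (𝓝[>] 0) := by
  refine tendsto_nhdsWithin_iff.2 ⟨?_, ?_⟩
  · have hc : Continuous fun ρ : ℝ => 1 - ρ ^ 2 := by fun_prop
    have := hc.tendsto 1
    rw [one_pow, sub_self] at this
    exact this.mono_left nhdsWithin_le_nhds
  · filter_upwards [Ioo_mem_nhdsLT (zero_lt_one' ℝ)] with ρ hρ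
    have : ρ ^ 2 < 1 := by nlinarith [hρ.1, hρ.2]
    simpa using this

theorem tendsto_rpow_one_sub_sq {a : ℝ} (ha : 0 < a) :
    Tendsto (fun ρ : ℝ => (1 - ρ ^ 2) ^ a) (𝓝[<] 1) (𝓝 0) := by
  have h := (Real.continuousAt_rpow_const 0 a (Or.inr ha.le)).tendsto
  rw [Real.zero_rpow ha.ne'] at h
  exact (h.mono_left nhdsWithin_le_nhds).comp tendsto_one_sub_sq

theorem hasDerivAt_radial {k : ℝ → ℝ} {k' ρ : ℝ} (h : HasDerivAt k k' (1 - ρ ^ 2)) :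
    HasDerivAt (fun t => k (1 - t ^ 2)) (k' * (-2 * ρ)) ρ := by
  have h1 : HasDerivAt (fun t : ℝ => 1 - t ^ 2) (-2 * ρ) ρ := by
    have := (hasDerivAt_pow 2 ρ).const_sub 1
    refine this.congr_deriv ?_
    simp
  exact h.comp ρ h1

theorem hasDerivAt_radial_mul {k : ℝ → ℝ} {k' ρ : ℝ} (h : HasDerivAt k k' (1 - ρ ^ 2)) {a : ℝ → ℂ} {a' : ℂ}
    (ha : HasDerivAt a a' ρ) : HasDerivAt (fun t => ((k (1 - t ^ 2) : ℝ) : ℂ) * a t)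
      (((k' * (-2 * ρ) : ℝ) : ℂ) * a ρ + ((k (1 - ρ ^ 2) : ℝ) : ℂ) * a') ρ :=
  (hasDerivAt_radial h).ofReal_comp.mul ha

/-- The terms of a Wronskian that remain bounded by powers of `x` do not contribute to the limit. -/
theorem hasNeumannTrace_of_radial {c₀ γ : ℝ} {f : ℂ → ℂ} {A : ℂ → ℂ} (hA : SmoothOnDisk A) {g : S1 → ℂ}
    (hg : ∀ θ : ℝ, g (θ : S1) = tauC γ * A (polar 1 θ))
    (h : ∀ θ : ℝ, ∃ E : ℝ → ℝ, Tendsto E (𝓝[<] 1) (𝓝 0) ∧ ∀ᶠ ρ in 𝓝[<] 1,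
      ‖wronskian c₀ γ f ρ θ - ((if γ < 0 then ρ ^ 2 else 1 : ℝ) : ℂ) * (tauC γ * A (polar ρ θ))‖ ≤ E ρ) :
    HasNeumannTrace c₀ γ f g := by
  intro θ
  obtain ⟨E, hE, hle⟩ := h θ
  rw [hg]
  have h1 := squeeze_zero_norm' hle hE
  -- For γ < 0 the leading term carries ρ²: one factor from the Wronskian, one from ∂_ρ x^(-γ).
  -- Otherwise the factor is exactly 1.
  have h2 : Tendsto (fun ρ : ℝ => ((if γ < 0 then ρ ^ 2 else 1 : ℝ) : ℂ)) (𝓝[<] 1) (𝓝 1) := by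
    have hc : Continuous fun ρ : ℝ => ((if γ < 0 then ρ ^ 2 else 1 : ℝ) : ℂ) := by
      split_ifs
      · exact Complex.continuous_ofReal.comp (continuous_pow 2)
      · exact continuous_const
    have := hc.tendsto 1
    simp only [one_pow, ite_self, Complex.ofReal_one] at this
    exact this.mono_left nhdsWithin_le_nhds
  have h3 := h1.add (h2.mul ((hA.tendsto_radial θ).const_mul (tauC γ : ℂ)))
  rw [zero_add, one_mul] at h3
  refine h3.congr fun ρ => ?_
  ring

section

variable {c₀ γ : ℝ} {f A B : ℂ → ℂ} {g : S1 → ℂ}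

theorem deriv_polar_eq {θ ρ : ℝ} (hρ : ρ ∈ Set.Ioo (0 : ℝ) 1)
    (h : ∀ z, 0 < xr z → f z = wt γ A z + dual γ 0 B z) {a' b' : ℂ} {h' : ℝ}
    (ha : HasDerivAt (fun t => A (polar t θ)) a' ρ) (hb : HasDerivAt (fun t => B (polar t θ)) b' ρ)
    (hh : HasDerivAt (hfun γ 0) h' (1 - ρ ^ 2)) :
    deriv (fun t => f (polar t θ)) ρ
      = ((sig γ * (1 - ρ ^ 2) ^ (sig γ - 1) * (-2 * ρ) : ℝ) : ℂ) * A (polar ρ θ)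
        + (((1 - ρ ^ 2) ^ sig γ : ℝ) : ℂ) * a'
        + (((h' * (-2 * ρ) : ℝ) : ℂ) * B (polar ρ θ) + ((hfun γ 0 (1 - ρ ^ 2) : ℝ) : ℂ) * b') := by
  have hX : 0 < 1 - ρ ^ 2 := by nlinarith [hρ.1, hρ.2]
  have h1 := hasDerivAt_radial_mul (k := fun x => x ^ sig γ)
    (Real.hasDerivAt_rpow_const (p := sig γ) (Or.inl hX.ne')) ha
  have h2 := hasDerivAt_radial_mul hh hb
  refine HasDerivAt.deriv ((h1.add h2).congr_of_eventuallyEq ?_)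
  filter_upwards [Ioo_mem_nhds hρ.1 hρ.2] with t ht
  have hx : 0 < xr (polar t θ) := by rw [xr_polar]; nlinarith [ht.1, ht.2]
  rw [h _ hx, wt, dual, xr_polar]
  rfl

/-- Here φ_γ = 1, and ∂_ρ x^(-γ) = 2γρ x^(-γ-1) gives the leading term -2γρ² A = 2|γ|ρ² A. The part
B contributes O(x^(γ+1)), so its boundary values play no role. -/
theorem hasNeumannTrace_of_neg (hγ : γ ∈ Set.Ioo (-1 : ℝ) 0) (hA : SmoothOnDisk A) (hB : SmoothOnDisk B)
    (h : ∀ z, 0 < xr z → f z = wt γ A z + dual γ 0 B z)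
    (hg : ∀ θ : ℝ, g (θ : S1) = tauC γ * A (polar 1 θ)) : HasNeumannTrace c₀ γ f g := by
  refine hasNeumannTrace_of_radial hA hg fun θ => ?_
  obtain ⟨a', Ca, hCa, ha⟩ := hA.exists_radial_deriv θ
  obtain ⟨b', Cb, hCb, hb⟩ := hB.exists_radial_deriv θ
  have hs : sig γ = -γ := by rw [sig, max_eq_left (by linarith [hγ.2])]
  have hh : hfun γ 0 = fun _ => 1 := by
    funext x; rw [hfun, if_neg hγ.2.ne, max_eq_right hγ.2.le, neg_zero, Real.rpow_zero]
  refine ⟨fun ρ => Ca * (1 - ρ ^ 2) ^ (1 : ℝ) + Cb * (1 - ρ ^ 2) ^ (γ + 1), ?_, ?_⟩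
  · have := ((tendsto_rpow_one_sub_sq one_pos).const_mul Ca).add
      ((tendsto_rpow_one_sub_sq (a := γ + 1) (by linarith [hγ.1])).const_mul Cb)
    simpa using this
  · filter_upwards [Ioo_mem_nhdsLT (zero_lt_one' ℝ)] with ρ hρ
    have hX : 0 < 1 - ρ ^ 2 := by nlinarith [hρ.1, hρ.2]
    have hd := deriv_polar_eq (θ := θ) hρ h (ha ρ hρ).1 (hb ρ hρ).1
      (h' := 0) (by rw [hh]; exact hasDerivAt_const _ _)
    have hp : deriv (fun t : ℝ => phi c₀ γ (1 - t ^ 2)) ρ = 0 := by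
      simp only [phi_of_neg c₀ hγ.2]; exact deriv_const _ _
    rw [wronskian, hp, hd, phi_of_neg c₀ hγ.2, if_pos hγ.2, tauC, if_neg hγ.2.ne, abs_of_neg hγ.2, hs, hh,
      Real.rpow_one]
    set X := 1 - ρ ^ 2
    have e1 : X ^ (γ + 1) * X ^ (-γ - 1) = 1 := by
      rw [← Real.rpow_add hX, show γ + 1 + (-γ - 1) = 0 by ring, Real.rpow_zero]
    have e2 : X ^ (γ + 1) * X ^ (-γ) = X := by
      rw [← Real.rpow_add hX, show γ + 1 + -γ = 1 by ring, Real.rpow_one]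
    have e1' : ((X ^ (γ + 1) : ℝ) : ℂ) * ((X ^ (-γ - 1) : ℝ) : ℂ) = 1 := by exact_mod_cast e1
    have e2' : ((X ^ (γ + 1) : ℝ) : ℂ) * ((X ^ (-γ) : ℝ) : ℂ) = (X : ℂ) := by exact_mod_cast e2
    have e3 : ((ρ * X ^ (γ + 1) : ℝ) : ℂ) * (f (polar ρ θ) * ((0 : ℝ) : ℂ) - ((1 : ℝ) : ℂ)
        * (((-γ * X ^ (-γ - 1) * (-2 * ρ) : ℝ) : ℂ) * A (polar ρ θ) + ((X ^ (-γ) : ℝ) : ℂ) * a' ρ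
          + (((0 * (-2 * ρ) : ℝ) : ℂ) * B (polar ρ θ) + ((1 : ℝ) : ℂ) * b' ρ)))
        - ((ρ ^ 2 : ℝ) : ℂ) * (((2 * -γ : ℝ) : ℂ) * A (polar ρ θ))
        = -(((ρ * X : ℝ) : ℂ) * a' ρ + ((ρ * X ^ (γ + 1) : ℝ) : ℂ) * b' ρ) := by
      push_cast
      linear_combination (-2 * (ρ : ℂ) ^ 2 * γ * A (polar ρ θ)) * e1' - (ρ : ℂ) * a' ρ * e2'
    rw [e3, norm_neg]
    refine (norm_add_le _ _).trans ?_
    have hXp := Real.rpow_nonneg hX.le (γ + 1)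
    rw [norm_mul, norm_mul, Complex.norm_of_nonneg (mul_nonneg hρ.1.le hX.le),
      Complex.norm_of_nonneg (mul_nonneg hρ.1.le hXp), mul_comm Ca, mul_comm Cb]
    exact add_le_add
      (mul_le_mul (mul_le_of_le_one_left hX.le hρ.2.le) (ha ρ hρ).2 (norm_nonneg _) hX.le)
      (mul_le_mul (mul_le_of_le_one_left hXp hρ.2.le) (hb ρ hρ).2 (norm_nonneg _) hXp)

/-- The derivative of φ_γ contributes exactly 2γ f. Since B = O(x), the singular part of f is
O(x^(1-γ)). The other half of the Wronskian is small because x^(γ+1) φ_γ = O(x). -/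
theorem hasNeumannTrace_of_pos (hγ : γ ∈ Set.Ioo (0 : ℝ) 1) (hA : SmoothOnDisk A) (hB : SmoothOnDisk B)
    (hB0 : ∀ z, ‖z‖ = 1 → B z = 0) (h : ∀ z, 0 < xr z → f z = wt γ A z + dual γ 0 B z)
    (hg : ∀ θ : ℝ, g (θ : S1) = tauC γ * A (polar 1 θ)) : HasNeumannTrace c₀ γ f g := by
  refine hasNeumannTrace_of_radial hA hg fun θ => ?_
  obtain ⟨a', Ca, hCa, ha⟩ := hA.exists_radial_deriv θ
  obtain ⟨b', Cb, hCb, hb⟩ := hB.exists_radial_deriv θ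
  obtain ⟨C, hC, hBx⟩ := hB.exists_le_xr hB0
  obtain ⟨K, hK, hφ⟩ := exists_phi_bound c₀ hγ
  have hγ0 := hγ.1
  have hs : sig γ = 0 := by rw [sig, max_eq_right (by linarith)]
  have hh : hfun γ 0 = fun x => x ^ (-γ) := by
    funext x; rw [hfun, if_neg hγ0.ne', max_eq_left hγ0.le]
  refine ⟨fun ρ => (2 * γ * C + K * (2 * γ * C + Cb)) * (1 - ρ ^ 2) ^ (1 - γ)
    + K * Ca * (1 - ρ ^ 2) ^ (1 : ℝ), ?_, ?_⟩
  · have := ((tendsto_rpow_one_sub_sq (a := 1 - γ) (by linarith [hγ.2])).const_mul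
      (2 * γ * C + K * (2 * γ * C + Cb))).add ((tendsto_rpow_one_sub_sq one_pos).const_mul (K * Ca))
    simpa using this
  -- ρ > 1/2 means x < 3/4, the range in which `exists_phi_bound` applies.
  · filter_upwards [Ioo_mem_nhdsLT (show (1 / 2 : ℝ) < 1 by norm_num)] with ρ hρ'
    have hρ : ρ ∈ Set.Ioo (0 : ℝ) 1 := ⟨by linarith [hρ'.1], hρ'.2⟩
    have hX : 0 < 1 - ρ ^ 2 := by nlinarith [hρ.1, hρ.2]
    have hX34 : 1 - ρ ^ 2 ≤ 3 / 4 := by nlinarith [hρ'.1]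
    have hX1 : 1 - ρ ^ 2 ∈ Set.Ioo (0 : ℝ) 1 := ⟨hX, by linarith⟩
    have hd := deriv_polar_eq (θ := θ) hρ h (ha ρ hρ).1 (hb ρ hρ).1
      (h' := -γ * (1 - ρ ^ 2) ^ (-γ - 1)) (by rw [hh]; exact Real.hasDerivAt_rpow_const (Or.inl hX.ne'))
    have hp := (hasDerivAt_radial (hasDerivAt_phi c₀ hγ hX1)).deriv
    have hBb := hBx (polar ρ θ) (polar_mem_disk ⟨hρ.1.le, hρ.2.le⟩ θ)
    have hψ := hφ _ hX hX34
    have hx : 0 < xr (polar ρ θ) := by rw [xr_polar]; exact hX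
    rw [xr_polar] at hBb
    rw [wronskian, hp, hd, h _ hx, wt, dual, xr_polar, if_neg hγ0.le.not_gt, tauC, if_neg hγ0.ne',
      abs_of_pos hγ0, hs, hh, Real.rpow_one, Real.rpow_zero, show 1 - (1 - ρ ^ 2) = ρ ^ 2 by ring]
    have hρ0 : (ρ : ℂ) ≠ 0 := by exact_mod_cast hρ.1.ne'
    set X := 1 - ρ ^ 2
    generalize phi c₀ γ X = φ at *
    have e1 : X ^ (γ + 1) * X ^ (-γ - 1) = 1 := by
      rw [← Real.rpow_add hX, show γ + 1 + (-γ - 1) = 0 by ring, Real.rpow_zero]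
    have e0 : X ^ (γ + 1) = X ^ γ * X := by rw [Real.rpow_add hX, Real.rpow_one]
    have e5 : X ^ (-γ - 1) * X = X ^ (-γ) := by
      rw [← Real.rpow_add_one hX.ne']; congr 1; ring
    have e6 : X ^ (-γ) * X = X ^ (1 - γ) := by
      rw [← Real.rpow_add_one hX.ne']; congr 1; ring
    have e1' : ((X ^ (γ + 1) : ℝ) : ℂ) * ((X ^ (-γ - 1) : ℝ) : ℂ) = 1 := by exact_mod_cast e1
    have e0' : ((X ^ (γ + 1) : ℝ) : ℂ) = ((X ^ γ : ℝ) : ℂ) * X := by exact_mod_cast e0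
    have e5' : ((X ^ (-γ - 1) : ℝ) : ℂ) * X = ((X ^ (-γ) : ℝ) : ℂ) := by exact_mod_cast e5
    have e6' : ((X ^ (-γ) : ℝ) : ℂ) * X = ((X ^ (1 - γ) : ℝ) : ℂ) := by exact_mod_cast e6
    have e3 : ((ρ * X ^ (γ + 1) : ℝ) : ℂ) * ((((1 : ℝ) : ℂ) * A (polar ρ θ)
          + ((X ^ (-γ) : ℝ) : ℂ) * B (polar ρ θ))
            * ((-γ * (X ^ (-γ - 1) / ρ ^ 2) * (-2 * ρ) : ℝ) : ℂ) - (φ : ℂ)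
        * (((0 * X ^ ((0 : ℝ) - 1) * (-2 * ρ) : ℝ) : ℂ) * A (polar ρ θ) + ((1 : ℝ) : ℂ) * a' ρ
          + (((-γ * X ^ (-γ - 1) * (-2 * ρ) : ℝ) : ℂ) * B (polar ρ θ) + ((X ^ (-γ) : ℝ) : ℂ) * b' ρ)))
        - ((1 : ℝ) : ℂ) * (((2 * γ : ℝ) : ℂ) * A (polar ρ θ))
        = ((2 * γ * X ^ (-γ) : ℝ) : ℂ) * B (polar ρ θ) - ((ρ * (X ^ γ * φ) : ℝ) : ℂ)
          * ((X : ℂ) * a' ρ + ((2 * γ * ρ * X ^ (-γ) : ℝ) : ℂ) * B (polar ρ θ)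
            + ((X ^ (1 - γ) : ℝ) : ℂ) * b' ρ) := by
      have e7 : ((ρ * X ^ (γ + 1) : ℝ) : ℂ) * ((-γ * (X ^ (-γ - 1) / ρ ^ 2) * (-2 * ρ) : ℝ) : ℂ)
          = 2 * γ := by
        push_cast
        field_simp
        linear_combination (γ : ℂ) * e1'
      clear_value X
      generalize X ^ (γ + 1) = P at *
      generalize X ^ (-γ - 1) = Q at *
      generalize X ^ (-γ) = R at *
      generalize X ^ (1 - γ) = S at *
      generalize X ^ γ = p at *
      push_cast at e7 ⊢
      linear_combination (A (polar ρ θ) + R * B (polar ρ θ)) * e7 - ρ * φ * a' ρ * e0'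
        - 2 * γ * ρ ^ 2 * φ * B (polar ρ θ) * (Q * e0' + p * e5')
        - ρ * φ * b' ρ * (R * e0' + p * e6')
    rw [e3]
    have p1 := Real.rpow_nonneg hX.le (-γ)
    have p2 := Real.rpow_nonneg hX.le (1 - γ)
    have n1 : ‖((2 * γ * X ^ (-γ) : ℝ) : ℂ) * B (polar ρ θ)‖ ≤ 2 * γ * C * X ^ (1 - γ) := by
      rw [norm_mul, Complex.norm_of_nonneg (by positivity), ← e6]
      refine (mul_le_mul_of_nonneg_left hBb (by positivity)).trans (le_of_eq (by ring))
    have n2 : ‖(X : ℂ) * a' ρ‖ ≤ X * Ca := by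
      rw [norm_mul, Complex.norm_of_nonneg hX.le]
      exact mul_le_mul_of_nonneg_left (ha ρ hρ).2 hX.le
    have n3 : ‖((2 * γ * ρ * X ^ (-γ) : ℝ) : ℂ) * B (polar ρ θ)‖ ≤ 2 * γ * C * X ^ (1 - γ) := by
      refine le_trans ?_ n1
      rw [norm_mul, norm_mul]
      refine mul_le_mul_of_nonneg_right ?_ (norm_nonneg _)
      have := hρ.1.le
      rw [Complex.norm_of_nonneg (by positivity), Complex.norm_of_nonneg (by positivity)]
      refine mul_le_mul_of_nonneg_right ?_ p1
      nlinarith [hρ.2]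
    have n4 : ‖((X ^ (1 - γ) : ℝ) : ℂ) * b' ρ‖ ≤ X ^ (1 - γ) * Cb := by
      rw [norm_mul, Complex.norm_of_nonneg p2]
      exact mul_le_mul_of_nonneg_left (hb ρ hρ).2 p2
    have n5 : ‖((ρ * (X ^ γ * φ) : ℝ) : ℂ)‖ ≤ K := by
      rw [Complex.norm_real, Real.norm_eq_abs, abs_mul, abs_of_pos hρ.1]
      exact (mul_le_of_le_one_left (abs_nonneg _) hρ.2.le).trans hψ
    refine (norm_sub_le _ _).trans ?_
    rw [norm_mul ((ρ * (X ^ γ * φ) : ℝ) : ℂ)]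
    have n6 := mul_le_mul n5 ((norm_add₃_le).trans (add_le_add (add_le_add n2 n3) n4))
      (norm_nonneg _) hK
    refine (add_le_add n1 n6).trans (le_of_eq (by ring))

/-- The summand -log(1 - x) makes ρ x ∂_ρ φ_0 = -2(ρ² + x) = -2 exactly. As B = O(x), the remaining
terms are bounded by x, x|log x| and x log² x. -/
theorem hasNeumannTrace_zero (hA : SmoothOnDisk A) (hB : SmoothOnDisk B)
    (hB0 : ∀ z, ‖z‖ = 1 → B z = 0) (h : ∀ z, 0 < xr z → f z = wt 0 A z + dual 0 0 B z)
    (hg : ∀ θ : ℝ, g (θ : S1) = tauC 0 * A (polar 1 θ)) : HasNeumannTrace c₀ 0 f g := by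
  refine hasNeumannTrace_of_radial hA hg fun θ => ?_
  obtain ⟨a', Ca, hCa, ha⟩ := hA.exists_radial_deriv θ
  obtain ⟨b', Cb, hCb, hb⟩ := hB.exists_radial_deriv θ
  obtain ⟨C, hC, hBx⟩ := hB.exists_le_xr hB0
  have hs : sig 0 = 0 := by simp [sig]
  have hh : hfun 0 0 = Real.log := by funext x; simp [hfun]
  -- For ρ > 1/2 one has |log ρ²| ≤ log 4, so φ_0 differs from log x by at most K.
  set K := Real.log 4 + |c₀| with hKdef
  have hK : 0 ≤ K := add_nonneg (Real.log_nonneg (by norm_num)) (abs_nonneg _)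
  refine ⟨fun ρ => 2 * C * |Real.log (1 - ρ ^ 2) * (1 - ρ ^ 2) ^ (1 : ℝ)|
    + ((Ca + 2 * C) * (|Real.log (1 - ρ ^ 2) * (1 - ρ ^ 2) ^ (1 : ℝ)| + K * (1 - ρ ^ 2) ^ (1 : ℝ))
      + Cb * ((Real.log (1 - ρ ^ 2) * (1 - ρ ^ 2) ^ (1 / 2 : ℝ)) ^ 2
        + K * |Real.log (1 - ρ ^ 2) * (1 - ρ ^ 2) ^ (1 : ℝ)|)), ?_, ?_⟩
  · have t1 := ((tendsto_log_mul_rpow_nhdsGT_zero one_pos).comp tendsto_one_sub_sq).abs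
    have t2 := tendsto_rpow_one_sub_sq one_pos
    have t3 := ((tendsto_log_mul_rpow_nhdsGT_zero (r := 1 / 2) (by norm_num)).comp tendsto_one_sub_sq).pow 2
    have := (t1.const_mul (2 * C)).add (((t1.add (t2.const_mul K)).const_mul (Ca + 2 * C)).add
      ((t3.add (t1.const_mul K)).const_mul Cb))
    simpa using this
  · filter_upwards [Ioo_mem_nhdsLT (show (1 / 2 : ℝ) < 1 by norm_num)] with ρ hρ'
    have hρ : ρ ∈ Set.Ioo (0 : ℝ) 1 := ⟨by linarith [hρ'.1], hρ'.2⟩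
    have hX : 0 < 1 - ρ ^ 2 := by nlinarith [hρ.1, hρ.2]
    have hρ2 : 0 < ρ ^ 2 := by nlinarith [hρ.1]
    have hd := deriv_polar_eq (θ := θ) hρ h (ha ρ hρ).1 (hb ρ hρ).1
      (h' := (1 - ρ ^ 2)⁻¹) (by rw [hh]; exact Real.hasDerivAt_log hX.ne')
    have hφd : HasDerivAt (phi c₀ 0) ((1 - ρ ^ 2)⁻¹ + (ρ ^ 2)⁻¹) (1 - ρ ^ 2) := by
      have h1 : HasDerivAt (fun x : ℝ => Real.log (1 - x)) (-(ρ ^ 2)⁻¹) (1 - ρ ^ 2) := by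
        have := ((hasDerivAt_id (1 - ρ ^ 2)).const_sub 1).log (by simp [hρ.1.ne'])
        refine this.congr_deriv ?_
        simp [div_eq_mul_inv]
      have h2 := ((Real.hasDerivAt_log hX.ne').sub h1).sub_const c₀
      rw [sub_neg_eq_add] at h2
      exact h2.congr_of_eventuallyEq (Eventually.of_forall fun x => phi_zero c₀ x)
    have hp := (hasDerivAt_radial hφd).deriv
    have hBb := hBx (polar ρ θ) (polar_mem_disk ⟨hρ.1.le, hρ.2.le⟩ θ)
    have hx : 0 < xr (polar ρ θ) := by rw [xr_polar]; exact hX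
    have hφ : |phi c₀ 0 (1 - ρ ^ 2)| ≤ |Real.log (1 - ρ ^ 2)| + K := by
      rw [phi_zero, show 1 - (1 - ρ ^ 2) = ρ ^ 2 by ring]
      have h1 : |Real.log (ρ ^ 2)| ≤ Real.log 4 := by
        rw [abs_of_nonpos (Real.log_nonpos hρ2.le (by nlinarith [hρ.2, hρ.1])), ← Real.log_inv]
        refine Real.log_le_log (by positivity) ?_
        rw [inv_le_comm₀ hρ2 (by norm_num)]
        nlinarith [hρ'.1]
      refine (abs_sub _ _).trans ?_
      have := abs_sub (Real.log (1 - ρ ^ 2)) (Real.log (ρ ^ 2))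
      rw [hKdef]
      linarith
    rw [xr_polar] at hBb
    rw [wronskian, hp, hd, h _ hx, wt, dual, xr_polar, if_neg (lt_irrefl 0), tauC, if_pos rfl, hs, hh,
      zero_add]
    simp only [Real.rpow_one, Real.rpow_zero]
    have hρ0 : (ρ : ℂ) ≠ 0 := by exact_mod_cast hρ.1.ne'
    have eX : ((1 - ρ ^ 2 : ℝ) : ℂ) = 1 - (ρ : ℂ) ^ 2 := by push_cast; rfl
    generalize phi c₀ 0 (1 - ρ ^ 2) = φ at *
    have eh : (1 - ρ ^ 2) ^ (1 / 2 : ℝ) * (1 - ρ ^ 2) ^ (1 / 2 : ℝ) = 1 - ρ ^ 2 := by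
      rw [← Real.rpow_add hX]; norm_num
    generalize (1 - ρ ^ 2) ^ (1 / 2 : ℝ) = y at *
    generalize 1 - ρ ^ 2 = X at *
    have hX0 : (X : ℂ) ≠ 0 := by exact_mod_cast hX.ne'
    generalize Real.log X = L at *
    have e3 : ((ρ * X : ℝ) : ℂ) * ((((1 : ℝ) : ℂ) * A (polar ρ θ) + (L : ℂ) * B (polar ρ θ))
            * (((X⁻¹ + (ρ ^ 2)⁻¹) * (-2 * ρ) : ℝ) : ℂ) - (φ : ℂ)
        * (((0 * X ^ ((0 : ℝ) - 1) * (-2 * ρ) : ℝ) : ℂ) * A (polar ρ θ) + ((1 : ℝ) : ℂ) * a' ρ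
          + (((X⁻¹ * (-2 * ρ) : ℝ) : ℂ) * B (polar ρ θ) + (L : ℂ) * b' ρ)))
        - ((1 : ℝ) : ℂ) * (((-2 : ℝ) : ℂ) * A (polar ρ θ))
        = -(((2 * L : ℝ) : ℂ) * B (polar ρ θ)) - ((ρ * φ : ℝ) : ℂ)
          * ((X : ℂ) * a' ρ + ((-2 * ρ : ℝ) : ℂ) * B (polar ρ θ) + ((X * L : ℝ) : ℂ) * b' ρ) := by
      push_cast
      rw [zero_mul, zero_mul, zero_mul, zero_add]
      field_simp
      rw [eX]
      ring
    rw [e3]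
    have n1 : ‖-(((2 * L : ℝ) : ℂ) * B (polar ρ θ))‖ ≤ 2 * C * |L * X| := by
      rw [norm_neg, norm_mul, Complex.norm_real, Real.norm_eq_abs, abs_mul, abs_two, abs_mul, abs_of_pos hX]
      refine (mul_le_mul_of_nonneg_left hBb (by positivity)).trans (le_of_eq (by ring))
    have n2 : ‖(X : ℂ) * a' ρ‖ ≤ X * Ca := by
      rw [norm_mul, Complex.norm_of_nonneg hX.le]
      exact mul_le_mul_of_nonneg_left (ha ρ hρ).2 hX.le
    have n3 : ‖((-2 * ρ : ℝ) : ℂ) * B (polar ρ θ)‖ ≤ 2 * C * X := by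
      rw [norm_mul, Complex.norm_real, Real.norm_eq_abs, abs_mul, abs_neg, abs_two, abs_of_pos hρ.1]
      have h2 : 2 * ρ ≤ 2 := by linarith [hρ.2]
      exact (mul_le_mul h2 hBb (norm_nonneg _) zero_le_two).trans (le_of_eq (by ring))
    have n4 : ‖((X * L : ℝ) : ℂ) * b' ρ‖ ≤ |L * X| * Cb := by
      rw [norm_mul, Complex.norm_real, Real.norm_eq_abs, mul_comm X]
      exact mul_le_mul_of_nonneg_left (hb ρ hρ).2 (abs_nonneg _)
    have n5 : ‖((ρ * φ : ℝ) : ℂ)‖ ≤ |L| + K := by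
      rw [Complex.norm_real, Real.norm_eq_abs, abs_mul, abs_of_pos hρ.1]
      exact (mul_le_of_le_one_left (abs_nonneg _) hρ.2.le).trans hφ
    refine (norm_sub_le _ _).trans ?_
    rw [norm_mul ((ρ * φ : ℝ) : ℂ)]
    have n6 := mul_le_mul n5 ((norm_add₃_le).trans (add_le_add (add_le_add n2 n3) n4))
      (norm_nonneg _) (add_nonneg (abs_nonneg L) hK)
    refine (add_le_add n1 n6).trans (le_of_eq ?_)
    have hL2 : (L * y) ^ 2 = |L| * |L| * X := by
      rw [abs_mul_abs_self, ← eh]; ring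
    rw [hL2, abs_mul, abs_of_pos hX]
    ring

theorem hasNeumannTrace_of_decomposition (hγ : γ ∈ Set.Ioo (-1 : ℝ) 1) (hA : SmoothOnDisk A)
    (hB : SmoothOnDisk B) (hB0 : ∀ z, ‖z‖ = 1 → B z = 0)
    (h : ∀ z, 0 < xr z → f z = wt γ A z + dual γ 0 B z)
    (hg : ∀ θ : ℝ, g (θ : S1) = tauC γ * A (polar 1 θ)) : HasNeumannTrace c₀ γ f g := by
  rcases lt_trichotomy γ 0 with h0 | rfl | h0
  · exact hasNeumannTrace_of_neg ⟨hγ.1, h0⟩ hA hB h hg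
  · exact hasNeumannTrace_zero hA hB hB0 h hg
  · exact hasNeumannTrace_of_pos ⟨h0, hγ.2⟩ hA hB hB0 h hg

end

/-! ### The Neumann trace of conormal functions -/

theorem conormal_wt {γ : ℝ} {p : ℂ → ℂ} (hp : SmoothOnDisk p) : Conormal γ (wt γ p) := by
  have h0 : SmoothOnDisk fun _ => 0 := contDiffOn_const
  rcases lt_or_ge γ 0 with hγ | hγ
  · refine ⟨_, p, h0, hp, fun z _ => ?_⟩
    rw [wt, sig, max_eq_left (by linarith), if_neg hγ.ne, xr, zero_add]
  · refine ⟨p, _, hp, h0, fun z _ => ?_⟩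
    rw [wt, sig, max_eq_right (by linarith), Real.rpow_zero]
    simp

theorem exists_eig_eq (γ : ℝ) (q : ℤ × ℕ) : ∃ p : ℂ → ℂ, ContDiff ℝ ∞ p ∧ eig γ q = vec γ (wt γ p) := by
  have hp : ContDiff ℝ ∞ fun z => ∑ i ∈ Finset.range (q.2 + 1),
      (gco γ q.1 q.2 i : ℂ) * mono q.1 (q.2 - i) z :=
    ContDiff.sum fun i _ => contDiff_const.mul (contDiff_mono _ _)
  exact ⟨_, contDiff_const.mul hp, by
    rw [vec_wt_const_mul _ hp.continuous, ← ev_eq_vec]; rfl⟩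

theorem toLp_circle {a : S1 → ℂ} (ha : Continuous a) {h : L2S1}
    (he : ∀ m, fourierCoeff h m = fourierCoeff a m) : (h : S1 → ℂ) =ᵐ[AddCircle.haarAddCircle] a := by
  let F : C(S1, ℂ) := ⟨a, ha⟩
  have e : h = ContinuousMap.toLp (E := ℂ) 2 AddCircle.haarAddCircle ℂ F :=
    circle_ext fun m => by rw [he, fourierCoeff_toLp]; rfl
  rw [e]
  exact ContinuousMap.coeFn_toLp (𝕜 := ℂ) AddCircle.haarAddCircle F

theorem HasNeumannTrace.unique {c₀ γ : ℝ} {f : ℂ → ℂ} {g g' : S1 → ℂ} (h : HasNeumannTrace c₀ γ f g)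
    (h' : HasNeumannTrace c₀ γ f g') : g = g' := by
  funext θ
  obtain ⟨t, rfl⟩ := QuotientAddGroup.mk_surjective θ
  exact tendsto_nhds_unique (h t) (h' t)

theorem isNeumannExtension_of_coeff (c₀ : ℝ) {γ s : ℝ} (hγ : γ ∈ Set.Ioo (-1 : ℝ) 1) (hs : 1 + |γ| < s)
    {T : dirichletSobolev γ s →ₗ[ℂ] circleSobolev (s - 1 - |γ|)}
    (hT : ∀ u m, fourierCoeff (T u : L2S1) m = tauC γ * bt γ m u)
    (hC : ∃ C : ℝ, ∀ u, circleSobolevNorm _ (T u) ≤ C * dirichletSobolevNorm γ s u) :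
    IsNeumannExtension c₀ γ s T := by
  refine ⟨hC, fun f u hf hu => ?_⟩
  obtain ⟨A, B, hA, hB, hd⟩ := hf.exists_decomposition
  have hm := (memLp_wt_smoothOnDisk (γ := γ) hA).add (hB.memLp_dual hγ 0)
  have e : (u : L2 γ) = vec γ (wt γ A) + vec γ (dual γ 0 B) := by
    rw [← vec_add (memLp_wt_smoothOnDisk hA) (hB.memLp_dual hγ 0), ← vec_eq hu]
    exact vec_congr hm hd
  obtain ⟨hB0, hbt⟩ := conormal_data hγ hs hA hB u.2 e
  refine ⟨fun θ => tauC γ * circ A θ, hasNeumannTrace_of_decomposition hγ hA hB hB0 hd fun θ => by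
    rw [circ_coe], ?_⟩
  have hc := continuous_of_smoothOnCircle hA.smoothOnCircle
  exact toLp_circle (continuous_const.mul hc) fun m => by
    rw [hT, hbt]
    exact (fourierCoeff.const_mul (circ A) (tauC γ : ℂ) m).symm

/-! ### Uniqueness of the extension -/

theorem norm_fourierCoeff_le_circleSobolevNorm {r : ℝ} (hr : 0 ≤ r) (h : circleSobolev r) (m : ℤ) :
    ‖fourierCoeff (h : L2S1) m‖ ≤ circleSobolevNorm r h := by
  refine Real.le_sqrt_of_sq_le ?_
  have h1 : (1 : ℝ) ≤ bracket m ^ (2 * r) := by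
    rw [bracket_rpow]
    exact Real.one_le_rpow (by nlinarith [sq_nonneg (m : ℝ)]) hr
  refine (le_mul_of_one_le_left (sq_nonneg _) h1).trans ?_
  exact h.2.le_tsum m fun n _ => mul_nonneg (Real.rpow_nonneg (Real.sqrt_nonneg _) _) (sq_nonneg _)

/-- Eigenfunctions are conormal, so two extensions agree on them. After the isometry L^(-s/2), each
Fourier coefficient of the difference is a bounded functional on L²_γ that vanishes on a Hilbert
basis. -/
theorem eq_of_isNeumannExtension {c₀ γ s : ℝ} (hγ : γ ∈ Set.Ioo (-1 : ℝ) 1) (hs : 1 + |γ| < s)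
    {T T' : dirichletSobolev γ s →ₗ[ℂ] circleSobolev (s - 1 - |γ|)} (hT : IsNeumannExtension c₀ γ s T)
    (hT' : IsNeumannExtension c₀ γ s T') : T' = T := by
  have hs0 : 0 < s := by linarith [abs_nonneg γ]
  obtain ⟨⟨C, hC⟩, hf⟩ := hT
  obtain ⟨⟨C', hC'⟩, hf'⟩ := hT'
  let N : L2 γ →ₗ[ℂ] dirichletSobolev γ s := (dirichletNegPow γ s).toLinearMap.rangeRestrict
  have hN : ∀ v, dirichletSobolevNorm γ s (N v) = ‖v‖ := fun v => dirichletSobolevNorm_eq hγ hs0 _ rfl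
  have heig : ∀ q, T' (N (eig γ q)) = T (N (eig γ q)) := fun q => by
    obtain ⟨p, hp, he⟩ := exists_eig_eq γ q
    set μ : ℂ := (((lam γ q.1 q.2)⁻¹ ^ (s / 2) : ℝ) : ℂ)
    have e1 : ((N (eig γ q) : dirichletSobolev γ s) : L2 γ) = vec γ (wt γ fun z => μ * p z) := by
      rw [vec_wt_const_mul _ hp.continuous, ← he]
      exact dirichletNegPow_eigenvector hs0 (eig_ne_zero γ q) (dirichletInverse_eig hγ q)
    have hsm : SmoothOnDisk fun z => μ * p z := (contDiff_const.mul hp).contDiffOn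
    have hae : ((N (eig γ q) : dirichletSobolev γ s) : L2 γ) =ᵐ[diskMeasure γ]
        wt γ fun z => μ * p z := by rw [e1]; exact vec_ae (memLp_wt_smoothOnDisk hsm)
    obtain ⟨g, hg, hgT⟩ := hf _ _ (conormal_wt hsm) hae
    obtain ⟨g', hg', hgT'⟩ := hf' _ _ (conormal_wt hsm) hae
    rw [hg'.unique hg] at hgT'
    exact Subtype.ext (Lp.ext (hgT'.trans hgT.symm))
  refine LinearMap.ext fun u => ?_
  obtain ⟨v, hv⟩ : ∃ v, N v = u := LinearMap.surjective_rangeRestrict _ u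
  subst hv
  refine Subtype.ext (circle_ext fun m => ?_)
  let ψ : L2 γ →ₗ[ℂ] ℂ :=
    { toFun := fun v => fourierCoeff (T' (N v) : L2S1) m - fourierCoeff (T (N v) : L2S1) m
      map_add' := fun v w => by
        simp only [map_add, Submodule.coe_add, fourierCoeff_add_L2]; ring
      map_smul' := fun c v => by
        simp only [map_smul, Submodule.coe_smul, fourierCoeff_smul_L2, RingHom.id_apply, smul_eq_mul]
        ring }
  have hr : 0 ≤ s - 1 - |γ| := by linarith
  have hψ : ∀ v, ‖ψ v‖ ≤ (C' + C) * ‖v‖ := fun v => by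
    refine (norm_sub_le _ _).trans ?_
    have h1 := (norm_fourierCoeff_le_circleSobolevNorm hr (T' (N v)) m).trans (hC' (N v))
    have h2 := (norm_fourierCoeff_le_circleSobolevNorm hr (T (N v)) m).trans (hC (N v))
    rw [hN] at h1 h2
    linarith
  have h := (ψ.mkContinuous _ hψ).hasSum ((eigBasis hγ).hasSum_repr v)
  have h0 : ∀ q, (ψ.mkContinuous _ hψ) ((eigBasis hγ).repr v q • eigBasis hγ q) = 0 := fun q => by
    rw [map_smul, eigBasis_apply, LinearMap.mkContinuous_apply]
    change _ • (fourierCoeff (T' (N (eig γ q)) : L2S1) m - fourierCoeff (T (N (eig γ q)) : L2S1) m) = 0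
    rw [heig, sub_self, smul_zero]
  have h1 : ψ v = 0 := by
    have := h.tsum_eq
    simp only [h0, tsum_zero] at this
    exact this.symm
  exact sub_eq_zero.1 h1

/-! ### The domain of the minimal operator -/

/-- The range of the minimal operator. -/
def minimalRange (γ : ℝ) : Submodule ℂ (L2 γ) :=
  (testGraph γ).comap ((dirichletInverse γ).toLinearMap.prod LinearMap.id)

theorem mem_minimalRange {γ : ℝ} {v : L2 γ} :
    v ∈ minimalRange γ ↔ (dirichletInverse γ v, v) ∈ testGraph γ := Iff.rfl

theorem isClosed_minimalRange (γ : ℝ) : IsClosed (minimalRange γ : Set (L2 γ)) :=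
  (isClosed_testGraph γ).preimage ((dirichletInverse γ).continuous.prodMk continuous_id)

theorem dirichletInverse_injective {γ : ℝ} (hγ : γ ∈ Set.Ioo (-1 : ℝ) 1) :
    Function.Injective (dirichletInverse γ) := by
  rw [← dirichletNegPow_two]
  exact dirichletNegPow_injective hγ two_pos

/-- M_j - M_{j+1} = (1 - |z|²) M_j vanishes on the circle, so x^σ times it belongs to the minimal
domain. -/
theorem lmonoVec_sub_mem {γ : ℝ} (hγ : γ ∈ Set.Ioo (-1 : ℝ) 1) (m : ℤ) (j : ℕ) :
    lmonoVec γ m j - lmonoVec γ m (j + 1) ∈ minimalRange γ := by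
  have hw : ContDiff ℝ ∞ fun z => mono m j z - mono m (j + 1) z :=
    (contDiff_mono m j).sub (contDiff_mono m (j + 1))
  obtain ⟨M, hb, hM⟩ := exists_radialBound_wt γ
  obtain ⟨-, hP⟩ := (smoothOnDisk_of_contDiff hw).mem_testGraph hγ hb hM fun z hz => by
    have h1 : z * conj z = 1 := by
      rw [Complex.mul_conj, Complex.normSq_eq_norm_sq, hz]; simp
    have h2 : mono m (j + 1) z = mono m j z * (z * conj z) := by
      simp only [mono, zpw]; ring
    rw [h2, h1, mul_one, sub_self]
  have e : (vec γ fun z => ((xr z ^ sig γ : ℝ) : ℂ) * (mono m j z - mono m (j + 1) z))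
      = dirichletInverse γ (lmonoVec γ m j - lmonoVec γ m (j + 1)) := by
    rw [map_sub, dirichletInverse_lmonoVec hγ, dirichletInverse_lmonoVec hγ, monoVec, monoVec,
      ← vec_sub (memLp_wt_of_continuous (contDiff_mono m j).continuous)
        (memLp_wt_of_continuous (contDiff_mono m (j + 1)).continuous)]
    congr 1; funext z; simp only [wt]; ring
  have k := testGraph_eq hγ.1 hP
  rw [mem_minimalRange]
  have k2 := dirichletInverse_injective hγ (e.symm.trans k)
  rw [k2, ← k]
  exact hP

/-- Orthogonality to the differences makes ⟨y, L M_j⟩ independent of j. The expansion of the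
eigenvector then collects the sum of its coefficients, which is its boundary value. -/
theorem inner_eig_of_orthogonal {γ : ℝ} (hγ : γ ∈ Set.Ioo (-1 : ℝ) 1) {y : L2 γ}
    (hy : y ∈ (minimalRange γ)ᗮ) (m : ℤ) (k : ℕ) :
    ⟪y, eig γ (m, k)⟫_ℂ = ⟪y, lmonoVec γ m 0⟫_ℂ * ((bv γ m k * (lam γ m k)⁻¹ : ℝ) : ℂ) := by
  have h1 : ∀ j, ⟪y, lmonoVec γ m j⟫_ℂ = ⟪y, lmonoVec γ m 0⟫_ℂ := fun j => by
    induction j with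
    | zero => rfl
    | succ j ih =>
      have := Submodule.inner_left_of_mem_orthogonal (lmonoVec_sub_mem hγ m j) hy
      rw [inner_sub_right, sub_eq_zero] at this
      rw [← this, ih]
  have hl : (lam γ m k : ℂ) ≠ 0 := by exact_mod_cast (lam_pos γ m k).ne'
  have h2 := congrArg (fun w => ⟪y, w⟫_ℂ) (sum_lmonoVec γ m k)
  simp only [inner_sum, inner_smul_right, h1] at h2
  rw [← Finset.sum_mul] at h2
  change ⟪y, ((‖ev γ m k‖⁻¹ : ℝ) : ℂ) • ev γ m k⟫_ℂ = _
  rw [inner_smul_right, bv]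
  have h3 : ⟪y, ev γ m k⟫_ℂ = (∑ i ∈ Finset.range (k + 1), (gco γ m k i : ℂ)) * ⟪y, lmonoVec γ m 0⟫_ℂ
      * (lam γ m k : ℂ)⁻¹ := by
    rw [h2, mul_comm, inv_mul_cancel_left₀ hl]
  rw [h3]
  push_cast
  ring

/-- The minimal range is closed, hence equal to its double orthogonal complement. For y in the
complement, the mode m part of ⟨y, v⟩ is a multiple of the boundary coefficient of L_{γ,D}⁻¹ v, so
it is zero. -/
theorem mem_minimalRange_of_bt {γ : ℝ} (hγ : γ ∈ Set.Ioo (-1 : ℝ) 1) {v : L2 γ}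
    (h : ∀ m, bt γ m (dirichletInverse γ v) = 0) : v ∈ minimalRange γ := by
  have : CompleteSpace (minimalRange γ) := (isClosed_minimalRange γ).completeSpace_coe
  rw [← Submodule.orthogonal_orthogonal (minimalRange γ), Submodule.mem_orthogonal]
  intro y hy
  have hs := hasSum_inner_eig hγ y v
  have hf : ∀ m, ∑' k, ⟪y, eig γ (m, k)⟫_ℂ * ⟪eig γ (m, k), v⟫_ℂ = 0 := fun m => by
    have e : ∀ k, ⟪y, eig γ (m, k)⟫_ℂ * ⟪eig γ (m, k), v⟫_ℂ = ⟪y, lmonoVec γ m 0⟫_ℂ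
        * ((bv γ m k : ℂ) * ⟪eig γ (m, k), dirichletInverse γ v⟫_ℂ) := fun k => by
      rw [inner_eig_of_orthogonal hγ hy, inner_eig_dirichletInverse hγ]
      push_cast
      ring
    rw [tsum_congr e, tsum_mul_left]
    have := h m
    rw [bt] at this
    rw [this, mul_zero]
  have h1 := hs.prod_fiberwise fun m => (hs.summable.prod_factor m).hasSum
  rw [← h1.tsum_eq, tsum_congr hf, tsum_zero]

theorem minimalDomain_eq {γ : ℝ} (hγ : γ ∈ Set.Ioo (-1 : ℝ) 1)
    {T : dirichletSobolev γ 2 →ₗ[ℂ] circleSobolev (2 - 1 - |γ|)}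
    (hT : ∀ u m, fourierCoeff (T u : L2S1) m = tauC γ * bt γ m u) :
    minimalDomain γ = (LinearMap.ker T).map (dirichletSobolev γ 2).subtype := by
  have hτ : (tauC γ : ℂ) ≠ 0 := by exact_mod_cast tauC_ne_zero γ
  have hκ : (kap γ : ℂ) ≠ 0 := by exact_mod_cast kap_ne_zero γ
  have hker : ∀ u, T u = 0 ↔ ∀ m, bt γ m u = 0 := fun u => by
    constructor
    · intro h m
      have := hT u m
      have h0 := fourierCoeff_smul_L2 0 0 m
      rw [smul_zero, zero_mul] at h0
      rw [h, Submodule.coe_zero, h0] at this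
      exact (mul_eq_zero.1 this.symm).resolve_left hτ
    · intro h
      refine Subtype.ext (circle_ext fun m => ?_)
      have h0 := fourierCoeff_smul_L2 0 0 m
      rw [smul_zero, zero_mul] at h0
      rw [hT, h, mul_zero, Submodule.coe_zero, h0]
  rw [minimalDomain, minimalGraph_eq hγ]
  ext u
  rw [Submodule.mem_map, Submodule.mem_map]
  constructor
  · rintro ⟨⟨u, w⟩, hP, rfl⟩
    have hK := testGraph_eq hγ.1 hP
    change u = dirichletInverse γ w at hK
    have hmem : u ∈ dirichletSobolev γ 2 := ⟨w, by rw [dirichletNegPow_two]; exact hK.symm⟩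
    refine ⟨⟨u, hmem⟩, (hker _).2 fun m => ?_, rfl⟩
    -- On the minimal graph the right-hand side is a Green pairing without boundary term, so the
    -- boundary coefficients vanish.
    have h1 := kap_mul_bt hγ 0 m 0 w
    have h2 := inner_testGraph hγ (ℓ := 0) (contDiff_mono m 0) hP
    rw [← hK, h2, sub_self] at h1
    exact (mul_eq_zero.1 h1).resolve_left hκ
  · rintro ⟨⟨u, v, hv⟩, hu, rfl⟩
    have hb : ∀ m, bt γ m u = 0 := (hker ⟨u, v, hv⟩).1 (LinearMap.mem_ker.1 hu)
    have hv' : dirichletInverse γ v = u := by rw [← dirichletNegPow_two]; exact hv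
    have hZ := mem_minimalRange_of_bt hγ (v := v) fun m => by rw [hv']; exact hb m
    rw [mem_minimalRange, hv'] at hZ
    exact ⟨(u, v), hZ, rfl⟩

/-! ### The smooth right inverse -/

theorem exists_isSmoothRightInverse {γ s : ℝ} (hγ : γ ∈ Set.Ioo (-1 : ℝ) 1) (hs : 1 + |γ| < s)
    {T : dirichletSobolev γ s →ₗ[ℂ] circleSobolev (s - 1 - |γ|)}
    (hT : ∀ u m, fourierCoeff (T u : L2S1) m = tauC γ * bt γ m u) :
    ∃ R, IsSmoothRightInverse γ s T R := by
  obtain ⟨R, hR, hC⟩ := exists_lift_map hγ hs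
  have hτ : (tauC γ : ℂ) ≠ 0 := by exact_mod_cast tauC_ne_zero γ
  refine ⟨R, hC, fun h => Subtype.ext (circle_ext fun m => ?_), smoothLift γ,
    isContinuousSmoothOperator_smoothLift γ, fun a h ha hh => ?_⟩
  · rw [hT, bt_lift hγ (hR h m), mul_div_cancel₀ _ hτ]
  · have e : (R h : L2 γ) = vec γ (wt γ (smoothLift γ a)) := ext_eig hγ fun q => by
      rw [hR h q.1 q.2, inner_eig_smoothLift ha, fourierCoeff_congr_ae hh]
    rw [e]
    exact vec_ae (memLp_wt_smoothOnDisk (smoothOnDisk_smoothLift γ ha))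

end

end KeldyshDisk

open KeldyshDisk in
theorem proposition4p1 (γ : ℝ) (hγ : γ ∈ Set.Ioo (-1 : ℝ) 1)
    (c₀ : ℝ) (hc₀ : Real.log (Real.exp 4 - 1) < c₀) :
    (∀ s : ℝ, 1 + |γ| < s →
      ∃ T : dirichletSobolev γ s →ₗ[ℂ] circleSobolev (s - 1 - |γ|),
        IsNeumannExtension c₀ γ s T ∧
        (∀ T', IsNeumannExtension c₀ γ s T' → T' = T) ∧
        Function.Surjective T ∧
        ∃ R, IsSmoothRightInverse γ s T R) ∧
    dirichletSobolev γ 2 = dirichletDomain γ ∧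
    (∀ T : dirichletSobolev γ 2 →ₗ[ℂ] circleSobolev (2 - 1 - |γ|),
      IsNeumannExtension c₀ γ 2 T →
        minimalDomain γ = (LinearMap.ker T).map (dirichletSobolev γ 2).subtype) := by
  refine ⟨fun s hs => ?_, dirichletSobolev_two γ, fun T hT => ?_⟩
  · obtain ⟨T, hT, hC⟩ := exists_neumann_map hγ hs
    obtain ⟨R, hR⟩ := exists_isSmoothRightInverse hγ hs hT
    have hN := isNeumannExtension_of_coeff c₀ hγ hs hT hC
    exact ⟨T, hN, fun T' hT' => eq_of_isNeumannExtension hγ hs hN hT',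
      fun h => ⟨R h, hR.2.1 h⟩, R, hR⟩
  · have hs : 1 + |γ| < 2 := by linarith [abs_lt.2 hγ]
    obtain ⟨T₀, hT₀, hC⟩ := exists_neumann_map hγ hs
    -- Uniqueness identifies the given extension with the one whose Fourier coefficients are known.
    obtain rfl := eq_of_isNeumannExtension hγ hs (isNeumannExtension_of_coeff c₀ hγ hs hT₀ hC) hT
    exact minimalDomain_eq hγ hT₀
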